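/- **Setting.** Let $d,n\ge1$, $\mathbb Z^d_+=\{z\in\mathbb Z^d:z_1>0\}$, $\tilde z=(-z_1,z_2,\dots,z_d)$ for $z\in\mathbb Z^d$ or $z\in\mathbb R^d$, $[x]=([x_1],\dots,[x_d])$ (integer parts), $\mathbb T^d=\mathbb R^d/(2\pi\mathbb Z)^d$. For functions $a$ on $\mathbb Z^d$ put $\hat a(\theta)=\sum_z e^{iz\cdot\theta}a(z)$, with inverse $F^{-1}_{\theta\to z}[f]=(2\pi)^{-d}\int_{\mathbb T^d}e^{-iz\cdot\theta}f(\theta)\,d\theta$; on $\mathbb R^d$, $F^{-1}_{y\to x}[f]=(2\pi)^{-d}\int e^{-ix\cdot y}f(y)\,dy$, an oscillatory integral (Gaussian summation: insert $e^{-\eta|y|^2}$ and let $\eta\to+0$) if $f$ is only bounded. **Potential.** $V:\mathbb Z^d\to\mathbb R^{n\times n}$ satisfies $V(\tilde z)=V(z)$ and: - E1: $\|V(z)\|\le Ce^{-\kappa|z|}$ for some $C,\kappa>0$. - E2: $V_{lk}(-z)=V_{kl}(z)$. - E3: $\hat V(\theta)\ge0$ for all $\theta$. Put $\Omega(\theta)=\hat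 V(\theta)^{1/2}\ge0$. Let $s$ be the maximal (equivalently, generic) number of distinct eigenvalues of $\Omega(\theta)$, $\mathcal C_*$ the closed null set of those $\theta$ where $\Omega(\theta)$ has fewer than $s$ distinct eigenvalues, and, off $\mathcal C_*$, let $\omega_1(\theta)<\dots<\omega_s(\theta)$ be the distinct eigenvalues of $\Omega(\theta)$ and $\Pi_\sigma(\theta)$ the corresponding orthogonal spectral projections. - E4: for every $\sigma$, $\det\nabla^2\omega_\sigma$ does not vanish identically on any nonempty open subset of $\mathbb T^d\setminus\mathcal C_*$. - E5: for $\sigma\ne\sigma'$, neither $\omega_\sigma+\omega_{\sigma'}$ nor $\omega_\sigma-\omega_{\sigma'}$ is identically equal to a non-zero constant on any nonempty open subset of $\mathbb T^d\setminus\mathcal C_*$. - E6: $\hat V(\theta)$ is invertible for a.e. $\theta$ and $\|\hat V^{-1}\|\in L^1(\mathbb T^d)$. **Dynamics.** For $\alpha\in\mathbb R$ let $\mathcal H_{\alpha,+}$ be the Hilbert space of functions $Y=(Y^0,Y^1):\mathbb Z^d_+\to\mathbb R^n\times\mathbb R^n$ with $\|Y\|^2=\sum_z|Y(z)|^2(1+|z|^2)^\alpha<\infty$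 (extended by $0$ to $z_1=0$), and let $U_+(t):Y(0)\mapsto Y(t)=(u(\cdot,t),\dot u(\cdot,t))\in C(\mathbb R,\mathcal H_{\alpha,+})$ be the solution operator of $$\ddot u(z,t)=-\sum_{z'\in\mathbb Z^d_+}\big(V(z-z')-V(z-\tilde z')\big)u(z',t),\quad z\in\mathbb Z^d_+,\qquad u(z,t)|_{z_1=0}=0.$$ **Covariance conditions.** Fix $C>0$, $\gamma>d$. All $2n\times2n$ matrices are split into $n\times n$ blocks $M^{ij}$, $i,j=0,1$. Let $\mathbf R_0(r,z)$, $r\in\mathbb R^d$, $z\in\mathbb Z^d$, be a complex $2n\times2n$ matrix function with ($\hat{\mathbf R}_0(r,\theta)$ being its Fourier transform in $z$) - I1: $|\mathbf R_0^{ij}(r,z)|\le C(1+|z|)^{-\gamma}$. - I2: $\hat{\mathbf R}_0^{00}\ge0$, $\hat{\mathbf R}_0^{11}\ge0$, $\hat{\mathbf R}_0^{01}=(\hat{\mathbf R}_0^{10})^*$. - I3: $\hat{\mathbf R}_0(r,\theta)\ge0$. - I4: $\hat{\mathbf R}_0(\cdot,\theta)$ is $C^d$, and $\sup_\theta\max_{i,j}\max_{\alpha_k\in\{0,1\}}|\partial_{r_1}^{\alpha_1}\cdots\partial_{r_d}^{\alpha_d}\hat{\mathbf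 R}^{ij}_0(r,\theta)|$ is bounded on bounded sets of $r$. - I4': either $\hat{\mathbf R}_0(\cdot,\theta)\in L^1(\mathbb R^d)$ for all $\theta$ and $\sup_\theta\big|\int e^{is\cdot r}\hat{\mathbf R}_0(r,\theta)\,dr\big|\le C'(1+|s|)^{-N}$ for some $C'$ and $N>d+3$; or $\hat{\mathbf R}_0(r,\theta)=(2\pi)^{-d}\int e^{-is\cdot r}\mu(\theta,ds)$ with complex (matrix-valued) Borel measures satisfying $\sup_\theta|\mu|(\theta,\{m\le|s|<m+1\})\le C'(1+m)^{-\delta}$, $m=0,1,2,\dots$, for some $C'$ and $\delta>d^2/2+2d+1$. Let $R(r,x,y)$, $r\in\mathbb R^d$, $x,y\in\mathbb Z^d$ with $x_1,y_1\ge0$, be a complex $2n\times2n$ matrix function with - (a) $R(r,x,y)=0$ if $x_1=0$ or $y_1=0$; $R(r,x,y)=\mathbf R(r,x_1,y_1,\bar x-\bar y)$, where $x=(x_1,\bar x)$, $y=(y_1,\bar y)$; and $\lim_{y_1\to+\infty}\mathbf R(r,y_1+z_1,y_1,\bar z)=\mathbf R_0(r,z)$ uniformly in $r\in\mathbb R^d$,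 for every $z\in\mathbb Z^d$. - (b) $|R^{ij}(r,x,y)|\le C(1+|x-y|)^{-\gamma}$ for $x,y\in\mathbb Z^d_+$. - (c) $R^{ii}(r,\cdot,\cdot)\ge0$ as a kernel, $R^{ij}(r,x,y)=R^{ji}(r,y,x)^T$ for $x,y\in\mathbb Z^d_+$. - (d) $R^{ij}(\cdot,x,y)\in C^1$ for $x,y\in\mathbb Z^d_+$. - (d') if $d>1$: for all fixed $x,y\in\mathbb Z^d_+$, $\sup_{\bar r\in\mathbb R^{d-1}}|R(r_1,\bar r,x,y)-R(0,\bar r,x,y)|\to0$ as $r_1\to0$; and $R(0,\cdot,x,y)\in L^1(\mathbb R^{d-1})$ has a Fourier transform bounded by $C_{x,y}(1+|\bar s|)^{-N}$, with some $N>d+2$. Let $\mu_0^\varepsilon$, $\varepsilon>0$, be Borel probability measures on $\mathcal H_{\alpha,+}$ with mean zero, finite second moments of all $Y(x)$, $x\in\mathbb Z^d_+$, and covariance $Q_\varepsilon^{ij}(x,x')=\mathbb E_0^\varepsilon\big(Y^i(x)\otimes Y^j(x')\big)$ such that for all $\varepsilon>0$, $x,x'\in\mathbb Z^d_+$ - V1':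 $|Q^{ij}_\varepsilon(x,x')-R^{ij}(\varepsilon x,x,x')|\le C\min\big[(1+|x-x'|)^{-\gamma},\varepsilon|x-x'|\big]$. - V2': $|Q^{ij}_\varepsilon(x,x')|\le C(1+|x-x'|)^{-\gamma}$. Let $\mu^\varepsilon_t$ be the image of $\mu_0^\varepsilon$ under $U_+(t)$, and $Q^{ij}_{\varepsilon,t}(x,y)=\int Y^i(x)\otimes Y^j(y)\,\mu^\varepsilon_t(dY)$ its correlation functions. **Asymptotic covariance.** For $\tau\ne0$, $r\in\mathbb R^d$, $\varepsilon>0$ and a.e. $\theta$ put $$C_\sigma(\theta)=\begin{pmatrix}0&\omega_\sigma^{-1}(\theta)\\-\omega_\sigma(\theta)&0\end{pmatrix},\qquad K^\pm_\sigma(\tau,x,\theta)=F^{-1}_{y\to x}\big[e^{\mp i(\tau/2)\,y\cdot\nabla^2\omega_\sigma(\theta)y}\big],\qquad \chi^\pm_{\tau,r_1}(\theta)=\tfrac12\big(1+\operatorname{sign}(r_1\pm\partial_1\omega_\sigma(\theta)\tau)\big),$$ $$A^\pm_{\varepsilon,\sigma}(\tau,r;\theta)=\int_{\mathbb R^d}\hat{\mathbf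 R}_0\big(r\pm\nabla\omega_\sigma(\theta)\tau/\varepsilon-x,\theta\big)K^\pm_\sigma(\tau,x,\theta)\,dx,$$ $$\hat g^\varepsilon_{\tau,r}(\theta)=\frac14\sum_{\sigma=1}^s\Pi_\sigma(\theta)\Big[\sum_\pm(I\pm iC_\sigma(\theta))\,A^\pm_{\varepsilon,\sigma}(\tau,r;\theta)\,\chi^\pm_{\tau/\varepsilon,r_1}(\theta)\,(I\mp iC^*_\sigma(\theta))\Big]\Pi_\sigma(\theta),\qquad g^\varepsilon_{\tau,r}(z)=F^{-1}_{\theta\to z}[\hat g^\varepsilon_{\tau,r}(\theta)].$$ (The integral for $A^\pm_{\varepsilon,\sigma}$ converges absolutely in the first case of I4'; in the second case it is understood with Gaussian summation in $x$.) **Theorem.** Under all the above conditions, for every $\tau\ne0$ and every $r\in\mathbb R^d$ with $r_1\ge0$, $$\lim_{\varepsilon\to+0}\Big(Q_{\varepsilon,\tau/\varepsilon^2}\big([r/\varepsilon]+z,[r/\varepsilon]+z'\big)-Q^\varepsilon_{\tau,r}(z,z')\Big)=0,$$ for all $z,z'\in\mathbb Z^d$ if $r_1>0$, and for all $z,z'\in\mathbb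 Z^d_+$ if $r_1=0$, where $$Q^\varepsilon_{\tau,r}(z,z')=\begin{cases}g^\varepsilon_{\tau,r}(z-z')+g^\varepsilon_{\tau,\tilde r}(\tilde z-\tilde z'),&r_1>0,\\ g^\varepsilon_{\tau,r}(z-z')-g^\varepsilon_{\tau,r}(z-\tilde z')-g^\varepsilon_{\tau,r}(\tilde z-z')+g^\varepsilon_{\tau,r}(\tilde z-\tilde z'),&r_1=0.\end{cases}$$ (For $r_1>0$ the points $[r/\varepsilon]+z$ and $[r/\varepsilon]+z'$ lie in $\mathbb Z^d_+$ for all small $\varepsilon$.) -/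

import Mathlib

open MeasureTheory Filter Topology Matrix
open scoped InnerProductSpace Kronecker

noncomputable section

namespace Crystal

/-! ### Lattice, half-lattice, Euclidean space -/

/-- The lattice `ℤ^d`; the distinguished first coordinate has index `0`. -/
abbrev Lat (d : ℕ) := Fin d → ℤ

/-- `ℝ^d` with its Euclidean structure. -/
abbrev Euc (d : ℕ) := EuclideanSpace ℝ (Fin d)

/-- Index set of the `2n` components: `(0, k)` displacements, `(1, k)` velocities. -/
abbrev Ix (n : ℕ) := Fin 2 × Fin n

/-- The half-lattice `ℤ^d_+ = {z : z₁ > 0}`. -/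
abbrev HalfLat (d : ℕ) [NeZero d] := {z : Lat d // 0 < z 0}

/-- A lattice point as a point of `ℝ^d`. -/
def toEuc {d : ℕ} (z : Lat d) : Euc d := WithLp.toLp 2 fun i => (z i : ℝ)

/-- `z ↦ z̃ = (-z₁, z₂, …, z_d)` on `ℤ^d`. -/
def refl {d : ℕ} [NeZero d] (z : Lat d) : Lat d := Function.update z 0 (-z 0)

/-- `r ↦ r̃ = (-r₁, r₂, …, r_d)` on `ℝ^d`. -/
def reflE {d : ℕ} [NeZero d] (r : Euc d) : Euc d :=
  WithLp.toLp 2 (Function.update r.ofLp 0 (-r 0))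

/-- The componentwise integer part `[x]`. -/
def intPart {d : ℕ} (x : Euc d) : Lat d := fun i => ⌊x i⌋

/-- The fundamental cell of the torus `𝕋^d = ℝ^d / (2πℤ)^d`.  Functions on the torus are treated as
periodic functions on `ℝ^d`. -/
def cell (d : ℕ) : Set (Euc d) := {θ | ∀ i, θ i ∈ Set.Icc (-Real.pi) Real.pi}

/-- The lattice Fourier transform `â(θ) = ∑_z e^{i z·θ} a(z)` of a matrix-valued function. -/
def latFourier {d : ℕ} {ι : Type*} (a : Lat d → Matrix ι ι ℂ) (θ : Euc d) : Matrix ι ι ℂ :=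
  ∑' z : Lat d, Complex.exp (Complex.I * (⟪toEuc z, θ⟫_ℝ : ℂ)) • a z

/-- The inverse lattice Fourier transform `(2π)^{-d} ∫_{𝕋^d} e^{-i z·θ} f(θ) dθ`, entry by entry. -/
def latFourierInv {d : ℕ} {ι : Type*} (f : Euc d → Matrix ι ι ℂ) (z : Lat d) : Matrix ι ι ℂ :=
  Matrix.of fun p q => (((2 * Real.pi) ^ d : ℝ) : ℂ)⁻¹ *
    ∫ θ in cell d, Complex.exp (-(Complex.I * (⟪toEuc z, θ⟫_ℝ : ℂ))) * f θ p q

/-! ### The interaction matrix and the dispersion relations -/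

section Potential

variable {d n : ℕ}

/-- `V̂(θ)`. -/
def Vhat (V : Lat d → Matrix (Fin n) (Fin n) ℝ) (θ : Euc d) : Matrix (Fin n) (Fin n) ℂ :=
  latFourier (fun z => (V z).map Complex.ofReal) θ

open scoped Matrix.Norms.L2Operator MatrixOrder in
/-- `Ω(θ) = V̂(θ)^{1/2}`, the non-negative square root. -/
def Omega (V : Lat d → Matrix (Fin n) (Fin n) ℝ) (θ : Euc d) : Matrix (Fin n) (Fin n) ℂ :=
  CFC.sqrt (Vhat V θ)

/-- The set of (real) eigenvalues of `Ω(θ)`. -/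
def eigs (V : Lat d → Matrix (Fin n) (Fin n) ℝ) (θ : Euc d) : Set ℝ :=
  {w | Module.End.HasEigenvalue (Matrix.toEuclideanLin (Omega V θ)) (w : ℂ)}

/-- `ω_σ(θ)`, `σ = 0, 1, …`: the distinct eigenvalues of `Ω(θ)` in increasing order, i.e. the
eigenvalue that has exactly `σ` distinct eigenvalues below it. -/
def om (V : Lat d → Matrix (Fin n) (Fin n) ℝ) (σ : ℕ) (θ : Euc d) : ℝ :=
  sInf {w | w ∈ eigs V θ ∧ (eigs V θ ∩ Set.Iio w).ncard = σ}

/-- `Π_σ(θ)`: the orthogonal projection of `ℂ^n` onto the eigenspace of `Ω(θ)` for `ω_σ(θ)`. -/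
def specProj (V : Lat d → Matrix (Fin n) (Fin n) ℝ) (σ : ℕ) (θ : Euc d) :
    Matrix (Fin n) (Fin n) ℂ :=
  Matrix.toEuclideanLin.symm
    ((Module.End.eigenspace (Matrix.toEuclideanLin (Omega V θ))
      ((om V σ θ : ℝ) : ℂ)).starProjection).toLinearMap

/-- `s`: the (generic, equivalently maximal) number of distinct eigenvalues of `Ω(θ)`. -/
def numBands (V : Lat d → Matrix (Fin n) (Fin n) ℝ) : ℕ :=
  sSup (Set.range fun θ : Euc d => (eigs V θ).ncard)

/-- `𝕋^d ∖ 𝒞_*` (as a periodic set): the points where `Ω(θ)` has the generic number of distinct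
eigenvalues, i.e. where no two bands cross. -/
def regularSet (V : Lat d → Matrix (Fin n) (Fin n) ℝ) : Set (Euc d) :=
  {θ | (eigs V θ).ncard = numBands V}

/-- The gradient `∇ω_σ(θ)`. -/
def gradOm (V : Lat d → Matrix (Fin n) (Fin n) ℝ) (σ : ℕ) (θ : Euc d) : Euc d :=
  gradient (om V σ) θ

/-- The Hessian matrix `∇²ω_σ(θ)`. -/
def hessOm (V : Lat d → Matrix (Fin n) (Fin n) ℝ) (σ : ℕ) (θ : Euc d) :
    Matrix (Fin d) (Fin d) ℝ :=
  Matrix.of fun i j =>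
    fderiv ℝ (fun x => fderiv ℝ (om V σ) x (EuclideanSpace.single j 1)) θ
      (EuclideanSpace.single i 1)

/-- **E1**: exponential decay. -/
def CondE1 (V : Lat d → Matrix (Fin n) (Fin n) ℝ) : Prop :=
  ∃ C > 0, ∃ κ > 0, ∀ z k l, |V z k l| ≤ C * Real.exp (-κ * ‖toEuc z‖)

/-- **E2**: symmetry (reality is part of the type of `V`). -/
def CondE2 (V : Lat d → Matrix (Fin n) (Fin n) ℝ) : Prop :=
  ∀ z k l, V (-z) l k = V z k l

open scoped ComplexOrder in
/-- **E3**: `V̂(θ)` is non-negative definite. -/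
def CondE3 (V : Lat d → Matrix (Fin n) (Fin n) ℝ) : Prop :=
  ∀ θ, (Vhat V θ).PosSemidef

/-- **E4**: the functions `det ∇²ω_σ` do not vanish identically, on any open piece of
`𝕋^d ∖ 𝒞_*`. -/
def CondE4 (V : Lat d → Matrix (Fin n) (Fin n) ℝ) : Prop :=
  ∀ σ < numBands V, ∀ U : Set (Euc d), IsOpen U → U.Nonempty → U ⊆ regularSet V →
    ∃ θ ∈ U, (hessOm V σ θ).det ≠ 0

/-- **E5**: for `σ ≠ σ'`, neither `ω_σ + ω_σ'` nor `ω_σ - ω_σ'` is identically equal to a non-zero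
constant, on any open piece of `𝕋^d ∖ 𝒞_*`. -/
def CondE5 (V : Lat d → Matrix (Fin n) (Fin n) ℝ) : Prop :=
  ∀ σ < numBands V, ∀ σ' < numBands V, σ ≠ σ' → ∀ c : ℝ, c ≠ 0 →
    ∀ U : Set (Euc d), IsOpen U → U.Nonempty → U ⊆ regularSet V →
      (∃ θ ∈ U, om V σ θ + om V σ' θ ≠ c) ∧ (∃ θ ∈ U, om V σ θ - om V σ' θ ≠ c)

/-- **E6**: `V̂(θ)` is invertible for almost every `θ`, and `V̂⁻¹` is integrable over the torus. -/
def CondE6 (V : Lat d → Matrix (Fin n) (Fin n) ℝ) : Prop :=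
  (∀ᵐ θ : Euc d, (Vhat V θ).det ≠ 0) ∧
    ∀ k l, IntegrableOn (fun θ => (Vhat V θ)⁻¹ k l) (cell d)

end Potential

/-! ### The dynamics in the half-space -/

section Dynamics

variable {d n : ℕ} [NeZero d]

/-- The weights `(1 + |z|²)^α` on the half-lattice, as a measure. -/
def weight (d : ℕ) [NeZero d] (α : ℝ) : Measure (HalfLat d) :=
  Measure.sum fun z : HalfLat d =>
    ENNReal.ofReal ((1 + ‖toEuc z.1‖ ^ 2) ^ α) • Measure.dirac z

/-- The phase space `ℋ_{α,+}`: the `ℝ^n × ℝ^n`-valued functions on `ℤ^d_+` with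
`‖Y‖² = ∑_z |Y(z)|² (1 + |z|²)^α < ∞`.  (All points have positive weight, so that a class of functions
modulo null sets is a function.) -/
abbrev PhaseSpace (d n : ℕ) [NeZero d] (α : ℝ) :=
  Lp (EuclideanSpace ℝ (Ix n)) 2 (weight d α)

/-- The Borel `σ`-algebra of the phase space. -/
instance instMeasurableSpacePhaseSpace (d n : ℕ) [NeZero d] (α : ℝ) :
    MeasurableSpace (PhaseSpace d n α) := borel _

/-- The components `Y^i_k(z)`, `p = (i, k)`, extended by zero to `z ∉ ℤ^d_+` (in particular to the
boundary `z₁ = 0`). -/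
def ev {α : ℝ} (Y : PhaseSpace d n α) (z : Lat d) (p : Ix n) : ℝ :=
  if h : 0 < z 0 then (Y : HalfLat d → EuclideanSpace ℝ (Ix n)) ⟨z, h⟩ p else 0

/-- `Y ∈ C(ℝ, ℋ_{α,+})` solves `u̇ = v`,
`v̇(z) = -∑_{z' ∈ ℤ^d_+} (V(z - z') - V(z - z̃')) u(z')` on `ℤ^d_+`, with `Y = (u, v)`; the boundary
condition `u = 0` on `z₁ = 0` is built into `ev`. -/
def IsSolution {α : ℝ} (V : Lat d → Matrix (Fin n) (Fin n) ℝ) (Y : ℝ → PhaseSpace d n α) : Prop :=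
  Continuous Y ∧ ∀ (t : ℝ) (z : Lat d), 0 < z 0 → ∀ k : Fin n,
    HasDerivAt (fun t => ev (Y t) z (0, k)) (ev (Y t) z (1, k)) t ∧
    HasDerivAt (fun t => ev (Y t) z (1, k))
      (-∑' z' : HalfLat d, ∑ l : Fin n,
        (V (z - z'.1) k l - V (z - refl z'.1) k l) * ev (Y t) z'.1 (0, l)) t

/-- The solution operator `U_+(t) : Y₀ ↦ Y(t)` of the mixed problem with `Y(0) = Y₀`. -/
def flow {α : ℝ} (V : Lat d → Matrix (Fin n) (Fin n) ℝ) (t : ℝ) (Y₀ : PhaseSpace d n α) :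
    PhaseSpace d n α :=
  Classical.epsilon (fun Y : ℝ → PhaseSpace d n α => IsSolution V Y ∧ Y 0 = Y₀) t

/-- The correlation functions `Q^{ij}(x, y) = ∫ Y^i(x) ⊗ Y^j(y) μ(dY)` of a measure `μ`. -/
def corr {α : ℝ} (μ : Measure (PhaseSpace d n α)) (x y : Lat d) : Matrix (Ix n) (Ix n) ℂ :=
  Matrix.of fun p q => ((∫ Y, ev Y x p * ev Y y q ∂μ : ℝ) : ℂ)

/-- `μ^ε_t`: the distribution at time `t` of the solution whose initial data have law `μ₀`. -/
def evolve {α : ℝ} (V : Lat d → Matrix (Fin n) (Fin n) ℝ) (μ₀ : Measure (PhaseSpace d n α))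
    (t : ℝ) : Measure (PhaseSpace d n α) :=
  μ₀.map (flow V t)

end Dynamics

/-! ### Conditions on the limiting covariances -/

section Covariance

variable {d n : ℕ}

/-- `R̂₀(r, θ)`: Fourier transform of `R₀(r, z)` in `z`. -/
def R0hat (R₀ : Euc d → Lat d → Matrix (Ix n) (Ix n) ℂ) (r θ : Euc d) : Matrix (Ix n) (Ix n) ℂ :=
  latFourier (R₀ r) θ

/-- **I1**: `|R₀^{ij}(r, z)| ≤ C (1 + |z|)^{-γ}`. -/
def CondI1 (C γ : ℝ) (R₀ : Euc d → Lat d → Matrix (Ix n) (Ix n) ℂ) : Prop :=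
  ∀ r z p q, ‖R₀ r z p q‖ ≤ C * (1 + ‖toEuc z‖) ^ (-γ)

/-- The `n × n` block `M^{ij}` of a `2n × 2n` matrix. -/
def block (M : Matrix (Ix n) (Ix n) ℂ) (i j : Fin 2) : Matrix (Fin n) (Fin n) ℂ :=
  Matrix.of fun k l => M (i, k) (j, l)

open scoped ComplexOrder in
/-- **I2**: `R̂₀^{00} ≥ 0`, `R̂₀^{11} ≥ 0`, `R̂₀^{01} = (R̂₀^{10})^*`. -/
def CondI2 (R₀ : Euc d → Lat d → Matrix (Ix n) (Ix n) ℂ) : Prop :=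
  ∀ r θ, (block (R0hat R₀ r θ) 0 0).PosSemidef ∧ (block (R0hat R₀ r θ) 1 1).PosSemidef ∧
    block (R0hat R₀ r θ) 0 1 = (block (R0hat R₀ r θ) 1 0)ᴴ

open scoped ComplexOrder in
/-- **I3**: `R̂₀(r, θ)` is non-negative definite. -/
def CondI3 (R₀ : Euc d → Lat d → Matrix (Ix n) (Ix n) ℂ) : Prop :=
  ∀ r θ, (R0hat R₀ r θ).PosSemidef

/-- **I4**: `R̂₀(·, θ)` is `C^d`, and its mixed partial derivatives `∏_{k ∈ S} ∂/∂r_k`,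
`S ⊆ {1, …, d}`, are bounded uniformly in `θ` and locally uniformly in `r`. -/
def CondI4 (R₀ : Euc d → Lat d → Matrix (Ix n) (Ix n) ℂ) : Prop :=
  (∀ θ p q, ContDiff ℝ d (fun r => R0hat R₀ r θ p q)) ∧
  ∀ B : ℝ, ∃ M : ℝ, ∀ r, ‖r‖ ≤ B → ∀ θ p q, ∀ S : Finset (Fin d),
    ‖iteratedFDeriv ℝ S.card (fun r => R0hat R₀ r θ p q) r
      (fun k => EuclideanSpace.single (S.orderEmbOfFin rfl k) 1)‖ ≤ M

/-- **I4'**, first form: `R̂₀(·, θ) ∈ L¹(ℝ^d)`, and its Fourier transform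
`R̃₀(s, θ) = ∫ e^{i s·r} R̂₀(r, θ) dr` is `O((1 + |s|)^{-N})` uniformly in `θ`, with `N > d + 3`. -/
def CondI4'Fourier (R₀ : Euc d → Lat d → Matrix (Ix n) (Ix n) ℂ) : Prop :=
  (∀ θ p q, Integrable (fun r => R0hat R₀ r θ p q)) ∧
  ∃ C > 0, ∃ N : ℝ, (d : ℝ) + 3 < N ∧ ∀ θ s p q,
    ‖∫ r, Complex.exp (Complex.I * (⟪s, r⟫_ℝ : ℂ)) * R0hat R₀ r θ p q‖ ≤ C * (1 + ‖s‖) ^ (-N)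

/-- **I4'**, second form: `R̂₀(r, θ) = (2π)^{-d} ∫ e^{-i s·r} μ(θ, ds)` for complex Borel measures
`μ(θ, ·)` (one for every matrix entry) whose total variation over the shell `m ≤ |s| < m + 1` is at
most `C (1 + m)^{-δ}`, uniformly in `θ`, with `δ > d²/2 + 2d + 1`. -/
def CondI4'Measure (R₀ : Euc d → Lat d → Matrix (Ix n) (Ix n) ℂ) : Prop :=
  ∃ μ : Euc d → Ix n → Ix n → ComplexMeasure (Euc d),
    (∀ r θ p q, R0hat R₀ r θ p q = (((2 * Real.pi) ^ d : ℝ) : ℂ)⁻¹ *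
      (μ θ p q).integral (fun s => Complex.exp (-(Complex.I * (⟪s, r⟫_ℝ : ℂ))))
        (ContinuousLinearMap.mul ℝ ℂ)) ∧
    ∃ C > 0, ∃ δ : ℝ, (d : ℝ) ^ 2 / 2 + 2 * d + 1 < δ ∧ ∀ θ p q, ∀ m : ℕ,
      (μ θ p q).variation {s | (m : ℝ) ≤ ‖s‖ ∧ ‖s‖ < m + 1} ≤
        ENNReal.ofReal (C * (1 + (m : ℝ)) ^ (-δ))

/-- **I4'**: one of its two forms. -/
def CondI4' (R₀ : Euc d → Lat d → Matrix (Ix n) (Ix n) ℂ) : Prop :=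
  CondI4'Fourier R₀ ∨ CondI4'Measure R₀

variable [NeZero d]

/-- **(a)**: `R(r, x, y)` vanishes if `x₁ = 0` or `y₁ = 0`; it depends on `x, y` only through `x₁`,
`y₁`, `x̄ - ȳ`; it tends to `R₀(r, z)`, uniformly in `r`, when `x - y = z` and `y₁ → +∞`. (The
conditions I1–I4 on `R₀` are stated separately. Only the values of `R` for `x₁, y₁ ≥ 0` matter.) -/
def CondA (R : Euc d → Lat d → Lat d → Matrix (Ix n) (Ix n) ℂ)
    (R₀ : Euc d → Lat d → Matrix (Ix n) (Ix n) ℂ) : Prop :=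
  (∀ r x y, 0 ≤ x 0 → 0 ≤ y 0 → (x 0 = 0 ∨ y 0 = 0) → R r x y = 0) ∧
  (∀ r x y h, 0 ≤ x 0 → 0 ≤ y 0 → h 0 = 0 → R r (x + h) (y + h) = R r x y) ∧
  ∀ z p q, TendstoUniformly
    (fun (m : ℕ) r => R r (Pi.single 0 (m : ℤ) + z) (Pi.single 0 (m : ℤ)) p q)
    (fun r => R₀ r z p q) atTop

/-- **(b)**: `|R^{ij}(r, x, y)| ≤ C (1 + |x - y|)^{-γ}` on the half-lattice. -/
def CondB (C γ : ℝ) (R : Euc d → Lat d → Lat d → Matrix (Ix n) (Ix n) ℂ) : Prop :=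
  ∀ r x y, 0 < x 0 → 0 < y 0 → ∀ p q,
    ‖R r x y p q‖ ≤ C * (1 + ‖toEuc (x - y)‖) ^ (-γ)

open scoped ComplexOrder in
/-- **(c)**: `R^{ii}(r, ·, ·) ≥ 0` as a kernel on the half-lattice, and
`R^{ij}(r, x, y) = R^{ji}(r, y, x)^T`. -/
def CondC (R : Euc d → Lat d → Lat d → Matrix (Ix n) (Ix n) ℂ) : Prop :=
  (∀ r i, (Matrix.of fun (a b : HalfLat d × Fin n) =>
    R r a.1.1 b.1.1 (i, a.2) (i, b.2)).PosSemidef) ∧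
  ∀ r x y, 0 < x 0 → 0 < y 0 → ∀ p q, R r x y p q = R r y x q p

/-- **(d)**: `R^{ij}(·, x, y)` is `C¹`. -/
def CondD (R : Euc d → Lat d → Lat d → Matrix (Ix n) (Ix n) ℂ) : Prop :=
  ∀ x y, 0 < x 0 → 0 < y 0 → ∀ p q, ContDiff ℝ 1 (fun r => R r x y p q)

/-- `ℝ^{d-1}`, the space of the last `d - 1` coordinates. -/
abbrev EucBar (d : ℕ) [NeZero d] := EuclideanSpace ℝ {j : Fin d // j ≠ 0}

/-- `(r₁, r̄) ∈ ℝ^d`. -/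
def joinE (r₁ : ℝ) (rb : EucBar d) : Euc d :=
  WithLp.toLp 2 fun j => if h : j = 0 then r₁ else rb ⟨j, h⟩

/-- **(d')**, a condition for `d > 1`: `R(r₁, r̄, x, y) → R(0, r̄, x, y)` as `r₁ → 0`, uniformly in
`r̄ ∈ ℝ^{d-1}`, and the Fourier transform of the integrable function `R(0, ·, x, y)` is
`O((1 + |s̄|)^{-N})` with `N > d + 2`. -/
def CondD' (R : Euc d → Lat d → Lat d → Matrix (Ix n) (Ix n) ℂ) : Prop :=
  1 < d →
  (∀ x y, 0 < x 0 → 0 < y 0 → ∀ p q, TendstoUniformly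
    (fun (r₁ : ℝ) (rb : EucBar d) => R (joinE r₁ rb) x y p q)
    (fun rb => R (joinE 0 rb) x y p q) (𝓝 0)) ∧
  ∃ N : ℝ, (d : ℝ) + 2 < N ∧ ∀ x y, 0 < x 0 → 0 < y 0 →
    (∀ p q, Integrable (fun rb : EucBar d => R (joinE 0 rb) x y p q)) ∧
    ∃ C > 0, ∀ (s : EucBar d) p q,
      ‖∫ rb : EucBar d, Complex.exp (Complex.I * (⟪s, rb⟫_ℝ : ℂ)) * R (joinE 0 rb) x y p q‖ ≤
        C * (1 + ‖s‖) ^ (-N)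

/-- Standing assumptions on the initial measures `μ₀^ε`, `ε > 0`: probability measures with finite
second moments and mean zero. -/
def IsInitialFamily {α : ℝ} (μ₀ : ℝ → Measure (PhaseSpace d n α)) : Prop :=
  ∀ ε > 0, IsProbabilityMeasure (μ₀ ε) ∧ ∀ x p, 0 < x 0 →
    MemLp (fun Y => ev Y x p) 2 (μ₀ ε) ∧ ∫ Y, ev Y x p ∂(μ₀ ε) = 0

/-- **V1'**: `|Q_ε^{ij}(x, x') - R^{ij}(εx, x, x')| ≤ C min((1 + |x - x'|)^{-γ}, ε |x - x'|)`. -/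
def CondV1' {α : ℝ} (C γ : ℝ) (R : Euc d → Lat d → Lat d → Matrix (Ix n) (Ix n) ℂ)
    (μ₀ : ℝ → Measure (PhaseSpace d n α)) : Prop :=
  ∀ ε > 0, ∀ x x', 0 < x 0 → 0 < x' 0 → ∀ p q,
    ‖corr (μ₀ ε) x x' p q - R (ε • toEuc x) x x' p q‖ ≤
      C * min ((1 + ‖toEuc (x - x')‖) ^ (-γ)) (ε * ‖toEuc (x - x')‖)

/-- **V2'**: `|Q_ε^{ij}(x, x')| ≤ C (1 + |x - x'|)^{-γ}`. -/
def CondV2' {α : ℝ} (C γ : ℝ) (μ₀ : ℝ → Measure (PhaseSpace d n α)) : Prop :=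
  ∀ ε > 0, ∀ x x', 0 < x 0 → 0 < x' 0 → ∀ p q,
    ‖corr (μ₀ ε) x x' p q‖ ≤ C * (1 + ‖toEuc (x - x')‖) ^ (-γ)

end Covariance

/-! ### The asymptotic covariance -/

section Asymptotic

variable {d n : ℕ}

/-- The inverse Fourier transform `F^{-1}_{y → x}[f] = (2π)^{-d} ∫_{ℝ^d} e^{-i x·y} f(y) dy` of a bounded
function, as an oscillatory integral (Gaussian summation). -/
def oscFourierInv (f : Euc d → ℂ) (x : Euc d) : ℂ :=
  limUnder (𝓝[>] (0 : ℝ)) fun η : ℝ => (((2 * Real.pi) ^ d : ℝ) : ℂ)⁻¹ *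
    ∫ y : Euc d, ((Real.exp (-η * ‖y‖ ^ 2) : ℝ) : ℂ) *
      (Complex.exp (-(Complex.I * (⟪x, y⟫_ℝ : ℂ))) * f y)

/-- The kernel `K^±_σ(τ, x, θ) = F^{-1}_{y → x}[exp(∓ i (τ/2) y · ∇²ω_σ(θ) y)]`; here and below the
sign `±` is the argument `sg = ±1`. -/
def kernelK (V : Lat d → Matrix (Fin n) (Fin n) ℝ) (sg : ℝ) (σ : ℕ) (τ : ℝ) (x θ : Euc d) : ℂ :=
  oscFourierInv (fun y => Complex.exp (-(Complex.I *
    ((sg * (τ / 2) * (y.ofLp ⬝ᵥ (hessOm V σ θ *ᵥ y.ofLp)) : ℝ) : ℂ)))) x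

/-- `A^±_{ε,σ}(τ, r; θ) = ∫_{ℝ^d} R̂₀(r ± ∇ω_σ(θ) τ/ε - x, θ) K^±_σ(τ, x, θ) dx`.  The integral is
understood with Gaussian summation; it is absolutely convergent, and the summation is immaterial, when
`R̂₀(·, θ)` is integrable. -/
def matA (V : Lat d → Matrix (Fin n) (Fin n) ℝ) (R₀ : Euc d → Lat d → Matrix (Ix n) (Ix n) ℂ)
    (sg : ℝ) (σ : ℕ) (ε τ : ℝ) (r θ : Euc d) : Matrix (Ix n) (Ix n) ℂ :=
  Matrix.of fun p q => limUnder (𝓝[>] (0 : ℝ)) fun η : ℝ =>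
    ∫ x : Euc d, ((Real.exp (-η * ‖x‖ ^ 2) : ℝ) : ℂ) *
      (R0hat R₀ (r + (sg * (τ / ε)) • gradOm V σ θ - x) θ p q * kernelK V sg σ τ x θ)

variable [NeZero d]

/-- `χ^±_{τ,r₁}(θ) = (1 + sign(r₁ ± ∂₁ω_σ(θ) τ)) / 2`. -/
def chi (V : Lat d → Matrix (Fin n) (Fin n) ℝ) (sg : ℝ) (σ : ℕ) (τ r₁ : ℝ) (θ : Euc d) : ℝ :=
  (1 + Real.sign (r₁ + sg * (gradOm V σ θ 0 * τ))) / 2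

/-- `C_σ(θ) = [[0, ω_σ⁻¹], [-ω_σ, 0]]` (times the `n × n` identity). -/
def matC (V : Lat d → Matrix (Fin n) (Fin n) ℝ) (σ : ℕ) (θ : Euc d) : Matrix (Ix n) (Ix n) ℂ :=
  (!![0, ((om V σ θ : ℝ) : ℂ)⁻¹; -((om V σ θ : ℝ) : ℂ), 0] : Matrix (Fin 2) (Fin 2) ℂ) ⊗ₖ
    (1 : Matrix (Fin n) (Fin n) ℂ)

/-- `Π_σ(θ)` acting on both components. -/
def matPi (V : Lat d → Matrix (Fin n) (Fin n) ℝ) (σ : ℕ) (θ : Euc d) : Matrix (Ix n) (Ix n) ℂ :=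
  (1 : Matrix (Fin 2) (Fin 2) ℂ) ⊗ₖ specProj V σ θ

/-- The term `(I ± i C_σ) A^±_{ε,σ}(τ, r; θ) χ^±_{τ/ε,r₁}(θ) (I ∓ i C_σ^*)`. -/
def signTerm (V : Lat d → Matrix (Fin n) (Fin n) ℝ) (R₀ : Euc d → Lat d → Matrix (Ix n) (Ix n) ℂ)
    (sg : ℝ) (σ : ℕ) (ε τ : ℝ) (r θ : Euc d) : Matrix (Ix n) (Ix n) ℂ :=
  (1 + ((sg : ℂ) * Complex.I) • matC V σ θ) *
    ((chi V sg σ (τ / ε) (r 0) θ : ℂ) • matA V R₀ sg σ ε τ r θ) *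
    (1 - ((sg : ℂ) * Complex.I) • (matC V σ θ)ᴴ)

/-- `ĝ^ε_{τ,r}(θ) = ¼ ∑_σ Π_σ [∑_± (I ± iC_σ) A^±_{ε,σ} χ^±_{τ/ε,r₁} (I ∓ iC_σ^*)] Π_σ`. -/
def gHat (V : Lat d → Matrix (Fin n) (Fin n) ℝ) (R₀ : Euc d → Lat d → Matrix (Ix n) (Ix n) ℂ)
    (ε τ : ℝ) (r θ : Euc d) : Matrix (Ix n) (Ix n) ℂ :=
  (1 / 4 : ℂ) • ∑ σ ∈ Finset.range (numBands V),
    matPi V σ θ * (signTerm V R₀ 1 σ ε τ r θ + signTerm V R₀ (-1) σ ε τ r θ) * matPi V σ θ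

/-- `g^ε_{τ,r}(z)`. -/
def gLat (V : Lat d → Matrix (Fin n) (Fin n) ℝ) (R₀ : Euc d → Lat d → Matrix (Ix n) (Ix n) ℂ)
    (ε τ : ℝ) (r : Euc d) (z : Lat d) : Matrix (Ix n) (Ix n) ℂ :=
  latFourierInv (gHat V R₀ ε τ r) z

/-- `Q^ε_{τ,r}(z, z')`, for `r₁ > 0` and for `r₁ = 0`. -/
def Qeps (V : Lat d → Matrix (Fin n) (Fin n) ℝ) (R₀ : Euc d → Lat d → Matrix (Ix n) (Ix n) ℂ)
    (ε τ : ℝ) (r : Euc d) (z z' : Lat d) : Matrix (Ix n) (Ix n) ℂ :=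
  if 0 < r 0 then
    gLat V R₀ ε τ r (z - z') + gLat V R₀ ε τ (reflE r) (refl z - refl z')
  else
    gLat V R₀ ε τ r (z - z') - gLat V R₀ ε τ r (z - refl z')
      - gLat V R₀ ε τ r (refl z - z') + gLat V R₀ ε τ r (refl z - refl z')

end Asymptotic

end Crystal

end

noncomputable section

namespace Crystal

open scoped ComplexConjugate
open Complex (exp I)
open EuclideanSpace (single)
open scoped Real

/-- The inner product of `ℝ^d`. -/
notation "⟪" x ", " y "⟫" => inner ℝ x y

/-- The pairing `z·θ` of a lattice point with a momentum. -/
notation:75 z:75 " ⋄ " θ:76 => inner ℝ (toEuc z) θ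

/-- Convergence as the scaling parameter tends to `0` from above. -/
notation:50 "Lim₀ " f:max x:max => Tendsto f (𝓝[>] 0) (𝓝 x)

/-- Square matrices acting on the displacements of one cell. -/
notation:max "Mat" n:max => Matrix (Fin n) (Fin n)

/-- Square matrices acting on the displacements and velocities of one cell. -/
notation:max "IxMat" n:max => Matrix (Ix n) (Ix n)

/-- `e^{ix}`. -/
notation "𝐞[" x "]" => exp (I * (x : ℂ))

/-- `e^{-ix}`. -/
notation "𝐞⁻[" x "]" => exp (-(I * (x : ℂ)))

/-- Lebesgue measure on the fundamental cell of the torus. -/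
notation:max "𝕋" d:max => Measure.restrict volume (cell d)

/-- The normalization `(2π)^{-d}`. -/
notation:max "c𝕋" d:max => (((2 * π) ^ d : ℝ) : ℂ)⁻¹

/-- The second derivative. -/
notation:max "D²" f:max => fderiv ℝ (fderiv ℝ f)

open Finset (sum_congr mul_sum mem_range sum_le_sum mem_univ sum_add_distrib sum_neg_distrib
  sum_sub_distrib sum_eq_single sum_nonneg sum_mul prod_eq_zero prod_mul_distrib)
open Complex (norm_real continuous_ofReal exp_add ofReal_mul continuous_conj ofRealCLM)
open Real (norm_of_nonneg norm_eq_abs rpow_neg rpow_le_rpow pi_pos)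
open Metric (ball isOpen_ball mem_ball_self)
open Set (univ)
open ENNReal (ofReal)

variable {d n σ σ' : ℕ} {α τ sg C m M γ W m1 c κ m2 δ B e sg' η l m1' : ℝ} {V : Lat d → Mat n ℝ}
    {θ ρ r s θ0 x : Euc d} {R0 : Euc d → Lat d → IxMat n ℂ} {f g F u h : Euc d → ℂ} {ω : Euc d → ℝ}
    {p q i j : Ix n} {z y X Y : Lat d} {φ ψ w a φ' : Lat d → ℂ} {ν : Lat d → ℝ}
    {K U T G : Set (Euc d)} {S : Set (Lat d)} {β : ℕ × ℝ} {A : ℝ → Euc d → ℂ} {P : ℝ → Lat d}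

attribute [local instance] instMeasureSpaceUnitAddCircle

/-! ### Fourier series on the lattice -/

/-- The scalar inverse lattice Fourier transform. -/
def fcoef (f : Euc d → ℂ) (z : Lat d) : ℂ := c𝕋 d * ∫ θ in cell d, 𝐞⁻[z ⋄ θ] * f θ

/-- The scalar lattice Fourier transform. -/
def fsum (a : Lat d → ℂ) (θ : Euc d) : ℂ := ∑' z : Lat d, 𝐞[z ⋄ θ] * a z

/-- The representative in `(-π, π]^d` of a point of the unit torus. -/
def torusRep (x : UnitAddTorus (Fin d)) : Euc d :=
  WithLp.toLp 2 ((2 * π) • (UnitAddTorus.measurableEquivPiIoc (fun _ : Fin d => -1 / 2) x).1)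

lemma two_pi_pow_pos (d : ℕ) : 0 < (2 * π) ^ d := by positivity

lemma measurableSet_cell : MeasurableSet (cell d) := by
  have : cell d = ⋂ i, (fun θ : Euc d => θ i) ⁻¹' Set.Icc (-π) π := by ext θ; simp [cell]
  rw [this]
  exact MeasurableSet.iInter fun i => (by fun_prop : Measurable fun θ : Euc d => θ i) measurableSet_Icc

lemma isCompact_cell : IsCompact (cell d) := by
  have h : cell d = (WithLp.ofLp : Euc d → Fin d → ℝ) ⁻¹' univ.pi fun _ => Set.Icc (-π) π := by
    ext θ; simp only [cell, Set.mem_ofPred_eq, Set.mem_preimage, Set.mem_univ_pi]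
  rw [h]
  exact (EuclideanSpace.equiv (Fin d) ℝ).toHomeomorph.isCompact_preimage.2
    (isCompact_univ_pi fun _ => isCompact_Icc)

instance isFiniteMeasure_cell : IsFiniteMeasure (𝕋 d) :=
  ⟨by simpa using isCompact_cell.measure_lt_top⟩

lemma measurable_torusRep : Measurable (torusRep (d := d)) := by
  unfold torusRep
  refine (WithLp.measurable_toLp 2 _).comp (Measurable.const_smul ?_ (2 * π))
  exact measurable_subtype_coe.comp (UnitAddTorus.measurableEquivPiIoc _).measurable

lemma map_torusRep : Measure.map (torusRep (d := d)) volume = ofReal ((2 * π) ^ d)⁻¹ • 𝕋 d := by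
  set e := UnitAddTorus.measurableEquivPiIoc (fun _ : Fin d => (-1 / 2 : ℝ))
  set S : Set (Fin d → ℝ) := {x | ∀ i, x i ∈ Set.Ioc (-1 / 2 : ℝ) (-1 / 2 + 1)}
  have hS : MeasurableSet S := MeasurableSet.univ_pi' fun i => measurableSet_Ioc
  have hpi := pi_pos
  have h1 : Measure.map (fun x => (e x).1) volume = volume.restrict S := by
    have : (fun x => (e x).1) = Subtype.val ∘ e := rfl
    rw [this, ← Measure.map_map measurable_subtype_coe e.measurable,
      (UnitAddTorus.measurePreserving_equivPiIoc _).map_eq]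
    exact _root_.map_comap_subtype_coe hS volume
  set S' : Set (Fin d → ℝ) := univ.pi fun _ => Set.Ioc (-π) π
  have hS' : MeasurableSet S' := MeasurableSet.univ_pi fun i => measurableSet_Ioc
  have h2 : Measure.map ((2 * π) • · : (Fin d → ℝ) → Fin d → ℝ) (volume.restrict S) =
      ofReal ((2 * π) ^ d)⁻¹ • volume.restrict S' := by
    have hpre : S = ((2 * π) • · : (Fin d → ℝ) → Fin d → ℝ) ⁻¹' S' := by
      ext x
      simp only [S, S', Set.mem_ofPred_eq, Set.mem_preimage, Set.mem_univ_pi, Set.mem_Ioc,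
        Pi.smul_apply, smul_eq_mul]
      refine forall_congr' fun i => and_congr ⟨fun h => by nlinarith, fun h => by nlinarith⟩
        ⟨fun h => by nlinarith, fun h => by nlinarith⟩
    rw [hpre, ← Measure.restrict_map (by fun_prop) hS', Measure.map_addHaar_smul _ (by positivity)]
    rw [Measure.restrict_smul]
    congr 2
    rw [abs_of_pos (by positivity)]; simp
  have h3 : S' =ᵐ[volume] univ.pi fun _ => Set.Icc (-π) π := by
    have := Measure.univ_pi_Ioc_ae_eq_Icc (μ := fun _ : Fin d => (volume : Measure ℝ))
      (f := fun _ => -π) (g := fun _ => π)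
    rw [← Set.pi_univ_Icc] at this
    exact this
  have h4 : Measure.map (WithLp.toLp 2 : (Fin d → ℝ) → Euc d) (volume.restrict S') = 𝕋 d := by
    rw [Measure.restrict_congr_set h3]
    have := ((PiLp.volume_preserving_toLp (Fin d)).restrict_preimage (measurableSet_cell (d := d))).map_eq
    rw [← this]
    congr 2
    ext x; simp only [cell, Set.mem_ofPred_eq, Set.mem_preimage, Set.mem_univ_pi]
  have he : Measurable fun x => (e x).1 := measurable_subtype_coe.comp e.measurable
  have : torusRep (d := d) = (WithLp.toLp 2 : (Fin d → ℝ) → Euc d) ∘ ((2 * π) • ·) ∘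
      (fun x => (e x).1) := rfl
  rw [this, ← Measure.map_map (WithLp.measurable_toLp 2 _)
    ((measurable_const_smul _).comp he), ← Measure.map_map (measurable_const_smul _) he, h1, h2,
    Measure.map_smul, h4]

lemma integral_torusRep {E : Type*} [NormedAddCommGroup E] [NormedSpace ℝ E] {g : Euc d → E}
    (hg : AEStronglyMeasurable g (𝕋 d)) :
    ∫ x, g (torusRep x) = ((2 * π) ^ d)⁻¹ • ∫ θ in cell d, g θ := by
  rw [← integral_map measurable_torusRep.aemeasurable, map_torusRep, integral_smul_measure,
    ENNReal.toReal_ofReal (by positivity)]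
  rw [map_torusRep]
  exact hg.smul_measure _

lemma inner_toEuc (z : Lat d) (θ : Euc d) : z ⋄ θ = ∑ i, (z i : ℝ) * θ i := by
  simp [toEuc, PiLp.inner_apply, mul_comm]

lemma mFourier_eq_cexp (z : Lat d) (x : UnitAddTorus (Fin d)) :
    UnitAddTorus.mFourier z x = 𝐞[z ⋄ torusRep x] := by
  have hx : ∀ i, x i = ((AddCircle.equivIoc 1 (-1 / 2 : ℝ) (x i) : ℝ) : UnitAddCircle) := fun i =>
    ((AddCircle.equivIoc 1 (-1 / 2 : ℝ)).symm_apply_apply (x i)).symm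
  simp only [UnitAddTorus.mFourier, ContinuousMap.coe_mk]
  rw [inner_toEuc]
  push_cast
  rw [mul_sum, Complex.exp_sum]
  refine Finset.prod_congr rfl fun i _ => ?_
  rw [hx i, fourier_coe_apply]
  congr 1
  simp only [torusRep, UnitAddTorus.coe_measurableEquivPiIoc_apply, Pi.smul_apply, smul_eq_mul]
  push_cast
  simp only [div_one]
  ring

lemma continuous_cexp_inner (z : Lat d) : Continuous fun θ : Euc d => 𝐞[z ⋄ θ] := by fun_prop

lemma continuous_cexp_neg_inner (z : Lat d) : Continuous fun θ : Euc d => 𝐞⁻[z ⋄ θ] := by fun_prop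

lemma norm_cexp_I_mul (x : ℝ) : ‖𝐞[x]‖ = 1 := by
  rw [mul_comm]; exact Complex.norm_exp_ofReal_mul_I x

lemma norm_cexp_neg_I_mul (x : ℝ) : ‖𝐞⁻[x]‖ = 1 := by
  have := norm_cexp_I_mul (-x)
  push_cast at this
  rwa [mul_neg] at this

lemma toEuc_neg (z : Lat d) : toEuc (-z) = -toEuc z := by ext i; simp [toEuc]

lemma toEuc_add (z w : Lat d) : toEuc (z + w) = toEuc z + toEuc w := by ext i; simp [toEuc]

lemma toEuc_sub (z w : Lat d) : toEuc (z - w) = toEuc z - toEuc w := by ext i; simp [toEuc]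

lemma toEuc_zero : toEuc (0 : Lat d) = 0 := by ext i; simp [toEuc]

lemma mFourierCoeff_torusRep (hf : AEStronglyMeasurable f (𝕋 d)) (z : Lat d) :
    UnitAddTorus.mFourierCoeff (fun x => f (torusRep x)) z = fcoef f z := by
  have h := integral_torusRep (d := d) (g := fun θ => 𝐞⁻[z ⋄ θ] * f θ)
    ((continuous_cexp_neg_inner z).aestronglyMeasurable.mul hf)
  simp only [UnitAddTorus.mFourierCoeff, mFourier_eq_cexp, fcoef, smul_eq_mul, toEuc_neg,
    inner_neg_left]
  push_cast
  simp only [mul_neg]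
  rw [h, Complex.real_smul]
  push_cast
  rfl

lemma hasSum_sq_fcoef (hf : MemLp f 2 (𝕋 d)) : HasSum (fun z => ‖fcoef f z‖ ^ 2) (((2 * π) ^ d)⁻¹ *
    ∫ θ in cell d, ‖f θ‖ ^ 2) := by
  have hmap : MemLp f 2 (Measure.map (torusRep (d := d)) volume) := by
    rw [map_torusRep]; exact hf.smul_measure (by simp)
  have hg : MemLp (fun x => f (torusRep x)) 2 volume :=
    hmap.comp_of_map measurable_torusRep.aemeasurable
  have h := UnitAddTorus.hasSum_sq_mFourierCoeff hg.toLp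
  have h1 : ∀ z, UnitAddTorus.mFourierCoeff (hg.toLp : UnitAddTorus (Fin d) → ℂ) z = fcoef f z := fun z => by
    rw [← mFourierCoeff_torusRep hf.1]
    refine integral_congr_ae ?_
    filter_upwards [hg.coeFn_toLp] with x hx
    rw [hx]
  have h2 : ∫ t, ‖(hg.toLp : UnitAddTorus (Fin d) → ℂ) t‖ ^ 2 =
      ((2 * π) ^ d)⁻¹ * ∫ θ in cell d, ‖f θ‖ ^ 2 := by
    rw [← smul_eq_mul, ← integral_torusRep (g := fun θ => ‖f θ‖ ^ 2) (hf.1.norm.pow 2)]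
    refine integral_congr_ae ?_
    filter_upwards [hg.coeFn_toLp] with x hx
    rw [hx]
  simpa only [h1, h2] using h

lemma fcoef_cexp (w z : Lat d) : fcoef (fun θ => 𝐞[w ⋄ θ]) z = if z = w then 1 else 0 := by
  rw [← mFourierCoeff_torusRep (continuous_cexp_inner w).aestronglyMeasurable]
  simp only [← mFourier_eq_cexp]
  have h := orthonormal_iff_ite.1 (UnitAddTorus.orthonormal_mFourier (d := Fin d)) z w
  rw [← h, ContinuousMap.inner_toLp]
  simp only [UnitAddTorus.mFourierCoeff, UnitAddTorus.mFourier_neg, smul_eq_mul, mul_comm]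

lemma summable_cexp_mul (ha : Summable fun z => ‖a z‖) (θ : Euc d) : Summable fun z => 𝐞[z ⋄ θ] * a
    z := by
  refine .of_norm ?_
  simpa using ha

lemma continuous_fsum (ha : Summable fun z => ‖a z‖) : Continuous (fsum a) := by
  refine continuous_tsum (fun z => (continuous_cexp_inner z).mul continuous_const) ha fun z θ => ?_
  simp

lemma norm_fsum_le (ha : Summable fun z => ‖a z‖) (θ : Euc d) : ‖fsum a θ‖ ≤ ∑' z, ‖a z‖ := by
  refine (norm_tsum_le_tsum_norm ?_).trans_eq ?_
  · simpa [norm_mul, norm_cexp_I_mul] using ha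
  · simp

lemma fcoef_fsum (ha : Summable fun z => ‖a z‖) (z : Lat d) : fcoef (fsum a) z = a z := by
  have key : ∀ w, c𝕋 d * ∫ θ in cell d, 𝐞⁻[z ⋄ θ] *
        (𝐞[w ⋄ θ] * a w) = if w = z then a w else 0 := fun w => by
    have h := fcoef_cexp w z
    simp only [fcoef] at h
    simp_rw [← mul_assoc]
    rw [integral_mul_const, ← mul_assoc, h]
    by_cases hzw : z = w
    · simp [hzw]
    · simp [hzw, Ne.symm hzw]
  have hsum : HasSum (fun w => ∫ θ in cell d, 𝐞⁻[z ⋄ θ] * (𝐞[w ⋄ θ] * a w))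
      (∫ θ in cell d, ∑' w, 𝐞⁻[z ⋄ θ] * (𝐞[w ⋄ θ] * a w)) := by
    refine hasSum_integral_of_summable_integral_norm (fun w => ?_) ?_
    · exact ContinuousOn.integrableOn_compact isCompact_cell (by fun_prop)
    · simp only [norm_mul, norm_cexp_I_mul, norm_cexp_neg_I_mul, one_mul, integral_const]
      exact ha.mul_left _
  rw [fcoef]
  simp only [fsum, ← tsum_mul_left] at hsum ⊢
  rw [← hsum.tsum_eq, ← tsum_mul_left]
  simp only [key]
  exact tsum_ite_eq z _

lemma cell_subset_closure_interior : cell d ⊆ closure (interior (cell d)) := by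
  have hconv : Convex ℝ (cell d) := fun x hx y hy a b ha hb hab i => by
    have := (convex_Icc (-π) π) (hx i) (hy i) ha hb hab
    simpa using this
  have hne : (interior (cell d)).Nonempty := by
    refine ⟨0, mem_interior.2 ⟨{θ : Euc d | ∀ i, θ i ∈ Set.Ioo (-π) π}, ?_, ?_, ?_⟩⟩
    · intro θ h i; exact Set.Ioo_subset_Icc_self (h i)
    · have : {θ : Euc d | ∀ i, θ i ∈ Set.Ioo (-π) π} =
          ⋂ i, (fun θ : Euc d => θ i) ⁻¹' Set.Ioo (-π) π := by
        ext θ; simp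
      rw [this]
      exact isOpen_iInter_of_finite fun i =>
        isOpen_Ioo.preimage (by fun_prop : Continuous fun θ : Euc d => θ i)
    · intro i; constructor <;> simpa using pi_pos
  rw [hconv.closure_interior_eq_closure_of_nonempty_interior hne]
  exact subset_closure

lemma integrable_cexp_mul (hf : Integrable f (𝕋 d)) (z : Lat d) : Integrable (fun θ => 𝐞⁻[z ⋄ θ] * f
    θ) (𝕋 d) :=
  hf.bdd_mul (c := 1) (continuous_cexp_neg_inner z).aestronglyMeasurable
    (ae_of_all _ fun _ => (norm_cexp_neg_I_mul _).le)

lemma fcoef_add (hf : Integrable f (𝕋 d)) (hg : Integrable g (𝕋 d)) (z : Lat d) : fcoef (fun θ => f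
    θ + g θ) z = fcoef f z + fcoef g z := by
  simp only [fcoef, mul_add]
  rw [integral_add (integrable_cexp_mul hf z) (integrable_cexp_mul hg z), mul_add]

lemma fcoef_sub (hf : Integrable f (𝕋 d)) (hg : Integrable g (𝕋 d)) (z : Lat d) : fcoef (fun θ => f
    θ - g θ) z = fcoef f z - fcoef g z := by
  simp only [fcoef, mul_sub]
  rw [integral_sub (integrable_cexp_mul hf z) (integrable_cexp_mul hg z), mul_sub]

lemma fcoef_finset_sum {ι : Type*} (s : Finset ι) {f : ι → Euc d → ℂ}
    (hf : ∀ i ∈ s, Integrable (f i) (𝕋 d)) (z : Lat d) :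
    fcoef (fun θ => ∑ i ∈ s, f i θ) z = ∑ i ∈ s, fcoef (f i) z := by
  simp only [fcoef, mul_sum]
  rw [integral_finsetSum _ fun i hi => integrable_cexp_mul (hf i hi) z, mul_sum]

lemma memLp_cell_of_continuous (hf : Continuous f) (p : ENNReal) : MemLp f p (𝕋 d) := by
  obtain ⟨B, hB⟩ := isCompact_cell.exists_bound_of_continuousOn (hf.continuousOn (s := cell d))
  exact .of_bound hf.aestronglyMeasurable B
    ((ae_restrict_iff' measurableSet_cell).2 (ae_of_all _ hB))

lemma integrable_cell_of_continuous (hf : Continuous f) : Integrable f (𝕋 d) :=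
  memLp_one_iff_integrable.1 (memLp_cell_of_continuous hf 1)

/-- Fourier inversion on the cell. -/
lemma fsum_fcoef (hu : Continuous u) (hs : Summable fun z => ‖fcoef u z‖) (hθ : θ ∈ cell d) : fsum
    (fcoef u) θ = u θ := by
  have hv := continuous_fsum hs
  have hw0 : ∀ z, fcoef (fun θ => fsum (fcoef u) θ - u θ) z = 0 := fun z => by
    rw [fcoef_sub (integrable_cell_of_continuous hv) (integrable_cell_of_continuous hu),
      fcoef_fsum hs, sub_self]
  have hsq := hasSum_sq_fcoef (memLp_cell_of_continuous (f := fun θ => fsum (fcoef u) θ - u θ) (hv.sub hu) 2)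
  simp only [hw0, norm_zero, ne_eq, OfNat.ofNat_ne_zero, not_false_eq_true, zero_pow] at hsq
  have h0 := hsq.unique hasSum_zero
  have hint : ∫ θ in cell d, ‖fsum (fcoef u) θ - u θ‖ ^ 2 = 0 :=
    (mul_eq_zero.1 h0).resolve_left (inv_ne_zero (two_pi_pow_pos d).ne')
  rw [integral_eq_zero_iff_of_nonneg (fun θ => by positivity)
    (memLp_cell_of_continuous (f := fun θ => fsum (fcoef u) θ - u θ) (hv.sub hu) 2).integrable_norm_pow']
    at hint
  have hae : fsum (fcoef u) =ᵐ[𝕋 d] u := by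
    filter_upwards [hint] with θ h
    simpa [sub_eq_zero] using h
  exact Measure.eqOn_of_ae_eq hae hv.continuousOn hu.continuousOn cell_subset_closure_interior hθ

lemma fsum_periodic (a : Lat d → ℂ) (θ : Euc d) (m : Lat d) :
    fsum a (θ + (2 * π) • toEuc m) = fsum a θ := by
  unfold fsum
  congr 1
  ext z
  congr 1
  rw [inner_add_right, inner_smul_right]
  have : z ⋄ toEuc m = ((∑ i, z i * m i : ℤ) : ℝ) := by rw [inner_toEuc]; push_cast; simp [toEuc]
  rw [this]
  push_cast
  rw [mul_add, exp_add]
  have h1 := Complex.exp_int_mul_two_pi_mul_I (∑ i, z i * m i)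
  have h2 : I * (2 * (π : ℂ) * ∑ i, (z i : ℂ) * (m i : ℂ)) =
      ((∑ i, z i * m i : ℤ) : ℂ) * (2 * π * I) := by
    push_cast; ring
  rw [h2, h1, mul_one]

lemma exists_translate_mem_cell (θ : Euc d) : ∃ m : Lat d, θ + (2 * π) • toEuc m ∈ cell d := by
  have hpi := pi_pos
  refine ⟨fun i => -round (θ i / (2 * π)), fun i => ?_⟩
  have h := abs_sub_round (θ i / (2 * π))
  rw [abs_le] at h
  have h3 : θ i / (2 * π) * (2 * π) = θ i := by field_simp
  simp only [toEuc, PiLp.add_apply, PiLp.smul_apply, smul_eq_mul, Int.cast_neg]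
  constructor <;> nlinarith

lemma norm_fsum_fcoef_le (hu : Continuous u) (hs : Summable fun z => ‖fcoef u z‖) (hB : ∀ θ, ‖u θ‖ ≤
    B) (θ : Euc d) : ‖fsum (fcoef u) θ‖ ≤ B := by
  obtain ⟨m, hm⟩ := exists_translate_mem_cell θ
  rw [← fsum_periodic _ _ m, fsum_fcoef hu hs hm]
  exact hB _

lemma toEuc_injective : Function.Injective (toEuc : Lat d → Euc d) := fun z w h => by
  ext i
  have := congrArg (fun v : Euc d => v i) h
  simpa [toEuc] using this

lemma one_le_norm_toEuc (hz : z ≠ 0) : 1 ≤ ‖toEuc z‖ := by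
  obtain ⟨i, hi⟩ := Function.ne_iff.1 hz
  have h1 : |(z i : ℝ)| ≤ ‖toEuc z‖ := by
    have := PiLp.norm_apply_le (toEuc z) i
    simpa [toEuc] using this
  have h2 : (1 : ℝ) ≤ |(z i : ℝ)| := by rw [← Int.cast_abs]; exact_mod_cast Int.one_le_abs hi
  linarith

lemma summable_one_add_norm (hγ : (d : ℝ) < γ) : Summable fun z : Lat d => (1 + ‖toEuc z‖) ^ (-γ) :=
    by
  set b := (EuclideanSpace.basisFun (Fin d) ℝ).toBasis
  set L : Submodule ℤ (Euc d) := Submodule.span ℤ (Set.range b)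
  have hrank : Module.finrank ℤ L = d := by rw [ZLattice.rank ℝ L]; simp
  have h1 := ZLattice.summable_norm_rpow L (-γ) (by rw [hrank]; linarith)
  have hmem : ∀ z : Lat d, toEuc z ∈ L := fun z => by
    have : toEuc z = ∑ i, z i • b i := by
      ext j
      simp [toEuc, b, Finset.sum_apply, Pi.single_apply]
    rw [this]
    exact Submodule.sum_mem _ fun i _ => Submodule.smul_mem _ _ (Submodule.subset_span ⟨i, rfl⟩)
  have h2 : Summable fun z : Lat d => ‖toEuc z‖ ^ (-γ) := by
    have hinj : Function.Injective fun z : Lat d => (⟨toEuc z, hmem z⟩ : L) := fun z w h => by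
      exact toEuc_injective (Subtype.ext_iff.1 h)
    have h3 := h1.comp_injective hinj
    simpa only [Function.comp_def, Submodule.coe_norm] using h3
  have hγ0 : 0 < γ := lt_of_le_of_lt (Nat.cast_nonneg d) hγ
  refine .of_nonneg_of_le (fun z => by positivity) (fun z => ?_)
    (h2.add (summable_of_hasFiniteSupport (f := fun z : Lat d => if z = 0 then (1 : ℝ) else 0) ?_))
  · by_cases hz : z = 0
    · subst hz
      simp [toEuc_zero]
      positivity
    · simp only [hz, if_false, add_zero]
      have := one_le_norm_toEuc hz
      exact Real.rpow_le_rpow_of_nonpos (by linarith) (by linarith) (by linarith)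
  · refine (Set.finite_singleton (0 : Lat d)).subset fun z hz => ?_
    by_contra h
    simp_all

lemma summable_exp_mul_one_add_norm (hκ : 0 < κ) (m : ℝ) : Summable fun z : Lat d => Real.exp
    (-κ * ‖toEuc z‖) * (1 + ‖toEuc z‖) ^ m := by
  have h := tendsto_rpow_mul_exp_neg_mul_atTop_nhds_zero (m + (d + 1)) κ hκ
  obtain ⟨x0, hx0⟩ := (h.eventually (ge_mem_nhds (show (0 : ℝ) < 1 by norm_num))).exists_forall_of_atTop
  have hcont : ContinuousOn (fun x : ℝ => x ^ (m + (d + 1)) * Real.exp (-κ * x)) (Set.Icc 1 (max 1 x0)) := by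
    refine ContinuousOn.mul (ContinuousOn.rpow_const continuousOn_id fun x hx => ?_) (by fun_prop)
    left; have := hx.1; simp; linarith
  obtain ⟨B, hB⟩ := isCompact_Icc.exists_bound_of_continuousOn hcont
  have hbd : ∀ x : ℝ, 1 ≤ x → x ^ (m + (d + 1)) * Real.exp (-κ * x) ≤ max 1 B := fun x hx => by
    by_cases hxx : x ≤ max 1 x0
    · exact (le_abs_self _).trans ((hB x ⟨hx, hxx⟩).trans (le_max_right _ _))
    · exact (hx0 x (le_of_lt (lt_of_le_of_lt (le_max_right _ _) (not_le.1 hxx)))).trans (le_max_left _ _)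
  refine .of_nonneg_of_le (fun z => by positivity) (fun z => ?_)
    ((summable_one_add_norm (d := d) (γ := d + 1) (by linarith)).mul_left (Real.exp κ * max 1 B))
  set x := 1 + ‖toEuc z‖
  have hx : 1 ≤ x := by simp [x]
  have hx0 : 0 < x := by linarith
  have h1 := hbd x hx
  have e1 : Real.exp (-κ * ‖toEuc z‖) = Real.exp κ * Real.exp (-κ * x) := by
    rw [← Real.exp_add]; congr 1; simp [x]; ring
  have e2 : x ^ m = x ^ (m + (d + 1)) * x ^ (-((d : ℝ) + 1)) := by
    rw [← Real.rpow_add hx0]; congr 1; ring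
  rw [e1, e2]
  calc Real.exp κ * Real.exp (-κ * x) * (x ^ (m + (d + 1)) * x ^ (-((d : ℝ) + 1)))
      = Real.exp κ * (x ^ (m + (d + 1)) * Real.exp (-κ * x)) * x ^ (-((d : ℝ) + 1)) := by ring
    _ ≤ Real.exp κ * max 1 B * x ^ (-((d : ℝ) + 1)) := by gcongr

/-- Lattice Fourier coefficients of a smooth function supported in the cell are summable. -/
lemma summable_fcoef_of_contDiff (hu : ContDiff ℝ (⊤ : ℕ∞) u) (hc : HasCompactSupport u)
    (hsupp : Function.support u ⊆ cell d) : Summable fun z => ‖fcoef u z‖ := by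
  set F : SchwartzMap (Euc d) ℂ := FourierTransform.fourier (hc.toSchwartzMap hu)
  have hF : ∀ z : Lat d, fcoef u z = c𝕋 d * F ((2 * π)⁻¹ • toEuc z) := fun z => by
    rw [fcoef]
    congr 1
    have h1 : ∫ θ in cell d, 𝐞⁻[z ⋄ θ] * u θ = ∫ θ, 𝐞⁻[z ⋄ θ] * u θ := by
      refine setIntegral_eq_integral_of_forall_compl_eq_zero fun θ hθ => ?_
      rw [Function.notMem_support.1 fun h => hθ (hsupp h), mul_zero]
    rw [h1]
    simp only [F]
    rw [SchwartzMap.fourier_coe, Real.fourier_eq']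
    refine integral_congr_ae (ae_of_all _ fun θ => ?_)
    simp only [smul_eq_mul, inner_smul_right]
    congr 2
    have := pi_pos.ne'
    rw [real_inner_comm (toEuc z) θ]
    have e : -2 * π * ((2 * π)⁻¹ * z ⋄ θ) = -z ⋄ θ := by field_simp
    rw [e]; push_cast; ring
  obtain ⟨C, hC⟩ : ∃ C, ∀ x, (1 + ‖x‖) ^ (d + 1) * ‖F x‖ ≤ C := by
    have := fun x => SchwartzMap.one_add_le_sup_seminorm_apply (𝕜 := ℝ) (m := (d + 1, 0)) le_rfl le_rfl F x
    simp only [norm_iteratedFDeriv_zero] at this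
    exact ⟨_, this⟩
  refine .of_nonneg_of_le (fun z => norm_nonneg _) (fun z => ?_)
    ((summable_one_add_norm (d := d) (γ := d + 1) (by linarith)).mul_left
      (((2 * π) ^ d)⁻¹ * (C * (2 * π) ^ (d + 1))))
  rw [hF, norm_mul, norm_inv, norm_real, norm_of_nonneg (two_pi_pow_pos d).le, mul_assoc]
  gcongr
  have h2 := hC ((2 * π)⁻¹ • toEuc z)
  rw [norm_smul, norm_inv, norm_of_nonneg (by positivity)] at h2
  have hpos : 0 < 1 + ‖toEuc z‖ := by positivity
  have e : (1 + ‖toEuc z‖) ^ (-((d : ℝ) + 1)) = ((1 + ‖toEuc z‖) ^ (d + 1))⁻¹ := by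
    rw [rpow_neg hpos.le]; congr 1; exact_mod_cast Real.rpow_natCast _ _
  rw [e, ← div_eq_mul_inv, le_div_iff₀ (by positivity)]
  have h3 : (1 + ‖toEuc z‖) ≤ (2 * π) * (1 + (2 * π)⁻¹ * ‖toEuc z‖) := by
    have : 3 < π := Real.pi_gt_three
    have : (2 * π) * ((2 * π)⁻¹ * ‖toEuc z‖) = ‖toEuc z‖ := by field_simp
    rw [mul_add, this]; linarith
  calc ‖F ((2 * π)⁻¹ • toEuc z)‖ * (1 + ‖toEuc z‖) ^ (d + 1)
      ≤ ‖F ((2 * π)⁻¹ • toEuc z)‖ * ((2 * π) * (1 + (2 * π)⁻¹ * ‖toEuc z‖)) ^ (d + 1) := by gcongr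
    _ = (1 + (2 * π)⁻¹ * ‖toEuc z‖) ^ (d + 1) * ‖F ((2 * π)⁻¹ • toEuc z)‖ *
          (2 * π) ^ (d + 1) := by rw [mul_pow]; ring
    _ ≤ C * (2 * π) ^ (d + 1) := by gcongr

section

variable {g : Euc d → ℝ}

/-! ### Wave packets -/

lemma contDiff_of_contDiffAt_tsupport {E F : Type*} [NormedAddCommGroup E] [NormedSpace ℝ E]
    [NormedAddCommGroup F] [NormedSpace ℝ F] {n : WithTop ℕ∞} {f : E → F}
    (h : ∀ x ∈ tsupport f, ContDiffAt ℝ n f x) : ContDiff ℝ n f := by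
  rw [contDiff_iff_contDiffAt]
  intro x
  by_cases hx : x ∈ tsupport f
  · exact h x hx
  · have : f =ᶠ[𝓝 x] fun _ => 0 := notMem_tsupport_iff_eventuallyEq.1 hx
    exact contDiffAt_const.congr_of_eventuallyEq this

lemma integrable_of_continuousOn_tsupport {F : Type*} [NormedAddCommGroup F] (hu : HasCompactSupport
    u) {f : Euc d → F} (hf : ContinuousOn f (tsupport u)) (h0 : ∀ x, x ∉ tsupport u → f x = 0) :
    Integrable f := by
  rw [← integrableOn_iff_integrable_of_support_subset (s := tsupport u)]
  · exact hf.integrableOn_compact hu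
  · intro x hx
    by_contra h
    exact hx (h0 x h)

lemma continuousAt_fderiv_apply (hg : ContDiffAt ℝ 1 g x) (v : Euc d) : ContinuousAt
    (fun y => fderiv ℝ g y v) x :=
  (hg.continuousAt_fderiv (by norm_num)).clm_apply continuousAt_const

/-- Integration by parts for oscillatory integrals. -/
lemma integral_cexp_fderiv_mul (hu : ContDiff ℝ 1 u) (hc : HasCompactSupport u) (hg : ∀ x ∈ tsupport
    u, ContDiffAt ℝ 1 g x) (v : Euc d) : ∫ x, 𝐞[g x] * ((fderiv ℝ g x v : ℂ) * u x) = I * ∫ x,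
    𝐞[g x] * fderiv ℝ u x v := by
  set E : Euc d → ℂ := fun x => 𝐞[g x]
  have hE : ∀ x ∈ tsupport u, HasFDerivAt E
      (E x • (I • (ofRealCLM.comp (fderiv ℝ g x)))) x := fun x hx => by
    have h1 := ((hg x hx).differentiableAt (by norm_num)).hasFDerivAt
    have h2 : HasFDerivAt (fun x => (g x : ℂ)) (ofRealCLM.comp (fderiv ℝ g x)) x :=
      ofRealCLM.hasFDerivAt.comp x h1
    exact (h2.const_mul I).cexp
  have hEc : ContinuousOn E (tsupport u) := fun x hx => (hE x hx).continuousAt.continuousWithinAt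
  have hgc : ContinuousOn (fun x => (fderiv ℝ g x v : ℂ)) (tsupport u) := fun x hx =>
    (continuous_ofReal.continuousAt.comp (continuousAt_fderiv_apply (hg x hx) v)).continuousWithinAt
  have huc : Continuous u := hu.continuous
  have hu'c : Continuous fun x => fderiv ℝ u x v :=
    (hu.continuous_fderiv (by norm_num)).clm_apply continuous_const
  have hu0 : ∀ x, x ∉ tsupport u → u x = 0 := fun x hx => image_eq_zero_of_notMem_tsupport hx
  have hu'0 : ∀ x, x ∉ tsupport u → fderiv ℝ u x v = 0 := fun x hx => by
    have : x ∉ tsupport (fderiv ℝ u) := fun h => hx (tsupport_fderiv_subset ℝ h)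
    rw [image_eq_zero_of_notMem_tsupport this]; rfl
  have hE' : ∀ x, fderiv ℝ E x v * u x = I * (E x * ((fderiv ℝ g x v : ℂ) * u x)) := fun x => by
    by_cases hx : x ∈ tsupport u
    · rw [(hE x hx).fderiv]
      simp only [_root_.smul_apply, ContinuousLinearMap.comp_apply,
        Complex.ofRealCLM_apply, smul_eq_mul]
      ring
    · rw [hu0 x hx]; simp
  have key := integral_mul_fderiv_eq_neg_fderiv_mul_of_integrable (𝕜 := ℂ) (μ := (volume : Measure (Euc d)))
    (f := E) (g := u) (v := v) ?_ ?_ ?_ (fun x hx => (hE x hx).differentiableAt)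
    (fun x _ => hu.differentiable (by norm_num) x)
  · rw [key]
    simp_rw [hE']
    rw [integral_const_mul, mul_neg, ← mul_assoc, Complex.I_mul_I]
    simp [E]
  · simp_rw [hE']
    exact integrable_of_continuousOn_tsupport hc
      (continuousOn_const.mul (hEc.mul (hgc.mul huc.continuousOn))) fun x hx => by simp [hu0 x hx]
  · exact integrable_of_continuousOn_tsupport hc (hEc.mul hu'c.continuousOn)
      fun x hx => by simp [hu'0 x hx]
  · exact integrable_of_continuousOn_tsupport hc (hEc.mul huc.continuousOn)
      fun x hx => by simp [hu0 x hx]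

/-- A phase function and a smooth amplitude supported in the open cell, with the phase smooth near the
support of the amplitude. -/
structure IsPiece (ω : Euc d → ℝ) (a : Euc d → ℂ) : Prop where
  smooth : ContDiff ℝ (⊤ : ℕ∞) a
  compact : HasCompactSupport a
  subset : tsupport a ⊆ interior (cell d)
  phase : ∀ θ ∈ tsupport a, ContDiffAt ℝ (⊤ : ℕ∞) ω θ

/-- The amplitude `a` propagated by the phase `ω`. -/
def wave (t : ℝ) (ω : Euc d → ℝ) (a : Euc d → ℂ) (θ : Euc d) : ℂ := 𝐞⁻[(t * ω θ : ℝ)] * a θ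

/-- The wave packet on the lattice with amplitude `a` and phase `ω` at time `t`. -/
def packet (t : ℝ) (ω : Euc d → ℝ) (a : Euc d → ℂ) : Lat d → ℂ := fcoef (wave t ω a)

lemma norm_wave (t : ℝ) (ω : Euc d → ℝ) (a : Euc d → ℂ) (θ : Euc d) : ‖wave t ω a θ‖ = ‖a θ‖ := by
  rw [wave, norm_mul, norm_cexp_neg_I_mul, one_mul]

lemma tsupport_wave_subset (t : ℝ) (ω : Euc d → ℝ) (a : Euc d → ℂ) :
    tsupport (wave t ω a) ⊆ tsupport a :=
  tsupport_mul_subset_right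

namespace IsPiece

variable {ω : Euc d → ℝ} {a : Euc d → ℂ}

lemma contDiff_wave (h : IsPiece ω a) (t : ℝ) : ContDiff ℝ (⊤ : ℕ∞) (wave t ω a) := by
  refine contDiff_of_contDiffAt_tsupport fun x hx => ?_
  have hx' := tsupport_wave_subset t ω a hx
  have h1 : ContDiffAt ℝ (⊤ : ℕ∞) (fun θ => ((t * ω θ : ℝ) : ℂ)) x :=
    ofRealCLM.contDiff.contDiffAt.comp x (contDiffAt_const.mul (h.phase x hx'))
  exact ((contDiffAt_const.mul h1).neg.cexp).mul h.smooth.contDiffAt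

lemma hasCompactSupport_wave (h : IsPiece ω a) (t : ℝ) : HasCompactSupport (wave t ω a) :=
  h.compact.mul_left

lemma support_wave_subset (h : IsPiece ω a) (t : ℝ) : Function.support (wave t ω a) ⊆ cell d :=
  (subset_tsupport _).trans ((tsupport_wave_subset t ω a).trans (h.subset.trans interior_subset))

lemma continuous_wave (h : IsPiece ω a) (t : ℝ) : Continuous (wave t ω a) :=
  (h.contDiff_wave t).continuous

lemma summable_packet (h : IsPiece ω a) (t : ℝ) : Summable fun z => ‖packet t ω a z‖ :=
  summable_fcoef_of_contDiff (h.contDiff_wave t) (h.hasCompactSupport_wave t) (h.support_wave_subset t)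

lemma fsum_packet (h : IsPiece ω a) (t : ℝ) (hθ : θ ∈ cell d) : fsum (packet t ω a) θ = wave t ω a θ
    :=
  fsum_fcoef (h.continuous_wave t) (h.summable_packet t) hθ

lemma exists_bound (h : IsPiece ω a) : ∃ B, 0 ≤ B ∧ ∀ θ, ‖a θ‖ ≤ B := by
  obtain ⟨B, hB⟩ := h.compact.exists_bound_of_continuous h.smooth.continuous
  exact ⟨B, (norm_nonneg _).trans (hB 0), hB⟩

lemma norm_fsum_packet_le (h : IsPiece ω a) (t : ℝ) (hB : ∀ θ, ‖a θ‖ ≤ B) (θ : Euc d) : ‖fsum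
    (packet t ω a) θ‖ ≤ B :=
  norm_fsum_fcoef_le (h.continuous_wave t) (h.summable_packet t)
    (fun θ => (norm_wave t ω a θ).trans_le (hB θ)) θ

lemma hasSum_sq_packet (h : IsPiece ω a) (t : ℝ) :
    HasSum (fun z => ‖packet t ω a z‖ ^ 2) (((2 * π) ^ d)⁻¹ * ∫ θ in cell d, ‖a θ‖ ^ 2) := by
  have := hasSum_sq_fcoef (memLp_cell_of_continuous (h.continuous_wave t) 2)
  simp only [norm_wave] at this
  exact this

lemma integral_wave (h : IsPiece ω a) (t : ℝ) (z : Lat d) : packet t ω a z =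
    c𝕋 d * ∫ θ, 𝐞⁻[z ⋄ θ] * wave t ω a θ := by
  rw [packet, fcoef]
  congr 1
  refine setIntegral_eq_integral_of_forall_compl_eq_zero fun θ hθ => ?_
  rw [Function.notMem_support.1 fun hh => hθ (h.support_wave_subset t hh), mul_zero]

end IsPiece

variable [NeZero d]

/-- The derivative in the first coordinate direction. -/
def der0 (ω : Euc d → ℝ) (θ : Euc d) : ℝ := fderiv ℝ ω θ (single 0 1)

lemma contDiffAt_der0 (h : ContDiffAt ℝ (⊤ : ℕ∞) ω θ) : ContDiffAt ℝ (⊤ : ℕ∞) (der0 ω) θ := by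
  have h1 : ContDiffAt ℝ (⊤ : ℕ∞) (fderiv ℝ ω) θ := h.fderiv_right (by simp)
  exact h1.clm_apply contDiffAt_const

/-- The mass of a wave packet on one layer `y₁ = m` off resonance. -/
lemma IsPiece.layer_bound {a : Euc d → ℂ} (h : IsPiece ω a) : ∃ A, 0 ≤ A ∧ ∀ (t : ℝ) (m : ℤ)
    (L : ℝ), 0 < L → (∀ θ ∈ tsupport a, L ≤ |m + t * der0 ω θ|) → ∀ F : Finset (Lat d), (∀ y ∈ F, y
    0 = m) → ∑ y ∈ F, ‖packet t ω a y‖ ^ 2 ≤ (A * (1 + |t| / L) / L) ^ 2 := by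
  set e0 : Euc d := single 0 1
  have ha1 : Continuous fun θ => fderiv ℝ a θ e0 :=
    (h.smooth.continuous_fderiv (by simp)).clm_apply continuous_const
  obtain ⟨A1, hA1⟩ := (show IsCompact (tsupport a) from h.compact).exists_bound_of_continuousOn
    ha1.continuousOn
  have ha2 : ContinuousOn (fun θ => fderiv ℝ (der0 ω) θ e0) (tsupport a) := fun θ hθ =>
    (continuousAt_fderiv_apply ((contDiffAt_der0 (h.phase θ hθ)).of_le (by simp)) e0).continuousWithinAt
  obtain ⟨A2, hA2⟩ := (show IsCompact (tsupport a) from h.compact).exists_bound_of_continuousOn ha2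
  obtain ⟨B, hB0, hB⟩ := h.exists_bound
  set M := max |A1| (B * |A2|)
  have hM0 : 0 ≤ M := (abs_nonneg _).trans (le_max_left _ _)
  set c : ℝ := ((2 * π) ^ d)⁻¹ * volume.real (cell d)
  have hc0 : 0 ≤ c := by positivity
  refine ⟨M * √c, by positivity, fun t m L hL hlow F hF => ?_⟩
  set g : Euc d → ℝ := fun θ => m + t * der0 ω θ
  have hgs : ∀ θ ∈ tsupport a, ContDiffAt ℝ (⊤ : ℕ∞) g θ := fun θ hθ =>
    contDiffAt_const.add (contDiffAt_const.mul (contDiffAt_der0 (h.phase θ hθ)))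
  have hg0 : ∀ θ ∈ tsupport a, g θ ≠ 0 := fun θ hθ h0 => by
    have := hlow θ hθ
    simp only [g] at h0
    rw [h0, abs_zero] at this
    linarith
  set u : Euc d → ℂ := fun θ => ((-(g θ)⁻¹ : ℝ) : ℂ) * a θ
  have hut : tsupport u ⊆ tsupport a := tsupport_mul_subset_right
  have hus : ContDiff ℝ (⊤ : ℕ∞) u := contDiff_of_contDiffAt_tsupport fun θ hθ =>
    (ofRealCLM.contDiff.contDiffAt.comp θ
      ((hgs θ (hut hθ)).inv (hg0 θ (hut hθ))).neg).mul h.smooth.contDiffAt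
  have huc : HasCompactSupport u := h.compact.mul_left
  set b : Euc d → ℂ := fun θ => fderiv ℝ u θ e0
  have hbc : Continuous b := (hus.continuous_fderiv (by simp)).clm_apply continuous_const
  have hb0 : ∀ θ, θ ∉ tsupport a → b θ = 0 := fun θ hθ => by
    have : θ ∉ tsupport (fderiv ℝ u) := fun hh => hθ (hut (tsupport_fderiv_subset ℝ hh))
    simp only [b]
    rw [image_eq_zero_of_notMem_tsupport this]; rfl
  -- pointwise bound on the new amplitude
  have hbb : ∀ θ, ‖b θ‖ ≤ M * (1 + |t| / L) / L := fun θ => by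
    by_cases hθ : θ ∈ tsupport a
    · have hd1 : HasFDerivAt g (t • fderiv ℝ (der0 ω) θ) θ := by
        have := ((contDiffAt_der0 (h.phase θ hθ)).differentiableAt (by simp)).hasFDerivAt
        exact (this.const_mul t).const_add _
      have hd2 : HasFDerivAt (fun θ => -(g θ)⁻¹) (((g θ) ^ 2)⁻¹ • (t • fderiv ℝ (der0 ω) θ)) θ := by
        have h3 := ((hasDerivAt_inv (hg0 θ hθ)).comp_hasFDerivAt θ hd1).neg
        rw [neg_smul, neg_neg] at h3
        exact h3
      have hd3 : HasFDerivAt (fun θ => ((-(g θ)⁻¹ : ℝ) : ℂ))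
          (ofRealCLM.comp (((g θ) ^ 2)⁻¹ • (t • fderiv ℝ (der0 ω) θ))) θ :=
        ofRealCLM.hasFDerivAt.comp θ hd2
      have hd4 := hd3.mul (h.smooth.differentiable (by simp) θ).hasFDerivAt
      have hval : b θ = ((-(g θ)⁻¹ : ℝ) : ℂ) * fderiv ℝ a θ e0 +
          a θ * (((((g θ) ^ 2)⁻¹ * (t * fderiv ℝ (der0 ω) θ e0)) : ℝ) : ℂ) := by
        simp only [b, u]
        have hd5 : fderiv ℝ (fun θ => ((-(g θ)⁻¹ : ℝ) : ℂ) * a θ) θ = _ := hd4.fderiv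
        rw [hd5]
        simp
      have hgL : L ≤ |g θ| := hlow θ hθ
      have hgpos : 0 < |g θ| := hL.trans_le hgL
      rw [hval]
      refine (norm_add_le _ _).trans ?_
      rw [norm_mul, norm_mul, norm_real, norm_real, norm_eq_abs, norm_eq_abs,
        abs_neg, abs_inv, abs_mul, abs_inv, abs_mul, abs_pow]
      have e1 : |g θ|⁻¹ * ‖fderiv ℝ a θ e0‖ ≤ L⁻¹ * M := by
        gcongr
        exact (hA1 θ hθ).trans ((le_abs_self _).trans (le_max_left _ _))
      have e2 : ‖a θ‖ * ((|g θ| ^ 2)⁻¹ * (|t| * |fderiv ℝ (der0 ω) θ e0|)) ≤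
          (L ^ 2)⁻¹ * |t| * M := by
        have h6 : |fderiv ℝ (der0 ω) θ e0| ≤ |A2| := (hA2 θ hθ).trans (le_abs_self _)
        calc ‖a θ‖ * ((|g θ| ^ 2)⁻¹ * (|t| * |fderiv ℝ (der0 ω) θ e0|))
            ≤ B * ((L ^ 2)⁻¹ * (|t| * |A2|)) := by
              gcongr
              exact hB θ
          _ = (L ^ 2)⁻¹ * |t| * (B * |A2|) := by ring
          _ ≤ (L ^ 2)⁻¹ * |t| * M := by gcongr; exact le_max_right _ _
      calc _ ≤ L⁻¹ * M + (L ^ 2)⁻¹ * |t| * M := add_le_add e1 e2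
        _ = M * (1 + |t| / L) / L := by field_simp
    · rw [hb0 θ hθ, norm_zero]; positivity
  -- integration by parts
  have hpk : ∀ y : Lat d, y 0 = m → packet t ω a y = I * fcoef (wave t ω b) y := fun y hy => by
    set G : Euc d → ℝ := fun θ => -(y ⋄ θ + t * ω θ)
    have hGs : ∀ θ ∈ tsupport u, ContDiffAt ℝ 1 G θ := fun θ hθ =>
      (((contDiff_const.inner ℝ contDiff_id).contDiffAt).add
        (contDiffAt_const.mul ((h.phase θ (hut hθ)).of_le (by simp)))).neg
    have hG' : ∀ θ ∈ tsupport a, fderiv ℝ G θ e0 = -g θ := fun θ hθ => by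
      have h1 := ((h.phase θ hθ).differentiableAt (by simp)).hasFDerivAt
      have h2 : HasFDerivAt (fun θ : Euc d => y ⋄ θ) (innerSL ℝ (toEuc y)) θ :=
        (innerSL ℝ (toEuc y)).hasFDerivAt
      have h3 : HasFDerivAt G (-(innerSL ℝ (toEuc y) + t • fderiv ℝ ω θ)) θ :=
        (h2.add (h1.const_mul t)).neg
      rw [h3.fderiv]
      have h4 : y ⋄ e0 = m := by rw [inner_toEuc]; simp [e0, Pi.single_apply, hy]
      simp only [g, der0, ← h4]
      simp [e0]
    have hibp := integral_cexp_fderiv_mul (hus.of_le (by simp)) huc hGs e0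
    have hexp : ∀ θ, 𝐞[G θ] = 𝐞⁻[y ⋄ θ] * 𝐞⁻[(t * ω θ : ℝ)] := fun θ => by
      rw [← exp_add]; congr 1; simp only [G]; push_cast; ring
    rw [h.integral_wave, fcoef]
    have e1 : ∫ θ in cell d, 𝐞⁻[y ⋄ θ] * wave t ω b θ = ∫ θ, 𝐞[G θ] * fderiv ℝ u θ e0 := by
      rw [setIntegral_eq_integral_of_forall_compl_eq_zero]
      · refine integral_congr_ae (ae_of_all _ fun θ => ?_)
        simp only [wave, hexp, b, mul_assoc]
      · intro θ hθ
        have : b θ = 0 := hb0 θ fun hh => hθ (interior_subset (h.subset hh))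
        simp [wave, this]
    have e2 : ∫ θ, 𝐞⁻[y ⋄ θ] * wave t ω a θ = ∫ θ, 𝐞[G θ] * ((fderiv ℝ G θ e0 : ℂ) * u θ) := by
      refine integral_congr_ae (ae_of_all _ fun θ => ?_)
      simp only [wave, hexp]
      by_cases hθ : θ ∈ tsupport a
      · rw [hG' θ hθ]
        have : (g θ : ℂ) ≠ 0 := by exact_mod_cast hg0 θ hθ
        simp only [u]
        push_cast
        field_simp
      · have : a θ = 0 := image_eq_zero_of_notMem_tsupport hθ
        simp [u, this]
    rw [e1, e2, hibp]
    ring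
  -- Bessel
  have hbm : MemLp (wave t ω b) 2 (𝕋 d) := by
    have hm : AEStronglyMeasurable (wave t ω b) (volume : Measure (Euc d)) := by
      refine (integrable_of_continuousOn_tsupport h.compact ?_ fun θ hθ => ?_).aestronglyMeasurable
      · intro θ hθ
        have h1 : ContinuousAt (fun θ => ((t * ω θ : ℝ) : ℂ)) θ :=
          continuous_ofReal.continuousAt.comp (continuousAt_const.mul (h.phase θ hθ).continuousAt)
        exact ((continuousAt_const.mul h1).neg.cexp.mul hbc.continuousAt).continuousWithinAt
      · simp [wave, hb0 θ hθ]
    exact .of_bound hm.restrict (M * (1 + |t| / L) / L)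
      (ae_of_all _ fun θ => (norm_wave t ω b θ).trans_le (hbb θ))
  have hbes := hasSum_sq_fcoef hbm
  calc ∑ y ∈ F, ‖packet t ω a y‖ ^ 2 = ∑ y ∈ F, ‖fcoef (wave t ω b) y‖ ^ 2 := by
        refine sum_congr rfl fun y hy => ?_
        rw [hpk y (hF y hy), norm_mul, Complex.norm_I, one_mul]
    _ ≤ ((2 * π) ^ d)⁻¹ * ∫ θ in cell d, ‖wave t ω b θ‖ ^ 2 :=
        sum_le_hasSum F (fun _ _ => by positivity) hbes
    _ ≤ ((2 * π) ^ d)⁻¹ * ((M * (1 + |t| / L) / L) ^ 2 * volume.real (cell d)) := by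
        gcongr
        have := norm_setIntegral_le_of_norm_le_const (μ := volume) (s := cell d)
          (f := fun θ => ‖wave t ω b θ‖ ^ 2) (C := (M * (1 + |t| / L) / L) ^ 2)
          isCompact_cell.measure_lt_top fun θ _ => by
            rw [norm_pow, norm_norm, norm_wave]
            exact pow_le_pow_left₀ (norm_nonneg _) (hbb θ) 2
        exact (le_abs_self _).trans this
    _ = (M * √c * (1 + |t| / L) / L) ^ 2 := by
        have : √c ^ 2 = c := Real.sq_sqrt hc0
        calc _ = (M * (1 + |t| / L) / L) ^ 2 * c := by ring
          _ = (M * (1 + |t| / L) / L) ^ 2 * √c ^ 2 := by rw [this]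
          _ = _ := by ring

end

section

variable {p q : Lat d} {a : Euc d → ℂ}

/-! ### Sesquilinear sums over the lattice -/

/-- Every finite partial sum of `‖φ‖²` over points of `S` is at most `m`. -/
def SqBound (φ : Lat d → ℂ) (S : Set (Lat d)) (m : ℝ) : Prop :=
  ∀ F : Finset (Lat d), (∀ y ∈ F, y ∈ S) → ∑ y ∈ F, ‖φ y‖ ^ 2 ≤ m

/-- `∑_x w(x) φ(p - x) conj ψ(q - x)`. -/
def pairSum (w φ ψ : Lat d → ℂ) (p q : Lat d) : ℂ := ∑' x, w x * (φ (p - x) * conj (ψ (q - x)))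

lemma sum_norm_pair_le {n : ℝ} (hW : ∀ x, ‖w x‖ ≤ W) (hS : ∀ x, w x ≠ 0 → p - x ∈ S) (hφ : SqBound φ
    S m) (hψ : SqBound ψ univ n) (F : Finset (Lat d)) : ∑ x ∈ F, ‖w x * (φ (p - x) * conj
    (ψ (q - x)))‖ ≤ W * (√m * √n) := by
  classical
  have hW0 : 0 ≤ W := (norm_nonneg _).trans (hW 0)
  set F' := F.filter fun x => w x ≠ 0
  have h1 : ∑ x ∈ F, ‖w x * (φ (p - x) * conj (ψ (q - x)))‖ =
      ∑ x ∈ F', ‖w x * (φ (p - x) * conj (ψ (q - x)))‖ := by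
    rw [Finset.sum_filter]
    refine sum_congr rfl fun x _ => ?_
    split_ifs with h
    · rfl
    · push Not at h; simp [h]
  have h2 : ∑ x ∈ F', ‖φ (p - x)‖ ^ 2 ≤ m := by
    have := hφ (F'.image fun x => p - x) (by
      intro y hy
      obtain ⟨x, hx, rfl⟩ := Finset.mem_image.1 hy
      exact hS x (Finset.mem_filter.1 hx).2)
    rwa [Finset.sum_image (fun x _ y _ h => sub_right_injective h)] at this
  have h3 : ∑ x ∈ F', ‖ψ (q - x)‖ ^ 2 ≤ n := by
    have := hψ (F'.image fun x => q - x) (by simp)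
    rwa [Finset.sum_image (fun x _ y _ h => sub_right_injective h)] at this
  rw [h1]
  calc ∑ x ∈ F', ‖w x * (φ (p - x) * conj (ψ (q - x)))‖
      ≤ ∑ x ∈ F', W * (‖φ (p - x)‖ * ‖ψ (q - x)‖) := by
        refine sum_le_sum fun x _ => ?_
        rw [norm_mul, norm_mul, RCLike.norm_conj]
        gcongr
        exact hW x
    _ = W * ∑ x ∈ F', ‖φ (p - x)‖ * ‖ψ (q - x)‖ := by rw [mul_sum]
    _ ≤ W * (√(∑ x ∈ F', ‖φ (p - x)‖ ^ 2) * √(∑ x ∈ F', ‖ψ (q - x)‖ ^ 2)) := by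
        gcongr
        exact Real.sum_mul_le_sqrt_mul_sqrt _ _ _
    _ ≤ W * (√m * √n) := by gcongr

lemma summable_pair {n : ℝ} (hW : ∀ x, ‖w x‖ ≤ W) (hφ : SqBound φ univ m) (hψ : SqBound ψ
    univ n) (p q : Lat d) : Summable fun x => w x * (φ (p - x) * conj (ψ (q - x))) :=
  Summable.of_norm (summable_of_sum_le (fun _ => norm_nonneg _)
    (sum_norm_pair_le hW (fun _ _ => Set.mem_univ _) hφ hψ))

lemma norm_pairSum_le {n : ℝ} (hW : ∀ x, ‖w x‖ ≤ W) (hS : ∀ x, w x ≠ 0 → p - x ∈ S) (hφ : SqBound φ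
    S m) (hψ : SqBound ψ univ n) : ‖pairSum w φ ψ p q‖ ≤ W * (√m * √n) := by
  have hs : Summable fun x => ‖w x * (φ (p - x) * conj (ψ (q - x)))‖ :=
    summable_of_sum_le (fun _ => norm_nonneg _) (sum_norm_pair_le hW hS hφ hψ)
  exact (norm_tsum_le_tsum_norm hs).trans
    (Real.tsum_le_of_sum_le (fun _ => norm_nonneg _) (sum_norm_pair_le hW hS hφ hψ))

/-- `∑_k ∑_x n(x, k) φ(p - x) conj ψ(q - x + k)`. -/
def bform (n : Lat d → Lat d → ℂ) (φ ψ : Lat d → ℂ) (p q : Lat d) : ℂ :=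
  ∑' k, pairSum (fun x => n x k) φ ψ p (q + k)

lemma norm_bform_le {n : Lat d → Lat d → ℂ} (hν : Summable ν) (hn : ∀ x k, ‖n x k‖ ≤ ν k)
    (hφ : SqBound φ univ m1) (hψ : SqBound ψ univ m2) (p q : Lat d) : ‖bform n φ ψ p q‖ ≤
    (∑' k, ν k) * (√m1 * √m2) := by
  rw [← tsum_mul_right]
  refine tsum_of_norm_bounded (hν.mul_right _).hasSum fun k => ?_
  exact norm_pairSum_le (fun x => hn x k) (fun _ _ => Set.mem_univ _) hφ hψ

lemma summable_pairSum {n : Lat d → Lat d → ℂ} (hν : Summable ν) (hn : ∀ x k, ‖n x k‖ ≤ ν k)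
    (hφ : SqBound φ univ m1) (hψ : SqBound ψ univ m2) (p q : Lat d) : Summable fun k =>
    pairSum (fun x => n x k) φ ψ p (q + k) :=
  Summable.of_norm_bounded (hν.mul_right (√m1 * √m2)) fun k =>
    norm_pairSum_le (fun x => hn x k) (fun _ _ => Set.mem_univ _) hφ hψ

lemma SqBound.add {m' : ℝ} (h : SqBound φ S m) (h' : SqBound φ' S m') : SqBound (fun y => φ y + φ'
    y) S (2 * (m + m')) := fun F hF => by
  calc ∑ y ∈ F, ‖φ y + φ' y‖ ^ 2 ≤ ∑ y ∈ F, 2 * (‖φ y‖ ^ 2 + ‖φ' y‖ ^ 2) := by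
        refine sum_le_sum fun y _ => ?_
        have := norm_add_le (φ y) (φ' y)
        nlinarith [norm_nonneg (φ y + φ' y), sq_nonneg (‖φ y‖ - ‖φ' y‖)]
    _ = 2 * (∑ y ∈ F, ‖φ y‖ ^ 2 + ∑ y ∈ F, ‖φ' y‖ ^ 2) := by rw [← mul_sum, sum_add_distrib]
    _ ≤ 2 * (m + m') := by gcongr <;> [exact h F hF; exact h' F hF]

lemma exists_sqBound_sum {ι : Type*} (s : Finset ι) {φ : ι → Lat d → ℂ} (h : ∀ i ∈ s, ∃ m, SqBound
    (φ i) S m) : ∃ m, SqBound (fun y => ∑ i ∈ s, φ i y) S m := by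
  classical
  induction s using Finset.induction_on with
  | empty => exact ⟨0, fun F _ => by simp⟩
  | insert i s hi ih =>
    obtain ⟨m, hm⟩ := h i (Finset.mem_insert_self i s)
    obtain ⟨m', hm'⟩ := ih fun j hj => h j (Finset.mem_insert_of_mem hj)
    exact ⟨_, by simpa only [Finset.sum_insert hi] using hm.add hm'⟩

lemma pairSum_sum_left {ι : Type*} (s : Finset ι) {φ : ι → Lat d → ℂ} {n : ℝ} (hW : ∀ x, ‖w x‖ ≤ W)
    (hφ : ∀ i ∈ s, ∃ m, SqBound (φ i) univ m) (hψ : SqBound ψ univ n) (p q : Lat d) :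
    pairSum w (fun y => ∑ i ∈ s, φ i y) ψ p q = ∑ i ∈ s, pairSum w (φ i) ψ p q := by
  simp only [pairSum]
  rw [← Summable.tsum_finsetSum]
  · congr 1; ext x; rw [sum_mul, mul_sum]
  · intro i hi
    obtain ⟨m, hm⟩ := hφ i hi
    exact summable_pair hW hm hψ p q

lemma pairSum_sum_right {ι : Type*} (s : Finset ι) {ψ : ι → Lat d → ℂ} {n : ℝ} (hW : ∀ x, ‖w x‖ ≤ W)
    (hψ : ∀ i ∈ s, ∃ m, SqBound (ψ i) univ m) (hφ : SqBound φ univ n) (p q : Lat d) :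
    pairSum w φ (fun y => ∑ i ∈ s, ψ i y) p q = ∑ i ∈ s, pairSum w φ (ψ i) p q := by
  simp only [pairSum]
  rw [← Summable.tsum_finsetSum]
  · congr 1; ext x; rw [map_sum, mul_sum, mul_sum]
  · intro i hi
    obtain ⟨m, hm⟩ := hψ i hi
    exact summable_pair hW hφ hm p q

lemma bform_sum_left {ι : Type*} (s : Finset ι) {n : Lat d → Lat d → ℂ} (hν : Summable ν)
    (hn : ∀ x k, ‖n x k‖ ≤ ν k) {φ : ι → Lat d → ℂ} (hφ : ∀ i ∈ s, ∃ m, SqBound (φ i) univ m)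
    (hψ : SqBound ψ univ m) (p q : Lat d) : bform n (fun y => ∑ i ∈ s, φ i y) ψ p q = ∑ i ∈ s,
    bform n (φ i) ψ p q := by
  simp only [bform]
  rw [← Summable.tsum_finsetSum]
  · congr 1; ext k
    exact pairSum_sum_left s (fun x => hn x k) hφ hψ _ _
  · intro i hi
    obtain ⟨m, hm⟩ := hφ i hi
    exact summable_pairSum hν hn hm hψ p q

lemma bform_sum_right {ι : Type*} (s : Finset ι) {n : Lat d → Lat d → ℂ} (hν : Summable ν)
    (hn : ∀ x k, ‖n x k‖ ≤ ν k) {ψ : ι → Lat d → ℂ} (hψ : ∀ i ∈ s, ∃ m, SqBound (ψ i) univ m)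
    (hφ : SqBound φ univ m) (p q : Lat d) : bform n φ (fun y => ∑ i ∈ s, ψ i y) p q = ∑ i ∈ s,
    bform n φ (ψ i) p q := by
  simp only [bform]
  rw [← Summable.tsum_finsetSum]
  · congr 1; ext k
    exact pairSum_sum_right s (fun x => hn x k) hψ hφ _ _
  · intro i hi
    obtain ⟨m, hm⟩ := hψ i hi
    exact summable_pairSum hν hn hφ hm p q

lemma sqBound_of_hasSum (h : HasSum (fun y => ‖φ y‖ ^ 2) m) (S : Set (Lat d)) : SqBound φ S m := fun F _ => sum_le_hasSum F (fun _ _ => by positivity) h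

lemma sqBound_fcoef (hf : MemLp f 2 (𝕋 d)) : SqBound (fcoef f) univ (((2 * π) ^ d)⁻¹ * ∫ θ in
    cell d, ‖f θ‖ ^ 2) :=
  sqBound_of_hasSum (hasSum_sq_fcoef hf) _

lemma IsPiece.sqBound (h : IsPiece ω a) (t : ℝ) : SqBound (packet t ω a) univ (((2 * π) ^ d)⁻¹ *
    ∫ θ in cell d, ‖a θ‖ ^ 2) :=
  sqBound_of_hasSum (h.hasSum_sq_packet t) _

/-! ### Propagation -/

lemma summable_int_weight : Summable fun m : ℤ => (|(m : ℝ)| + 1) ^ (-(3 / 2 : ℝ)) := by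
  have h := Real.summable_abs_int_rpow (b := 3 / 2) (by norm_num)
  have h0 : Summable fun m : ℤ => if m = 0 then (1 : ℝ) else 0 := by
    refine summable_of_hasFiniteSupport ((Set.finite_singleton (0 : ℤ)).subset fun m hm => ?_)
    by_contra h
    simp_all
  refine .of_nonneg_of_le (fun m => by positivity) (fun m => ?_) (h.add h0)
  by_cases hm : m = 0
  · simp [hm]
  · simp only [hm, if_false, add_zero]
    have : 0 < |(m : ℝ)| := by positivity
    exact Real.rpow_le_rpow_of_nonpos this (by linarith) (by norm_num)

variable [NeZero d]

/-- A wave packet has little mass on sets where no classical trajectory can be. -/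
lemma IsPiece.mass_bound (h : IsPiece ω a) (hc : 0 < c) : ∃ K, 0 ≤ K ∧ ∀ t : ℝ, 1 ≤ c * |t| → ∀ S :
    Set (Lat d), (∀ y ∈ S, ∀ θ ∈ tsupport a, (|(y 0 : ℝ)| + c * |t|) / 4 ≤ |y 0 + t * der0 ω θ|) →
    SqBound (packet t ω a) S (K * (c * |t|) ^ (-(1 / 2 : ℝ))) := by
  classical
  obtain ⟨A, hA0, hA⟩ := h.layer_bound
  refine ⟨16 * (A * (1 + 4 / c)) ^ 2 * ∑' m : ℤ, (|(m : ℝ)| + 1) ^ (-(3 / 2 : ℝ)), by positivity,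
    fun t ht S hS F hF => ?_⟩
  set X := c * |t|
  have hX : 0 < X := by linarith
  have hlayer : ∀ m ∈ F.image fun y => y 0, ∑ y ∈ F with y 0 = m, ‖packet t ω a y‖ ^ 2 ≤
      16 * (A * (1 + 4 / c)) ^ 2 * X ^ (-(1 / 2 : ℝ)) * (|(m : ℝ)| + 1) ^ (-(3 / 2 : ℝ)) := fun m hm => by
    set L := (|(m : ℝ)| + X) / 4
    have hL : 0 < L := by positivity
    obtain ⟨y0, hy0, hy0m⟩ := Finset.mem_image.1 hm
    have h1 := hA t m L hL (fun θ hθ => by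
        have := hS y0 (hF y0 hy0) θ hθ
        rwa [hy0m] at this) (F.filter fun y => y 0 = m)
      fun y hy => (Finset.mem_filter.1 hy).2
    refine h1.trans ?_
    have h2 : |t| / L ≤ 4 / c := by
      rw [div_le_div_iff₀ hL hc]
      have : |t| * c = X := mul_comm _ _
      rw [this]
      simp only [L]; linarith [abs_nonneg (m : ℝ)]
    have h3 : (X ^ (1 / 2 : ℝ)) * (|(m : ℝ)| + 1) ^ (3 / 2 : ℝ) ≤ (|(m : ℝ)| + X) ^ 2 := by
      have e1 : X ^ (1 / 2 : ℝ) ≤ (|(m : ℝ)| + X) ^ (1 / 2 : ℝ) :=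
        rpow_le_rpow hX.le (by linarith [abs_nonneg (m : ℝ)]) (by norm_num)
      have e2 : (|(m : ℝ)| + 1) ^ (3 / 2 : ℝ) ≤ (|(m : ℝ)| + X) ^ (3 / 2 : ℝ) :=
        rpow_le_rpow (by positivity) (by linarith) (by norm_num)
      calc _ ≤ (|(m : ℝ)| + X) ^ (1 / 2 : ℝ) * (|(m : ℝ)| + X) ^ (3 / 2 : ℝ) := by gcongr
        _ = (|(m : ℝ)| + X) ^ (2 : ℝ) := by rw [← Real.rpow_add (by positivity)]; norm_num
        _ = _ := by norm_cast
    calc (A * (1 + |t| / L) / L) ^ 2 ≤ (A * (1 + 4 / c) / L) ^ 2 := by gcongr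
      _ = 16 * (A * (1 + 4 / c)) ^ 2 / (|(m : ℝ)| + X) ^ 2 := by simp only [L]; field_simp; ring
      _ ≤ 16 * (A * (1 + 4 / c)) ^ 2 / ((X ^ (1 / 2 : ℝ)) * (|(m : ℝ)| + 1) ^ (3 / 2 : ℝ)) := by gcongr
      _ = _ := by
          rw [rpow_neg hX.le, rpow_neg (by positivity)]
          field_simp
  calc ∑ y ∈ F, ‖packet t ω a y‖ ^ 2
      = ∑ m ∈ F.image (fun y => y 0), ∑ y ∈ F with y 0 = m, ‖packet t ω a y‖ ^ 2 :=
        (Finset.sum_fiberwise_of_maps_to (fun y hy => Finset.mem_image_of_mem _ hy) _).symm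
    _ ≤ ∑ m ∈ (F.image (fun y : Lat d => y 0) : Finset ℤ), 16 * (A * (1 + 4 / c)) ^ 2 * X ^ (-(1 / 2 : ℝ)) *
          (|(m : ℝ)| + 1) ^ (-(3 / 2 : ℝ)) := sum_le_sum hlayer
    _ = 16 * (A * (1 + 4 / c)) ^ 2 * X ^ (-(1 / 2 : ℝ)) *
          ∑ m ∈ (F.image (fun y : Lat d => y 0) : Finset ℤ), (|(m : ℝ)| + 1) ^ (-(3 / 2 : ℝ)) := by rw [mul_sum]
    _ ≤ 16 * (A * (1 + 4 / c)) ^ 2 * X ^ (-(1 / 2 : ℝ)) *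
          ∑' m : ℤ, (|(m : ℝ)| + 1) ^ (-(3 / 2 : ℝ)) := by
        gcongr
        exact summable_int_weight.sum_le_tsum _ fun _ _ => by positivity
    _ = _ := by ring

end

/-! ### Non-stationary phase -/

/-- The derivative in the `j`-th coordinate direction. -/
def der (j : Fin d) (f : Euc d → ℝ) (x : Euc d) : ℝ := fderiv ℝ f x (single j 1)

/-- The squared length of the gradient. -/
def gradSq (f : Euc d → ℝ) (x : Euc d) : ℝ := ∑ j, der j f x ^ 2

lemma gradSq_nonneg (f : Euc d → ℝ) (x : Euc d) : 0 ≤ gradSq f x :=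
  sum_nonneg fun _ _ => sq_nonneg _

lemma fderiv_apply_eq_sum (L : Euc d →L[ℝ] ℝ) (v : Euc d) : L v = ∑ j, v j * L (single j 1) := by
  conv_lhs => rw [show v = ∑ j, v j • single j (1 : ℝ) by ext i; simp [Pi.single_apply]]
  simp

lemma gradSq_eq_zero {f : Euc d → ℝ} (h : gradSq f x = 0) : fderiv ℝ f x = 0 := by
  have h1 := (Finset.sum_eq_zero_iff_of_nonneg fun j _ => sq_nonneg (der j f x)).1 h
  ext v
  rw [fderiv_apply_eq_sum]
  refine Finset.sum_eq_zero fun j _ => ?_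
  have : der j f x = 0 := by simpa using h1 j (mem_univ j)
  rw [der] at this
  rw [this, mul_zero]

lemma abs_apply_single_le (L : Euc d →L[ℝ] ℝ) (j : Fin d) : |L (single j 1)| ≤ ‖L‖ := by
  have := L.le_opNorm (single j 1)
  simpa using this

/-- Non-stationary phase: if `λ⁻¹ ∇g → ∇f` uniformly on the support of `u`, `∇f ≠ 0` almost everywhere
there, and `|λ| → ∞`, then `∫ e^{i g} u → 0`. -/
lemma tendsto_integral_cexp_mul {ι : Type*} {l : Filter ι} (hu : ContDiff ℝ 1 u)
    (hc : HasCompactSupport u) {f : Euc d → ℝ} (hf : ∀ x ∈ tsupport u, ContDiffAt ℝ 2 f x)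
    (hne : ∀ᵐ x, x ∈ tsupport u → fderiv ℝ f x ≠ 0) {g : ι → Euc d → ℝ} (hg : ∀ᶠ i in l, ∀ x ∈
    tsupport u, ContDiffAt ℝ 1 (g i) x) {lam : ι → ℝ} (hlam : Tendsto (fun i => |lam i|) l atTop)
    (hlim : ∀ δ > 0, ∀ᶠ i in l, ∀ x ∈ tsupport u, ‖(lam i)⁻¹ • fderiv ℝ (g i) x - fderiv ℝ f x‖ ≤ δ)
    : Tendsto (fun i => ∫ x, 𝐞[g i x] * u x) l (𝓝 0) := by
  have hder : ∀ j, ∀ x ∈ tsupport u, ContDiffAt ℝ 1 (der j f) x := fun j x hx =>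
    ((hf x hx).fderiv_right (m := 1) (by norm_num)).clm_apply contDiffAt_const
  have hgrad : ∀ x ∈ tsupport u, ContDiffAt ℝ 1 (gradSq f) x := fun x hx =>
    ContDiffAt.sum fun j _ => (hder j x hx).pow 2
  have hden : ∀ {κ : ℝ}, 0 < κ → ∀ x, gradSq f x + κ ≠ 0 := fun hκ x =>
    (add_pos_of_nonneg_of_pos (gradSq_nonneg f x) hκ).ne'
  have hR : ∀ κ : ℝ, 0 < κ → Integrable fun x => ‖u x‖ * (κ / (gradSq f x + κ)) := fun κ hκ =>
    integrable_of_continuousOn_tsupport hc (fun x hx => (hu.continuous.norm.continuousAt.mul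
      (continuousAt_const.div ((hgrad x hx).continuousAt.add continuousAt_const)
        (hden hκ x))).continuousWithinAt)
      fun x hx => by simp [image_eq_zero_of_notMem_tsupport hx]
  -- the regularized remainder is small
  have hrem : Lim₀ (fun κ : ℝ => ∫ x, ‖u x‖ * (κ / (gradSq f x + κ))) 0 := by
    suffices Lim₀ (fun κ : ℝ => ∫ x, ‖u x‖ * (κ / (gradSq f x + κ))) (∫ _ : Euc d, (0 : ℝ)) by simpa using this
    refine tendsto_integral_filter_of_dominated_convergence (fun x => ‖u x‖) ?_ ?_ ?_ ?_
    · filter_upwards [self_mem_nhdsWithin] with κ hκ using (hR κ hκ).aestronglyMeasurable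
    · filter_upwards [self_mem_nhdsWithin] with κ hκ
      refine ae_of_all _ fun x => ?_
      have hκ' : 0 < κ := hκ
      have h1 := gradSq_nonneg f x
      rw [norm_of_nonneg (by positivity)]
      refine mul_le_of_le_one_right (norm_nonneg _) ?_
      rw [div_le_one (by positivity)]
      linarith
    · exact (hu.continuous.integrable_of_hasCompactSupport hc).norm
    · filter_upwards [hne] with x hx
      by_cases hxs : x ∈ tsupport u
      · have hpos : gradSq f x ≠ 0 := fun h => hx hxs (gradSq_eq_zero h)
        have : Tendsto (fun κ : ℝ => ‖u x‖ * (κ / (gradSq f x + κ))) (𝓝 0)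
            (𝓝 (‖u x‖ * (0 / (gradSq f x + 0)))) :=
          (continuousAt_const.mul (continuousAt_id.div (continuousAt_const.add continuousAt_id)
            (by simpa using hpos))).tendsto
        simpa using this.mono_left nhdsWithin_le_nhds
      · simp [image_eq_zero_of_notMem_tsupport hxs]
  rw [Metric.tendsto_nhds]
  intro e he
  obtain ⟨κ, hκe, hκ⟩ := ((hrem.eventually (gt_mem_nhds (show (0 : ℝ) < e / 3 by linarith))).and
    self_mem_nhdsWithin).exists
  have hκ : 0 < κ := hκ
  set v : Fin d → Euc d → ℂ := fun j x => ((der j f x / (gradSq f x + κ) : ℝ) : ℂ) * u x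
  have hvt : ∀ j, tsupport (v j) ⊆ tsupport u := fun j => tsupport_mul_subset_right
  have hvs : ∀ j, ContDiff ℝ 1 (v j) := fun j => contDiff_of_contDiffAt_tsupport fun x hx => by
    have hx' := hvt j hx
    exact (ofRealCLM.contDiff.contDiffAt.comp x
      ((hder j x hx').div ((hgrad x hx').add contDiffAt_const) (hden hκ x))).mul hu.contDiffAt
  have hvc : ∀ j, HasCompactSupport (v j) := fun j => hc.mul_left
  have hvi : ∀ j, Integrable (v j) := fun j =>
    (hvs j).continuous.integrable_of_hasCompactSupport (hvc j)
  have hv1 : ∀ x, ∑ j, (der j f x : ℂ) * v j x + ((κ / (gradSq f x + κ) : ℝ) : ℂ) * u x = u x := fun x => by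
    have h : (1 : ℝ) - κ / (gradSq f x + κ) = ∑ j, der j f x * (der j f x / (gradSq f x + κ)) := by
      rw [one_sub_div (hden hκ x), add_sub_cancel_right, gradSq, Finset.sum_div]
      exact sum_congr rfl fun j _ => by ring
    rw [← eq_sub_iff_add_eq, ← one_sub_mul, ← Complex.ofReal_one, ← Complex.ofReal_sub, h, Complex.ofReal_sum,
      sum_mul]
    exact sum_congr rfl fun j _ => by simp [v, mul_assoc]
  set D1 := ∫ x, ∑ j, ‖v j x‖
  set D2 := ∑ j, ∫ x, ‖fderiv ℝ (v j) x (single j 1)‖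
  have hD1 : 0 ≤ D1 := integral_nonneg fun x => sum_nonneg fun j _ => norm_nonneg _
  have hD2 : 0 ≤ D2 := sum_nonneg fun j _ => integral_nonneg fun x => norm_nonneg _
  set δ := e / (3 * (D1 + 1))
  have hδ : 0 < δ := by positivity
  filter_upwards [hg, hlim δ hδ, hlam.eventually_gt_atTop (3 * (D2 + 1) / e)] with i hgi hli hlami
  have hlpos : 0 < |lam i| := lt_trans (by positivity) hlami
  set E : Euc d → ℂ := fun x => 𝐞[g i x]
  have hEc : ContinuousOn E (tsupport u) := fun x hx =>
    ((continuousAt_const.mul (continuous_ofReal.continuousAt.comp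
      (hgi x hx).continuousAt)).cexp).continuousWithinAt
  have hv0 : ∀ j x, x ∉ tsupport u → v j x = 0 := fun j x hx => by
    simp [v, image_eq_zero_of_notMem_tsupport hx]
  have hi0 : Integrable fun x => E x * u x := integrable_of_continuousOn_tsupport hc
    (hEc.mul hu.continuous.continuousOn) fun x hx => by simp [image_eq_zero_of_notMem_tsupport hx]
  have hi2 : ∀ j, Integrable fun x => ((lam i)⁻¹ : ℂ) * (E x * ((der j (g i) x : ℂ) * v j x)) :=
    fun j => integrable_of_continuousOn_tsupport hc
      (continuousOn_const.mul (hEc.mul ((continuous_ofReal.comp_continuousOn fun x hx =>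
        (continuousAt_fderiv_apply (hgi x hx) _).continuousWithinAt).mul
          (hvs j).continuous.continuousOn))) fun x hx => by simp [hv0 j x hx]
  have b1 : ‖∫ x, (E x * u x - ∑ j, ((lam i)⁻¹ : ℂ) * (E x * ((der j (g i) x : ℂ) * v j x)))‖ ≤
      δ * D1 + ∫ x, ‖u x‖ * (κ / (gradSq f x + κ)) := by
    have hs := (integrable_finsetSum Finset.univ fun j _ => (hvi j).norm).const_mul δ
    rw [← integral_const_mul, ← integral_add hs (hR κ hκ)]
    refine norm_integral_le_of_norm_le (hs.add (hR κ hκ)) (ae_of_all _ fun x => ?_)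
    have h1 : E x * u x - ∑ j, ((lam i)⁻¹ : ℂ) * (E x * ((der j (g i) x : ℂ) * v j x)) =
        E x * (∑ j, ((der j f x - (lam i)⁻¹ * der j (g i) x : ℝ) : ℂ) * v j x +
          ((κ / (gradSq f x + κ) : ℝ) : ℂ) * u x) := by
      nth_rw 1 [← hv1 x]
      rw [mul_add, mul_add, add_sub_right_comm, mul_sum, mul_sum, ← sum_sub_distrib]
      congr 1
      refine sum_congr rfl fun j _ => ?_
      push_cast
      ring
    rw [h1, norm_mul, norm_cexp_I_mul, one_mul]
    refine (norm_add_le _ _).trans (add_le_add ?_ (le_of_eq ?_))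
    · rw [mul_sum]
      refine norm_sum_le_of_le _ fun j _ => ?_
      by_cases hx : x ∈ tsupport u
      · rw [norm_mul, norm_real, norm_eq_abs, abs_sub_comm]
        gcongr
        exact (abs_apply_single_le ((lam i)⁻¹ • fderiv ℝ (g i) x - fderiv ℝ f x) j).trans (hli x hx)
      · simp [hv0 j x hx]
    · have := gradSq_nonneg f x
      rw [norm_mul, norm_real, norm_of_nonneg (by positivity), mul_comm]
  have b2 : ‖∑ j, ∫ x, ((lam i)⁻¹ : ℂ) * (E x * ((der j (g i) x : ℂ) * v j x))‖ ≤
      |lam i|⁻¹ * D2 := by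
    rw [mul_sum]
    refine norm_sum_le_of_le _ fun j _ => ?_
    rw [integral_const_mul]
    simp only [der, E]
    rw [integral_cexp_fderiv_mul (hvs j) (hvc j) (fun x hx => hgi x (hvt j hx)), norm_mul, norm_mul,
      Complex.norm_I, one_mul, norm_inv, norm_real, norm_eq_abs]
    gcongr
    refine norm_integral_le_of_norm_le ?_ (ae_of_all _ fun x => ?_)
    · exact ((((hvs j).continuous_fderiv (by norm_num)).clm_apply
        continuous_const).integrable_of_hasCompactSupport ((hvc j).fderiv_apply ℝ _)).norm
    · rw [norm_mul, norm_cexp_I_mul, one_mul]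
  have hfin := norm_add_le_of_le b1 b2
  rw [integral_sub hi0 (integrable_finsetSum _ fun j _ => hi2 j),
    integral_finsetSum _ fun j _ => hi2 j, sub_add_cancel] at hfin
  rw [dist_zero_right]
  have c1 : δ * D1 < e / 3 := by
    simp only [δ]
    rw [div_mul_eq_mul_div, div_lt_div_iff₀ (by positivity) (by norm_num)]
    nlinarith
  have c2 : |lam i|⁻¹ * D2 < e / 3 := by
    rw [inv_mul_lt_iff₀ hlpos]
    rw [div_lt_iff₀ he] at hlami
    nlinarith
  linarith

/-! ### Evaluation of the sesquilinear sums in Fourier space -/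

lemma conj_cexp_I_mul (x : ℝ) : conj (𝐞⁻[x]) = 𝐞[x] := by rw [← Complex.exp_conj]; congr 1; simp

lemma conj_fcoef (f : Euc d → ℂ) (z : Lat d) : conj (fcoef f z) = c𝕋 d *
      ∫ θ in cell d, 𝐞[z ⋄ θ] * conj (f θ) := by
  rw [fcoef, map_mul, map_inv₀, Complex.conj_ofReal, ← integral_conj]
  simp_rw [map_mul, conj_cexp_I_mul]

lemma pairSum_fcoef (hW : ∀ x, ‖w x‖ ≤ W) (hφ : Summable fun z => ‖φ z‖) (hf : Integrable f (𝕋 d))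
    (p q : Lat d) : pairSum w φ (fcoef f) p q = c𝕋 d * ∫ θ in cell d, 𝐞[q ⋄ θ] * conj (f θ) * ∑' x,
    w x * φ (p - x) * 𝐞⁻[x ⋄ θ] := by
  have hfc : Integrable (fun θ => conj (f θ)) (𝕋 d) :=
    hf.congr' (continuous_conj.comp_aestronglyMeasurable hf.1) (ae_of_all _ fun θ => by simp)
  have hφ' : Summable fun x => ‖φ (p - x)‖ := (Equiv.subLeft p).summable_iff.2 hφ
  have hint : ∀ x, Integrable (fun θ => 𝐞[q ⋄ θ] * conj (f θ) *
      (w x * φ (p - x) * 𝐞⁻[x ⋄ θ])) (𝕋 d) := fun x => by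
    have h1 : Integrable (fun θ => 𝐞[q ⋄ θ] * conj (f θ)) (𝕋 d) :=
      hfc.bdd_mul (c := 1) (continuous_cexp_inner q).aestronglyMeasurable
        (ae_of_all _ fun _ => (norm_cexp_I_mul _).le)
    refine h1.mul_bdd (c := ‖w x * φ (p - x)‖) ?_ (ae_of_all _ fun θ => ?_)
    · exact (continuous_const.mul (continuous_cexp_neg_inner x)).aestronglyMeasurable
    · rw [norm_mul, norm_cexp_neg_I_mul, mul_one]
  have hsum := hasSum_integral_of_summable_integral_norm hint (by
    have : ∀ x, ∫ θ in cell d, ‖𝐞[q ⋄ θ] * conj (f θ) * (w x * φ (p - x) * 𝐞⁻[x ⋄ θ])‖ =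
        ‖w x‖ * ‖φ (p - x)‖ * ∫ θ in cell d, ‖f θ‖ := fun x => by
      rw [← integral_const_mul]
      refine integral_congr_ae (ae_of_all _ fun θ => ?_)
      simp only [norm_mul, norm_cexp_I_mul, norm_cexp_neg_I_mul, RCLike.norm_conj]
      ring
    simp_rw [this]
    refine .mul_right _ (Summable.of_nonneg_of_le (fun x => by positivity) (fun x => ?_)
      (hφ'.mul_left W))
    gcongr
    exact hW x)
  simp only [tsum_mul_left] at hsum
  rw [← hsum.tsum_eq, ← tsum_mul_left, pairSum]
  congr 1
  ext x
  rw [conj_fcoef, mul_left_comm (φ _), mul_left_comm (w x)]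
  congr 1
  rw [← mul_assoc, ← integral_const_mul]
  refine integral_congr_ae (ae_of_all _ fun θ => ?_)
  simp only
  rw [toEuc_sub, inner_sub_left]
  push_cast
  rw [mul_sub, Complex.exp_sub, Complex.exp_neg, div_eq_mul_inv]
  ring

lemma tsum_mul_cexp_eq_fsum (φ : Lat d → ℂ) (p : Lat d) (θ s : Euc d) :
    ∑' x, 𝐞⁻[⟪s, toEuc x⟫] * φ (p - x) * 𝐞⁻[x ⋄ θ] =
    𝐞⁻[p ⋄ (θ + s)] * fsum φ (θ + s) := by
  rw [fsum, ← tsum_mul_left, ← (Equiv.subLeft p).tsum_eq]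
  congr 1
  ext x
  simp only [Equiv.subLeft_apply, sub_sub_cancel]
  rw [mul_comm _ (φ x), mul_assoc, ← exp_add, mul_comm (φ x), ← mul_assoc, ← exp_add]
  congr 2
  rw [toEuc_sub, inner_sub_left, inner_sub_right, inner_add_right, inner_add_right,
    real_inner_comm (toEuc p) s, real_inner_comm (toEuc x) s]
  push_cast
  ring

/-- Plane-wave weights. -/
lemma pairSum_planeWave (hφ : Summable fun z => ‖φ z‖) (hf : Integrable f (𝕋 d)) (s : Euc d)
    (p q : Lat d) : pairSum (fun x => 𝐞⁻[⟪s, toEuc x⟫]) φ (fcoef f) p q = c𝕋 d * ∫ θ in cell d,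
    𝐞[q ⋄ θ] * conj (f θ) * (𝐞⁻[p ⋄ (θ + s)] * fsum φ (θ + s)) := by
  rw [pairSum_fcoef (W := 1) (fun x => (norm_cexp_neg_I_mul _).le) hφ hf]
  simp_rw [tsum_mul_cexp_eq_fsum]

/-- Weights given by a symbol. -/
lemma bform_fcoef {n : Lat d → Lat d → ℂ} (hν : Summable ν) (hn : ∀ x k, ‖n x k‖ ≤ ν k)
    (hφ : Summable fun z => ‖φ z‖) (hf : Integrable f (𝕋 d)) (p q : Lat d) : bform n φ (fcoef f) p
    q = c𝕋 d * ∫ θ in cell d, 𝐞[q ⋄ θ] * conj (f θ) * ∑' x, fsum (n x) θ * φ (p - x) * 𝐞⁻[x ⋄ θ] :=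
    by
  have hfc : Integrable (fun θ => conj (f θ)) (𝕋 d) :=
    hf.congr' (continuous_conj.comp_aestronglyMeasurable hf.1) (ae_of_all _ fun θ => by simp)
  have hφ' : Summable fun x => ‖φ (p - x)‖ := (Equiv.subLeft p).summable_iff.2 hφ
  set Φ := ∑' x, ‖φ (p - x)‖
  have hterm : ∀ k x θ, ‖n x k * φ (p - x) * 𝐞⁻[x ⋄ θ]‖ ≤ ν k * ‖φ (p - x)‖ := fun k x θ => by
    rw [norm_mul, norm_mul, norm_cexp_neg_I_mul, mul_one]
    gcongr
    exact hn x k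
  have hT : ∀ k θ, ‖∑' x, n x k * φ (p - x) * 𝐞⁻[x ⋄ θ]‖ ≤ ν k * Φ :=
    fun k θ => tsum_of_norm_bounded (hφ'.hasSum.mul_left (ν k)) fun x => hterm k x θ
  have hTc : ∀ k, Continuous fun θ : Euc d =>
      ∑' x, n x k * φ (p - x) * 𝐞⁻[x ⋄ θ] := fun k =>
    continuous_tsum (fun x => continuous_const.mul (continuous_cexp_neg_inner x)) (hφ'.mul_left (ν k))
      fun x θ => hterm k x θ
  have hint : ∀ k, Integrable (fun θ => 𝐞[(q + k) ⋄ θ] * conj (f θ) *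
      ∑' x, n x k * φ (p - x) * 𝐞⁻[x ⋄ θ]) (𝕋 d) := fun k => by
    have h1 : Integrable (fun θ => 𝐞[(q + k) ⋄ θ] * conj (f θ)) (𝕋 d) :=
      hfc.bdd_mul (c := 1) (continuous_cexp_inner _).aestronglyMeasurable
        (ae_of_all _ fun _ => (norm_cexp_I_mul _).le)
    exact h1.mul_bdd (c := ν k * Φ) (hTc k).aestronglyMeasurable (ae_of_all _ fun θ => hT k θ)
  have hsum := hasSum_integral_of_summable_integral_norm hint (by
    refine .of_nonneg_of_le (fun k => integral_nonneg fun θ => norm_nonneg _) (fun k => ?_)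
      ((hν.mul_right (Φ * ∫ θ in cell d, ‖f θ‖)))
    rw [← mul_assoc, ← integral_const_mul]
    refine integral_mono_of_nonneg (ae_of_all _ fun θ => norm_nonneg _) (hf.norm.const_mul _)
      (ae_of_all _ fun θ => ?_)
    simp only [norm_mul, norm_cexp_I_mul, RCLike.norm_conj, one_mul]
    rw [mul_comm]
    gcongr
    exact hT k θ)
  rw [bform]
  simp_rw [pairSum_fcoef (fun x => hn x _) hφ hf]
  rw [tsum_mul_left, hsum.tsum_eq]
  congr 1
  refine integral_congr_ae (ae_of_all _ fun θ => ?_)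
  simp only
  have h3 : ∀ k, 𝐞[(q + k) ⋄ θ] = 𝐞[q ⋄ θ] * 𝐞[k ⋄ θ] := fun k => by
    rw [toEuc_add, inner_add_left, ← exp_add]; push_cast; ring_nf
  have h4 : ∀ k, 𝐞[(q + k) ⋄ θ] * conj (f θ) * ∑' x, n x k * φ (p - x) * 𝐞⁻[x ⋄ θ] =
      𝐞[q ⋄ θ] * conj (f θ) * ∑' x, 𝐞[k ⋄ θ] * (n x k * φ (p - x) * 𝐞⁻[x ⋄ θ]) := fun k => by
    rw [h3, tsum_mul_left]; ring
  simp_rw [h4]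
  rw [tsum_mul_left]
  congr 1
  rw [Summable.tsum_comm]
  · congr 1
    ext x
    rw [fsum, ← tsum_mul_right, ← tsum_mul_right]
    congr 1
    ext k
    ring
  · refine .of_norm_bounded (g := fun xk : Lat d × Lat d => ‖φ (p - xk.1)‖ * ν xk.2) ?_ ?_
    · exact hφ'.mul_of_nonneg hν (fun x => norm_nonneg _) fun k => (norm_nonneg _).trans (hn 0 k)
    · rintro ⟨x, k⟩
      simp only [Function.uncurry]
      rw [norm_mul, norm_cexp_I_mul, one_mul, mul_comm ‖φ _‖]
      exact hterm k x θ

section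

/-! ### Removal of the boundary -/

lemma pairSum_add_weight {w' : Lat d → ℂ} {W' n : ℝ} (hW : ∀ x, ‖w x‖ ≤ W) (hW' : ∀ x, ‖w' x‖ ≤ W')
    (hφ : SqBound φ univ m) (hψ : SqBound ψ univ n) (p q : Lat d) : pairSum (fun x => w x +
    w' x) φ ψ p q = pairSum w φ ψ p q + pairSum w' φ ψ p q := by
  simp only [pairSum, add_mul]
  exact (summable_pair hW hφ hψ p q).tsum_add (summable_pair hW' hφ hψ p q)

lemma bform_sub_weight {n n' : Lat d → Lat d → ℂ} {ν' : Lat d → ℝ} (hν : Summable ν) (hn : ∀ x k, ‖n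
    x k‖ ≤ ν k) (hν' : Summable ν') (hn' : ∀ x k, ‖n' x k‖ ≤ ν' k) (hφ : SqBound φ univ m1)
    (hψ : SqBound ψ univ m2) (p q : Lat d) : bform (fun x k => n x k - n' x k) φ ψ p q = bform n
    φ ψ p q - bform n' φ ψ p q := by
  simp only [bform]
  rw [← (summable_pairSum hν hn hφ hψ p q).tsum_sub (summable_pairSum hν' hn' hφ hψ p q)]
  congr 1; ext k
  simp only [pairSum, sub_mul]
  exact (summable_pair (fun x => hn x k) hφ hψ p _).tsum_sub (summable_pair (fun x => hn' x k) hφ hψ p _)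

lemma tendsto_tsum_zero {ι : Type*} {l : Filter ι} {f : ι → Lat d → ℂ} (hν : Summable ν)
    (hb : ∀ᶠ i in l, ∀ k, ‖f i k‖ ≤ ν k) (hf : ∀ k, Tendsto (fun i => f i k) l (𝓝 0)) : Tendsto
    (fun i => ∑' k, f i k) l (𝓝 0) := by
  have := tendsto_tsum_of_dominated_convergence (g := fun _ => (0 : ℂ)) hν hf hb
  simpa using this

lemma tendsto_sqrt_rate {ι : Type*} {l : Filter ι} {t : ι → ℝ} (ht : Tendsto (fun i => |t i|) l
    atTop) (hc : 0 < c) (K W n : ℝ) : Tendsto (fun i => W * (√(K * (c * |t i|) ^ (-(1 / 2 : ℝ))) *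
    √n)) l (𝓝 0) := by
  have h1 : Tendsto (fun i => (c * |t i|) ^ (-(1 / 2 : ℝ))) l (𝓝 0) :=
    (tendsto_rpow_neg_atTop (by norm_num)).comp (ht.const_mul_atTop hc)
  have h2 := (((h1.const_mul K).sqrt).mul_const (√n)).const_mul W
  simpa using h2

section Boundary

variable [NeZero d] {ι : Type*} {l : Filter ι} {a : Euc d → ℂ} {t : ι → ℝ}
  {p q : ι → Lat d} {ψ : ι → Lat d → ℂ}

/-- Packets that would come from outside the half-space contribute nothing. -/
lemma IsPiece.tendsto_bform_of_neg (h : IsPiece ω a) (hc : 0 < c)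
    (ht : Tendsto (fun i => |t i|) l atTop)
    (hsign : ∀ᶠ i in l, ∀ θ ∈ tsupport a, t i * der0 ω θ ≤ -(c * |t i|))
    (hp : ∀ δ > 0, ∀ᶠ i in l, |(p i 0 : ℝ)| ≤ δ * |t i|)
    (hψ : ∀ᶠ i in l, SqBound (ψ i) univ m2) (hν : Summable ν) {n : ι → Lat d → Lat d → ℂ}
    (hn : ∀ᶠ i in l, ∀ x k, ‖n i x k‖ ≤ ν k) (hn0 : ∀ᶠ i in l, ∀ x k, x 0 ≤ 0 → n i x k = 0) :
    Tendsto (fun i => bform (n i) (packet (t i) ω a) (ψ i) (p i) (q i)) l (𝓝 0) := by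
  obtain ⟨K, hK0, hK⟩ := h.mass_bound hc
  refine squeeze_zero_norm' ?_ (tendsto_sqrt_rate ht hc K (∑' k, ν k) m2)
  filter_upwards [hsign, hp (c / 4) (by positivity), hψ, hn, hn0,
    (ht.const_mul_atTop hc).eventually_ge_atTop 1] with i hsi hpi hψi hni hn0i hti
  have hX : 0 < c * |t i| := by linarith
  have hmass := hK (t i) hti {y | y 0 ≤ p i 0} (by
    intro y hy θ hθ
    have h1 := hsi θ hθ
    have h2 : (y 0 : ℝ) ≤ p i 0 := by exact_mod_cast hy
    have h3 := le_abs_self (p i 0 : ℝ)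
    have h4 : (p i 0 : ℝ) ≤ c * |t i| / 4 := by linarith
    rw [abs_of_nonpos (show (y 0 : ℝ) + t i * der0 ω θ ≤ 0 by linarith)]
    rcases le_total 0 (y 0 : ℝ) with h0 | h0
    · rw [abs_of_nonneg h0]; linarith
    · rw [abs_of_nonpos h0]; linarith)
  rw [bform, ← tsum_mul_right]
  refine tsum_of_norm_bounded (hν.mul_right _).hasSum fun k => ?_
  refine norm_pairSum_le (fun x => hni x k) (fun x hx => ?_) hmass hψi
  have : ¬ x 0 ≤ 0 := fun h0 => hx (hn0i x k h0)
  simp only [Set.mem_ofPred_eq, Pi.sub_apply]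
  omega

/-- For packets coming from inside, weights may be changed near the boundary. -/
lemma IsPiece.tendsto_bform_of_pos (h : IsPiece ω a) (hc : 0 < c)
    (ht : Tendsto (fun i => |t i|) l atTop)
    (hsign : ∀ᶠ i in l, ∀ θ ∈ tsupport a, c * |t i| ≤ t i * der0 ω θ)
    (hp : ∀ δ > 0, ∀ᶠ i in l, |(p i 0 : ℝ)| ≤ δ * |t i|)
    (hψ : ∀ᶠ i in l, SqBound (ψ i) univ m2) (hν : Summable ν) {n : ι → Lat d → Lat d → ℂ}
    (hn : ∀ᶠ i in l, ∀ x k, ‖n i x k‖ ≤ ν k)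
    (hlim : ∀ k, ∀ δ > 0, ∃ M : ℝ, ∀ᶠ i in l, ∀ x : Lat d, M < x 0 → ‖n i x k‖ ≤ δ) :
    Tendsto (fun i => bform (n i) (packet (t i) ω a) (ψ i) (p i) (q i)) l (𝓝 0) := by
  obtain ⟨K, hK0, hK⟩ := h.mass_bound hc
  set m1 := ((2 * π) ^ d)⁻¹ * ∫ θ in cell d, ‖a θ‖ ^ 2
  have hm₁ : ∀ i, SqBound (packet (t i) ω a) univ m1 := fun i => h.sqBound (t i)
  refine tendsto_tsum_zero (hν.mul_right (√m1 * √m2)) ?_ fun k => ?_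
  · filter_upwards [hψ, hn] with i hψi hni k
    exact norm_pairSum_le (fun x => hni x k) (fun _ _ => Set.mem_univ _) (hm₁ i) hψi
  rw [Metric.tendsto_nhds]
  intro e he
  set δ := e / (2 * (√m1 * √m2 + 1))
  have hδ : 0 < δ := by positivity
  obtain ⟨M, hM⟩ := hlim k δ hδ
  have hrate := (tendsto_sqrt_rate ht hc K (ν k) m2).eventually (gt_mem_nhds (show (0 : ℝ) < e / 2 by linarith))
  filter_upwards [hsign, hp (c / 8) (by positivity), hψ, hn, hM, hrate,
    (ht.const_mul_atTop hc).eventually_ge_atTop 1,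
    (ht.const_mul_atTop hc).eventually_ge_atTop (8 * M)] with i hsi hpi hψi hni hMi hri hti hti'
  have hX : 0 < c * |t i| := by linarith
  have hmass := hK (t i) hti {y | (p i 0 : ℝ) - M ≤ y 0} (by
    intro y hy θ hθ
    have h1 := hsi θ hθ
    have h2 : (p i 0 : ℝ) - M ≤ y 0 := hy
    have h3 := neg_abs_le (p i 0 : ℝ)
    have h4 : -(c * |t i| / 4) ≤ y 0 := by linarith
    rw [abs_of_nonneg (show 0 ≤ (y 0 : ℝ) + t i * der0 ω θ by linarith)]
    rcases le_total 0 (y 0 : ℝ) with h0 | h0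
    · rw [abs_of_nonneg h0]; linarith
    · rw [abs_of_nonpos h0]; linarith)
  have hν0 : 0 ≤ ν k := (norm_nonneg _).trans (hni 0 k)
  classical
  set w1 : Lat d → ℂ := fun x => if (x 0 : ℝ) ≤ M then n i x k else 0
  set w2 : Lat d → ℂ := fun x => if (x 0 : ℝ) ≤ M then 0 else n i x k
  have hw1 : ∀ x, ‖w1 x‖ ≤ ν k := fun x => by simp only [w1]; split_ifs <;> simp [hni x k, hν0]
  have hw2 : ∀ x, ‖w2 x‖ ≤ δ := fun x => by
    simp only [w2]; split_ifs with hx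
    · simpa using hδ.le
    · exact hMi x (not_le.1 hx)
  have hsplit : (fun x => n i x k) = fun x => w1 x + w2 x := by
    ext x; simp only [w1, w2]; split_ifs <;> simp
  rw [hsplit, pairSum_add_weight hw1 hw2 (hm₁ i) hψi, dist_zero_right]
  have e1 := norm_pairSum_le (p := p i) (q := q i + k) hw1 (S := {y | (p i 0 : ℝ) - M ≤ y 0}) (fun x hx => by
    have : (x 0 : ℝ) ≤ M := by by_contra h0; exact hx (by simp [w1, h0])
    simp only [Set.mem_ofPred_eq, Pi.sub_apply]
    push_cast
    linarith) hmass hψi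
  have e2 := norm_pairSum_le (p := p i) (q := q i + k) hw2 (fun _ _ => Set.mem_univ _) (hm₁ i) hψi
  have e3 : δ * (√m1 * √m2) < e / 2 := by
    simp only [δ]
    have : 0 ≤ √m1 * √m2 := by positivity
    rw [div_mul_eq_mul_div, div_lt_div_iff₀ (by positivity) (by norm_num)]
    nlinarith
  refine (norm_add_le _ _).trans_lt ?_
  linarith

end Boundary

/-! ### Superpositions of plane waves -/

/-- `F(y) = ∫ e^{-i s·y} h(s) m(ds)` with `‖h‖_{L¹(m)} ≤ M`. -/
structure FTRep (F : Euc d → ℂ) (m : Measure (Euc d)) (h : Euc d → ℂ) (M : ℝ) : Prop where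
  sFinite : SFinite m
  integrable : Integrable h m
  bound : ∫ s, ‖h s‖ ∂m ≤ M
  eq : ∀ y, F y = ∫ s, 𝐞⁻[⟪s, y⟫] * h s ∂m

lemma FTRep.norm_integral_le {m : Measure (Euc d)} (H : FTRep F m h M) (f : Euc d → ℝ) : ‖∫ s,
    𝐞⁻[f s] * h s ∂m‖ ≤ M :=
  (norm_integral_le_integral_norm _).trans
    (by simpa only [norm_mul, norm_cexp_neg_I_mul, one_mul] using H.bound)

lemma FTRep.norm_le {m : Measure (Euc d)} (H : FTRep F m h M) (y : Euc d) : ‖F y‖ ≤ M := (H.eq y).symm ▸ H.norm_integral_le _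

lemma continuous_pairSum {X : Type*} [TopologicalSpace X] {G : X → Lat d → ℂ} {n : ℝ}
    (hG : ∀ x, Continuous fun s => G s x) (hW : ∀ s x, ‖G s x‖ ≤ W) (hφ : SqBound φ univ m)
    (hψ : SqBound ψ univ n) (p q : Lat d) : Continuous fun s => pairSum (G s) φ ψ p q := by
  have h1 : Summable fun x => ‖(1 : ℂ) * (φ (p - x) * conj (ψ (q - x)))‖ :=
    (summable_pair (w := fun _ => 1) (W := 1) (by simp) hφ hψ p q).norm
  refine continuous_tsum (fun x => (hG x).mul continuous_const) (h1.mul_left W) fun x s => ?_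
  rw [norm_mul, one_mul]
  gcongr
  exact hW s x

lemma pairSum_integral {X : Type*} [TopologicalSpace X] [MeasurableSpace X] [OpensMeasurableSpace X]
    {μ : Measure X} {G : X → Lat d → ℂ} {n : ℝ} (hG : ∀ x, Continuous fun s => G s x) (hW : ∀ s x,
    ‖G s x‖ ≤ W) {h : X → ℂ} (hh : Integrable h μ) (hφ : SqBound φ univ m) (hψ : SqBound ψ
    univ n) (p q : Lat d) : pairSum (fun x => ∫ s, G s x * h s ∂μ) φ ψ p q = ∫ s, pairSum (G s)
    φ ψ p q * h s ∂μ := by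
  have h1 : Summable fun x => ‖(1 : ℂ) * (φ (p - x) * conj (ψ (q - x)))‖ :=
    (summable_pair (w := fun _ => 1) (W := 1) (by simp) hφ hψ p q).norm
  simp only [one_mul] at h1
  have hi : ∀ x, Integrable (fun s => G s x * h s) μ := fun x =>
    hh.bdd_mul (c := W) (hG x).aestronglyMeasurable (ae_of_all _ fun s => hW s x)
  have hsum := hasSum_integral_of_summable_integral_norm
    (F := fun x s => (G s x * h s) * (φ (p - x) * conj (ψ (q - x)))) (μ := μ)
    (fun x => (hi x).mul_const _) (by
      refine .of_nonneg_of_le (fun x => integral_nonneg fun s => norm_nonneg _) (fun x => ?_)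
        (h1.mul_left (W * ∫ s, ‖h s‖ ∂μ))
      rw [← integral_const_mul, ← integral_mul_const]
      refine integral_mono_of_nonneg (ae_of_all _ fun s => norm_nonneg _)
        ((hh.norm.const_mul W).mul_const _) (ae_of_all _ fun s => ?_)
      simp only
      rw [norm_mul, norm_mul]
      gcongr
      exact hW s x)
  simp only [pairSum]
  have e1 : ∀ x, (∫ s, G s x * h s ∂μ) * (φ (p - x) * conj (ψ (q - x))) =
      ∫ s, (G s x * h s) * (φ (p - x) * conj (ψ (q - x))) ∂μ := fun x => (integral_mul_const _ _).symm
  simp_rw [e1]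
  rw [hsum.tsum_eq]
  refine integral_congr_ae (ae_of_all _ fun s => ?_)
  simp only
  rw [← tsum_mul_right]
  congr 1; ext x; ring

lemma eventually_add_smul_mem (hK : IsCompact K) (hU : IsOpen U) (hKU : K ⊆ U) (s : Euc d) : ∀ᶠ e in
    𝓝 (0 : ℝ), ∀ θ ∈ K, θ + e • s ∈ U := by
  obtain ⟨δ, hδ, hsub⟩ := hK.exists_thickening_subset_open hU hKU
  have h1 : Tendsto (fun e : ℝ => e • s) (𝓝 0) (𝓝 0) := by
    have : Continuous fun e : ℝ => e • s := by fun_prop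
    simpa using this.tendsto 0
  filter_upwards [h1.eventually (Metric.ball_mem_nhds 0 hδ)] with e he θ hθ
  refine hsub (Metric.mem_thickening_iff.2 ⟨θ, hθ, ?_⟩)
  rw [dist_eq_norm]
  simpa using he

lemma norm_planeWave (e : ℝ) (s : Euc d) (x : Lat d) :
    ‖𝐞⁻[⟪e • s, toEuc x⟫]‖ = 1 := norm_cexp_neg_I_mul _

lemma continuous_planeWave (e : ℝ) (x : Lat d) :
    Continuous fun s : Euc d => 𝐞⁻[⟪e • s, toEuc x⟫] := by
  have : Continuous fun s : Euc d => ⟪e • s, toEuc x⟫ := by fun_prop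
  exact (continuous_const.mul (continuous_ofReal.comp this)).neg.cexp

end

section

/-! ### Cross terms -/

lemma two_le_infty : (2 : WithTop ℕ∞) ≤ ((⊤ : ℕ∞) : WithTop ℕ∞) :=
  WithTop.coe_le_coe.2 (le_top : (2 : ℕ∞) ≤ ⊤)

lemma tendsto_smul_right_nhds_zero (s : Euc d) : Lim₀ (fun e : ℝ => e • s) 0 := by
  have : Continuous fun e : ℝ => e • s := by fun_prop
  simpa using (this.tendsto 0).mono_left nhdsWithin_le_nhds

lemma IsPiece.fsum_packet_add {a : Euc d → ℂ} (h : IsPiece ω a) (hK : IsCompact K)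
    (hKc : K ⊆ interior (cell d)) (s : Euc d) : ∀ᶠ e in 𝓝[>] (0 : ℝ), ∀ θ ∈ K, ∀ t, fsum (packet t ω
    a) (θ + e • s) = wave t ω a (θ + e • s) := by
  filter_upwards [(eventually_add_smul_mem hK isOpen_interior hKc s).filter_mono nhdsWithin_le_nhds]
    with e he θ hθ t
  exact h.fsum_packet t (interior_subset (he θ hθ))

/-- The phase of a cross term between packets with phases `ω` and `ω'` (shifted by `e • s`). -/
def crossPhase (ω ω' : Euc d → ℝ) (p q : ℝ → Lat d) (t : ℝ → ℝ) (s : Euc d) (e : ℝ) (θ : Euc d) : ℝ :=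
  (q e - p e) ⋄ θ + t e * (ω' θ - ω (θ + e • s))

/-- The phase `crossPhase` is non-stationary on `T` in the limit `e → 0`. -/
def NonStationary (ω ω' : Euc d → ℝ) (p q : ℝ → Lat d) (t : ℝ → ℝ) (s : Euc d) (T : Set (Euc d)) : Prop :=
  ∃ (f : Euc d → ℝ) (lam : ℝ → ℝ), (∀ θ ∈ T, ContDiffAt ℝ 2 f θ) ∧
    (∀ᵐ θ, θ ∈ T → fderiv ℝ f θ ≠ 0) ∧ Tendsto (fun e => |lam e|) (𝓝[>] 0) atTop ∧
    ∀ δ > 0, ∀ᶠ e in 𝓝[>] (0 : ℝ), ∀ θ ∈ T,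
      ‖(lam e)⁻¹ • fderiv ℝ (crossPhase ω ω' p q t s e) θ - fderiv ℝ f θ‖ ≤ δ

variable {ω' : Euc d → ℝ} {a b : Euc d → ℂ} {p q : ℝ → Lat d} {t : ℝ → ℝ}

lemma IsPiece.eventually_contDiffAt (h : IsPiece ω a) (s : Euc d) :
    ∀ᶠ e in 𝓝[>] (0 : ℝ), ∀ θ ∈ tsupport a, ContDiffAt ℝ 2 ω (θ + e • s) := by
  have hsub : tsupport a ⊆ interior {x | ContDiffAt ℝ 2 ω x} := fun x hx => by
    rw [mem_interior_iff_mem_nhds]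
    exact ((h.phase x hx).of_le (m := 2) two_le_infty).eventually (by norm_num)
  filter_upwards [(eventually_add_smul_mem h.compact isOpen_interior hsub s).filter_mono
    nhdsWithin_le_nhds] with e he θ hθ
  have := interior_subset (he θ hθ)
  exact this

lemma tendsto_pairSum_planeWave (h : IsPiece ω a) (h' : IsPiece ω' b) (s : Euc d) (k : Lat d)
    (hns : NonStationary ω ω' p q t s (tsupport a ∩ tsupport b)) :
    Lim₀ (fun e => pairSum (fun x => 𝐞⁻[⟪e • s, toEuc x⟫])
      (packet (t e) ω a) (packet (t e) ω' b) (p e) (q e + k)) 0 := by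
  obtain ⟨f, lam, hf, hfne, hlam, hlim⟩ := hns
  have hi' : ∀ t, Integrable (wave t ω' b) (𝕋 d) := fun t =>
    integrable_cell_of_continuous (h'.continuous_wave t)
  set u : Euc d → ℂ := fun θ => conj (b θ) * a θ * 𝐞[k ⋄ θ]
  have hbconj : ContDiff ℝ (⊤ : ℕ∞) fun θ => conj (b θ) := Complex.conjCLE.contDiff.comp h'.smooth
  have hus : ContDiff ℝ 1 u := by
    refine ((hbconj.mul h.smooth).of_le (by simp)).mul ?_
    exact (contDiff_const.mul (ofRealCLM.contDiff.comp (contDiff_const.inner ℝ contDiff_id))).cexp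
  have hsa : tsupport u ⊆ tsupport a := by
    refine closure_mono fun θ hθ => ?_
    simp only [Function.mem_support, u] at hθ ⊢
    intro h0; exact hθ (by simp [h0])
  have hsb : tsupport u ⊆ tsupport b := by
    refine closure_mono fun θ hθ => ?_
    simp only [Function.mem_support, u] at hθ ⊢
    intro h0; exact hθ (by simp [h0])
  have hsT : tsupport u ⊆ tsupport a ∩ tsupport b := Set.subset_inter hsa hsb
  have huc : HasCompactSupport u := h.compact.of_isClosed_subset (isClosed_tsupport _) hsa
  have hmain : Lim₀ (fun e => ∫ θ, 𝐞[crossPhase ω ω' p q t s e θ] * u θ) 0 := by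
    refine tendsto_integral_cexp_mul hus huc (f := f) (fun θ hθ => hf θ (hsT hθ)) ?_ ?_ hlam ?_
    · filter_upwards [hfne] with θ hθ hθu using hθ (hsT hθu)
    · filter_upwards [h.eventually_contDiffAt s] with e he θ hθ
      have h1 : ContDiffAt ℝ 1 (fun θ => ω (θ + e • s)) θ :=
        ((he θ (hsa hθ)).of_le (by norm_num)).comp θ (contDiffAt_id.add contDiffAt_const)
      exact (contDiff_const.inner ℝ contDiff_id).contDiffAt.add
        (contDiffAt_const.mul (((h'.phase θ (hsb hθ)).of_le (by simp)).sub h1))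
    · intro δ hδ
      filter_upwards [hlim δ hδ] with e he θ hθ using he θ (hsT hθ)
  -- uniform continuity of the amplitude
  have huca : ∀ δ > 0, ∀ᶠ e in 𝓝[>] (0 : ℝ), ∀ θ, ‖a (θ + e • s) - a θ‖ ≤ δ := fun δ hδ => by
    have hu := h.compact.uniformContinuous_of_continuous h.smooth.continuous
    obtain ⟨η, hη, hηa⟩ := Metric.uniformContinuous_iff.1 hu δ hδ
    filter_upwards [(tendsto_smul_right_nhds_zero s).eventually (Metric.ball_mem_nhds 0 hη)] with e he θ
    have := hηa (a := θ + e • s) (b := θ) (by rw [dist_eq_norm]; simpa using he)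
    rw [dist_eq_norm] at this
    exact this.le
  set Bn := ∫ θ in cell d, ‖b θ‖
  have hB0 : 0 ≤ Bn := integral_nonneg fun _ => norm_nonneg _
  set c0 : ℂ := c𝕋 d
  have hbi : Integrable b (𝕋 d) := integrable_cell_of_continuous h'.smooth.continuous
  rw [Metric.tendsto_nhds]
  intro η hη
  set δ := η / (2 * (‖c0‖ * Bn + 1))
  have hδ : 0 < δ := by positivity
  have hmain' := (hmain.norm.const_mul ‖c0‖).eventually
    (gt_mem_nhds (show ‖c0‖ * ‖(0 : ℂ)‖ < η / 2 by simpa using hη))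
  filter_upwards [hmain', huca δ hδ, h.fsum_packet_add h'.compact h'.subset s,
    h.eventually_contDiffAt s] with e hme hue hfe hce
  have hpw := pairSum_planeWave (h.summable_packet (t e)) (hi' (t e)) (e • s) (p e) (q e + k)
  rw [← packet] at hpw
  rw [hpw, dist_zero_right]
  set κ : ℂ := 𝐞⁻[(p e) ⋄ (e • s)]
  have hκ : ‖κ‖ = 1 := norm_cexp_neg_I_mul _
  -- the integrand
  have hpt : ∀ θ, 𝐞[(q e + k) ⋄ θ] * conj (wave (t e) ω' b θ) *
      (𝐞⁻[(p e) ⋄ (θ + e • s)] * fsum (packet (t e) ω a) (θ + e • s)) =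
      κ * (𝐞[crossPhase ω ω' p q t s e θ] * u θ) +
      κ * (𝐞[crossPhase ω ω' p q t s e θ] *
        (conj (b θ) * (a (θ + e • s) - a θ) * 𝐞[k ⋄ θ])) := fun θ => by
    by_cases hθ : θ ∈ tsupport b
    · rw [hfe θ hθ]
      simp only [wave, u, κ, crossPhase, map_mul]
      have e1 : 𝐞[(q e + k) ⋄ θ] * conj (𝐞⁻[(t e * ω' θ : ℝ)]) *
          (𝐞⁻[(p e) ⋄ (θ + e • s)] * 𝐞⁻[(t e * ω (θ + e • s) : ℝ)]) =
          𝐞⁻[(p e) ⋄ (e • s)] * (𝐞[((q e - p e) ⋄ θ + t e * (ω' θ - ω (θ + e • s)) : ℝ)] *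
              𝐞[k ⋄ θ]) := by
        rw [conj_cexp_I_mul]
        simp only [← exp_add]
        congr 1
        rw [toEuc_add, toEuc_sub, inner_add_left, inner_sub_left, inner_add_right]
        push_cast
        ring
      linear_combination (conj (b θ) * a (θ + e • s)) * e1
    · have : b θ = 0 := image_eq_zero_of_notMem_tsupport hθ
      simp [wave, u, this]
  have hF : Integrable (fun θ => 𝐞[(q e + k) ⋄ θ] * conj (wave (t e) ω' b θ) *
      (𝐞⁻[(p e) ⋄ (θ + e • s)] * fsum (packet (t e) ω a) (θ + e • s)))
      (𝕋 d) := by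
    have c4 : Continuous fun θ : Euc d => θ + e • s := by fun_prop
    exact integrable_cell_of_continuous (((continuous_cexp_inner (q e + k)).mul
      (continuous_conj.comp (h'.continuous_wave (t e)))).mul
      (((continuous_cexp_neg_inner (p e)).comp c4).mul
        ((continuous_fsum (h.summable_packet (t e))).comp c4)))
  set E : Euc d → ℂ := fun θ => κ * (𝐞[crossPhase ω ω' p q t s e θ] *
        (conj (b θ) * (a (θ + e • s) - a θ) * 𝐞[k ⋄ θ]))
  have hEb : ∀ θ, ‖E θ‖ ≤ δ * ‖b θ‖ := fun θ => by
    simp only [E, norm_mul, hκ, norm_cexp_I_mul, RCLike.norm_conj, one_mul, mul_one]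
    rw [mul_comm]
    gcongr
    exact hue θ
  have hdiff : ‖(∫ θ in cell d, 𝐞[(q e + k) ⋄ θ] * conj (wave (t e) ω' b θ) *
      (𝐞⁻[(p e) ⋄ (θ + e • s)] * fsum (packet (t e) ω a) (θ + e • s)))‖ ≤
      ‖∫ θ, 𝐞[crossPhase ω ω' p q t s e θ] * u θ‖ + δ * Bn := by
    have e2 : ∫ θ, 𝐞[crossPhase ω ω' p q t s e θ] * u θ =
        ∫ θ in cell d, 𝐞[crossPhase ω ω' p q t s e θ] * u θ := by
      refine (setIntegral_eq_integral_of_forall_compl_eq_zero fun θ hθ => ?_).symm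
      have : b θ = 0 := image_eq_zero_of_notMem_tsupport fun hh => hθ (interior_subset (h'.subset hh))
      simp [u, this]
    have hu : Integrable (fun θ => κ * (𝐞[crossPhase ω ω' p q t s e θ] * u θ)) (𝕋 d) := by
      refine ((integrable_of_continuousOn_tsupport huc (f := fun θ =>
        𝐞[crossPhase ω ω' p q t s e θ] * u θ) ?_ fun θ hθ => ?_).const_mul κ).restrict
      · intro θ hθ
        have h1 : ContinuousAt (fun θ => ω (θ + e • s)) θ :=
          ContinuousAt.comp (g := ω) (hce θ (hsa hθ)).continuousAt (by fun_prop)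
        have h2 : ContinuousAt (fun θ => crossPhase ω ω' p q t s e θ) θ :=
          (by fun_prop : Continuous fun θ : Euc d => (q e - p e) ⋄ θ).continuousAt.add
            (continuousAt_const.mul ((h'.phase θ (hsb hθ)).continuousAt.sub h1))
        exact ((continuousAt_const.mul (continuous_ofReal.continuousAt.comp h2)).cexp.mul
          hus.continuous.continuousAt).continuousWithinAt
      · simp [image_eq_zero_of_notMem_tsupport hθ]
    have hE : Integrable E (𝕋 d) := by
      have := hF.sub hu
      refine this.congr (ae_of_all _ fun θ => ?_)
      simp only [Pi.sub_apply, hpt θ, E]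
      ring
    rw [integral_congr_ae (ae_of_all _ hpt), integral_add hu hE, integral_const_mul, e2]
    refine (norm_add_le _ _).trans ?_
    rw [norm_mul, hκ, one_mul]
    gcongr
    rw [← integral_const_mul]
    exact norm_integral_le_of_norm_le (hbi.norm.const_mul δ) (ae_of_all _ hEb)
  have e4 : δ * (‖c0‖ * Bn) < η / 2 := by
    simp only [δ]
    have : 0 ≤ ‖c0‖ * Bn := by positivity
    rw [div_mul_eq_mul_div, div_lt_div_iff₀ (by positivity) (by norm_num)]
    nlinarith
  calc _ = ‖c0‖ * ‖(∫ θ in cell d, 𝐞[(q e + k) ⋄ θ] *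
      conj (wave (t e) ω' b θ) *
      (𝐞⁻[(p e) ⋄ (θ + e • s)] * fsum (packet (t e) ω a) (θ + e • s)))‖ := norm_mul _ _
    _ ≤ ‖c0‖ * (‖∫ θ, 𝐞[crossPhase ω ω' p q t s e θ] * u θ‖ + δ * Bn) := by gcongr
    _ < η := by nlinarith

section Cross

variable {m : Measure (Euc d)}

lemma tendsto_pairSum_cross (h : IsPiece ω a) (h' : IsPiece ω' b) (hF : FTRep F m g M) (hns : ∀ s, NonStationary ω ω' p q t s (tsupport a ∩ tsupport b)) (k : Lat d) :
    Lim₀ (fun e => pairSum (fun x => F (e • toEuc x)) (packet (t e) ω a) (packet (t e) ω' b)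
    (p e) (q e + k)) 0 := by
  have e1 : ∀ e : ℝ, pairSum (fun x => F (e • toEuc x)) (packet (t e) ω a) (packet (t e) ω' b)
      (p e) (q e + k) = ∫ s, pairSum (fun x => 𝐞⁻[⟪e • s, toEuc x⟫])
        (packet (t e) ω a) (packet (t e) ω' b) (p e) (q e + k) * g s ∂m := fun e => by
    rw [← pairSum_integral (continuous_planeWave e) (W := 1) (fun s x => (norm_planeWave e s x).le)
      hF.integrable (h.sqBound _) (h'.sqBound _)]
    congr 1
    ext x
    rw [hF.eq]
    simp_rw [real_inner_smul_left, real_inner_smul_right]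
  simp_rw [e1]
  set A := √(((2 * π) ^ d)⁻¹ * ∫ θ in cell d, ‖a θ‖ ^ 2) *
    √(((2 * π) ^ d)⁻¹ * ∫ θ in cell d, ‖b θ‖ ^ 2)
  have := tendsto_integral_filter_of_dominated_convergence (μ := m) (l := 𝓝[>] (0 : ℝ))
    (F := fun e s => pairSum (fun x => 𝐞⁻[⟪e • s, toEuc x⟫])
        (packet (t e) ω a) (packet (t e) ω' b) (p e) (q e + k) * g s) (f := fun _ => 0)
    (fun s => A * ‖g s‖) (.of_forall fun e =>
      (continuous_pairSum (continuous_planeWave e) (W := 1) (fun s x => (norm_planeWave e s x).le)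
        (h.sqBound _) (h'.sqBound _) _ _).aestronglyMeasurable.mul hF.integrable.1)
    (.of_forall fun e => ae_of_all _ fun s => by
      rw [norm_mul]
      gcongr
      have := norm_pairSum_le (p := p e) (q := q e + k) (fun x => (norm_planeWave e s x).le)
        (fun _ _ => Set.mem_univ _) (h.sqBound (t e)) (h'.sqBound (t e))
      rwa [one_mul] at this)
    (hF.integrable.norm.const_mul A)
    (ae_of_all _ fun s => by
      have := (tendsto_pairSum_planeWave h h' s k (hns s)).mul_const (g s)
      rwa [zero_mul] at this)
  rwa [integral_zero] at this

variable {R0 : Euc d → Lat d → ℂ} {m : Euc d → Measure (Euc d)} {g : Euc d → Euc d → ℂ}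

/-- Non-stationary cross terms vanish in the limit. -/
lemma tendsto_bform_cross (h : IsPiece ω a) (h' : IsPiece ω' b) (hν : Summable ν)
    (hR : ∀ y k, ‖R0 y k‖ ≤ ν k) (hF : ∀ ϑ, FTRep (fun y => fsum (R0 y) ϑ) (m ϑ) (g ϑ) M)
    (hns : ∀ s, NonStationary ω ω' p q t s (tsupport a ∩ tsupport b)) :
    Lim₀ (fun e => bform (fun x k => R0 (e • toEuc x) k) (packet (t e) ω a) (packet (t e) ω' b)
      (p e) (q e)) 0 := by
  set A := √(((2 * π) ^ d)⁻¹ * ∫ θ in cell d, ‖a θ‖ ^ 2) *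
    √(((2 * π) ^ d)⁻¹ * ∫ θ in cell d, ‖b θ‖ ^ 2)
  refine tendsto_tsum_zero (hν.mul_right A) (.of_forall fun e k =>
    norm_pairSum_le (fun x => hR _ k) (fun _ _ => Set.mem_univ _) (h.sqBound _) (h'.sqBound _)) fun k => ?_
  have hRs : ∀ y, Summable fun k => ‖R0 y k‖ := fun y =>
    hν.of_nonneg_of_le (fun _ => norm_nonneg _) (hR y)
  set c0 : ℂ := c𝕋 d
  set w : Euc d → ℂ := fun ϑ => c0 * 𝐞⁻[k ⋄ ϑ]
  have hw : Integrable w (𝕋 d) :=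
    integrable_cell_of_continuous (continuous_const.mul (continuous_cexp_neg_inner k))
  have hGc : ∀ (e : ℝ) (x : Lat d), Continuous fun ϑ => fsum (R0 (e • toEuc x)) ϑ := fun e x =>
    continuous_fsum (hRs _)
  have hGb : ∀ (e : ℝ) ϑ (x : Lat d), ‖fsum (R0 (e • toEuc x)) ϑ‖ ≤ M := fun e ϑ x => (hF ϑ).norm_le _
  have e1 : ∀ e : ℝ, pairSum (fun x => R0 (e • toEuc x) k) (packet (t e) ω a) (packet (t e) ω' b)
      (p e) (q e + k) = ∫ ϑ in cell d, pairSum (fun x => fsum (R0 (e • toEuc x)) ϑ)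
        (packet (t e) ω a) (packet (t e) ω' b) (p e) (q e + k) * w ϑ := fun e => by
    rw [← pairSum_integral (hGc e) (hGb e) hw (h.sqBound _) (h'.sqBound _)]
    congr 1
    ext x
    rw [← fcoef_fsum (hRs (e • toEuc x)) k, fcoef, ← integral_const_mul]
    refine integral_congr_ae (ae_of_all _ fun ϑ => ?_)
    simp only [w, c0]
    ring
  simp_rw [e1]
  have := tendsto_integral_filter_of_dominated_convergence (μ := 𝕋 d) (l := 𝓝[>] (0 : ℝ))
    (F := fun e ϑ => pairSum (fun x => fsum (R0 (e • toEuc x)) ϑ)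
        (packet (t e) ω a) (packet (t e) ω' b) (p e) (q e + k) * w ϑ) (f := fun _ => 0)
    (fun ϑ => M * A * ‖w ϑ‖) (.of_forall fun e =>
      (continuous_pairSum (hGc e) (hGb e) (h.sqBound _) (h'.sqBound _) _ _).aestronglyMeasurable.mul hw.1)
    (.of_forall fun e => ae_of_all _ fun ϑ => by
      rw [norm_mul]
      gcongr
      exact norm_pairSum_le (fun x => hGb e ϑ x) (fun _ _ => Set.mem_univ _) (h.sqBound _) (h'.sqBound _))
    (hw.norm.const_mul (M * A))
    (ae_of_all _ fun ϑ => by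
      have := (tendsto_pairSum_cross h h' (hF ϑ) hns k).mul_const (w ϑ)
      rwa [zero_mul] at this)
  rwa [integral_zero] at this

end Cross

/-! ### The two sources of non-stationarity -/

lemma fderiv_inner_toEuc (z : Lat d) (θ : Euc d) :
    HasFDerivAt (fun θ : Euc d => z ⋄ θ) (innerSL ℝ (toEuc z)) θ :=
  (innerSL ℝ (toEuc z)).hasFDerivAt

lemma hasFDerivAt_crossPhase (hω : DifferentiableAt ℝ ω (θ + e • s)) (hω' : DifferentiableAt ℝ ω' θ)
    : HasFDerivAt (crossPhase ω ω' p q t s e) (innerSL ℝ (toEuc (q e - p e)) + t e • (fderiv ℝ ω'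
    θ - fderiv ℝ ω (θ + e • s))) θ := by
  have h1 : HasFDerivAt (fun θ => ω (θ + e • s)) (fderiv ℝ ω (θ + e • s)) θ := by
    have := HasFDerivAt.comp θ hω.hasFDerivAt ((hasFDerivAt_id θ).add_const (e • s))
    exact this
  exact (fderiv_inner_toEuc _ θ).add ((hω'.hasFDerivAt.sub h1).const_mul (t e))

/-- The gradients of `ω` and `ω'` differ. -/
lemma nonStationary_of_ne (h : IsPiece ω a) (h' : IsPiece ω' b) (s : Euc d)
    (hne : ∀ᵐ θ, θ ∈ tsupport a ∩ tsupport b → fderiv ℝ ω' θ - fderiv ℝ ω θ ≠ 0)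
    (ht : Tendsto (fun e => |t e|) (𝓝[>] 0) atTop)
    (hpq : Lim₀ (fun e => (t e)⁻¹ • toEuc (q e - p e)) 0) :
    NonStationary ω ω' p q t s (tsupport a ∩ tsupport b) := by
  refine ⟨fun θ => ω' θ - ω θ, t, fun θ hθ => ?_, ?_, ht, fun δ hδ => ?_⟩
  · exact ((h'.phase θ hθ.2).of_le two_le_infty).sub ((h.phase θ hθ.1).of_le two_le_infty)
  · filter_upwards [hne] with θ hθ hθT
    have e1 := ((h'.phase θ hθT.2).differentiableAt (by simp)).hasFDerivAt.sub
      ((h.phase θ hθT.1).differentiableAt (by simp)).hasFDerivAt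
    have e2 : fderiv ℝ (fun θ => ω' θ - ω θ) θ = fderiv ℝ ω' θ - fderiv ℝ ω θ := e1.fderiv
    rw [e2]
    exact hθ hθT
  · -- uniform continuity of `∇ω` near the support
    have hunif : ∀ᶠ e in 𝓝[>] (0 : ℝ), ∀ θ ∈ tsupport a, ‖fderiv ℝ ω (θ + e • s) - fderiv ℝ ω θ‖ ≤ δ / 2 := by
      refine (h.compact.eventually_forall_of_forall_eventually (x₀ := (0 : ℝ))
        (P := fun e θ => ‖fderiv ℝ ω (θ + e • s) - fderiv ℝ ω θ‖ ≤ δ / 2) fun θ hθ => ?_).filter_mono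
        nhdsWithin_le_nhds
      have hc1 : ContinuousAt (fderiv ℝ ω) θ :=
        ((h.phase θ hθ).of_le (m := 2) two_le_infty).continuousAt_fderiv (by norm_num)
      have hc2 : ContinuousAt (fun z : ℝ × Euc d => fderiv ℝ ω (z.2 + z.1 • s) - fderiv ℝ ω z.2) (0, θ) := by
        refine .sub ?_ ?_
        · refine .comp (g := fderiv ℝ ω) (f := fun z : ℝ × Euc d => z.2 + z.1 • s) ?_ (by fun_prop)
          simpa using hc1
        · exact .comp (g := fderiv ℝ ω) (f := fun z : ℝ × Euc d => z.2) hc1 (by fun_prop)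
      have hc3 := hc2.norm
      have : ‖fderiv ℝ ω (((0 : ℝ), θ).2 + ((0 : ℝ), θ).1 • s) - fderiv ℝ ω ((0 : ℝ), θ).2‖ < δ / 2 := by
        simpa using hδ
      exact (hc3.eventually (gt_mem_nhds this)).mono fun z hz => hz.le
    have hp' : ∀ᶠ e in 𝓝[>] (0 : ℝ), ‖(t e)⁻¹ • toEuc (q e - p e)‖ < δ / 2 := by
      have := hpq.norm
      rw [norm_zero] at this
      exact this.eventually (gt_mem_nhds (by linarith))
    filter_upwards [hunif, hp', h.eventually_contDiffAt s, ht.eventually_gt_atTop 0] with e hu hpe hce hte θ hθ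
    have ht0 : t e ≠ 0 := abs_pos.1 hte
    have hd' := (h'.phase θ hθ.2).differentiableAt (by simp)
    have hd := (h.phase θ hθ.1).differentiableAt (by simp)
    have e2 : fderiv ℝ (fun θ => ω' θ - ω θ) θ = fderiv ℝ ω' θ - fderiv ℝ ω θ :=
      (hd'.hasFDerivAt.sub hd.hasFDerivAt).fderiv
    rw [(hasFDerivAt_crossPhase ((hce θ hθ.1).differentiableAt (by norm_num)) hd').fderiv, e2]
    have e3 : (t e)⁻¹ • (innerSL ℝ (toEuc (q e - p e)) + t e • (fderiv ℝ ω' θ - fderiv ℝ ω (θ + e • s))) -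
        (fderiv ℝ ω' θ - fderiv ℝ ω θ) = innerSL ℝ ((t e)⁻¹ • toEuc (q e - p e)) -
          (fderiv ℝ ω (θ + e • s) - fderiv ℝ ω θ) := by
      rw [smul_add, inv_smul_smul₀ ht0, map_smul]
      abel
    rw [e3]
    refine (norm_sub_le _ _).trans ?_
    rw [innerSL_apply_norm]
    have := hu θ hθ.1
    linarith

end

section

variable {m : Measure (Euc d)}

variable {ω' : Euc d → ℝ} {a b : Euc d → ℂ} {p q : ℝ → Lat d} {t : ℝ → ℝ}

/-! ### Shifted packets with the same phase -/

lemma hasDerivAt_fderiv_line {x : ℝ} (h : ContDiffAt ℝ 2 ω (θ + x • s)) : HasDerivAt (fun x : ℝ =>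
    fderiv ℝ ω (θ + x • s)) (D² ω (θ + x • s) s) x := by
  have h1 : HasFDerivAt (fderiv ℝ ω) (D² ω (θ + x • s)) (θ + x • s) :=
    ((h.fderiv_right (m := 1) (by norm_num)).differentiableAt (by norm_num)).hasFDerivAt
  have h2 : HasDerivAt (fun x : ℝ => θ + x • s) s x := by
    simpa using ((hasDerivAt_id x).smul_const s).const_add θ
  exact h1.comp_hasDerivAt x h2

lemma eventually_fderiv_fderiv_close (hT : IsCompact T) (h : ∀ θ ∈ T, ContDiffAt ℝ 2 ω θ)
    (s : Euc d) (hδ : 0 < δ) : ∀ᶠ e in 𝓝 (0 : ℝ), ∀ θ ∈ T, ContDiffAt ℝ 2 ω (θ + e • s) ∧ ‖D² ω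
    (θ + e • s) s - D² ω θ s‖ ≤ δ := by
  refine hT.eventually_forall_of_forall_eventually (x₀ := (0 : ℝ))
    (P := fun e θ => ContDiffAt ℝ 2 ω (θ + e • s) ∧
      ‖D² ω (θ + e • s) s - D² ω θ s‖ ≤ δ) fun θ hθ => ?_
  have hc1 : ContinuousAt (fun x => D² ω x s) θ :=
    (((h θ hθ).fderiv_right (m := 1) (by norm_num)).continuousAt_fderiv (by norm_num)).clm_apply
      continuousAt_const
  have hm : ContinuousAt (fun z : ℝ × Euc d => z.2 + z.1 • s) (0, θ) := by fun_prop
  have hm0 : ((0 : ℝ), θ).2 + ((0 : ℝ), θ).1 • s = θ := by simp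
  have hc2 : ContinuousAt (fun z : ℝ × Euc d => D² ω (z.2 + z.1 • s) s - D² ω z.2 s) (0, θ) := by
    refine .sub ?_ ?_
    · refine .comp (g := fun x => D² ω x s) (f := fun z : ℝ × Euc d => z.2 + z.1 • s) ?_ hm
      rw [hm0]; exact hc1
    · exact .comp (g := fun x => D² ω x s) (f := fun z : ℝ × Euc d => z.2) hc1 (by fun_prop)
  have hsmall : ‖D² ω (((0 : ℝ), θ).2 + ((0 : ℝ), θ).1 • s) s - D² ω ((0 : ℝ), θ).2 s‖ < δ := by
    simpa using hδ
  have hev : ∀ᶠ z : ℝ × Euc d in 𝓝 (0, θ), ContDiffAt ℝ 2 ω (z.2 + z.1 • s) := by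
    have h2 := (h θ hθ).eventually (by norm_num)
    rw [← hm0] at h2
    exact hm.eventually h2
  filter_upwards [hev, hc2.norm.eventually (gt_mem_nhds hsmall)] with z h1 h2 using ⟨h1, h2.le⟩

/-- First-order expansion of the gradient, uniformly on compact sets. -/
lemma eventually_fderiv_expansion (hT : IsCompact T) (h : ∀ θ ∈ T, ContDiffAt ℝ 2 ω θ) (s : Euc d)
    (hδ : 0 < δ) : ∀ᶠ e in 𝓝[>] (0 : ℝ), ∀ θ ∈ T, ContDiffAt ℝ 2 ω (θ + e • s) ∧ ‖fderiv ℝ ω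
    (θ + e • s) - fderiv ℝ ω θ - e • D² ω θ s‖ ≤ δ * e := by
  obtain ⟨η, hη, hηb⟩ := Metric.eventually_nhds_iff.1 (eventually_fderiv_fderiv_close hT h s hδ)
  have hlt : ∀ᶠ e in 𝓝[>] (0 : ℝ), e < η := nhdsWithin_le_nhds (gt_mem_nhds hη)
  filter_upwards [hlt, self_mem_nhdsWithin] with e heη he θ hθ
  have he : 0 < e := he
  have hin : ∀ x ∈ Set.Icc 0 e, dist x 0 < η := fun x hx => by
    rw [dist_zero_right, norm_of_nonneg hx.1]; exact hx.2.trans_lt heη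
  refine ⟨(hηb (hin e ⟨he.le, le_rfl⟩) θ hθ).1, ?_⟩
  have := norm_image_sub_le_of_norm_deriv_le_segment' (a := 0) (b := e)
    (f := fun x => fderiv ℝ ω (θ + x • s) - x • D² ω θ s)
    (f' := fun x => D² ω (θ + x • s) s - D² ω θ s) (C := δ)
    (fun x hx => by
      have h1 := hasDerivAt_fderiv_line (hηb (hin x hx) θ hθ).1
      have h2 : HasDerivAt (fun x : ℝ => x • D² ω θ s) (D² ω θ s) x := by
        simpa using (hasDerivAt_id x).smul_const (D² ω θ s)
      exact (h1.sub h2).hasDerivWithinAt)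
    (fun x hx => (hηb (hin x ⟨hx.1, hx.2.le⟩) θ hθ).2) e ⟨he.le, le_rfl⟩
  simp only [zero_smul, add_zero, sub_zero] at this
  rwa [sub_right_comm] at this

/-- The endpoints are far apart. -/
lemma nonStationary_of_shift (h : IsPiece ω a) (s β : Euc d) (τ : ℝ)
    (ht : ∀ e, 0 < e → t e = τ / e ^ 2)
    (hpq : Lim₀ (fun e => e • toEuc (q e - p e)) β)
    (hne : ∀ᵐ θ, θ ∈ tsupport a → innerSL ℝ β - τ • D² ω θ s ≠ 0) :
    NonStationary ω ω p q t s (tsupport a ∩ tsupport b) := by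
  have h2 : ∀ θ ∈ tsupport a, ContDiffAt ℝ 2 ω θ := fun θ hθ => (h.phase θ hθ).of_le two_le_infty
  have hfd : ∀ θ ∈ tsupport a, fderiv ℝ (fun θ => ⟪β, θ⟫ - τ * fderiv ℝ ω θ s) θ =
      innerSL ℝ β - τ • D² ω θ s := fun θ hθ => by
    have e1 : HasFDerivAt (fun θ : Euc d => ⟪β, θ⟫) (innerSL ℝ β) θ := (innerSL ℝ β).hasFDerivAt
    have e2 : HasFDerivAt (fderiv ℝ ω) (D² ω θ) θ :=
      (((h2 θ hθ).fderiv_right (m := 1) (by norm_num)).differentiableAt (by norm_num)).hasFDerivAt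
    have e3 : HasFDerivAt (fun θ => fderiv ℝ ω θ s) ((D² ω θ).flip s) θ := by
      have := e2.clm_apply (hasFDerivAt_const s θ)
      simpa using this
    have e4 : (D² ω θ).flip s = D² ω θ s := by
      ext v
      exact ((h2 θ hθ).isSymmSndFDerivAt (by simp)).eq v s
    rw [e4] at e3
    exact (e1.sub (e3.const_mul τ)).fderiv
  refine ⟨fun θ => ⟪β, θ⟫ - τ * fderiv ℝ ω θ s, fun e => e⁻¹, fun θ hθ => ?_, ?_, ?_, fun δ hδ => ?_⟩
  · refine (contDiff_const.inner ℝ contDiff_id).contDiffAt.sub (contDiffAt_const.mul ?_)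
    exact ((h.phase θ hθ.1).fderiv_right (m := 2) (WithTop.coe_le_coe.2 (le_top : (2 + 1 : ℕ∞) ≤ ⊤))).clm_apply contDiffAt_const
  · filter_upwards [hne] with θ hθ hθT
    rw [hfd θ hθT.1]
    exact hθ hθT.1
  · exact tendsto_abs_atTop_atTop.comp tendsto_inv_nhdsGT_zero
  · set δ' := δ / (2 * (|τ| + 1))
    have hδ' : 0 < δ' := by positivity
    have hp' : ∀ᶠ e in 𝓝[>] (0 : ℝ), ‖e • toEuc (q e - p e) - β‖ < δ / 2 := by
      have := (hpq.sub_const β).norm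
      rw [sub_self, norm_zero] at this
      exact this.eventually (gt_mem_nhds (by linarith))
    filter_upwards [eventually_fderiv_expansion h.compact h2 s hδ', hp', self_mem_nhdsWithin]
      with e hexp hpe he θ hθ
    have he : 0 < e := he
    obtain ⟨hc, hb⟩ := hexp θ hθ.1
    rw [hfd θ hθ.1, (hasFDerivAt_crossPhase (hc.differentiableAt (by norm_num))
      ((h2 θ hθ.1).differentiableAt (by norm_num))).fderiv, inv_inv, ht e he]
    have e3 : e • (innerSL ℝ (toEuc (q e - p e)) + (τ / e ^ 2) • (fderiv ℝ ω θ - fderiv ℝ ω (θ + e • s))) -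
        (innerSL ℝ β - τ • D² ω θ s) = innerSL ℝ (e • toEuc (q e - p e) - β) -
          (τ / e) • (fderiv ℝ ω (θ + e • s) - fderiv ℝ ω θ - e • D² ω θ s) := by
      rw [smul_add, smul_smul, map_sub, map_smul, smul_sub (τ / e), smul_smul,
        show e * (τ / e ^ 2) = τ / e by field_simp, show τ / e * e = τ by field_simp, smul_sub, smul_sub]
      abel
    rw [e3]
    refine (norm_sub_le _ _).trans ?_
    rw [innerSL_apply_norm, norm_smul, norm_eq_abs, abs_div, abs_of_pos he]
    have e5 : |τ| / e * ‖fderiv ℝ ω (θ + e • s) - fderiv ℝ ω θ - e • D² ω θ s‖ ≤ δ / 2 := by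
      calc _ ≤ |τ| / e * (δ' * e) := by gcongr
        _ = |τ| * δ' := by field_simp
        _ ≤ (|τ| + 1) * δ' := by gcongr; linarith
        _ = δ / 2 := by simp only [δ']; field_simp
    linarith

/-- Second-order expansion of the phase. -/
lemma tendsto_phase_expansion (h : ContDiffAt ℝ 2 ω θ) (s : Euc d) : Lim₀ (fun e : ℝ =>
    (ω (θ + e • s) - ω θ - e * fderiv ℝ ω θ s - e ^ 2 / 2 * D² ω θ s s) / e ^ 2) 0 := by
  rw [Metric.tendsto_nhds]
  intro δ hδ
  set δ' := δ / (2 * (‖s‖ + 1))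
  have hδ' : 0 < δ' := by positivity
  have hexp := eventually_fderiv_expansion (isCompact_singleton (x := θ)) (by simpa using h) s hδ'
  rw [eventually_nhdsWithin_iff, Metric.eventually_nhds_iff] at hexp
  obtain ⟨η, hη, hηb⟩ := hexp
  have hlt : ∀ᶠ e in 𝓝[>] (0 : ℝ), e < η := nhdsWithin_le_nhds (gt_mem_nhds hη)
  filter_upwards [hlt, self_mem_nhdsWithin] with e heη he
  have he : 0 < e := he
  have hin : ∀ x ∈ Set.Icc 0 e, dist x 0 < η := fun x hx => by
    rw [dist_zero_right, norm_of_nonneg hx.1]; exact hx.2.trans_lt heη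
  have hcd : ∀ x ∈ Set.Icc 0 e, ContDiffAt ℝ 2 ω (θ + x • s) ∧
      ‖fderiv ℝ ω (θ + x • s) - fderiv ℝ ω θ - x • D² ω θ s‖ ≤ δ' * x := fun x hx => by
    rcases hx.1.eq_or_lt with rfl | hx0
    · simpa using h
    · exact hηb (hin x hx) hx0 θ rfl
  have := norm_image_sub_le_of_norm_deriv_le_segment' (a := 0) (b := e)
    (f := fun x => ω (θ + x • s) - x * fderiv ℝ ω θ s - x ^ 2 / 2 * D² ω θ s s)
    (f' := fun x => (fderiv ℝ ω (θ + x • s) - fderiv ℝ ω θ - x • D² ω θ s) s)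
    (C := δ' * e * ‖s‖)
    (fun x hx => by
      have h1 : HasDerivAt (fun x : ℝ => θ + x • s) s x := by
        simpa using ((hasDerivAt_id x).smul_const s).const_add θ
      have h2 := (((hcd x hx).1.differentiableAt (by norm_num)).hasFDerivAt).comp_hasDerivAt x h1
      have h3 : HasDerivAt (fun x : ℝ => x * fderiv ℝ ω θ s) (fderiv ℝ ω θ s) x := by
        simpa using (hasDerivAt_id x).mul_const (fderiv ℝ ω θ s)
      have h4 : HasDerivAt (fun x : ℝ => x ^ 2 / 2 * D² ω θ s s) (x * D² ω θ s s) x := by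
        have := (((hasDerivAt_id x).pow 2).div_const 2).mul_const (D² ω θ s s)
        refine this.congr_deriv ?_
        simp
      exact ((h2.sub h3).sub h4).hasDerivWithinAt)
    (fun x hx => by
      refine (ContinuousLinearMap.le_opNorm _ _).trans ?_
      gcongr
      refine (hcd x ⟨hx.1, hx.2.le⟩).2.trans ?_
      gcongr
      exact hx.2.le) e ⟨he.le, le_rfl⟩
  simp only [zero_smul, add_zero, sub_zero, zero_mul] at this
  rw [dist_zero_right, norm_div, norm_pow, norm_of_nonneg he.le, div_lt_iff₀ (by positivity)]
  calc ‖ω (θ + e • s) - ω θ - e * fderiv ℝ ω θ s - e ^ 2 / 2 * D² ω θ s s‖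
      = ‖ω (θ + e • s) - e * fderiv ℝ ω θ s - e ^ 2 / 2 * D² ω θ s s -
          (ω θ - 0 ^ 2 / 2 * D² ω θ s s)‖ := by congr 1; ring
    _ ≤ δ' * e * ‖s‖ * e := this
    _ = δ' * ‖s‖ * e ^ 2 := by ring
    _ ≤ δ' * (‖s‖ + 1) * e ^ 2 := by gcongr; linarith
    _ = δ / 2 * e ^ 2 := by simp only [δ']; field_simp
    _ < δ * e ^ 2 := by gcongr; linarith

/-! ### The diagonal terms -/

lemma tsum_ftRep (H : FTRep F m g M) (hφ : Summable fun z => ‖φ z‖) (p : Lat d) (θ : Euc d) (e : ℝ)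
    : ∑' x, F (e • toEuc x) * φ (p - x) * 𝐞⁻[x ⋄ θ] = ∫ s, 𝐞⁻[p ⋄ (θ + e • s)] * fsum φ (θ + e • s)
    * g s ∂m := by
  have hφ' : Summable fun x => ‖φ (p - x)‖ := (Equiv.subLeft p).summable_iff.2 hφ
  have hi : ∀ x, Integrable (fun s => 𝐞⁻[⟪e • s, toEuc x⟫] * g s) m :=
    fun x => H.integrable.bdd_mul (c := 1) (continuous_planeWave e x).aestronglyMeasurable
      (ae_of_all _ fun s => (norm_planeWave e s x).le)
  have hsum := hasSum_integral_of_summable_integral_norm (μ := m)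
    (F := fun x s => 𝐞⁻[⟪e • s, toEuc x⟫] * g s * (φ (p - x) * 𝐞⁻[x ⋄ θ]))
    (fun x => (hi x).mul_const _) (by
      have e1 : ∀ x, ∫ s, ‖𝐞⁻[⟪e • s, toEuc x⟫] * g s * (φ (p - x) * 𝐞⁻[x ⋄ θ])‖ ∂m =
          (∫ s, ‖g s‖ ∂m) * ‖φ (p - x)‖ := fun x => by
        rw [← integral_mul_const]
        simp only [norm_mul, norm_cexp_neg_I_mul, one_mul, mul_one]
      simp_rw [e1]
      exact hφ'.mul_left _)
  have e2 : ∀ x, F (e • toEuc x) * φ (p - x) * 𝐞⁻[x ⋄ θ] = ∫ s, 𝐞⁻[⟪e • s, toEuc x⟫] * g s *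
      (φ (p - x) * 𝐞⁻[x ⋄ θ]) ∂m := fun x => by
    rw [integral_mul_const, H.eq, mul_assoc]
    simp_rw [real_inner_smul_left, real_inner_smul_right]
  simp_rw [e2]
  rw [hsum.tsum_eq]
  refine integral_congr_ae (ae_of_all _ fun s => ?_)
  simp only
  rw [← tsum_mul_cexp_eq_fsum, ← tsum_mul_right]
  congr 1
  ext x
  ring

lemma IsPiece.continuous_fsum_packet_line (h : IsPiece ω a) (t : ℝ) (p : Lat d) (θ : Euc d) (e : ℝ) :
    Continuous fun s => 𝐞⁻[p ⋄ (e • s)] * fsum (packet t ω a) (θ + e • s) := by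
  have h1 := continuous_fsum (h.summable_packet t)
  fun_prop

lemma continuous_cexp_quadratic (ω : Euc d → ℝ) (θ ρ : Euc d) (c c' : ℝ) : Continuous fun s =>
    𝐞⁻[(⟪s, ρ⟫ + c * fderiv ℝ ω θ s + c' * D² ω θ s s : ℝ)] := by
  have : Continuous fun s : Euc d => D² ω θ s s := (D² ω θ).continuous.clm_apply continuous_id
  fun_prop

/-- The limiting amplitude of a packet transported for the time `τ/e²`. -/
lemma tendsto_transport (h : IsPiece ω a) (H : FTRep F m g M) (ht : ∀ e, 0 < e → t e = τ / e ^ 2)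
    (hp : Lim₀ (fun e => e • toEuc (p e)) ρ) (hθ : θ ∈ interior (cell d)) (hC : ContDiffAt ℝ 2 ω
    θ) : Lim₀ (fun e => ∫ s, (𝐞[(t e * ω θ : ℝ)] * (𝐞⁻[(p e) ⋄ (e • s)] * fsum (packet (t e) ω
    a) (θ + e • s)) - a θ * 𝐞⁻[(⟪s, ρ⟫ + τ / e * fderiv ℝ ω θ s + τ / 2 * D² ω θ s s : ℝ)]) * g s
    ∂m) 0 := by
  obtain ⟨B, hB0, hB⟩ := h.exists_bound
  have := tendsto_integral_filter_of_dominated_convergence (μ := m) (l := 𝓝[>] (0 : ℝ))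
    (F := fun e s => (𝐞[(t e * ω θ : ℝ)] *
        (𝐞⁻[(p e) ⋄ (e • s)] * fsum (packet (t e) ω a) (θ + e • s)) -
      a θ * 𝐞⁻[(⟪s, ρ⟫ + τ / e * fderiv ℝ ω θ s + τ / 2 * D² ω θ s s : ℝ)]) * g s) (f := fun _ => 0)
    (fun s => 2 * B * ‖g s‖) (.of_forall fun e => ?_)
    (.of_forall fun e => ae_of_all _ fun s => ?_) (H.integrable.norm.const_mul _)
    (ae_of_all _ fun s => ?_)
  · rwa [integral_zero] at this
  · exact ((continuous_const.mul (h.continuous_fsum_packet_line _ _ _ _)).sub (continuous_const.mul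
      (continuous_cexp_quadratic ω θ ρ _ _))).aestronglyMeasurable.mul H.integrable.1
  · rw [norm_mul]
    gcongr
    refine (norm_sub_le _ _).trans ?_
    rw [norm_mul, norm_mul, norm_mul, norm_cexp_I_mul, norm_cexp_neg_I_mul, norm_cexp_neg_I_mul, one_mul,
      one_mul, mul_one, two_mul]
    exact add_le_add (h.norm_fsum_packet_le (t e) hB _) (hB θ)
  · -- pointwise convergence of the integrand
    set X : ℝ → ℝ := fun e => (p e) ⋄ (e • s) + t e * (ω (θ + e • s) - ω θ)
    set Y : ℝ → ℝ := fun e => ⟪s, ρ⟫ + τ / e * fderiv ℝ ω θ s + τ / 2 * D² ω θ s s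
    have hXY : Lim₀ (fun e => X e - Y e) 0 := by
      have h1 : Lim₀ (fun e => ⟪e • toEuc (p e) - ρ, s⟫) 0 := by
        have := (hp.sub_const ρ).inner (𝕜 := ℝ) (tendsto_const_nhds (x := s))
        rwa [sub_self, inner_zero_left] at this
      have h2 := (tendsto_phase_expansion hC s).const_mul τ
      have h3 := h1.add h2
      rw [mul_zero, add_zero] at h3
      refine h3.congr' ?_
      filter_upwards [self_mem_nhdsWithin] with e he
      have he : 0 < e := he
      simp only [X, Y]
      rw [ht e he, inner_sub_left, real_inner_smul_left, real_inner_smul_right, real_inner_comm s ρ]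
      field_simp
      ring
    have hmem := h.fsum_packet_add (isCompact_singleton (x := θ)) (by simpa using hθ) s
    have ha : Lim₀ (fun e : ℝ => a (θ + e • s)) (a θ) := by
      have : Continuous fun e : ℝ => a (θ + e • s) := h.smooth.continuous.comp (by fun_prop)
      have := (this.tendsto 0).mono_left (nhdsWithin_le_nhds (s := Set.Ioi 0))
      simpa using this
    have hE : Lim₀ (fun e => 𝐞⁻[(X e - Y e : ℝ)]) 1 := by
      have c : Continuous fun x : ℝ => 𝐞⁻[x] := by fun_prop
      have h0 := (c.tendsto 0).comp hXY
      rw [show 𝐞⁻[(0 : ℝ)] = 1 by simp] at h0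
      exact h0
    have hd : Lim₀ (fun e => 𝐞⁻[(X e - Y e : ℝ)] * a (θ + e • s) - a θ) 0 := by
      have := (hE.mul ha).sub_const (a θ)
      rwa [one_mul, sub_self] at this
    have hd2 := hd.norm.mul_const ‖g s‖
    rw [norm_zero, zero_mul] at hd2
    refine squeeze_zero_norm' ?_ hd2
    filter_upwards [hmem] with e he
    rw [he θ rfl, norm_mul]
    gcongr
    have e1 : 𝐞[(t e * ω θ : ℝ)] * (𝐞⁻[(p e) ⋄ (e • s)] * wave (t e) ω a (θ + e • s)) -
      a θ * 𝐞⁻[(Y e : ℝ)] =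
      𝐞⁻[Y e] * (𝐞⁻[(X e - Y e : ℝ)] * a (θ + e • s) - a θ) := by
      have e2 : 𝐞[(t e * ω θ : ℝ)] * (𝐞⁻[(p e) ⋄ (e • s)] * 𝐞⁻[(t e * ω (θ + e • s) : ℝ)]) =
          𝐞⁻[Y e] * 𝐞⁻[(X e - Y e : ℝ)] := by
        simp only [← exp_add]
        congr 1
        simp only [X]
        push_cast
        ring
      simp only [wave]
      linear_combination a (θ + e • s) * e2
    rw [e1, norm_mul, norm_cexp_neg_I_mul, one_mul]

/-- The limit of the diagonal terms. -/
lemma tendsto_bform_diag (h : IsPiece ω a) (h' : IsPiece ω b) {R0 : Euc d → Lat d → ℂ} {m : Euc d →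
    Measure (Euc d)} {g : Euc d → Euc d → ℂ} (hν : Summable ν) (hR : ∀ y k, ‖R0 y k‖ ≤ ν k)
    (hF : ∀ ϑ, FTRep (fun y => fsum (R0 y) ϑ) (m ϑ) (g ϑ) M) (ht : ∀ e, 0 < e → t e = τ / e ^ 2)
    (hp : Lim₀ (fun e => e • toEuc (p e)) ρ) (hpq : ∀ e, p e - q e = z) (hA : ∀ᵐ θ ∂𝕋 d, ∀ e,
    0 < e → A e θ = ∫ s, 𝐞⁻[(⟪s, ρ⟫ + τ / e * fderiv ℝ ω θ s + τ / 2 * D² ω θ s s : ℝ)] * g θ s ∂m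
    θ) (hAm : ∀ e, 0 < e → AEStronglyMeasurable (fun θ => conj (b θ) * a θ * A e θ) (𝕋 d)) :
    Lim₀ (fun e => bform (fun x k => R0 (e • toEuc x) k) (packet (t e) ω a) (packet (t e) ω b)
    (p e) (q e) - fcoef (fun θ => conj (b θ) * a θ * A e θ) z) 0 := by
  have hRs : ∀ y, Summable fun k => ‖R0 y k‖ := fun y =>
    hν.of_nonneg_of_le (fun _ => norm_nonneg _) (hR y)
  obtain ⟨B, hB0, hB⟩ := h.exists_bound
  have hM0 : 0 ≤ M := (norm_nonneg _).trans ((hF 0).norm_le 0)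
  set c0 : ℂ := c𝕋 d
  set S : ℝ → Euc d → ℂ := fun e θ => ∑' x, fsum (R0 (e • toEuc x)) θ * packet (t e) ω a (p e - x) *
    𝐞⁻[x ⋄ θ]
  have hφ' : ∀ e, Summable fun x => ‖packet (t e) ω a (p e - x)‖ := fun e =>
    (Equiv.subLeft (p e)).summable_iff.2 (h.summable_packet (t e))
  have hSc : ∀ e, Continuous (S e) := fun e => by
    refine continuous_tsum (fun x => ((continuous_fsum (hRs _)).mul continuous_const).mul
      (continuous_cexp_neg_inner x)) ((hφ' e).mul_left M) fun x θ => ?_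
    rw [norm_mul, norm_mul, norm_cexp_neg_I_mul, mul_one]
    gcongr
    exact (hF θ).norm_le _
  set Φ : ℝ → Euc d → ℂ := fun e θ => 𝐞[(q e) ⋄ θ] * conj (wave (t e) ω b θ) * S e θ
  set Ψ : ℝ → Euc d → ℂ := fun e θ => 𝐞⁻[z ⋄ θ] * (conj (b θ) * a θ * A e θ)
  have hΦc : ∀ e, Integrable (Φ e) (𝕋 d) := fun e =>
    integrable_cell_of_continuous (((continuous_cexp_inner (q e)).mul
      (continuous_conj.comp (h'.continuous_wave (t e)))).mul (hSc e))
  have hΨm : ∀ e, 0 < e → AEStronglyMeasurable (Ψ e) (𝕋 d) := fun e he =>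
    (continuous_cexp_neg_inner z).aestronglyMeasurable.mul (hAm e he)
  have hbi : Integrable b (𝕋 d) := integrable_cell_of_continuous h'.smooth.continuous
  have hΨb : ∀ e, 0 < e → ∀ᵐ θ ∂𝕋 d, ‖Ψ e θ‖ ≤ B * M * ‖b θ‖ := fun e he => by
    filter_upwards [hA] with θ hθ
    have : ‖A e θ‖ ≤ M := by
      rw [hθ e he]
      exact (hF θ).norm_integral_le _
    simp only [Ψ, norm_mul, norm_cexp_neg_I_mul, one_mul, RCLike.norm_conj]
    calc ‖b θ‖ * ‖a θ‖ * ‖A e θ‖ ≤ ‖b θ‖ * B * M := by gcongr; exact hB θ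
      _ = _ := by ring
  have hΨi : ∀ e, 0 < e → Integrable (Ψ e) (𝕋 d) := fun e he =>
    (hbi.norm.const_mul (B * M)).mono' (hΨm e he) (hΨb e he)
  have hΦb : ∀ e θ, ‖Φ e θ‖ ≤ B * M * ‖b θ‖ := fun e θ => by
    simp only [Φ, norm_mul, norm_cexp_I_mul, one_mul, RCLike.norm_conj, norm_wave]
    rw [mul_comm]
    gcongr
    simp only [S]
    rw [tsum_ftRep (hF θ) (h.summable_packet (t e))]
    refine (norm_integral_le_integral_norm _).trans ?_
    refine (integral_mono_of_nonneg (ae_of_all _ fun s => norm_nonneg _)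
      ((hF θ).integrable.norm.const_mul B) (ae_of_all _ fun s => ?_)).trans ?_
    · simp only [norm_mul, norm_cexp_neg_I_mul, one_mul]
      gcongr
      exact h.norm_fsum_packet_le (t e) hB _
    · rw [integral_const_mul]
      gcongr
      exact (hF θ).bound
  have hlim : Lim₀ (fun e => ∫ θ in cell d, (Φ e θ - Ψ e θ)) 0 := by
    have := tendsto_integral_filter_of_dominated_convergence (μ := 𝕋 d)
      (l := 𝓝[>] (0 : ℝ)) (F := fun e θ => Φ e θ - Ψ e θ) (f := fun _ => 0)
      (fun θ => 2 * (B * M * ‖b θ‖)) ?_ ?_ ((hbi.norm.const_mul _).const_mul 2) ?_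
    · rwa [integral_zero] at this
    · filter_upwards [self_mem_nhdsWithin] with e he using (hΦc e).1.sub (hΨm e he)
    · filter_upwards [self_mem_nhdsWithin] with e he
      filter_upwards [hΨb e he] with θ hθ
      refine (norm_sub_le _ _).trans ?_
      linarith [hΦb e θ]
    · filter_upwards [hA] with θ hθA
      by_cases hb0 : b θ = 0
      · have : ∀ e, Φ e θ - Ψ e θ = 0 := fun e => by simp [Φ, Ψ, wave, hb0]
        simp only [this]
        exact tendsto_const_nhds
      have hθb : θ ∈ tsupport b := subset_tsupport b hb0
      have hθc : θ ∈ interior (cell d) := h'.subset hθb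
      have htr := tendsto_transport h (hF θ) ht hp hθc ((h'.phase θ hθb).of_le two_le_infty)
      have htr2 := htr.norm.const_mul ‖b θ‖
      rw [norm_zero, mul_zero] at htr2
      refine squeeze_zero_norm' ?_ htr2
      filter_upwards [self_mem_nhdsWithin] with e he
      have hint1 : Integrable (fun s => 𝐞[(t e * ω θ : ℝ)] * (𝐞⁻[(p e) ⋄ (e • s)] *
            fsum (packet (t e) ω a) (θ + e • s)) * g θ s) (m θ) := by
        refine (hF θ).integrable.bdd_mul (c := B) (continuous_const.mul
          (h.continuous_fsum_packet_line _ _ _ _)).aestronglyMeasurable (ae_of_all _ fun s => ?_)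
        rw [norm_mul, norm_mul, norm_cexp_I_mul, norm_cexp_neg_I_mul, one_mul, one_mul]
        exact h.norm_fsum_packet_le (t e) hB _
      have hint2 : Integrable (fun s => a θ * 𝐞⁻[(⟪s, ρ⟫ + τ / e * fderiv ℝ ω θ s +
        τ / 2 * D² ω θ s s : ℝ)] * g θ s) (m θ) := by
        refine (hF θ).integrable.bdd_mul (c := B) (continuous_const.mul
          (continuous_cexp_quadratic ω θ ρ _ _)).aestronglyMeasurable (ae_of_all _ fun s => ?_)
        rw [norm_mul, norm_cexp_neg_I_mul, mul_one]
        exact hB θ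
      have e1 : Φ e θ - Ψ e θ = 𝐞⁻[z ⋄ θ] * conj (b θ) * ∫ s, (𝐞[(t e * ω θ : ℝ)] *
        (𝐞⁻[(p e) ⋄ (e • s)] * fsum (packet (t e) ω a) (θ + e • s)) -
      a θ * 𝐞⁻[(⟪s, ρ⟫ + τ / e * fderiv ℝ ω θ s + τ / 2 * D² ω θ s s : ℝ)]) * g θ s ∂m θ := by
        simp only [sub_mul]
        rw [integral_sub hint1 hint2, mul_sub]
        congr 1
        · simp only [Φ, S]
          rw [tsum_ftRep (hF θ) (h.summable_packet (t e)), ← integral_const_mul, ← integral_const_mul]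
          refine integral_congr_ae (ae_of_all _ fun s => ?_)
          simp only [wave, map_mul]
          rw [conj_cexp_I_mul, inner_add_right, ← hpq e, toEuc_sub, inner_sub_left]
          have e2 : 𝐞[(q e) ⋄ θ] * 𝐞⁻[((p e) ⋄ θ + (p e) ⋄ (e • s) : ℝ)] =
              𝐞⁻[((p e) ⋄ θ - (q e) ⋄ θ : ℝ)] *
              𝐞⁻[(p e) ⋄ (e • s)] := by
            rw [← exp_add, ← exp_add]
            congr 1
            push_cast
            ring
          linear_combination (𝐞[(t e * ω θ : ℝ)] * conj (b θ) *
            fsum (packet (t e) ω a) (θ + e • s) * g θ s) * e2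
        · simp only [Ψ]
          rw [hθA e he]
          simp only [mul_assoc]
          rw [integral_const_mul]
      rw [e1, norm_mul, norm_mul, norm_cexp_neg_I_mul, one_mul, RCLike.norm_conj]
  have hfin := hlim.const_mul c0
  rw [mul_zero] at hfin
  refine hfin.congr' ?_
  filter_upwards [self_mem_nhdsWithin] with e he
  have hb := bform_fcoef (n := fun x k => R0 (e • toEuc x) k) hν (fun x k => hR _ k) (h.summable_packet (t e))
    (integrable_cell_of_continuous (h'.continuous_wave (t e))) (p e) (q e)
  rw [← packet] at hb
  rw [hb, fcoef, integral_sub (hΦc e) (hΨi e he), mul_sub]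

end

section

open scoped ComplexConjugate ENNReal

/-! ### Complex measures -/

section ComplexMeasure

variable {X : Type*} [MeasurableSpace X]

/-- The polar decomposition of a complex measure of finite variation. -/
lemma exists_density (ν : ComplexMeasure X) [IsFiniteMeasure ν.variation] :
    ∃ g : X → ℂ, Integrable g ν.variation ∧ ν = ν.variation.withDensityᵥ g ∧
      ∀ᵐ x ∂ν.variation, ‖g x‖ = 1 := by
  set m := ν.variation
  have hzero : ∀ s, MeasurableSet s → m s = 0 → ν s = 0 := fun s hs h0 => by
    have := VectorMeasure.enorm_measure_le_variation ν s
    rw [show ν.variation s = 0 from h0] at this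
    simpa using this
  have hre_ap : ∀ s, ComplexMeasure.re ν s = (ν s).re := fun s => rfl
  have him_ap : ∀ s, ComplexMeasure.im ν s = (ν s).im := fun s => rfl
  have hre : ComplexMeasure.re ν ≪ᵥ m.toENNRealVectorMeasure := by
    refine VectorMeasure.AbsolutelyContinuous.mk fun s hs h0 => ?_
    rw [Measure.toENNRealVectorMeasure_apply_measurable hs] at h0
    rw [hre_ap, hzero s hs h0, Complex.zero_re]
  have him : ComplexMeasure.im ν ≪ᵥ m.toENNRealVectorMeasure := by
    refine VectorMeasure.AbsolutelyContinuous.mk fun s hs h0 => ?_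
    rw [Measure.toENNRealVectorMeasure_apply_measurable hs] at h0
    rw [him_ap, hzero s hs h0, Complex.zero_im]
  have hre' := SignedMeasure.withDensityᵥ_rnDeriv_eq _ m hre
  have him' := SignedMeasure.withDensityᵥ_rnDeriv_eq _ m him
  set u := (ComplexMeasure.re ν).rnDeriv m
  set v := (ComplexMeasure.im ν).rnDeriv m
  have hu : Integrable u m := SignedMeasure.integrable_rnDeriv _ _
  have hv : Integrable v m := SignedMeasure.integrable_rnDeriv _ _
  have hg : Integrable (fun x => (u x : ℂ) + I * (v x : ℂ)) m :=
    hu.ofReal.add (hv.ofReal.const_mul _)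
  have hν : ν = m.withDensityᵥ fun x => (u x : ℂ) + I * (v x : ℂ) := by
    ext s hs
    rw [withDensityᵥ_apply hg hs, integral_add hu.ofReal.restrict (hv.ofReal.const_mul _).restrict,
      integral_const_mul, integral_complex_ofReal, integral_complex_ofReal, ← withDensityᵥ_apply hu hs,
      ← withDensityᵥ_apply hv hs, hre', him', hre_ap, him_ap]
    apply Complex.ext <;> simp
  refine ⟨_, hg, hν, ?_⟩
  have hvar := Measure.variation_withDensityᵥ hg
  rw [← hν] at hvar
  have h1 : m.withDensity (fun x => ‖(u x : ℂ) + I * (v x : ℂ)‖ₑ) = m.withDensity fun _ => 1 := by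
    rw [← hvar]; exact withDensity_one.symm
  rw [withDensity_eq_iff hg.1.enorm aemeasurable_const hg.2.ne] at h1
  filter_upwards [h1] with x hx
  have h2 := congrArg ENNReal.toReal hx
  rwa [toReal_enorm, ENNReal.toReal_one] at h2

lemma complexMeasure_integral_eq (ν : ComplexMeasure X) [IsFiniteMeasure ν.variation] {g : X → ℂ}
    (hg : Integrable g ν.variation) (hν : ν = ν.variation.withDensityᵥ g)
    (hg1 : ∀ᵐ x ∂ν.variation, ‖g x‖ = 1) {f : X → ℂ} (hf : Integrable f ν.variation) :
    ν.integral f (ContinuousLinearMap.mul ℝ ℂ) = ∫ x, f x * g x ∂ν.variation := by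
  set m := ν.variation
  have hfg : ∀ {f : X → ℂ}, Integrable f m → Integrable (fun x => f x * g x) m := fun hf =>
    hf.mul_bdd (c := 1) hg.1 (hg1.mono fun x hx => hx.le)
  refine Integrable.induction (μ := m)
    (fun f => ν.integral f (ContinuousLinearMap.mul ℝ ℂ) = ∫ x, f x * g x ∂m) ?_ ?_ ?_ ?_ hf
  · intro c s hs _
    rw [VectorMeasure.integral_eq_setToFun,
      setToFun_indicator_const _ hs (measure_ne_top (ν.variation) s)]
    have e1 : ∀ x, s.indicator (fun _ => c) x * g x = s.indicator (fun x => c * g x) x := fun x => by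
      by_cases hx : x ∈ s <;> simp [hx]
    simp_rw [e1]
    rw [integral_indicator hs, integral_const_mul, ← withDensityᵥ_apply hg hs, ← hν]
    rfl
  · intro f f' _ hf hf' h1 h2
    rw [VectorMeasure.integral_add hf hf', h1, h2, ← integral_add (hfg hf) (hfg hf')]
    refine integral_congr_ae (ae_of_all _ fun x => ?_)
    simp only [Pi.add_apply]; ring
  · refine isClosed_eq VectorMeasure.continuous_integral ?_
    refine LipschitzWith.continuous (K := 1) (LipschitzWith.of_dist_le_mul fun f f' => ?_)
    rw [L1.dist_eq_integral_dist, NNReal.coe_one, one_mul, dist_eq_norm,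
      ← integral_sub (hfg (L1.integrable_coeFn f)) (hfg (L1.integrable_coeFn f'))]
    refine norm_integral_le_of_norm_le ?_ (hg1.mono fun x hx => ?_)
    · have := ((L1.integrable_coeFn f).sub (L1.integrable_coeFn f')).norm
      simpa only [dist_eq_norm, Pi.sub_apply] using this
    · rw [← sub_mul, norm_mul, hx, mul_one, dist_eq_norm]
  · intro f f' hff' _ h
    rw [← VectorMeasure.integral_congr_ae hff', h]
    refine integral_congr_ae (hff'.mono fun x hx => ?_)
    simp only [hx]

end ComplexMeasure

lemma summable_shell (hδ : 1 < δ) : Summable fun m : ℕ => (1 + (m : ℝ)) ^ (-δ) := by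
  have h := (summable_nat_add_iff 1).2 (Real.summable_nat_rpow.2 (show -δ < -1 by linarith))
  refine h.congr fun m => ?_
  rw [add_comm 1]; push_cast; rfl

lemma lintegral_shell_le {m : Measure (Euc d)} (hC : 0 < C) (hδ : 1 < δ) (h : ∀ k : ℕ, m
    {s | (k : ℝ) ≤ ‖s‖ ∧ ‖s‖ < k + 1} ≤ ofReal (C * (1 + (k : ℝ)) ^ (-δ))) : m univ ≤
    ofReal (∑' k : ℕ, C * (1 + (k : ℝ)) ^ (-δ)) := by
  have hcov : (univ : Set (Euc d)) ⊆ ⋃ k : ℕ, {s | (k : ℝ) ≤ ‖s‖ ∧ ‖s‖ < k + 1} := fun s _ =>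
    Set.mem_iUnion.2 ⟨⌊‖s‖⌋₊, Nat.floor_le (norm_nonneg s), Nat.lt_floor_add_one _⟩
  refine (measure_mono hcov).trans ((measure_iUnion_le _).trans ?_)
  rw [ENNReal.ofReal_tsum_of_nonneg (fun k => by positivity) ((summable_shell hδ).mul_left C)]
  exact ENNReal.tsum_le_tsum h

lemma norm_cexp_neg_I_mul_le (s y : Euc d) : ‖𝐞⁻[⟪s, y⟫]‖ ≤ 1 := (norm_cexp_neg_I_mul _).le

lemma continuous_cexp_neg_I_inner (y : Euc d) : Continuous fun s : Euc d => 𝐞⁻[⟪s, y⟫] := by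
  have : Continuous fun s : Euc d => ⟪s, y⟫ := by fun_prop
  exact (continuous_const.mul (continuous_ofReal.comp this)).neg.cexp

lemma ftRep_of_complexMeasure {c : ℂ} {ν : ComplexMeasure (Euc d)} (hB0 : 0 ≤ B) (hB : ν.variation
    univ ≤ ofReal B) (hF : ∀ y, F y = c * ν.integral (fun s => 𝐞⁻[⟪s, y⟫])
    (ContinuousLinearMap.mul ℝ ℂ)) : ∃ m g, FTRep F m g (‖c‖ * B) := by
  have hfin : IsFiniteMeasure ν.variation := ⟨hB.trans_lt ENNReal.ofReal_lt_top⟩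
  obtain ⟨g, hg, hν, hg1⟩ := exists_density ν
  refine ⟨ν.variation, fun s => c * g s, ⟨inferInstance, hg.const_mul c, ?_, fun y => ?_⟩⟩
  · simp only [norm_mul]
    rw [integral_const_mul]
    gcongr
    rw [integral_congr_ae hg1, integral_const, smul_eq_mul, mul_one]
    exact ENNReal.toReal_le_of_le_ofReal hB0 hB
  · rw [hF, complexMeasure_integral_eq ν hg hν hg1, ← integral_const_mul]
    · refine integral_congr_ae (ae_of_all _ fun s => ?_)
      simp only; ring
    · exact (integrable_const (1 : ℝ)).mono' (continuous_cexp_neg_I_inner y).aestronglyMeasurable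
        (ae_of_all _ fun s => norm_cexp_neg_I_mul_le s y)

lemma ftRep_of_fourier (hFc : Continuous F) (hFi : Integrable F) {N : ℝ} (hN : (d : ℝ) < N)
    (hb : ∀ s, ‖∫ r, 𝐞[⟪s, r⟫] * F r‖ ≤ C * (1 + ‖s‖) ^ (-N)) : ∃ m g, FTRep F m g (C * ∫ w : Euc d,
    (1 + ‖(2 * π) • w‖) ^ (-N)) := by
  set G : Euc d → ℂ := fun s => ∫ r, 𝐞[⟪s, r⟫] * F r
  have h2π : (2 * π : ℝ) ≠ 0 := by positivity
  have hinv : ∀ w, FourierTransformInv.fourierInv F w = G ((2 * π) • w) := fun w => by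
    rw [Real.fourierInv_eq']
    refine integral_congr_ae (ae_of_all _ fun r => ?_)
    simp only [smul_eq_mul]
    congr 2
    rw [real_inner_smul_left, real_inner_comm]
    push_cast; ring
  have hint : Integrable fun w : Euc d => (1 + ‖(2 * π) • w‖) ^ (-N) := by
    have h1 : Integrable fun w : Euc d => (1 + ‖w‖) ^ (-N) :=
      integrable_one_add_norm (by simpa using hN)
    exact h1.comp_smul h2π
  have hFinv : FourierTransformInv.fourierInv F = fun w => G ((2 * π) • w) := funext hinv
  have hGc : Continuous fun w => G ((2 * π) • w) := by
    rw [← hFinv]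
    have h3 := VectorFourier.fourierIntegral_continuous Real.continuous_fourierChar
      (L := innerₗ (Euc d)) (by exact continuous_inner) hFi
    have h4 : FourierTransformInv.fourierInv F = fun w => FourierTransform.fourier F (-w) := by
      ext w; rw [Real.fourierInv_eq_fourier_neg]
    rw [h4]
    exact h3.comp continuous_neg
  have hGi : Integrable fun w => G ((2 * π) • w) :=
    (hint.const_mul C).mono' hGc.aestronglyMeasurable (ae_of_all _ fun w => hb _)
  have he : MeasurableEmbedding fun w : Euc d => (2 * π) • w :=
    (Homeomorph.smulOfNeZero _ h2π).measurableEmbedding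
  refine ⟨Measure.map (fun w : Euc d => (2 * π) • w) volume, G, ⟨inferInstance, ?_, ?_, fun y => ?_⟩⟩
  · rw [he.integrable_map_iff]; exact hGi
  · rw [he.integral_map, ← integral_const_mul]
    exact integral_mono hGi.norm (hint.const_mul C) fun w => hb _
  · rw [he.integral_map]
    have h5 : Integrable (FourierTransform.fourier F) := by
      have h6 : FourierTransform.fourier F = fun w => FourierTransformInv.fourierInv F (-w) := by
        ext w; rw [Real.fourierInv_eq_fourier_neg, neg_neg]
      rw [h6, hFinv]
      exact hGi.comp_neg
    have h7 := congrFun (hFc.fourier_fourierInv_eq hFi h5) y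
    rw [← h7, hFinv, Real.fourier_eq']
    refine integral_congr_ae (ae_of_all _ fun w => ?_)
    simp only [smul_eq_mul]
    congr 2
    rw [real_inner_smul_left]
    push_cast; ring

lemma latFourier_apply {ι : Type*} [Finite ι] {a : Lat d → Matrix ι ι ℂ}
    (ha : ∀ p q, Summable fun z => ‖a z p q‖) (θ : Euc d) (p q : ι) :
    latFourier a θ p q = fsum (fun z => a z p q) θ := by
  have hs : Summable fun z : Lat d => 𝐞[z ⋄ θ] • a z :=
    Pi.summable.2 fun p => Pi.summable.2 fun q => summable_cexp_mul (ha p q) θ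
  rw [latFourier, fsum]
  have h1 : (∑' z : Lat d, 𝐞[z ⋄ θ] • a z) p = ∑' z : Lat d, (𝐞[z ⋄ θ] • a z) p := tsum_apply hs
  rw [h1, tsum_apply (Pi.summable.1 hs p)]
  rfl

lemma CondI1.summable (hγ : (d : ℝ) < γ) (h : CondI1 C γ R0) (r : Euc d) (p q : Ix n) : Summable fun
    z => ‖R0 r z p q‖ :=
  Summable.of_nonneg_of_le (fun _ => norm_nonneg _) (fun z => h r z p q)
    ((summable_one_add_norm hγ).mul_left C)

lemma R0hat_apply (hγ : (d : ℝ) < γ) (h : CondI1 C γ R0) (r θ : Euc d) (p q : Ix n) : R0hat R0 r θ p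
    q = fsum (fun z => R0 r z p q) θ :=
  latFourier_apply (h.summable hγ r) θ p q

/-- Under I4', the covariances are superpositions of plane waves in the macroscopic variable. -/
lemma exists_ftRep (hI4 : CondI4 R0) (hI4' : CondI4' R0) : ∃ (M : ℝ) (m : Ix n → Ix n → Euc d →
    Measure (Euc d)) (g : Ix n → Ix n → Euc d → Euc d → ℂ), ∀ p q θ, FTRep (fun y => R0hat R0 y θ p
    q) (m p q θ) (g p q θ) M := by
  suffices ∃ M : ℝ, ∀ p q θ, ∃ m g, FTRep (fun y => R0hat R0 y θ p q) m g M by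
    obtain ⟨M, h⟩ := this
    choose m g h using h
    exact ⟨M, m, g, h⟩
  rcases hI4' with ⟨hi, C, hC, N, hN, hb⟩ | ⟨μ, hμ, C, hC, δ, hδ, hb⟩
  · exact ⟨_, fun p q θ => ftRep_of_fourier (hI4.1 θ p q).continuous (hi θ p q) (by linarith)
      fun s => hb θ s p q⟩
  · have hδ1 : 1 < δ := by
      have : (0 : ℝ) ≤ (d : ℝ) ^ 2 / 2 + 2 * d := by positivity
      linarith
    refine ⟨_, fun p q θ => ftRep_of_complexMeasure (tsum_nonneg fun k => by positivity)
      (lintegral_shell_le hC hδ1 (hb θ p q)) (fun y => hμ y θ p q)⟩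

end

/-- A measurable set that meets every ray from the origin in a null set is null. -/
lemma volume_null_of_rays {S : Set (Euc d)} (hS : MeasurableSet S) (h0 : (0 : Euc d) ∉ S)
    (h : ∀ e : Euc d, volume {u : ℝ | 0 < u ∧ u • e ∈ S} = 0) : volume S = 0 := by
  have hmp := (volume : Measure (Euc d)).measurePreserving_homeomorphUnitSphereProd
  set Φ := homeomorphUnitSphereProd (Euc d) with hΦ
  set T : Set (({0}ᶜ : Set (Euc d))) := (↑) ⁻¹' S with hT
  have hTm : MeasurableSet T := measurable_subtype_coe hS
  have h1 : (volume.comap ((↑) : ({0}ᶜ : Set (Euc d)) → Euc d)) T = volume S := by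
    rw [comap_subtype_coe_apply (measurableSet_singleton _).compl, hT, Subtype.image_preimage_coe]
    congr 1
    ext x
    simp only [Set.mem_inter_iff, Set.mem_compl_iff, Set.mem_singleton_iff, and_iff_right_iff_imp]
    rintro hx rfl
    exact h0 hx
  rw [← h1]
  have h2 : T = Φ ⁻¹' (Φ.symm ⁻¹' T) := by rw [← Set.preimage_comp]; simp
  have hm2 : MeasurableSet (Φ.symm ⁻¹' T) := Φ.symm.measurable hTm
  rw [h2, hmp.measure_preimage hm2.nullMeasurableSet, Measure.measure_prod_null hm2]
  refine .of_forall fun e => ?_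
  refine withDensity_absolutelyContinuous _ _ ?_
  rw [comap_subtype_coe_apply measurableSet_Ioi]
  refine measure_mono_null ?_ (h e)
  rintro _ ⟨u, hu, rfl⟩
  refine ⟨u.2, ?_⟩
  simpa [hT, hΦ] using hu

/-- The zero set of a real-analytic function that vanishes on no open set is null. -/
lemma volume_zero_set_of_analytic {F : Type*} [NormedAddCommGroup F] [NormedSpace ℝ F]
    {f : Euc d → F} (hU : IsOpen U) (hf : AnalyticOnNhd ℝ f U) (hne : ∀ W ⊆ U, IsOpen W → W.Nonempty
    → ∃ x ∈ W, f x ≠ 0) : volume (U ∩ {x | f x = 0}) = 0 := by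
  refine measure_null_of_locally_null _ fun x₀ hx₀ => ?_
  obtain ⟨ρ, hρ, hball⟩ := Metric.isOpen_iff.1 hU x₀ hx₀.1
  obtain ⟨y, hy, hfy⟩ := hne (ball x₀ (ρ / 2))
    ((Metric.ball_subset_ball (by linarith)).trans hball) isOpen_ball
    ⟨x₀, mem_ball_self (by positivity)⟩
  have hsub : ball y (ρ / 2) ⊆ U := by
    refine subset_trans (fun z hz => ?_) hball
    rw [Metric.mem_ball] at *
    linarith [dist_triangle z y x₀]
  refine ⟨ball y (ρ / 2) ∩ {x | f x = 0}, ?_, ?_⟩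
  · exact inter_mem (mem_nhdsWithin_of_mem_nhds (isOpen_ball.mem_nhds (by
      rw [Metric.mem_ball, dist_comm]; exact hy)))
      (mem_of_superset self_mem_nhdsWithin Set.inter_subset_right)
  have hm : MeasurableSet (ball y (ρ / 2) ∩ {x | f x = 0}) := by
    have h1 : IsOpen (ball y (ρ / 2) ∩ f ⁻¹' {0}ᶜ) :=
      (hf.continuousOn.mono hsub).isOpen_inter_preimage isOpen_ball isOpen_compl_singleton
    have h2 : ball y (ρ / 2) ∩ {x | f x = 0} = ball y (ρ / 2) \ (ball y (ρ / 2) ∩ f ⁻¹' {0}ᶜ) := by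
      ext x; simp
    rw [h2]
    exact measurableSet_ball.diff h1.measurableSet
  rw [← measure_preimage_add_right volume y]
  refine volume_null_of_rays (hm.preimage (measurable_add_const y)) (by simpa using fun _ => hfy)
    fun e => ?_
  set W : Set ℝ := {u : ℝ | u • e + y ∈ ball y (ρ / 2)} with hW
  have hWo : IsOpen W := isOpen_ball.preimage (by fun_prop)
  have hWc : IsConnected W := by
    refine ⟨⟨0, by simp [hW, hρ]⟩, Convex.isPreconnected ?_⟩
    have := ((convex_ball y (ρ / 2)).translate_preimage_right y).linear_preimage
      (LinearMap.toSpanSingleton ℝ (Euc d) e)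
    refine Eq.mp (congrArg (Convex ℝ) ?_) this
    ext u
    simp [hW, add_comm]
  have hg : AnalyticOnNhd ℝ (fun u : ℝ => f (u • e + y)) W := fun u hu => by
    refine (hf _ (hsub hu)).comp_of_eq (g := f) (f := fun u : ℝ => u • e + y) ?_ rfl
    exact (analyticAt_id.smul analyticAt_const).add analyticAt_const
  have hz := hg.preimage_zero_mem_codiscreteWithin (x := 0) (by simpa using hfy)
    (by simp [hW, hρ]) hWc
  have hz2 := ae_restrict_le_codiscreteWithin (μ := (volume : Measure ℝ)) hWo.measurableSet hz
  rw [mem_ae_iff, Measure.restrict_apply' hWo.measurableSet] at hz2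
  refine measure_mono_null ?_ hz2
  rintro u ⟨_, hu1, hu2⟩
  exact ⟨by simpa using hu2, hu1⟩

/-- The Fourier series with exponentially decaying coefficients is real-analytic. -/
lemma analyticAt_fsum (hκ : 0 < κ) (ha : ∀ z, ‖a z‖ ≤ C * Real.exp (-κ * ‖toEuc z‖)) (θ0 : Euc d)
    : AnalyticAt ℝ (fsum a) θ0 := by
  set r : ℝ := κ / 2 with hr
  have hr0 : 0 < r := by positivity
  have hsr : Summable fun z : Lat d => ‖a z‖ * Real.exp (r * ‖toEuc z‖) := by
    refine .of_nonneg_of_le (fun z => by positivity) (fun z => ?_)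
      ((summable_exp_mul_one_add_norm (d := d) hr0 0).mul_left C)
    calc ‖a z‖ * Real.exp (r * ‖toEuc z‖)
        ≤ C * Real.exp (-κ * ‖toEuc z‖) * Real.exp (r * ‖toEuc z‖) := by gcongr; exact ha z
      _ = _ := by rw [mul_assoc, ← Real.exp_add, hr]; norm_num; left; ring
  set L : Lat d → Euc d →L[ℝ] ℂ := fun z => I • ofRealCLM.comp (innerSL ℝ (toEuc z)) with hL
  have hLn : ∀ z, ‖L z‖ ≤ ‖toEuc z‖ := fun z => by
    refine ContinuousLinearMap.opNorm_le_bound _ (norm_nonneg _) fun x => ?_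
    simpa [hL] using abs_real_inner_le_norm (toEuc z) x
  set c : Lat d → ℂ := fun z => 𝐞[z ⋄ θ0] * a z with hc
  have hcn : ∀ z, ‖c z‖ = ‖a z‖ := fun z => by simp [hc]
  set P : (m : ℕ) → Lat d → ContinuousMultilinearMap ℝ (fun _ : Fin m => Euc d) ℂ := fun m z =>
    (c z * (m.factorial : ℂ)⁻¹) •
      (ContinuousMultilinearMap.mkPiAlgebraFin ℝ m ℂ).compContinuousLinearMap (fun _ => L z) with hP
  have hPn : ∀ m z, ‖P m z‖ ≤ ‖a z‖ * (‖toEuc z‖ ^ m / m.factorial) := fun m z => by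
    calc ‖P m z‖ ≤ ‖c z * (m.factorial : ℂ)⁻¹‖ * (‖ContinuousMultilinearMap.mkPiAlgebraFin ℝ m ℂ‖ *
          ∏ _i : Fin m, ‖L z‖) := by
          refine (norm_smul_le (c z * (m.factorial : ℂ)⁻¹)
            ((ContinuousMultilinearMap.mkPiAlgebraFin ℝ m ℂ).compContinuousLinearMap
              fun _ => L z)).trans ?_
          gcongr
          exact ContinuousMultilinearMap.norm_compContinuousLinearMap_le _ _
      _ ≤ ‖a z‖ * (m.factorial : ℝ)⁻¹ * (1 * ‖toEuc z‖ ^ m) := by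
          rw [norm_mul, hcn]
          gcongr
          · simp
          · simp
          · rw [Finset.prod_const, Finset.card_univ, Fintype.card_fin]
            gcongr; exact hLn z
      _ = _ := by ring
  have hPr : ∀ m z, ‖P m z‖ * r ^ m ≤ ‖a z‖ * Real.exp (r * ‖toEuc z‖) := fun m z => by
    calc ‖P m z‖ * r ^ m ≤ ‖a z‖ * (‖toEuc z‖ ^ m / m.factorial) * r ^ m := by
          gcongr; exact hPn m z
      _ = ‖a z‖ * ((r * ‖toEuc z‖) ^ m / m.factorial) := by rw [mul_pow]; ring
      _ ≤ _ := by gcongr; exact Real.pow_div_factorial_le_exp _ (by positivity) m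
  have hPns : ∀ m, Summable fun z => ‖P m z‖ := fun m => by
    refine .of_nonneg_of_le (fun _ => norm_nonneg _) (fun z => ?_) (hsr.mul_right ((r ^ m)⁻¹))
    rw [← div_eq_mul_inv, le_div_iff₀ (by positivity)]
    exact hPr m z
  have hPs : ∀ m, Summable (P m) := fun m => (hPns m).of_norm
  set p : FormalMultilinearSeries ℝ (Euc d) ℂ := fun m => ∑' z, P m z with hp
  refine ⟨p, ofReal r, ⟨?_, by simpa using hr0, ?_⟩⟩
  · have := p.le_radius_of_bound (r := r.toNNReal)
      (∑' z : Lat d, ‖a z‖ * Real.exp (r * ‖toEuc z‖)) fun m => ?_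
    · simpa [ofReal] using this
    rw [Real.coe_toNNReal _ hr0.le]
    calc ‖p m‖ * r ^ m ≤ (∑' z, ‖P m z‖) * r ^ m := by
          gcongr; exact norm_tsum_le_tsum_norm (hPns m)
      _ = ∑' z, ‖P m z‖ * r ^ m := tsum_mul_right.symm
      _ ≤ _ := ((hPns m).mul_right _).tsum_le_tsum (hPr m) hsr
  · intro y hy
    have hyr : ‖y‖ < r := by
      rw [Metric.mem_eball, edist_zero_right, ← ofReal_norm] at hy
      exact (ENNReal.ofReal_lt_ofReal_iff hr0).1 hy
    have hterm : ∀ m z, P m z (fun _ => y) =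
        c z * ((m.factorial : ℂ)⁻¹ * (I * (z ⋄ y : ℂ)) ^ m) := fun m z => by
      simp [hP, hL, mul_assoc]
    have hb : ∀ z m, ‖P m z (fun _ => y)‖ ≤ ‖a z‖ * ((r * ‖toEuc z‖) ^ m / m.factorial) :=
      fun z m => by
      rw [hterm, norm_mul, hcn, norm_mul, norm_pow, norm_mul, Complex.norm_I, one_mul]
      gcongr
      rw [div_eq_inv_mul]
      gcongr
      · simp
      · rw [norm_real, mul_comm]
        refine (norm_inner_le_norm _ _).trans ?_
        gcongr
    have hes : ∀ z : Lat d, HasSum (fun m : ℕ => ‖a z‖ * ((r * ‖toEuc z‖) ^ m / m.factorial))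
        (‖a z‖ * Real.exp (r * ‖toEuc z‖)) := fun z => by
      refine .mul_left _ ?_
      rw [Real.exp_eq_exp_ℝ]
      exact NormedSpace.expSeries_div_hasSum_exp _
    have hdom : Summable fun q : Lat d × ℕ => ‖a q.1‖ * ((r * ‖toEuc q.1‖) ^ q.2 / q.2.factorial) := by
      refine (summable_prod_of_nonneg fun q => by positivity).2 ⟨fun z => (hes z).summable, ?_⟩
      exact hsr.congr fun z => ((hes z).tsum_eq).symm
    have hsum : Summable fun q : Lat d × ℕ => P q.2 q.1 (fun _ => y) :=
      Summable.of_norm_bounded hdom fun q => hb q.1 q.2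
    have h1 : ∀ z, HasSum (fun m => P m z (fun _ => y)) (𝐞[z ⋄ (θ0 + y)] * a z) := fun z => by
      have he := (NormedSpace.expSeries_div_hasSum_exp (𝔸 := ℂ) (I * (z ⋄ y : ℂ))).mul_left (c z)
      rw [← Complex.exp_eq_exp_ℂ] at he
      have e1 : (fun m => P m z (fun _ => y)) = fun m : ℕ =>
          c z * ((I * (z ⋄ y : ℂ)) ^ m / m.factorial) := by
        funext m; rw [hterm]; ring
      have e2 : 𝐞[z ⋄ (θ0 + y)] * a z = c z * 𝐞[z ⋄ y] := by
        simp only [hc]; rw [inner_add_right]; push_cast; rw [mul_add, exp_add]; ring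
      rw [e1, e2]
      exact he
    have h2 : ∀ m, HasSum (fun z => P m z (fun _ => y)) (p m (fun _ => y)) := fun m =>
      ContinuousMultilinearMap.hasSum_eval (hPs m).hasSum _
    have h3 := hsum.hasSum.prod_fiberwise h1
    have h4 := ((Equiv.prodComm ℕ (Lat d)).hasSum_iff.2 hsum.hasSum).prod_fiberwise h2
    have h5 : fsum a (θ0 + y) = ∑' q : Lat d × ℕ, P q.2 q.1 (fun _ => y) := h3.tsum_eq
    rw [h5]
    exact h4

section

/-! ### Functional calculus of a Hermitian matrix -/

section FunctionalCalculus

variable {n : ℕ} {B : Mat n ℂ} (hB : B.IsHermitian)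

/-- `f(B)` for a Hermitian matrix `B`. -/
def fc (f : ℝ → ℂ) : Mat n ℂ :=
  (hB.eigenvectorUnitary : Mat n ℂ) * diagonal (fun l => f (hB.eigenvalues l)) *
    star (hB.eigenvectorUnitary : Mat n ℂ)

lemma fc_mul (f g : ℝ → ℂ) : fc hB f * fc hB g = fc hB (fun x => f x * g x) := by
  unfold fc
  set U := (hB.eigenvectorUnitary : Mat n ℂ)
  have hU : star U * U = 1 := Unitary.coe_star_mul_self hB.eigenvectorUnitary
  calc _ = U * diagonal (fun l => f (hB.eigenvalues l)) * (star U * U) *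
        diagonal (fun l => g (hB.eigenvalues l)) * star U := by simp only [mul_assoc]
    _ = _ := by rw [hU, mul_one, mul_assoc U, diagonal_mul_diagonal]

lemma fc_one : fc hB (fun _ => 1) = 1 := by
  unfold fc
  rw [diagonal_one, mul_one]
  exact Unitary.coe_mul_star_self hB.eigenvectorUnitary

lemma fc_id : fc hB (fun x => (x : ℂ)) = B := by
  have := hB.spectral_theorem
  rw [Unitary.conjStarAlgAut_apply] at this
  exact this.symm

lemma fc_congr {f g : ℝ → ℂ} (h : ∀ l, f (hB.eigenvalues l) = g (hB.eigenvalues l)) :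
    fc hB f = fc hB g := by
  unfold fc; simp only [h]

lemma fc_smul (c : ℂ) (f : ℝ → ℂ) : fc hB (fun x => c * f x) = c • fc hB f := by
  have : diagonal (fun l => c * f (hB.eigenvalues l)) =
      c • diagonal (fun l => f (hB.eigenvalues l)) := by
    rw [← diagonal_smul]; rfl
  unfold fc; rw [this, Matrix.mul_smul, Matrix.smul_mul]

lemma fc_add (f g : ℝ → ℂ) : fc hB (fun x => f x + g x) = fc hB f + fc hB g := by
  unfold fc
  rw [← Matrix.add_mul, ← Matrix.mul_add, diagonal_add]

lemma fc_zero : fc hB (fun _ => 0) = 0 := by simpa using fc_smul hB 0 (fun _ => 0)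

lemma fc_sum {ι : Type*} (s : Finset ι) (f : ι → ℝ → ℂ) :
    fc hB (fun x => ∑ i ∈ s, f i x) = ∑ i ∈ s, fc hB (f i) := by
  classical
  induction s using Finset.induction_on with
  | empty => simpa using fc_zero hB
  | insert a s ha ih => simp only [Finset.sum_insert ha]; rw [fc_add, ih]

lemma fc_pow (f : ℝ → ℂ) (k : ℕ) : fc hB f ^ k = fc hB (fun x => f x ^ k) := by
  induction k with
  | zero => simpa using (fc_one hB).symm
  | succ k ih => rw [pow_succ, ih, fc_mul]; rfl

lemma fc_conjTranspose (f : ℝ → ℂ) : (fc hB f)ᴴ = fc hB (fun x => star (f x)) := by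
  unfold fc
  rw [conjTranspose_mul, conjTranspose_mul, diagonal_conjTranspose, ← star_eq_conjTranspose,
    star_star, ← star_eq_conjTranspose, mul_assoc]
  rfl

lemma trace_fc (f : ℝ → ℂ) : (fc hB f).trace = ∑ l, f (hB.eigenvalues l) := by
  unfold fc
  rw [Matrix.trace_mul_comm, ← mul_assoc, Unitary.coe_star_mul_self, one_mul, trace_diagonal]

lemma det_fc (f : ℝ → ℂ) : (fc hB f).det = ∏ l, f (hB.eigenvalues l) := by
  unfold fc
  rw [Matrix.det_mul_comm, ← mul_assoc, Unitary.coe_star_mul_self, one_mul, det_diagonal]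

/-- The entries of `f(B)` are bounded by `max |f|` over the spectrum. -/
lemma norm_fc_apply_le (f : ℝ → ℂ) (hM : 0 ≤ M) (hf : ∀ l, ‖f (hB.eigenvalues l)‖ ≤ M)
    (i j : Fin n) : ‖fc hB f i j‖ ≤ n * M := by
  have hU : ∀ i j, ‖(hB.eigenvectorUnitary : Mat n ℂ) i j‖ ≤ 1 :=
    fun i j => entry_norm_bound_of_unitary (SetLike.coe_mem _) i j
  unfold fc
  rw [mul_apply]
  refine (norm_sum_le _ _).trans ?_
  have : ∀ l : Fin n, ‖((hB.eigenvectorUnitary : Mat n ℂ) *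
      diagonal (fun l => f (hB.eigenvalues l))) i l *
      (star (hB.eigenvectorUnitary : Mat n ℂ)) l j‖ ≤ M := fun l => by
    rw [mul_diagonal, norm_mul, norm_mul, star_apply, norm_star]
    calc _ ≤ 1 * M * 1 := by
          gcongr
          · exact hU _ _
          · exact hf l
          · exact hU _ _
      _ = M := by ring
  calc _ ≤ ∑ _l : Fin n, M := sum_le_sum fun l _ => this l
    _ = n * M := by simp

lemma hasEigenvalue_iff_mem_range (w : ℝ) :
    Module.End.HasEigenvalue (Matrix.toEuclideanLin B) (w : ℂ) ↔ w ∈ Set.range hB.eigenvalues := by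
  rw [Module.End.hasEigenvalue_iff_mem_spectrum, spectrum_toLpLin, hB.spectrum_eq_image_range]
  constructor
  · rintro ⟨x, hx, hxw⟩
    have : x = w := by simpa using hxw
    rwa [← this]
  · intro h
    exact ⟨w, h, rfl⟩

/-- The orthogonal projection onto an eigenspace through the functional calculus. -/
lemma starProjection_eigenspace (w : ℝ) : Matrix.toEuclideanLin.symm
      ((Module.End.eigenspace (Matrix.toEuclideanLin B) (w : ℂ)).starProjection).toLinearMap =
      fc hB (fun x => if x = w then 1 else 0) := by
  set P := fc hB (fun x => if x = w then 1 else 0) with hP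
  have hBP : B * P = (w : ℂ) • P := by
    conv_lhs => rw [← fc_id hB]
    rw [hP, fc_mul, ← fc_smul]
    refine fc_congr hB fun l => ?_
    split_ifs with h <;> simp [h]
  have hPh : Pᴴ = P := by
    rw [hP, fc_conjTranspose]
    refine fc_congr hB fun l => ?_
    split_ifs <;> simp
  set g : ℝ → ℂ := fun x => if x = w then 0 else ((x : ℂ) - w)⁻¹ with hg
  have hg1 : fc hB g * (B - (w : ℂ) • 1) = 1 - P := by
    have h1 : B - (w : ℂ) • (1 : Mat n ℂ) = fc hB (fun x => (x : ℂ) + (-(w : ℂ)) * 1) := by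
      rw [fc_add, fc_smul, fc_id, fc_one, neg_smul, sub_eq_add_neg]
    have h2 : (1 : Mat n ℂ) - P = fc hB (fun x => 1 + (-1) * (if x = w then 1 else 0)) := by
      rw [fc_add, fc_smul, fc_one, neg_one_smul, sub_eq_add_neg]
    rw [h1, h2, fc_mul]
    refine fc_congr hB fun l => ?_
    simp only [hg]
    split_ifs with h
    · simp
    · have : (hB.eigenvalues l : ℂ) - w ≠ 0 := sub_ne_zero.2 (by exact_mod_cast h)
      rw [mul_one, ← sub_eq_add_neg, inv_mul_cancel₀ this]; simp
  rw [LinearEquiv.symm_apply_eq]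
  refine LinearMap.ext fun v => ?_
  refine Submodule.eq_starProjection_of_mem_of_inner_eq_zero
    (K := Module.End.eigenspace (Matrix.toEuclideanLin B) (w : ℂ)) (u := v)
    (v := Matrix.toEuclideanLin P v) ?_ fun e he => ?_
  · rw [Module.End.mem_eigenspace_iff]
    apply (WithLp.equiv 2 _).injective
    change B *ᵥ (P *ᵥ v.ofLp) = (w : ℂ) • (P *ᵥ v.ofLp)
    rw [mulVec_mulVec, hBP, smul_mulVec]
  · rw [Module.End.mem_eigenspace_iff] at he
    have he' : B *ᵥ e.ofLp = (w : ℂ) • e.ofLp := congrArg WithLp.ofLp he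
    have hPe : P *ᵥ e.ofLp = e.ofLp := by
      have : (1 - P) *ᵥ e.ofLp = 0 := by
        rw [← hg1, ← mulVec_mulVec, sub_mulVec, he', smul_mulVec, one_mulVec, sub_self, mulVec_zero]
      rw [sub_mulVec, one_mulVec, sub_eq_zero] at this
      exact this.symm
    rw [EuclideanSpace.inner_eq_star_dotProduct]
    change e.ofLp ⬝ᵥ star (v.ofLp - P *ᵥ v.ofLp) = 0
    rw [star_sub, star_mulVec, hPh, dotProduct_sub, dotProduct_comm _ (star v.ofLp ᵥ* P),
      ← dotProduct_mulVec, hPe, dotProduct_comm, sub_self]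

end FunctionalCalculus

/-! ### The bands at a given point -/

section Bands

/-- The standing assumptions on the interaction matrix. -/
class Stable {d n : ℕ} (V : Lat d → Mat n ℝ) : Prop where
  e1 : CondE1 V
  e3 : CondE3 V
  e4 : CondE4 V
  e5 : CondE5 V
  e6 : CondE6 V

open scoped Matrix.Norms.L2Operator MatrixOrder ComplexOrder in
lemma posSemidef_Omega (θ : Euc d) :
    (Omega V θ).IsHermitian ∧ ∀ h : (Omega V θ).IsHermitian, ∀ l, 0 ≤ h.eigenvalues l := by
  have h : (Omega V θ).PosSemidef := Matrix.nonneg_iff_posSemidef.1 (CFC.sqrt_nonneg (Vhat V θ))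
  exact ⟨h.isHermitian, fun h' l => h.eigenvalues_nonneg l⟩

lemma isHermitian_Omega (θ : Euc d) : (Omega V θ).IsHermitian := (posSemidef_Omega θ).1

/-- The eigenvalues of `Ω(θ)`, with multiplicities. -/
abbrev eval (V : Lat d → Mat n ℝ) (θ : Euc d) : Fin n → ℝ :=
  (isHermitian_Omega (V := V) θ).eigenvalues

lemma eval_nonneg (θ : Euc d) (l : Fin n) : 0 ≤ eval V θ l := (posSemidef_Omega θ).2 _ l

open scoped Matrix.Norms.L2Operator MatrixOrder in
lemma Omega_mul_self [Stable V] (θ : Euc d) : Omega V θ * Omega V θ = Vhat V θ :=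
  CFC.sqrt_mul_sqrt_self _ (Matrix.nonneg_iff_posSemidef.2 (Stable.e3 θ))

lemma Vhat_eq_fc [Stable V] (θ : Euc d) :
    Vhat V θ = fc (isHermitian_Omega (V := V) θ) (fun x => (x : ℂ) ^ 2) := by
  rw [← Omega_mul_self, ← fc_pow, fc_id, pow_two]

lemma eigs_eq_range (θ : Euc d) : eigs V θ = Set.range (eval V θ) := by
  ext w
  exact hasEigenvalue_iff_mem_range (isHermitian_Omega θ) w

lemma finite_eigs (θ : Euc d) : (eigs V θ).Finite := by
  rw [eigs_eq_range]; exact Set.finite_range _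

lemma ncard_eigs_le (θ : Euc d) : (eigs V θ).ncard ≤ n := by
  rw [eigs_eq_range, ← Set.image_univ]
  refine (Set.ncard_image_le Set.finite_univ).trans ?_
  simp [Set.ncard_univ]

lemma ncard_eigs_le_numBands (θ : Euc d) : (eigs V θ).ncard ≤ numBands V :=
  le_csSup ⟨n, by rintro _ ⟨θ, rfl⟩; exact ncard_eigs_le θ⟩ ⟨θ, rfl⟩

lemma exists_mem_regularSet : ∃ θ, θ ∈ regularSet V := by
  obtain ⟨θ, h⟩ := Nat.sSup_mem (s := Set.range fun θ : Euc d => (eigs V θ).ncard)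
    (Set.range_nonempty _) ⟨n, by rintro _ ⟨θ, rfl⟩; exact ncard_eigs_le θ⟩
  exact ⟨θ, h⟩

/-- The sorted list of the distinct eigenvalues. -/
lemma om_enum (θ : Euc d) : StrictMono (fun σ : Fin (eigs V θ).ncard => om V σ θ) ∧
      Set.range (fun σ : Fin (eigs V θ).ncard => om V σ θ) = eigs V θ := by
  classical
  set E : Finset ℝ := (finite_eigs (V := V) θ).toFinset with hE
  have hcoe : (E : Set ℝ) = eigs V θ := Set.Finite.coe_toFinset _
  have hcard : E.card = (eigs V θ).ncard := (Set.ncard_eq_toFinset_card _ _).symm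
  set e := E.orderEmbOfFin hcard with he
  have hrange : Set.range e = eigs V θ := by rw [he, Finset.range_orderEmbOfFin, hcoe]
  have hcount : ∀ σ, (eigs V θ ∩ Set.Iio (e σ)).ncard = σ := fun σ => by
    have : eigs V θ ∩ Set.Iio (e σ) = e '' Set.Iio σ := by
      ext w
      rw [Set.mem_inter_iff, ← Set.ext_iff.1 hrange w]
      constructor
      · rintro ⟨⟨σ', rfl⟩, h⟩
        exact ⟨σ', e.lt_iff_lt.1 h, rfl⟩
      · rintro ⟨σ', h, rfl⟩
        exact ⟨⟨σ', rfl⟩, e.lt_iff_lt.2 h⟩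
    rw [this, Set.ncard_image_of_injective _ e.injective, ← Finset.coe_Iio, Set.ncard_coe_finset,
      Fin.card_Iio]
  have hom : (fun σ : Fin (eigs V θ).ncard => om V σ θ) = e := by
    funext σ
    have : {w | w ∈ eigs V θ ∧ (eigs V θ ∩ Set.Iio w).ncard = σ} = {e σ} := by
      ext w
      constructor
      · rintro ⟨hw, hc⟩
        obtain ⟨σ', rfl⟩ := (Set.ext_iff.1 hrange w).2 hw
        rw [hcount] at hc
        rw [Set.mem_singleton_iff, Fin.ext hc]
      · rintro rfl
        exact ⟨(Set.ext_iff.1 hrange _).1 ⟨σ, rfl⟩, hcount σ⟩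
    rw [om, this, csInf_singleton]
  rw [hom]
  exact ⟨e.strictMono, hrange⟩

lemma om_lt_om (hθ : θ ∈ regularSet V) (h : σ < σ') (h' : σ' < numBands V) : om V σ θ < om V σ' θ
    := by
  have hθ' : (eigs V θ).ncard = numBands V := hθ
  rw [← hθ'] at h'
  exact (om_enum (V := V) θ).1 (show (⟨σ, h.trans h'⟩ : Fin (eigs V θ).ncard) < ⟨σ', h'⟩ from h)

lemma om_injOn (hθ : θ ∈ regularSet V) (h : σ < numBands V) (h' : σ' < numBands V) (heq : om V σ
    θ = om V σ' θ) : σ = σ' := by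
  rcases lt_trichotomy σ σ' with hl | hl | hl
  · exact absurd heq (om_lt_om hθ hl h').ne
  · exact hl
  · exact absurd heq (om_lt_om hθ hl h).ne'

lemma om_mem_eigs (hθ : θ ∈ regularSet V) (h : σ < numBands V) : om V σ θ ∈ eigs V θ := by
  have hθ' : (eigs V θ).ncard = numBands V := hθ
  rw [← hθ'] at h
  rw [← (om_enum (V := V) θ).2]
  exact ⟨⟨σ, h⟩, rfl⟩

lemma exists_eval_eq_om (hθ : θ ∈ regularSet V) (h : σ < numBands V) : ∃ l, eval V θ l = om V σ θ
    := by
  have := om_mem_eigs hθ h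
  rwa [eigs_eq_range] at this

lemma exists_om_eq_eval (hθ : θ ∈ regularSet V) (l : Fin n) : ∃ σ < numBands V, om V σ θ = eval V
    θ l := by
  have hθ' : (eigs V θ).ncard = numBands V := hθ
  have : eval V θ l ∈ eigs V θ := by rw [eigs_eq_range]; exact ⟨l, rfl⟩
  rw [← (om_enum (V := V) θ).2] at this
  obtain ⟨σ, h⟩ := this
  exact ⟨σ, hθ' ▸ σ.2, h⟩

lemma om_nonneg (hθ : θ ∈ regularSet V) (h : σ < numBands V) : 0 ≤ om V σ θ := by
  obtain ⟨l, hl⟩ := exists_eval_eq_om hθ h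
  rw [← hl]; exact eval_nonneg θ l

lemma eval_pos [Stable V] (hdet : (Vhat V θ).det ≠ 0) (l : Fin n) : 0 < eval V θ l := by
  refine lt_of_le_of_ne (eval_nonneg θ l) fun h => hdet ?_
  rw [Vhat_eq_fc, det_fc]
  refine prod_eq_zero (mem_univ l) ?_
  rw [show (isHermitian_Omega (V := V) θ).eigenvalues l = 0 from h.symm]
  simp

lemma om_pos [Stable V] (hθ : θ ∈ regularSet V) (hdet : (Vhat V θ).det ≠ 0) (h : σ < numBands V) :
    0 < om V σ θ := by
  obtain ⟨l, hl⟩ := exists_eval_eq_om hθ h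
  rw [← hl]; exact eval_pos hdet l

lemma specProj_eq_fc (σ : ℕ) (θ : Euc d) :
    specProj V σ θ = fc (isHermitian_Omega (V := V) θ) (fun x => if x = om V σ θ then 1 else 0) :=
  starProjection_eigenspace (isHermitian_Omega θ) _

lemma specProj_conjTranspose (σ : ℕ) (θ : Euc d) : (specProj V σ θ)ᴴ = specProj V σ θ := by
  rw [specProj_eq_fc, fc_conjTranspose]
  refine fc_congr _ fun l => ?_
  split_ifs <;> simp

lemma Vhat_mul_specProj [Stable V] (σ : ℕ) (θ : Euc d) :
    Vhat V θ * specProj V σ θ = ((om V σ θ : ℝ) : ℂ) ^ 2 • specProj V σ θ := by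
  rw [specProj_eq_fc, Vhat_eq_fc, fc_mul, ← fc_smul]
  refine fc_congr _ fun l => ?_
  split_ifs with h
  · rw [h]
  · simp

lemma sum_specProj (hθ : θ ∈ regularSet V) : ∑ σ ∈ Finset.range (numBands V), specProj V σ θ = 1
    := by
  simp_rw [specProj_eq_fc]
  rw [← fc_sum, ← fc_one (isHermitian_Omega (V := V) θ)]
  refine fc_congr _ fun l => ?_
  obtain ⟨σ, hσ, h⟩ := exists_om_eq_eval hθ l
  rw [sum_eq_single σ]
  · rw [if_pos h.symm]
  · intro σ' hσ' hne
    rw [if_neg]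
    intro h'
    exact hne (om_injOn hθ (mem_range.1 hσ') hσ (h'.symm.trans h.symm))
  · intro h'; exact absurd (mem_range.2 hσ) h'

lemma norm_specProj_apply_le (σ : ℕ) (θ : Euc d) (i j : Fin n) : ‖specProj V σ θ i j‖ ≤ n := by
  rw [specProj_eq_fc]
  simpa using norm_fc_apply_le (isHermitian_Omega (V := V) θ)
    (fun x => if x = om V σ θ then 1 else 0) zero_le_one
    (fun l => by split_ifs <;> simp) i j

/-- `Π_σ` as a Lagrange polynomial in `V̂`. -/
lemma specProj_eq_lagrange [Stable V] (hθ : θ ∈ regularSet V) (hσ : σ < numBands V) : specProj V σ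
    θ = (((Finset.range (numBands V)).erase σ).toList.map fun σ' =>
    (((om V σ θ ^ 2 - om V σ' θ ^ 2 : ℝ) : ℂ)⁻¹ • (Vhat V θ - ((om V σ' θ ^ 2 : ℝ) : ℂ) • 1))).prod
    := by
  set B := isHermitian_Omega (V := V) θ
  have h1 : ∀ L : List ℕ, (L.map fun σ' =>
      (((om V σ θ ^ 2 - om V σ' θ ^ 2 : ℝ) : ℂ)⁻¹ •
        (Vhat V θ - ((om V σ' θ ^ 2 : ℝ) : ℂ) • 1))).prod =
      fc B (fun x => (L.map fun σ' => ((om V σ θ ^ 2 - om V σ' θ ^ 2 : ℝ) : ℂ)⁻¹ *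
        ((x : ℂ) ^ 2 + (-((om V σ' θ ^ 2 : ℝ) : ℂ)) * 1)).prod) := fun L => by
    induction L with
    | nil => simpa using (fc_one B).symm
    | cons σ' L ih =>
      simp only [List.map_cons, List.prod_cons]
      rw [ih, ← fc_mul, fc_smul, fc_add, fc_smul, fc_one, ← Vhat_eq_fc, neg_smul,
        sub_eq_add_neg (Vhat V θ)]
  rw [h1, specProj_eq_fc]
  refine fc_congr _ fun l => ?_
  obtain ⟨τ, hτ, h⟩ := exists_om_eq_eval hθ l
  rw [← List.prod_toFinset _ (Finset.nodup_toList _), Finset.toList_toFinset]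
  change (if eval V θ l = om V σ θ then (1 : ℂ) else 0) = _
  rw [← h]
  by_cases hs : τ = σ
  · subst hs
    rw [if_pos rfl, eq_comm]
    refine Finset.prod_eq_one fun σ' hσ' => ?_
    obtain ⟨hne, hr⟩ := Finset.mem_erase.1 hσ'
    have h2 : om V τ θ ^ 2 - om V σ' θ ^ 2 ≠ 0 := by
      rw [sub_ne_zero]
      intro h3
      have h4 := (pow_left_inj₀ (om_nonneg hθ hσ) (om_nonneg hθ (mem_range.1 hr)) two_ne_zero).1 h3
      exact hne (om_injOn hθ hσ (mem_range.1 hr) h4).symm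
    have h3 : ((om V τ θ ^ 2 - om V σ' θ ^ 2 : ℝ) : ℂ) ≠ 0 := by exact_mod_cast h2
    rw [mul_one, ← sub_eq_add_neg]
    have h4 : ((om V τ θ : ℝ) : ℂ) ^ 2 - ((om V σ' θ ^ 2 : ℝ) : ℂ) =
      ((om V τ θ ^ 2 - om V σ' θ ^ 2 : ℝ) : ℂ) := by push_cast; ring
    rw [show B.eigenvalues l = om V τ θ from h.symm, h4, inv_mul_cancel₀ h3]
  · rw [if_neg fun h' => hs (om_injOn hθ hτ hσ h'), eq_comm]
    refine prod_eq_zero (i := τ) (Finset.mem_erase.2 ⟨hs, mem_range.2 hτ⟩) ?_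
    rw [show B.eigenvalues l = om V τ θ from h.symm]
    push_cast; ring

end Bands

end

section

variable {m : ℕ}

section Analytic

variable {E : Type*} [NormedAddCommGroup E] [NormedSpace ℝ E] {𝕂 : Type*} [NormedField 𝕂]
  [NormedAlgebra ℝ 𝕂]

lemma analyticAt_det {A : E → Mat m 𝕂} {x : E} (h : ∀ i j, AnalyticAt ℝ (fun y => A y i j) x) :
    AnalyticAt ℝ (fun y => (A y).det) x := by
  simp only [det_apply]
  refine Finset.analyticAt_fun_sum _ fun σ _ => ?_
  have h1 : AnalyticAt ℝ (fun y => ∏ i, A y (σ i) i) x :=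
    Finset.analyticAt_fun_prod _ fun i _ => h _ _
  rcases Int.units_eq_one_or (Equiv.Perm.sign σ) with hs | hs
  · simpa [hs] using h1
  · have h2 := h1.neg
    simp only [hs, Units.neg_smul, one_smul]
    exact h2

lemma analyticAt_matrix_pow {A : E → Mat m 𝕂} {x : E} (h : ∀ i j, AnalyticAt ℝ (fun y => A y i j)
    x) (k : ℕ) (i j : Fin m) : AnalyticAt ℝ (fun y => (A y ^ k) i j) x := by
  induction k generalizing i j with
  | zero => simpa using analyticAt_const
  | succ k ih =>
    simp only [pow_succ, mul_apply]
    exact Finset.analyticAt_fun_sum _ fun l _ => (ih i l).mul (h l j)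

lemma analyticAt_list_prod {L : List ℕ} {A : ℕ → E → Mat m 𝕂} {x : E} (h : ∀ σ ∈ L, ∀ i j,
    AnalyticAt ℝ (fun y => A σ y i j) x) (i j : Fin m) : AnalyticAt ℝ (fun y => (L.map fun σ => A σ
    y).prod i j) x := by
  induction L generalizing i j with
  | nil => simpa using analyticAt_const
  | cons σ L ih =>
    simp only [List.map_cons, List.prod_cons, mul_apply]
    exact Finset.analyticAt_fun_sum _ fun l _ => (h σ (by simp) i l).mul
      (ih (fun σ' h' => h σ' (by simp [h'])) l j)

end Analytic

lemma CondE1.exists_bound (hE1 : CondE1 V) : ∃ C > 0, ∃ κ > 0, ∀ z k l,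
    ‖((V z k l : ℝ) : ℂ)‖ ≤ C * Real.exp (-κ * ‖toEuc z‖) := by
  obtain ⟨C, hC, κ, hκ, h⟩ := hE1
  exact ⟨C, hC, κ, hκ, fun z k l => by simpa using h z k l⟩

lemma CondE1.summable_mul (hE1 : CondE1 V) (m : ℕ) (k l : Fin n) :
    Summable fun z => ‖((V z k l : ℝ) : ℂ)‖ * (1 + ‖toEuc z‖) ^ m := by
  obtain ⟨C, hC, κ, hκ, h⟩ := hE1.exists_bound
  refine .of_nonneg_of_le (fun z => by positivity) (fun z => ?_)
    ((summable_exp_mul_one_add_norm (d := d) hκ m).mul_left C)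
  calc _ ≤ C * Real.exp (-κ * ‖toEuc z‖) * (1 + ‖toEuc z‖) ^ m := by gcongr; exact h z k l
    _ = _ := by simp [mul_assoc]

lemma CondE1.summable (hE1 : CondE1 V) (k l : Fin n) :
    Summable fun z => ‖((V z k l : ℝ) : ℂ)‖ := by
  simpa using hE1.summable_mul 0 k l

lemma Vhat_apply [Stable V] (θ : Euc d) (k l : Fin n) :
    Vhat V θ k l = fsum (fun z => ((V z k l : ℝ) : ℂ)) θ := by
  have := latFourier_apply (a := fun z => (V z).map Complex.ofReal) (θ := θ) (p := k) (q := l)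
    (fun p q => Stable.e1.summable p q)
  exact this

lemma analyticAt_Vhat [Stable V] (θ : Euc d) (k l : Fin n) :
    AnalyticAt ℝ (fun θ => Vhat V θ k l) θ := by
  obtain ⟨C, hC, κ, hκ, h⟩ := (Stable.e1 (V := V)).exists_bound
  have h1 := analyticAt_fsum (a := fun z => ((V z k l : ℝ) : ℂ)) hκ (fun z => h z k l) θ
  refine h1.congr (.of_forall fun θ => (Vhat_apply θ k l).symm)

/-! ### The number of distinct eigenvalues and the Gram determinant -/

/-- The Gram matrix `(tr V̂^{i+j})_{i,j < s}`. -/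
def gram (V : Lat d → Mat n ℝ) (θ : Euc d) : Matrix (Fin (numBands V)) (Fin (numBands V)) ℝ :=
  Matrix.of fun i j => ((Vhat V θ ^ ((i : ℕ) + j)).trace).re

lemma trace_Vhat_pow [Stable V] (θ : Euc d) (k : ℕ) :
    ((Vhat V θ ^ k).trace).re = ∑ l, (eval V θ l ^ 2) ^ k := by
  rw [Vhat_eq_fc, fc_pow, trace_fc]
  rw [← Complex.ofReal_re (∑ l, (eval V θ l ^ 2) ^ k)]
  push_cast
  rfl

/-- The rectangular Vandermonde matrix of the eigenvalues of `V̂`. -/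
def vander (V : Lat d → Mat n ℝ) (θ : Euc d) : Matrix (Fin n) (Fin (numBands V)) ℝ :=
  Matrix.of fun l i => (eval V θ l ^ 2) ^ (i : ℕ)

lemma gram_eq [Stable V] (θ : Euc d) : gram V θ = (vander V θ)ᵀ * vander V θ := by
  ext i j
  simp only [gram, of_apply]
  rw [trace_Vhat_pow]
  simp only [vander, of_apply, mul_apply, transpose_apply, pow_add]

lemma analyticAt_trace_pow [Stable V] (θ : Euc d) (k : ℕ) :
    AnalyticAt ℝ (fun θ => ((Vhat V θ ^ k).trace).re) θ := by
  have h : AnalyticAt ℝ (fun θ => (Vhat V θ ^ k).trace) θ := by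
    simp only [Matrix.trace, diag_apply]
    exact Finset.analyticAt_fun_sum _ fun i _ => analyticAt_matrix_pow (analyticAt_Vhat θ) k i i
  exact (Complex.reCLM.analyticAt _).comp h

lemma analyticAt_det_gram [Stable V] (θ : Euc d) : AnalyticAt ℝ (fun θ => (gram V θ).det) θ :=
  analyticAt_det fun _ _ => analyticAt_trace_pow θ _

lemma ncard_sq_eval (θ : Euc d) :
    ((Finset.univ.image fun l => eval V θ l ^ 2 : Finset ℝ)).card = (eigs V θ).ncard := by
  classical
  have h1 : eigs V θ = ((Finset.univ.image (eval V θ) : Finset ℝ) : Set ℝ) := by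
    rw [eigs_eq_range]; simp
  rw [h1, Set.ncard_coe_finset]
  have h2 : (Finset.univ.image fun l => eval V θ l ^ 2) =
      (Finset.univ.image (eval V θ)).image (fun x => x ^ 2) := by
    rw [Finset.image_image]; rfl
  rw [h2]
  refine Finset.card_image_of_injOn fun x hx y hy hxy => ?_
  simp only [Finset.coe_image, Finset.coe_univ, Set.image_univ, Set.mem_range] at hx hy
  obtain ⟨l, rfl⟩ := hx
  obtain ⟨l', rfl⟩ := hy
  exact (pow_left_inj₀ (eval_nonneg θ l) (eval_nonneg θ l') two_ne_zero).1 hxy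

open Polynomial in
lemma det_gram_ne_zero_iff [Stable V] (θ : Euc d) : (gram V θ).det ≠ 0 ↔ θ ∈ regularSet V := by
  classical
  set S : Finset ℝ := Finset.univ.image fun l => eval V θ l ^ 2 with hS
  have hcard : S.card = (eigs V θ).ncard := ncard_sq_eval θ
  have hker : ∀ v : Fin (numBands V) → ℝ, gram V θ *ᵥ v = 0 ↔
      ∀ x ∈ S, ∑ i : Fin (numBands V), v i * x ^ (i : ℕ) = 0 := fun v => by
    have h1 : gram V θ *ᵥ v = 0 ↔ vander V θ *ᵥ v = 0 := by
      rw [gram_eq]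
      rw [← Matrix.mulVecLin_apply, ← LinearMap.mem_ker, Matrix.ker_mulVecLin_transpose_mul_self,
        LinearMap.mem_ker, Matrix.mulVecLin_apply]
    rw [h1, funext_iff]
    constructor
    · intro h x hx
      obtain ⟨l, -, rfl⟩ := Finset.mem_image.1 hx
      have := h l
      simp only [mulVec, dotProduct, vander, of_apply, Pi.zero_apply] at this
      rw [← this]
      exact sum_congr rfl fun i _ => mul_comm _ _
    · intro h l
      have := h _ (Finset.mem_image.2 ⟨l, mem_univ _, rfl⟩)
      simp only [mulVec, dotProduct, vander, of_apply, Pi.zero_apply]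
      rw [← this]
      exact sum_congr rfl fun i _ => mul_comm _ _
  have hpoly : ∀ v : Fin (numBands V) → ℝ, ∀ x : ℝ,
      (∑ i : Fin (numBands V), C (v i) * X ^ (i : ℕ) : ℝ[X]).eval x =
        ∑ i : Fin (numBands V), v i * x ^ (i : ℕ) := fun v x => by
    simp [eval_finsetSum]
  change _ ↔ (eigs V θ).ncard = numBands V
  rw [← hcard]
  constructor
  · intro hdet
    by_contra hne
    have hlt : S.card < numBands V := lt_of_le_of_ne (hcard ▸ ncard_eigs_le_numBands θ) hne
    set p : ℝ[X] := ∏ x ∈ S, (X - C x) with hp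
    have hpm : p.Monic := monic_prod_of_monic _ _ fun x _ => monic_X_sub_C x
    have hdeg : p.natDegree = S.card := by rw [hp, natDegree_prod_of_monic _ _ fun x _ => monic_X_sub_C x]; simp
    have hv : gram V θ *ᵥ (fun i => p.coeff i) = 0 := by
      rw [hker]
      intro x hx
      rw [Fin.sum_univ_eq_sum_range (fun i => p.coeff i * x ^ i) (numBands V),
        ← eval_eq_sum_range' (by rw [hdeg]; exact hlt), hp, eval_prod]
      exact prod_eq_zero hx (by simp)
    have h0 := Matrix.eq_zero_of_mulVec_eq_zero hdet hv
    have := congrFun h0 ⟨S.card, hlt⟩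
    simp only [Pi.zero_apply] at this
    rw [← hdeg] at this
    exact one_ne_zero ((hpm.coeff_natDegree).symm.trans this)
  · intro hs hdet
    obtain ⟨v, hv0, hv⟩ := Matrix.exists_mulVec_eq_zero_iff.2 hdet
    refine hv0 ?_
    rw [hker] at hv
    set p : ℝ[X] := ∑ i : Fin (numBands V), C (v i) * X ^ (i : ℕ) with hp
    have hp0 : p = 0 := by
      refine Polynomial.eq_zero_of_degree_lt_of_eval_finset_eq_zero S ?_ fun x hx => by
        rw [hpoly]; exact hv x hx
      rw [hs]
      refine (degree_sum_fin_lt v)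
    funext i
    have := congrArg (fun q => coeff q (i : ℕ)) hp0
    simp only [hp, finsetSum_coeff, coeff_C_mul, coeff_X_pow, coeff_zero] at this
    rw [sum_eq_single i] at this
    · simpa using this
    · intro j _ hj
      rw [if_neg fun h => hj (Fin.ext h).symm, mul_zero]
    · simp

lemma isOpen_regularSet [Stable V] : IsOpen (regularSet V) := by
  have h : regularSet V = {θ | (gram V θ).det ≠ 0} := by ext θ; exact (det_gram_ne_zero_iff θ).symm
  rw [h]
  exact isOpen_ne.preimage
    (continuous_iff_continuousAt.2 fun θ => (analyticAt_det_gram θ).continuousAt)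

lemma ae_mem_regularSet [Stable V] : ∀ᵐ θ, θ ∈ regularSet V := by
  obtain ⟨θ0, hθ₀⟩ := exists_mem_regularSet (V := V)
  have hf : AnalyticOnNhd ℝ (fun θ => (gram V θ).det) univ := fun θ _ => analyticAt_det_gram θ
  have := volume_zero_set_of_analytic isOpen_univ hf fun W _ hW ⟨x, hx⟩ => by
    by_contra! h
    have h1 : (fun θ => (gram V θ).det) =ᶠ[𝓝 x] fun _ => 0 := by
      filter_upwards [hW.mem_nhds hx] with y hy using h y hy
    have h2 := hf.eq_of_eventuallyEq (g := fun _ => (0 : ℝ)) (fun _ _ => analyticAt_const) h1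
    exact (det_gram_ne_zero_iff θ0).2 hθ₀ (congrFun h2 θ0)
  rw [Set.univ_inter] at this
  filter_upwards [measure_eq_zero_iff_ae_notMem.1 this] with θ h
  exact (det_gram_ne_zero_iff θ).1 h

end

section

lemma om_sq_injective (hθ : θ ∈ regularSet V) : StrictMono fun σ : Fin (numBands V) => om V σ θ ^
    2 := fun σ σ' h => by
  have h1 := om_lt_om hθ (show (σ : ℕ) < σ' from h) σ'.2
  have h2 := om_nonneg hθ σ.2
  exact pow_lt_pow_left₀ h1 h2 two_ne_zero

variable [Stable V]

/-- The moments `tr V̂^{i+s}`, `i < s`. -/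
def moment (V : Lat d → Mat n ℝ) (θ : Euc d) : Fin (numBands V) → ℝ :=
  fun i => ((Vhat V θ ^ ((i : ℕ) + numBands V)).trace).re

/-- The polynomial `λ ↦ ∏_σ (λ - ω_σ(θ)²)`, with coefficients computed from traces of powers. -/
def bandPoly (V : Lat d → Mat n ℝ) (q : Euc d × ℝ) : ℝ := q.2 ^ numBands V +
    ∑ i, (-((gram V q.1).det)⁻¹ * (gram V q.1).cramer (moment V q.1) i) * q.2 ^ (i : ℕ)

open Polynomial in
lemma bandPoly_eq (hθ : θ ∈ regularSet V) (x : ℝ) : bandPoly V (θ, x) = ∏ σ : Fin (numBands V),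
    (x - om V σ θ ^ 2) := by
  set p : ℝ[X] := ∏ σ : Fin (numBands V), (X - C (om V σ θ ^ 2)) with hp
  have hpm : p.Monic := monic_prod_of_monic _ _ fun x _ => monic_X_sub_C _
  have hdeg : p.natDegree = numBands V := by
    rw [hp, natDegree_prod_of_monic _ _ fun x _ => monic_X_sub_C _]
    simp only [natDegree_X_sub_C]; simp
  have hev : ∀ x, p.eval x = x ^ numBands V + ∑ i : Fin (numBands V), p.coeff i * x ^ (i : ℕ) :=
    fun x => by
    rw [eval_eq_sum_range, hdeg, Finset.sum_range_succ, add_comm,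
      Fin.sum_univ_eq_sum_range (fun i => p.coeff i * x ^ i) (numBands V)]
    congr 1
    rw [← hdeg, hpm.coeff_natDegree, one_mul]
  have hroot : ∀ l, p.eval (eval V θ l ^ 2) = 0 := fun l => by
    obtain ⟨σ, hσ, h⟩ := exists_om_eq_eval hθ l
    rw [hp, eval_prod]
    exact prod_eq_zero (mem_univ ⟨σ, hσ⟩) (by simp [h])
  have hdet := (det_gram_ne_zero_iff θ).2 hθ
  set c : Fin (numBands V) → ℝ := fun i => p.coeff i with hc
  have hG : gram V θ *ᵥ c = -moment V θ := by
    have h1 : vander V θ *ᵥ c = fun l => -(eval V θ l ^ 2) ^ numBands V := by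
      funext l
      have := (hev _).symm.trans (hroot l)
      simp only [mulVec, dotProduct, vander, of_apply]
      rw [sum_congr rfl fun i _ => mul_comm _ _]
      linarith
    rw [gram_eq, ← mulVec_mulVec, h1]
    funext i
    simp only [mulVec, dotProduct, vander, transpose_apply, of_apply, Pi.neg_apply, moment]
    rw [trace_Vhat_pow, ← sum_neg_distrib]
    exact sum_congr rfl fun l _ => by ring
  have hcr : c = fun i => -((gram V θ).det)⁻¹ * (gram V θ).cramer (moment V θ) i := by
    have h1 : (gram V θ).det • c = -(gram V θ).cramer (moment V θ) := by
      have := congrArg (fun v => (gram V θ).adjugate *ᵥ v) hG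
      simp only [mulVec_mulVec, adjugate_mul, smul_mulVec, one_mulVec, mulVec_neg] at this
      rw [this, cramer_eq_adjugate_mulVec]
    funext i
    have h2 := congrFun h1 i
    simp only [Pi.smul_apply, smul_eq_mul, Pi.neg_apply] at h2
    rw [neg_mul, ← mul_neg, ← h2, inv_mul_cancel_left₀ hdet]
  have : bandPoly V (θ, x) = p.eval x := by
    rw [hev, bandPoly]
    simp only
    rw [show (∑ i : Fin (numBands V), p.coeff i * x ^ (i : ℕ)) = ∑ i, c i * x ^ (i : ℕ) from rfl, hcr]
  rw [this, hp, eval_prod]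
  simp

lemma analyticAt_bandPoly {q : Euc d × ℝ}
    (hθ : q.1 ∈ regularSet V) : AnalyticAt ℝ (bandPoly V) q := by
  have hdet := (det_gram_ne_zero_iff q.1).2 hθ
  have h1 : AnalyticAt ℝ (fun q : Euc d × ℝ => (gram V q.1).det) q :=
    (analyticAt_det_gram q.1).comp analyticAt_fst
  unfold bandPoly
  refine (analyticAt_snd.pow _).add (Finset.analyticAt_fun_sum _ fun i _ => ?_)
  refine ((h1.inv hdet).neg.mul ?_).mul (analyticAt_snd.pow _)
  have h2 : AnalyticAt ℝ (fun θ => (gram V θ).cramer (moment V θ) i) q.1 := by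
    simp only [cramer_apply]
    refine analyticAt_det fun k l => ?_
    by_cases hl : l = i
    · subst hl
      simp only [updateCol_self]
      exact analyticAt_trace_pow _ _
    · simp only [updateCol_ne hl]
      exact analyticAt_trace_pow _ _
  exact h2.comp analyticAt_fst

lemma analyticAt_of_contDiffAt_top {E F : Type*} [NormedAddCommGroup E] [NormedSpace ℝ E]
    [NormedAddCommGroup F] [NormedSpace ℝ F] [CompleteSpace F] {f : E → F} {x : E}
    (h : ContDiffAt ℝ (⊤ : WithTop ℕ∞) f x) : AnalyticAt ℝ f x := by
  rw [← analyticWithinAt_univ]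
  exact contDiffWithinAt_omega_iff_analyticWithinAt.1 h

/-- A simple root of an equation with analytic coefficients is locally an analytic function. -/
lemma exists_analytic_root {E : Type*} [NormedAddCommGroup E] [NormedSpace ℝ E] [CompleteSpace E]
    {F : E × ℝ → ℝ} {x₀ : E} {y₀ : ℝ} (hF : AnalyticAt ℝ F (x₀, y₀)) (hc : HasDerivAt (fun y => F
    (x₀, y)) c y₀) (hc0 : c ≠ 0) (h0 : F (x₀, y₀) = 0) : ∃ φ : E → ℝ, AnalyticAt ℝ φ x₀ ∧ φ x₀ = y₀
    ∧ ∀ᶠ x in 𝓝 x₀, F (x, φ x) = 0 := by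
  have hcd : ContDiffAt ℝ (⊤ : WithTop ℕ∞) F (x₀, y₀) := hF.contDiffAt
  have hinv : (fderiv ℝ F (x₀, y₀) ∘L .inr ℝ E ℝ).IsInvertible := by
    have h1 : HasFDerivAt (fun y : ℝ => F (x₀, y)) (fderiv ℝ F (x₀, y₀) ∘L .inr ℝ E ℝ) y₀ :=
      hF.differentiableAt.hasFDerivAt.comp y₀ (hasFDerivAt_prodMk_right x₀ y₀)
    have h3 := h1.unique hc.hasFDerivAt
    rw [h3]
    exact ⟨ContinuousLinearEquiv.unitsEquivAut ℝ (Units.mk0 c hc0), by ext; simp⟩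
  refine ⟨hcd.implicitFunction (by simp) hinv,
    analyticAt_of_contDiffAt_top (hcd.contDiffAt_implicitFunction (by simp) hinv),
    hcd.implicitFunction_apply_self (by simp) hinv, ?_⟩
  filter_upwards [hcd.eventually_apply_implicitFunction (by simp) hinv] with x h
  rw [h, h0]

lemma exists_analytic_band (hθ : θ0 ∈ regularSet V) (σ : Fin (numBands V)) : ∃ φ : Euc d → ℝ,
    AnalyticAt ℝ φ θ0 ∧ φ θ0 = om V σ θ0 ^ 2 ∧ ∀ᶠ θ in 𝓝 θ0, bandPoly V (θ, φ θ) = 0 := by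
  refine exists_analytic_root (c := ∏ σ' ∈ Finset.univ.erase σ, (om V σ θ0 ^ 2 - om V σ' θ0 ^ 2))
    (analyticAt_bandPoly hθ) ?_ ?_ ?_
  · simp_rw [bandPoly_eq hθ]
    have := HasDerivAt.fun_finsetProd (u := (Finset.univ : Finset (Fin (numBands V))))
      (f := fun σ' (x : ℝ) => x - om V σ' θ0 ^ 2) (f' := fun _ => (1 : ℝ)) (x := om V σ θ0 ^ 2)
      (fun σ' _ => (hasDerivAt_id _).sub_const _)
    rw [sum_eq_single σ] at this
    · simpa using this
    · intro σ' _ hne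
      rw [prod_eq_zero (i := σ)]
      · simp
      · exact Finset.mem_erase.2 ⟨hne.symm, mem_univ _⟩
      · simp
    · simp
  · exact Finset.prod_ne_zero_iff.2 fun σ' h' =>
      sub_ne_zero.2 fun h => (Finset.mem_erase.1 h').1 ((om_sq_injective hθ).injective h).symm
  · rw [bandPoly_eq hθ]
    exact prod_eq_zero (mem_univ σ) (by simp)

/-- The squared bands are analytic on the regular set. -/
lemma analyticAt_om_sq (hθ : θ0 ∈ regularSet V) (hσ : σ < numBands V) : AnalyticAt ℝ (fun θ => om
    V σ θ ^ 2) θ0 := by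
  choose φ hφa hφ0 hφz using exists_analytic_band hθ
  have hmono : ∀ᶠ θ in 𝓝 θ0, ∀ σ σ' : Fin (numBands V), σ < σ' → φ σ θ < φ σ' θ := by
    rw [eventually_all]; intro σ
    rw [eventually_all]; intro σ'
    by_cases h : σ < σ'
    · have h1 : φ σ θ0 < φ σ' θ0 := by rw [hφ0, hφ0]; exact om_sq_injective hθ h
      filter_upwards [(hφa σ).continuousAt.eventually_lt (hφa σ').continuousAt h1] with θ h2 _ using h2
    · exact .of_forall fun θ h' => absurd h' h
  have heq : φ ⟨σ, hσ⟩ =ᶠ[𝓝 θ0] fun θ => om V σ θ ^ 2 := by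
    filter_upwards [hmono, eventually_all.2 hφz, (isOpen_regularSet).mem_nhds hθ] with θ h1 h2 h3
    have hm : StrictMono fun σ => φ σ θ := fun σ σ' h => h1 σ σ' h
    have hsub : Set.range (fun σ => φ σ θ) ⊆ Set.range fun σ : Fin (numBands V) => om V σ θ ^ 2 := by
      rintro _ ⟨σ, rfl⟩
      have := h2 σ
      rw [bandPoly_eq h3, Finset.prod_eq_zero_iff] at this
      obtain ⟨σ', -, h⟩ := this
      exact ⟨σ', (sub_eq_zero.1 h).symm⟩
    have hr : Set.range (fun σ => φ σ θ) = Set.range fun σ : Fin (numBands V) => om V σ θ ^ 2 := by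
      refine Set.eq_of_subset_of_ncard_le hsub ?_ (Set.finite_range _)
      rw [← Set.image_univ, ← Set.image_univ, Set.ncard_image_of_injective _ hm.injective,
        Set.ncard_image_of_injective _ (om_sq_injective h3).injective]
    exact congrFun ((StrictMono.range_inj hm (om_sq_injective h3)).1 hr) ⟨σ, hσ⟩
  exact (hφa ⟨σ, hσ⟩).congr heq

/-- The points where all bands are analytic. -/
def analyticSet (V : Lat d → Mat n ℝ) : Set (Euc d) := regularSet V ∩ {θ | (Vhat V θ).det ≠ 0}

lemma isOpen_analyticSet : IsOpen (analyticSet V) := (isOpen_regularSet).inter (isOpen_ne.preimage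
    (continuous_iff_continuousAt.2 fun θ => (analyticAt_det (analyticAt_Vhat θ)).continuousAt))

lemma ae_mem_analyticSet : ∀ᵐ θ, θ ∈ analyticSet V := by
  filter_upwards [ae_mem_regularSet (V := V), (Stable.e6 (V := V)).1] with θ h1 h2 using ⟨h1, h2⟩

lemma analyticAt_om (hθ : θ0 ∈ analyticSet V) (hσ : σ < numBands V) : AnalyticAt ℝ (om V σ) θ0 :=
    by
  have hpos := om_pos hθ.1 hθ.2 hσ
  have h1 := (Real.contDiffAt_sqrt (n := (⊤ : WithTop ℕ∞)) (pow_pos hpos 2).ne').comp θ0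
    (analyticAt_om_sq hθ.1 hσ).contDiffAt
  refine (analyticAt_of_contDiffAt_top h1).congr ?_
  filter_upwards [(isOpen_regularSet).mem_nhds hθ.1] with θ h
  exact Real.sqrt_sq (om_nonneg h hσ)

lemma analyticAt_specProj (hθ : θ0 ∈ regularSet V) (hσ : σ < numBands V) (i j : Fin n) :
    AnalyticAt ℝ (fun θ => specProj V σ θ i j) θ0 := by
  have hlam : ∀ σ' < numBands V, AnalyticAt ℝ (fun θ => ((om V σ' θ ^ 2 : ℝ) : ℂ)) θ0 :=
    fun σ' h => (ofRealCLM.analyticAt _).comp (analyticAt_om_sq hθ h)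
  refine (analyticAt_list_prod (L := ((Finset.range (numBands V)).erase σ).toList)
    (A := fun σ' θ => ((om V σ θ ^ 2 - om V σ' θ ^ 2 : ℝ) : ℂ)⁻¹ •
      (Vhat V θ - ((om V σ' θ ^ 2 : ℝ) : ℂ) • 1)) (fun σ' hσ' k l => ?_) i j).congr ?_
  · obtain ⟨hne, hr⟩ := Finset.mem_erase.1 (Finset.mem_toList.1 hσ')
    rw [mem_range] at hr
    have h0 : ((om V σ θ0 ^ 2 - om V σ' θ0 ^ 2 : ℝ) : ℂ) ≠ 0 := by
      rw [Complex.ofReal_ne_zero, sub_ne_zero]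
      intro h
      have := (om_sq_injective hθ).injective (a₁ := ⟨σ, hσ⟩) (a₂ := ⟨σ', hr⟩) h
      exact hne (Fin.mk.inj_iff.1 this).symm
    have h1 : AnalyticAt ℝ (fun θ => ((om V σ θ ^ 2 - om V σ' θ ^ 2 : ℝ) : ℂ)) θ0 :=
      ((hlam σ hσ).sub (hlam σ' hr)).congr (.of_forall fun θ => by simp)
    simp only [Matrix.smul_apply, Matrix.sub_apply, smul_eq_mul]
    exact (h1.inv h0).mul ((analyticAt_Vhat _ k l).sub ((hlam σ' hr).mul analyticAt_const))
  · filter_upwards [(isOpen_regularSet).mem_nhds hθ] with θ h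
    rw [specProj_eq_lagrange h hσ]

end

section

variable {x : ℝ} {W : Set (Euc d)}

variable [Stable V]

/-- The phase `± ω_σ`. -/
def phase (V : Lat d → Mat n ℝ) (sg : ℝ) (σ : ℕ) (θ : Euc d) : ℝ := sg * om V σ θ

lemma analyticAt_phase (sg : ℝ) (hθ : θ ∈ analyticSet V) (hσ : σ < numBands V) : AnalyticAt ℝ
    (phase V sg σ) θ :=
  analyticAt_const.mul (analyticAt_om hθ hσ)

lemma fderiv_phase (sg : ℝ) (hθ : θ ∈ analyticSet V) (hσ : σ < numBands V) : fderiv ℝ (phase V sg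
    σ) θ = sg • fderiv ℝ (om V σ) θ :=
  fderiv_const_mul (analyticAt_om hθ hσ).differentiableAt sg

lemma fderiv_fderiv_phase (sg : ℝ) (hθ : θ ∈ analyticSet V) (hσ : σ < numBands V) : D² (phase V sg
    σ) θ = sg • D² (om V σ) θ := by
  have h : fderiv ℝ (phase V sg σ) =ᶠ[𝓝 θ] fun x => sg • fderiv ℝ (om V σ) x := by
    filter_upwards [isOpen_analyticSet.mem_nhds hθ] with x hx
    exact fderiv_phase sg hx hσ
  rw [h.fderiv_eq]
  exact fderiv_fun_const_smul (analyticAt_om hθ hσ).fderiv.differentiableAt sg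

/-- An analytic function that vanishes identically on no open set is non-zero almost everywhere. -/
lemma ae_ne_zero_of_analytic {F : Type*} [NormedAddCommGroup F] [NormedSpace ℝ F] {f : Euc d → F}
    (hf : AnalyticOnNhd ℝ f (analyticSet V))
    (hne : ∀ x ρ, 0 < ρ → ball x ρ ⊆ analyticSet V → ∃ y ∈ ball x ρ, f y ≠ 0) :
    ∀ᵐ θ, f θ ≠ 0 := by
  have h := volume_zero_set_of_analytic isOpen_analyticSet hf fun W hWs hW ⟨x, hx⟩ => by
    obtain ⟨ρ, hρ, hb⟩ := Metric.isOpen_iff.1 hW x hx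
    obtain ⟨y, hy, h⟩ := hne x ρ hρ (hb.trans hWs)
    exact ⟨y, hb hy, h⟩
  filter_upwards [measure_eq_zero_iff_ae_notMem.1 h, ae_mem_analyticSet (V := V)] with θ h1 h2 h3
  exact h1 ⟨h2, h3⟩

lemma hessOm_eq (hθ : θ ∈ analyticSet V) (hσ : σ < numBands V) (i j : Fin d) : hessOm V σ θ i j =
    D² (om V σ) θ (single i 1) (single j 1) := by
  simp only [hessOm, of_apply]
  rw [fderiv_clm_apply (analyticAt_om hθ hσ).fderiv.differentiableAt (differentiableAt_const _)]
  simp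

lemma isSymm_hess (hθ : θ ∈ analyticSet V) (hσ : σ < numBands V) (sg : ℝ) (x y : Euc d) : D²
    (phase V sg σ) θ x y = D² (phase V sg σ) θ y x :=
  ((analyticAt_phase sg hθ hσ).contDiffAt (n := 2)).isSymmSndFDerivAt (by simp) x y

lemma ae_det_hessOm_ne (hσ : σ < numBands V) : ∀ᵐ θ, (hessOm V σ θ).det ≠ 0 := by
  refine ae_ne_zero_of_analytic (fun θ hθ => analyticAt_det fun i j => ?_)
    fun x ρ hρ hb => Stable.e4 σ hσ _ isOpen_ball ⟨x, mem_ball_self hρ⟩ fun y hy => (hb hy).1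
  have h1 := (ContinuousLinearMap.apply ℝ ℝ (single j (1 : ℝ) : Euc d)).analyticAt
    (fderiv ℝ (om V σ) θ)
  have h2 := h1.comp (analyticAt_om hθ hσ).fderiv
  have h3 := (ContinuousLinearMap.apply ℝ ℝ (single i (1 : ℝ) : Euc d)).analyticAt
    (fderiv ℝ (fun x => fderiv ℝ (om V σ) x (single j 1)) θ)
  exact h3.comp (AnalyticAt.fderiv h2)

lemma phase_ne (hθ : θ ∈ analyticSet V) (hσ : σ < numBands V) (hσ' : σ' < numBands V)
    (hne : σ ≠ σ') (hs : sg = 1 ∨ sg = -1) (hs' : sg' = 1 ∨ sg' = -1) : phase V sg' σ' θ - phase V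
    sg σ θ ≠ 0 := by
  have h1 := om_pos hθ.1 hθ.2 hσ
  have h2 := om_pos hθ.1 hθ.2 hσ'
  have h3 : om V σ θ ≠ om V σ' θ := fun h => hne (om_injOn hθ.1 hσ hσ' h)
  unfold phase
  rcases hs with rfl | rfl <;> rcases hs' with rfl | rfl
  · simpa [sub_ne_zero] using h3.symm
  · linarith
  · linarith
  · intro h; apply h3; linarith

section First

variable [NeZero d]

lemma analyticAt_der0_om (hθ : θ ∈ analyticSet V) (hσ : σ < numBands V) : AnalyticAt ℝ
    (der0 (om V σ)) θ :=
  ((ContinuousLinearMap.apply ℝ ℝ (single 0 (1 : ℝ) : Euc d)).analyticAt _).comp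
    (analyticAt_om hθ hσ).fderiv

lemma ae_der0_om_ne (hσ : σ < numBands V) : ∀ᵐ θ, der0 (om V σ) θ ≠ 0 := by
  refine ae_ne_zero_of_analytic (fun θ hθ => analyticAt_der0_om hθ hσ) fun x ρ hρ hb => ?_
  by_contra! h
  obtain ⟨y, hy, hdet⟩ := Stable.e4 σ hσ _ isOpen_ball ⟨x, mem_ball_self hρ⟩ fun y hy => (hb hy).1
  refine hdet (Matrix.det_eq_zero_of_column_eq_zero 0 fun i => ?_)
  have h1 : (fun x => fderiv ℝ (om V σ) x (single 0 1)) =ᶠ[𝓝 y] fun _ => 0 := by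
    filter_upwards [isOpen_ball.mem_nhds hy] with z hz using h z hz
  simp only [hessOm, of_apply]
  rw [h1.fderiv_eq]
  simp

lemma ae_fderiv_phase_sub_ne (hσ : σ < numBands V) (hσ' : σ' < numBands V) (hs : sg = 1 ∨ sg = -1)
    (hs' : sg' = 1 ∨ sg' = -1) (hne : ¬(σ = σ' ∧ sg = sg')) : ∀ᵐ θ, fderiv ℝ (phase V sg' σ') θ -
    fderiv ℝ (phase V sg σ) θ ≠ 0 := by
  by_cases hσσ : σ = σ'
  · subst hσσ
    have hss : sg' = -sg := by rcases hs with rfl | rfl <;> rcases hs' with rfl | rfl <;> simp_all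
    filter_upwards [ae_mem_analyticSet (V := V), ae_der0_om_ne hσ] with θ h1 h2 h3
    rw [fderiv_phase _ h1 hσ, fderiv_phase _ h1 hσ, hss, ← sub_smul] at h3
    have h4 := DFunLike.congr_fun h3 (single 0 1)
    have h5 : (-sg - sg) * der0 (om V σ) θ = 0 := h4
    rcases mul_eq_zero.1 h5 with h | h
    · rcases hs with rfl | rfl <;> norm_num at h
    · exact h2 h
  · refine ae_ne_zero_of_analytic (fun θ hθ =>
      (analyticAt_phase sg' hθ hσ').fderiv.sub (analyticAt_phase sg hθ hσ).fderiv)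
      fun x ρ hρ hb => ?_
    by_contra! h
    have hd : ∀ y ∈ ball x ρ, HasFDerivAt (fun θ => phase V sg' σ' θ - phase V sg σ θ)
        (fderiv ℝ (phase V sg' σ') y - fderiv ℝ (phase V sg σ) y) y := fun y hy =>
      (analyticAt_phase sg' (hb hy) hσ').differentiableAt.hasFDerivAt.sub
        (analyticAt_phase sg (hb hy) hσ).differentiableAt.hasFDerivAt
    have hconst : ∀ y ∈ ball x ρ,
        phase V sg' σ' y - phase V sg σ y = phase V sg' σ' x - phase V sg σ x := fun y hy =>
      isOpen_ball.is_const_of_fderiv_eq_zero (𝕜 := ℝ)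
        (f := fun θ => phase V sg' σ' θ - phase V sg σ θ) (convex_ball x ρ).isPreconnected
        (fun y hy => (hd y hy).differentiableAt.differentiableWithinAt)
        (fun y hy => by rw [(hd y hy).fderiv]; exact h y hy) hy (mem_ball_self hρ)
    have hc := phase_ne (hb (mem_ball_self hρ)) hσ hσ' hσσ hs hs'
    set c := phase V sg' σ' x - phase V sg σ x with hcdef
    have hU : ∀ c' : ℝ, c' ≠ 0 → _ := fun c' hc' => Stable.e5 σ' hσ' σ hσ (Ne.symm hσσ) c' hc' _
      isOpen_ball ⟨x, mem_ball_self hρ⟩ fun y hy => (hb hy).1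
    unfold phase at hconst
    rcases hs with rfl | rfl <;> rcases hs' with rfl | rfl
    · obtain ⟨-, y, hy, h⟩ := hU c hc
      exact h (by linarith [hconst y hy])
    · obtain ⟨⟨y, hy, h⟩, -⟩ := hU (-c) (neg_ne_zero.2 hc)
      exact h (by linarith [hconst y hy])
    · obtain ⟨⟨y, hy, h⟩, -⟩ := hU c hc
      exact h (by linarith [hconst y hy])
    · obtain ⟨-, y, hy, h⟩ := hU (-c) (neg_ne_zero.2 hc)
      exact h (by linarith [hconst y hy])

end First

/-! ### The Hessian in a fixed direction -/

lemma exists_om_bound : ∃ M : ℝ, ∀ (θ : Euc d) (l : Fin n), eval V θ l ^ 2 ≤ M := by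
  refine ⟨∑ p : Fin n, ∑' z, ‖((V z p p : ℝ) : ℂ)‖, fun θ l => ?_⟩
  have h1 := trace_Vhat_pow (V := V) θ 1
  simp only [pow_one] at h1
  calc eval V θ l ^ 2 ≤ ∑ l, eval V θ l ^ 2 :=
        Finset.single_le_sum (f := fun l => eval V θ l ^ 2) (fun _ _ => sq_nonneg _) (mem_univ l)
    _ = (Vhat V θ).trace.re := h1.symm
    _ = ∑ p, (Vhat V θ p p).re := by simp [Matrix.trace]
    _ ≤ _ := sum_le_sum fun p _ => by
        refine (Complex.re_le_norm _).trans ?_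
        rw [Vhat_apply]
        exact norm_fsum_le (Stable.e1.summable p p) θ

lemma exists_eval_of_det (h : (((x : ℂ) ^ 2) • (1 : Mat n ℂ) - Vhat V θ).det = 0) : ∃ l, x ^ 2 =
    eval V θ l ^ 2 := by
  have h1 : ((x : ℂ) ^ 2) • (1 : Mat n ℂ) - Vhat V θ =
      fc (isHermitian_Omega (V := V) θ) (fun y => (x : ℂ) ^ 2 * 1 + (-1) * (y : ℂ) ^ 2) := by
    rw [fc_add, fc_smul, fc_smul, fc_one, ← Vhat_eq_fc, neg_one_smul, sub_eq_add_neg]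
  rw [h1, det_fc, Finset.prod_eq_zero_iff] at h
  obtain ⟨l, -, h⟩ := h
  refine ⟨l, ?_⟩
  have h2 : (x : ℂ) ^ 2 = ((eval V θ l : ℝ) : ℂ) ^ 2 := by linear_combination h
  exact_mod_cast h2

lemma det_of_eval (h : ∃ l, x ^ 2 = eval V θ l ^ 2) : (((x : ℂ) ^ 2) • (1 : Mat n ℂ) - Vhat V
    θ).det = 0 := by
  have h1 : ((x : ℂ) ^ 2) • (1 : Mat n ℂ) - Vhat V θ =
      fc (isHermitian_Omega (V := V) θ) (fun y => (x : ℂ) ^ 2 * 1 + (-1) * (y : ℂ) ^ 2) := by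
    rw [fc_add, fc_smul, fc_smul, fc_one, ← Vhat_eq_fc, neg_one_smul, sub_eq_add_neg]
  obtain ⟨l, h⟩ := h
  have h2 : (x : ℂ) ^ 2 = ((eval V θ l : ℝ) : ℂ) ^ 2 := by exact_mod_cast h
  rw [h1, det_fc]
  exact prod_eq_zero (mem_univ l) (by rw [h2]; ring)

lemma eq_zero_of_quadratic_bounded {a b : ℝ} (h : ∀ u : ℝ, (a + b * u + c * u ^ 2) ^ 2 ≤ M) : b =
    0 := by
  have hM : 0 ≤ M := (sq_nonneg _).trans (h 0)
  have h1 : ∀ u : ℝ, |a + b * u + c * u ^ 2| ≤ M + 1 := fun u => by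
    rw [abs_le]; constructor <;> nlinarith [h u]
  by_contra hb
  have h2 : ∀ u : ℝ, |b * u| ≤ M + 1 := fun u => by
    have e1 := abs_le.1 (h1 u)
    have e2 := abs_le.1 (h1 (-u))
    rw [abs_le]; constructor <;> nlinarith [e1.1, e1.2, e2.1, e2.2]
  have h3 := h2 ((M + 2) / b)
  rw [mul_div_cancel₀ _ hb, abs_of_nonneg (by linarith)] at h3
  linarith

lemma hasFDerivAt_fderiv_apply {x : Euc d} (hω : AnalyticAt ℝ ω x) (s : Euc d) : ∃ L : Euc d →L[ℝ]
    ℝ, HasFDerivAt (fun y => fderiv ℝ ω y s) L x ∧ ∀ v, L v = D² ω x v s :=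
  ⟨_, hω.fderiv.differentiableAt.hasFDerivAt.clm_apply (hasFDerivAt_const s x), fun v => by simp⟩

/-- A function with constant second derivative in a direction is quadratic along lines. -/
lemma quadratic_of_hess_const (hW : IsOpen W) (hω : AnalyticOnNhd ℝ ω W) (hκ : ∀ θ ∈ W, D² ω θ s
    s = κ) (hθ : θ ∈ W) : ∃ ρ > 0, ∀ u ∈ ball (0 : ℝ) ρ, θ + u • s ∈ W ∧ ω (θ + u • s) = ω
    θ + fderiv ℝ ω θ s * u + κ / 2 * u ^ 2 := by
  set b := fderiv ℝ ω θ s with hb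
  have hline : ∀ u : ℝ, HasDerivAt (fun u : ℝ => θ + u • s) s u := fun u => by
    simpa using ((hasDerivAt_id u).smul_const s).const_add θ
  obtain ⟨ρ, hρ, hbW⟩ : ∃ ρ > 0, ∀ u ∈ ball (0 : ℝ) ρ, θ + u • s ∈ W := by
    have hc : Continuous fun u : ℝ => θ + u • s := by fun_prop
    obtain ⟨ρ, hρ, h⟩ := Metric.isOpen_iff.1 (hW.preimage hc) 0 (by simpa using hθ)
    exact ⟨ρ, hρ, fun u hu => h hu⟩
  have hpre : IsPreconnected (ball (0 : ℝ) ρ) := (convex_ball _ _).isPreconnected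
  have hd1 : ∀ u ∈ ball (0 : ℝ) ρ, HasDerivAt (fun u : ℝ => fderiv ℝ ω (θ + u • s) s - κ * u)
      0 u := fun u hu => by
    obtain ⟨L, h1, hL⟩ := hasFDerivAt_fderiv_apply (hω _ (hbW u hu)) s
    have h2 := h1.comp_hasDerivAt u (hline u)
    have h3 := h2.sub ((hasDerivAt_id u).const_mul κ)
    rw [hL, hκ _ (hbW u hu), mul_one, sub_self] at h3
    exact h3
  have he1 : ∀ u ∈ ball (0 : ℝ) ρ, fderiv ℝ ω (θ + u • s) s = b + κ * u := fun u hu => by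
    have := isOpen_ball.is_const_of_deriv_eq_zero hpre
      (fun u hu => (hd1 u hu).differentiableAt.differentiableWithinAt)
      (fun u hu => (hd1 u hu).deriv) hu (mem_ball_self hρ)
    simp only [zero_smul, add_zero, mul_zero, sub_zero] at this
    linarith
  have hd2 : ∀ u ∈ ball (0 : ℝ) ρ,
      HasDerivAt (fun u : ℝ => ω (θ + u • s) - (b * u + κ / 2 * u ^ 2)) 0 u :=
    fun u hu => by
    have h1 := (hω _ (hbW u hu)).differentiableAt.hasFDerivAt
    have h2 := h1.comp_hasDerivAt u (hline u)
    have h3 : HasDerivAt (fun u : ℝ => b * u + κ / 2 * u ^ 2) (b + κ * u) u := by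
      have := ((hasDerivAt_id u).const_mul b).add ((hasDerivAt_pow 2 u).const_mul (κ / 2))
      refine HasDerivAt.congr_deriv this ?_
      norm_num; ring
    have h4 := h2.sub h3
    rw [he1 u hu, sub_self] at h4
    exact h4
  refine ⟨ρ, hρ, fun u hu => ⟨hbW u hu, ?_⟩⟩
  have := isOpen_ball.is_const_of_deriv_eq_zero hpre
    (fun u hu => (hd2 u hu).differentiableAt.differentiableWithinAt)
    (fun u hu => (hd2 u hu).deriv) hu (mem_ball_self hρ)
  simp only [zero_smul, add_zero] at this
  linarith

/-- If `ω'' s` is constant along the line, then `ω` is quadratic there, hence constant since the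
spectrum is bounded. -/
lemma fderiv_phase_apply_eq_zero (hs : sg = 1 ∨ sg = -1) (hσ : σ < numBands V) (hW : IsOpen W)
    (hWs : W ⊆ analyticSet V) (hκ : ∀ θ ∈ W, D² (phase V sg σ) θ s s = κ) (hθ : θ ∈ W) : fderiv ℝ
    (phase V sg σ) θ s = 0 := by
  obtain ⟨ρ, hρ, he⟩ := quadratic_of_hess_const hW
    (fun x hx => analyticAt_phase sg (hWs hx) hσ) hκ hθ
  generalize hc : phase V sg σ θ = c at he
  generalize hb : fderiv ℝ (phase V sg σ) θ s = b at he
  set q : ℝ → ℝ := fun u => c + b * u + κ / 2 * u ^ 2 with hq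
  set P : ℝ → ℂ := fun u => (((q u : ℝ) : ℂ) ^ 2 • (1 : Mat n ℂ) - Vhat V (θ + u • s)).det with hP
  have hPa : AnalyticOnNhd ℝ P univ := fun u _ => by
    have hqa : AnalyticAt ℝ (fun u : ℝ => ((q u : ℝ) : ℂ)) u := by
      refine (ofRealCLM.analyticAt _).comp (f := q) ?_
      simp only [hq]
      exact ((analyticAt_const.add (analyticAt_const.mul analyticAt_id)).add
        (analyticAt_const.mul (analyticAt_id.pow 2)))
    refine analyticAt_det fun i j => ?_
    simp only [Matrix.smul_apply, Matrix.sub_apply, smul_eq_mul]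
    refine ((hqa.pow 2).mul analyticAt_const).sub ?_
    refine (analyticAt_Vhat (θ + u • s) i j).comp_of_eq (f := fun u : ℝ => θ + u • s) ?_ rfl
    exact analyticAt_const.add (analyticAt_id.smul analyticAt_const)
  have hP0 : P = fun _ => 0 := by
    refine hPa.eq_of_eventuallyEq (z₀ := 0) (fun _ _ => analyticAt_const) ?_
    filter_upwards [Metric.ball_mem_nhds (0 : ℝ) hρ] with u hu
    refine det_of_eval ?_
    obtain ⟨l, hl⟩ := exists_eval_eq_om (hWs (he u hu).1).1 hσ
    refine ⟨l, ?_⟩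
    rw [hl, ← show phase V sg σ (θ + u • s) = q u from (he u hu).2, phase]
    rcases hs with rfl | rfl <;> ring
  obtain ⟨M, hM⟩ := exists_om_bound (V := V)
  refine eq_zero_of_quadratic_bounded (a := c) (b := b) (c := κ / 2) (M := M) fun u => ?_
  obtain ⟨l, hl⟩ := exists_eval_of_det (congrFun hP0 u)
  change q u ^ 2 ≤ M
  rw [hl]
  exact hM _ _

lemma ae_hess_shift_ne (hσ : σ < numBands V) (hs : sg = 1 ∨ sg = -1) {β : Euc d} (hβ : β ≠ 0)
    (hτ : τ ≠ 0) (s : Euc d) : ∀ᵐ θ, innerSL ℝ β - τ • D² (phase V sg σ) θ s ≠ 0 := by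
  have han : ∀ θ ∈ analyticSet V, AnalyticAt ℝ (fun θ => D² (phase V sg σ) θ s) θ := fun θ hθ =>
    by
    have h1 : ContDiffAt ℝ (⊤ : WithTop ℕ∞) (fun θ => D² (phase V sg σ) θ s) θ :=
      (analyticAt_phase sg hθ hσ).fderiv.fderiv.contDiffAt.clm_apply contDiffAt_const
    exact analyticAt_of_contDiffAt_top h1
  refine ae_ne_zero_of_analytic (fun θ hθ => analyticAt_const.sub
    (analyticAt_const.fun_smul (han θ hθ))) fun x ρ hρ hb => ?_
  by_contra! h
  have h' : ∀ y ∈ ball x ρ, ∀ v, ⟪β, v⟫ = τ * D² (phase V sg σ) y s v := fun y hy v => by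
    have := DFunLike.congr_fun (h y hy) v
    simpa [sub_eq_zero] using this
  have hz : ∀ y ∈ ball x ρ, fderiv ℝ (phase V sg σ) y s = 0 := fun y hy =>
    fderiv_phase_apply_eq_zero hs hσ isOpen_ball hb (κ := τ⁻¹ * ⟪β, s⟫)
      (fun θ hθ => by rw [h' θ hθ, inv_mul_cancel_left₀ hτ]) hy
  have hx : x ∈ ball x ρ := mem_ball_self hρ
  have h2 : ∀ v, D² (phase V sg σ) x v s = 0 := fun v => by
    have e1 : (fun y => fderiv ℝ (phase V sg σ) y s) =ᶠ[𝓝 x] fun _ => 0 := by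
      filter_upwards [isOpen_ball.mem_nhds hx] with y hy using hz y hy
    have e2 := e1.fderiv_eq (𝕜 := ℝ)
    rw [fderiv_clm_apply (analyticAt_phase sg (hb hx) hσ).fderiv.differentiableAt
      (differentiableAt_const _)] at e2
    simpa using DFunLike.congr_fun e2 v
  refine hβ (inner_self_eq_zero (𝕜 := ℝ).1 ?_)
  rw [h' x hx, isSymm_hess (hb hx) hσ, h2, mul_zero]

end

/-- The symbol `[[0, 1], [-V̂, 0]]` of the first-order system. -/
def Ahat (V : Lat d → Mat n ℝ) (θ : Euc d) : IxMat n ℂ :=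
  (!![0, 1; 0, 0] : Mat 2 ℂ) ⊗ₖ (1 : Mat n ℂ) + (!![0, 0; -1, 0] : Mat 2 ℂ) ⊗ₖ Vhat V θ

/-- The `2 × 2` matrix `I ± i C`. -/
def bandMat (sg w : ℝ) : Mat 2 ℂ := !![1, (sg : ℂ) * I * (w : ℂ)⁻¹; -((sg : ℂ) * I * w), 1]

/-- The amplitude `½ Π_σ (I ± i C_σ)` of the phase `± ω_σ` in the propagator. -/
def amp (V : Lat d → Mat n ℝ) (sg : ℝ) (σ : ℕ) (θ : Euc d) : IxMat n ℂ :=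
  (1 / 2 : ℂ) • (bandMat sg (om V σ θ) ⊗ₖ specProj V σ θ)

lemma amp_apply (sg : ℝ) (σ : ℕ) (θ : Euc d) (p q : Ix n) :
    amp V sg σ θ p q = 1 / 2 * (bandMat sg (om V σ θ) p.1 q.1 * specProj V σ θ p.2 q.2) := rfl

lemma bandMat_eq (sg w : ℝ) : bandMat sg w =
    1 + ((sg : ℂ) * I) • (!![0, (w : ℂ)⁻¹; -(w : ℂ), 0] : Mat 2 ℂ) := by
  ext i j
  fin_cases i <;> fin_cases j <;> simp [bandMat]

lemma amp_eq (sg : ℝ) (σ : ℕ) (θ : Euc d) :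
    amp V sg σ θ = (1 / 2 : ℂ) • (matPi V σ θ * (1 + ((sg : ℂ) * I) • matC V σ θ)) := by
  have h1 : (1 : IxMat n ℂ) = (1 : Mat 2 ℂ) ⊗ₖ (1 : Mat n ℂ) := (one_kronecker_one).symm
  rw [amp, matPi, matC, h1, ← smul_kronecker ((sg : ℂ) * I), ← add_kronecker,
    ← mul_kronecker_mul, one_mul, mul_one, bandMat_eq]

lemma amp_mul_mul_conjTranspose (σ : ℕ) (θ : Euc d) (M : IxMat n ℂ) : amp V sg σ θ * M * (amp V sg
    σ θ)ᴴ = (1 / 4 : ℂ) • (matPi V σ θ * ((1 + ((sg : ℂ) * I) • matC V σ θ) * M *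
    (1 - ((sg : ℂ) * I) • (matC V σ θ)ᴴ)) * matPi V σ θ) := by
  have h1 : (matPi V σ θ)ᴴ = matPi V σ θ := by
    rw [matPi, conjTranspose_kronecker, specProj_conjTranspose, conjTranspose_one]
  have h2 : (amp V sg σ θ)ᴴ = (1 / 2 : ℂ) • ((1 - ((sg : ℂ) * I) • (matC V σ θ)ᴴ) *
      matPi V σ θ) := by
    rw [amp_eq, conjTranspose_smul, conjTranspose_mul, h1, conjTranspose_add, conjTranspose_smul,
      conjTranspose_one]
    simp [sub_eq_add_neg]
  rw [h2, amp_eq]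
  simp only [Matrix.smul_mul, Matrix.mul_smul, smul_smul, mul_assoc]
  norm_num

lemma Ahat_mul_amp [Stable V] (hs : sg = 1 ∨ sg = -1) (hθ : θ ∈ analyticSet V) (hσ : σ < numBands
    V) : Ahat V θ * amp V sg σ θ = (-(I * (phase V sg σ θ : ℂ))) • amp V sg σ θ := by
  have hw : ((om V σ θ : ℝ) : ℂ) ≠ 0 := by exact_mod_cast (om_pos hθ.1 hθ.2 hσ).ne'
  have hsq : ((sg : ℝ) : ℂ) ^ 2 = 1 := by rcases hs with rfl | rfl <;> simp
  have key : (!![0, 1; 0, 0] : Mat 2 ℂ) * bandMat sg (om V σ θ) +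
      ((om V σ θ : ℝ) : ℂ) ^ 2 • ((!![0, 0; -1, 0] : Mat 2 ℂ) * bandMat sg (om V σ θ)) =
      (-(I * (phase V sg σ θ : ℂ))) • bandMat sg (om V σ θ) := by
    have hI := Complex.I_sq
    unfold phase bandMat
    push_cast
    generalize ((om V σ θ : ℝ) : ℂ) = w at hw
    ext i j
    fin_cases i <;> fin_cases j <;> simp
    · ring
    · field_simp
      linear_combination (-1 : ℂ) * hsq + (sg : ℂ) ^ 2 * hI
    · linear_combination (w ^ 2) * hsq - (sg : ℂ) ^ 2 * w ^ 2 * hI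
    · field_simp
  rw [Ahat, amp, Matrix.mul_smul, Matrix.add_mul, ← mul_kronecker_mul, ← mul_kronecker_mul, one_mul,
    Vhat_mul_specProj, kronecker_smul, ← smul_kronecker (((om V σ θ : ℝ) : ℂ) ^ 2),
    ← add_kronecker, key, smul_kronecker, smul_comm]

lemma sum_amp (hθ : θ ∈ analyticSet V) : ∑ σ ∈ Finset.range (numBands V), (amp V 1 σ θ + amp V
    (-1) σ θ) = 1 := by
  have h1 : ∀ σ, amp V 1 σ θ + amp V (-1) σ θ = matPi V σ θ := fun σ => by
    rw [amp, amp, ← smul_add, ← add_kronecker, ← smul_kronecker, matPi]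
    congr 1
    ext i j
    fin_cases i <;> fin_cases j <;> simp [bandMat] <;> norm_num
  simp_rw [h1, matPi]
  rw [← one_kronecker_one, ← sum_specProj hθ.1]
  ext p q
  simp [Matrix.sum_apply, kroneckerMap_apply, mul_sum]

lemma Ahat_pow [Stable V] (hθ : θ ∈ analyticSet V) (k : ℕ) : Ahat V θ ^ k = ∑ σ ∈ Finset.range
    (numBands V), ((-(I * (phase V 1 σ θ : ℂ))) ^ k • amp V 1 σ θ + (-(I * (phase V (-1) σ θ : ℂ)))
    ^ k • amp V (-1) σ θ) := by
  induction k with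
  | zero => simpa using (sum_amp hθ).symm
  | succ k ih =>
    rw [pow_succ', ih, mul_sum]
    refine sum_congr rfl fun σ hσ => ?_
    rw [Matrix.mul_add, Matrix.mul_smul, Matrix.mul_smul,
      Ahat_mul_amp (Or.inl rfl) hθ (mem_range.1 hσ),
      Ahat_mul_amp (Or.inr rfl) hθ (mem_range.1 hσ), smul_smul, smul_smul, pow_succ,
      pow_succ]

/-- The propagator in terms of the bands. -/
lemma hasSum_Ahat_pow [Stable V] (hθ : θ ∈ analyticSet V) (t : ℝ) (p q : Ix n) : HasSum
    (fun k : ℕ => ((t : ℂ) ^ k / k.factorial) * (Ahat V θ ^ k) p q) (∑ σ ∈ Finset.range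
    (numBands V), (wave t (phase V 1 σ) (fun θ => amp V 1 σ θ p q) θ + wave t (phase V (-1) σ)
    (fun θ => amp V (-1) σ θ p q) θ)) := by
  have hexp : ∀ (w a : ℂ), HasSum (fun k : ℕ => ((t : ℂ) ^ k / k.factorial) * ((-(I * w)) ^ k * a))
      (exp (-(I * (t * w))) * a) := fun w a => by
    have h := (NormedSpace.expSeries_div_hasSum_exp (𝔸 := ℂ) (-(I * (t * w)))).mul_right a
    rw [← Complex.exp_eq_exp_ℂ] at h
    refine h.congr_fun fun k => ?_
    rw [show -(I * (t * w)) = (t : ℂ) * (-(I * w)) by ring, mul_pow]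
    ring
  have h1 := hasSum_sum (s := Finset.range (numBands V)) fun σ _ =>
    (hexp (phase V 1 σ θ : ℂ) (amp V 1 σ θ p q)).add (hexp (phase V (-1) σ θ : ℂ) (amp V (-1) σ θ p q))
  have e1 : (fun k : ℕ => ((t : ℂ) ^ k / k.factorial) * (Ahat V θ ^ k) p q) = fun k : ℕ =>
      ∑ σ ∈ Finset.range (numBands V), (((t : ℂ) ^ k / k.factorial) *
        ((-(I * (phase V 1 σ θ : ℂ))) ^ k * amp V 1 σ θ p q) +
        ((t : ℂ) ^ k / k.factorial) *
          ((-(I * (phase V (-1) σ θ : ℂ))) ^ k * amp V (-1) σ θ p q)) := by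
    funext k
    rw [Ahat_pow hθ, Matrix.sum_apply, mul_sum]
    exact sum_congr rfl fun σ _ => by
      rw [Matrix.add_apply, Matrix.smul_apply, Matrix.smul_apply, smul_eq_mul, smul_eq_mul, mul_add]
  rw [e1]
  simp only [wave, ofReal_mul]
  exact h1

/-! ### Size and regularity of the amplitudes -/

lemma analyticAt_amp [Stable V] (sg : ℝ) (hθ : θ ∈ analyticSet V) (hσ : σ < numBands V)
    (p q : Ix n) : AnalyticAt ℝ (fun θ => amp V sg σ θ p q) θ := by
  simp only [amp_apply]
  refine analyticAt_const.mul (AnalyticAt.mul ?_ (analyticAt_specProj hθ.1 hσ _ _))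
  have h1 : AnalyticAt ℝ (fun θ => ((om V σ θ : ℝ) : ℂ)) θ :=
    (ofRealCLM.analyticAt _).comp (analyticAt_om hθ hσ)
  have hw : ((om V σ θ : ℝ) : ℂ) ≠ 0 := by exact_mod_cast (om_pos hθ.1 hθ.2 hσ).ne'
  obtain ⟨i, k⟩ := p
  obtain ⟨j, l⟩ := q
  fin_cases i <;> fin_cases j <;> simp [bandMat]
  · exact analyticAt_const
  · exact analyticAt_const.mul (h1.inv hw)
  · exact (analyticAt_const.mul h1).neg
  · exact analyticAt_const

/-- A function that is continuous on the analytic set is measurable. -/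
lemma aestronglyMeasurable_of_analyticSet [Stable V]
    {F : Type*} [TopologicalSpace F] [TopologicalSpace.PseudoMetrizableSpace F]
    [SecondCountableTopologyEither (Euc d) F] {f : Euc d → F}
    (hf : ∀ θ ∈ analyticSet V, ContinuousAt f θ) :
    AEStronglyMeasurable f (volume : Measure (Euc d)) := by
  have h1 : AEStronglyMeasurable f (volume.restrict (analyticSet V)) :=
    ContinuousOn.aestronglyMeasurable (fun θ hθ => (hf θ hθ).continuousWithinAt)
      isOpen_analyticSet.measurableSet
  rwa [Measure.restrict_eq_self_of_ae_mem (ae_mem_analyticSet)] at h1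

lemma Vhat_inv_eq_fc [Stable V] (hdet : (Vhat V θ).det ≠ 0) : (Vhat V θ)⁻¹ = fc (isHermitian_Omega
    (V := V) θ) (fun x => ((x : ℂ) ^ 2)⁻¹) := by
  refine Matrix.inv_eq_right_inv ?_
  rw [Vhat_eq_fc, fc_mul, ← fc_one (isHermitian_Omega (V := V) θ)]
  refine fc_congr _ fun l => mul_inv_cancel₀ ?_
  have := (eval_pos hdet l).ne'
  exact pow_ne_zero 2 (by exact_mod_cast this)

/-- `tr V̂⁻¹`. -/
def invTrace (V : Lat d → Mat n ℝ) (θ : Euc d) : ℝ := ((Vhat V θ)⁻¹.trace).re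

lemma inv_om_sq_le [Stable V] (hθ : θ ∈ analyticSet V) (hσ : σ < numBands V) : (om V σ θ ^ 2)⁻¹ ≤
    invTrace V θ := by
  obtain ⟨l, hl⟩ := exists_eval_eq_om hθ.1 hσ
  have h1 : invTrace V θ = ∑ l, (eval V θ l ^ 2)⁻¹ := by
    rw [invTrace, Vhat_inv_eq_fc hθ.2, trace_fc, ← Complex.ofReal_re (∑ l, (eval V θ l ^ 2)⁻¹)]
    push_cast
    rfl
  rw [h1, ← hl]
  exact Finset.single_le_sum (f := fun l => (eval V θ l ^ 2)⁻¹)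
    (fun _ _ => inv_nonneg.2 (sq_nonneg _)) (mem_univ l)

lemma integrable_invTrace [Stable V] : Integrable (invTrace V) (𝕋 d) := by
  have h : Integrable (fun θ => (Vhat V θ)⁻¹.trace) (𝕋 d) := by
    simp only [Matrix.trace, diag_apply]
    exact integrable_finsetSum _ fun k _ => Stable.e6.2 k k
  exact h.re

lemma exists_norm_amp_le [Stable V] :
    ∃ K : ℝ, ∀ θ ∈ analyticSet V, ∀ σ < numBands V, ∀ sg : ℝ, (sg = 1 ∨ sg = -1) → ∀ p q,
      ‖amp V sg σ θ p q‖ ^ 2 ≤ K * (1 + invTrace V θ) := by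
  obtain ⟨M, hM⟩ := exists_om_bound (V := V)
  refine ⟨(n : ℝ) ^ 2 * (1 + |M|), fun θ hθ σ hσ sg hs p q => ?_⟩
  have hpos := om_pos hθ.1 hθ.2 hσ
  have hinv := inv_om_sq_le hθ hσ
  have hM' : om V σ θ ^ 2 ≤ |M| := by
    obtain ⟨l, hl⟩ := exists_eval_eq_om hθ.1 hσ
    rw [← hl]; exact (hM θ l).trans (le_abs_self M)
  have hi0 : 0 ≤ invTrace V θ := (inv_nonneg.2 (sq_nonneg _)).trans hinv
  have hb : ‖bandMat sg (om V σ θ) p.1 q.1‖ ^ 2 ≤ (1 + |M|) * (1 + invTrace V θ) := by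
    have e1 : (1 : ℝ) ≤ (1 + |M|) * (1 + invTrace V θ) := by nlinarith [abs_nonneg M]
    have e2 : (om V σ θ ^ 2)⁻¹ ≤ (1 + |M|) * (1 + invTrace V θ) := by nlinarith [abs_nonneg M]
    have e3 : om V σ θ ^ 2 ≤ (1 + |M|) * (1 + invTrace V θ) := by nlinarith [abs_nonneg M]
    obtain ⟨i, k⟩ := p
    obtain ⟨j, l⟩ := q
    fin_cases i <;> fin_cases j <;> simp only [bandMat]
    · simpa using e1
    · rcases hs with rfl | rfl <;> simpa using e2
    · rcases hs with rfl | rfl <;> simpa using e3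
    · simpa using e1
  rw [amp_apply, norm_mul, norm_mul, mul_pow, mul_pow]
  have hp := norm_specProj_apply_le (V := V) σ θ p.2 q.2
  have hp2 : ‖specProj V σ θ p.2 q.2‖ ^ 2 ≤ (n : ℝ) ^ 2 := by gcongr
  have hh : ‖(1 / 2 : ℂ)‖ ^ 2 ≤ 1 := by norm_num
  calc _ ≤ 1 * (((1 + |M|) * (1 + invTrace V θ)) * (n : ℝ) ^ 2) := by gcongr
    _ = _ := by ring

lemma memLp_amp [Stable V] (hs : sg = 1 ∨ sg = -1) (hσ : σ < numBands V) (p q : Ix n) : MemLp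
    (fun θ => amp V sg σ θ p q) 2 (𝕋 d) := by
  have hm : AEStronglyMeasurable (fun θ => amp V sg σ θ p q) (𝕋 d) :=
    (aestronglyMeasurable_of_analyticSet (V := V)
      fun θ hθ => (analyticAt_amp sg hθ hσ p q).continuousAt).restrict
  rw [memLp_two_iff_integrable_sq_norm hm]
  obtain ⟨K, hK⟩ := exists_norm_amp_le (V := V)
  refine .mono' (((integrable_const (1 : ℝ)).add (integrable_invTrace (V := V))).const_mul K)
    (hm.norm.pow 2) ?_
  filter_upwards [ae_restrict_of_ae (ae_mem_analyticSet (V := V))] with θ hθ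
  rw [norm_of_nonneg (by positivity)]
  exact hK θ hθ σ hσ sg hs p q

section

/-- The Gaussian regularization factor. -/
notation "𝐆[" η ", " x "]" => ((Real.exp (-η * ‖x‖ ^ 2) : ℝ) : ℂ)

/-! ### Gaussian summation of oscillatory integrals with a non-degenerate quadratic phase -/

section Gauss

lemma integral_gauss {b : Fin d → ℂ} (hb : ∀ i, 0 < (b i).re) (c : Fin d → ℂ) :
    ∫ v : Euc d, exp (-∑ i, b i * (v i : ℂ) ^ 2 + ∑ i, c i * (v i : ℂ)) =
      ∏ i, (π / b i) ^ (1 / 2 : ℂ) * exp (c i ^ 2 / (4 * b i)) := by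
  rw [← GaussianFourier.integral_cexp_neg_sum_mul_add hb c,
    ← (PiLp.volume_preserving_toLp (Fin d)).integral_comp (MeasurableEquiv.toLp 2 _).measurableEmbedding]

lemma inner_eq_sum (x y : Euc d) : ⟪x, y⟫ = ∑ j, x j * y j := by simp [PiLp.inner_apply, mul_comm]

lemma norm_sq_eq_sum (x : Euc d) : ‖x‖ ^ 2 = ∑ j, x j ^ 2 := by
  rw [EuclideanSpace.norm_sq_eq]; simp

lemma integral_comp_isometry {F : Type*} [NormedAddCommGroup F] [NormedSpace ℝ F]
    (O : Euc d ≃ₗᵢ[ℝ] Euc d) (f : Euc d → F) : ∫ y, f (O y) = ∫ y, f y :=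
  O.measurePreserving.integral_comp O.toHomeomorph.measurableEmbedding f

/-- The oscillatory kernel of a diagonal quadratic form. -/
def diagKernel (lam : Fin d → ℝ) (x : Euc d) : ℂ :=
  c𝕋 d * ∏ j, (π / (I * (lam j / 2))) ^ (1 / 2 : ℂ) *
    exp ((-(I * x j)) ^ 2 / (4 * (I * (lam j / 2))))

variable {O : Euc d ≃ₗᵢ[ℝ] Euc d} {lam : Fin d → ℝ} {Q : Euc d → ℝ}

lemma integral_regularized (hQ : ∀ y, Q (O y) = ∑ j, lam j / 2 * y j ^ 2) (hη : 0 < η) (x : Euc d)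
    : ∫ y : Euc d, 𝐆[η, y] * (𝐞⁻[⟪O x, y⟫] * 𝐞⁻[(Q y : ℝ)]) = ∏ j,
    (π / (η + I * (lam j / 2))) ^ (1 / 2 : ℂ) * exp ((-(I * x j)) ^ 2 / (4 * (η + I * (lam j / 2))))
    := by
  rw [← integral_gauss (fun j => by simpa using hη), ← integral_comp_isometry O]
  refine integral_congr_ae (.of_forall fun y => ?_)
  simp only
  rw [LinearIsometryEquiv.norm_map, LinearIsometryEquiv.inner_map_map, hQ, inner_eq_sum,
    norm_sq_eq_sum, Complex.ofReal_exp, ← exp_add, ← exp_add]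
  congr 1
  push_cast
  rw [mul_sum, mul_sum, mul_sum, ← sum_neg_distrib,
    ← sum_neg_distrib, ← sum_neg_distrib, ← sum_add_distrib,
    ← sum_add_distrib, ← sum_add_distrib]
  exact sum_congr rfl fun j _ => by ring

lemma slit_aux (hl : l ≠ 0) : (π / (I * (l / 2)) : ℂ) ∈ Complex.slitPlane ∧
    (π * (4 * (I * (l / 2))) : ℂ) ∈ Complex.slitPlane := by
  have h1 : (π / (I * (l / 2)) : ℂ) = ((-(2 * π / l) : ℝ) : ℂ) * I := by
    have : (l : ℂ) ≠ 0 := by exact_mod_cast hl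
    push_cast
    field_simp
    rw [Complex.I_sq]; ring
  have h2 : (π * (4 * (I * (l / 2))) : ℂ) = ((2 * π * l : ℝ) : ℂ) * I := by push_cast; ring
  rw [h1, h2]
  refine ⟨Complex.mem_slitPlane_iff.2 (Or.inr ?_), Complex.mem_slitPlane_iff.2 (Or.inr ?_)⟩
  · rw [Complex.im_ofReal_mul]
    simp [hl, Real.pi_ne_zero]
  · rw [Complex.im_ofReal_mul]
    simp [hl, Real.pi_ne_zero]

lemma tendsto_regularized (hlam : ∀ j, lam j ≠ 0) (hQ : ∀ y, Q (O y) = ∑ j, lam j / 2 * y j ^ 2)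
    (x : Euc d) :
    Lim₀ (fun η : ℝ => c𝕋 d * ∫ y : Euc d, 𝐆[η, y] * (𝐞⁻[⟪x, y⟫] *
        𝐞⁻[(Q y : ℝ)])) (diagKernel lam (O.symm x)) := by
  have h1 : ContinuousAt (fun η : ℝ => c𝕋 d * ∏ j, (π / (η + I * (lam j / 2))) ^ (1 / 2 : ℂ) *
        exp ((-(I * (O.symm x) j)) ^ 2 / (4 * (η + I * (lam j / 2))))) 0 := by
    refine continuousAt_const.mul (tendsto_finsetProd _ fun j _ => ?_)
    have hb : ((0 : ℝ) : ℂ) + I * (lam j / 2) ≠ 0 := by simp [hlam j]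
    have hc : ContinuousAt (fun η : ℝ => (η : ℂ) + I * (lam j / 2)) 0 := by fun_prop
    refine .mul (ContinuousAt.cpow (continuousAt_const.div hc hb) continuousAt_const ?_)
      (ContinuousAt.cexp (continuousAt_const.div (continuousAt_const.mul hc) (by simpa using hb)))
    simpa using (slit_aux (hlam j)).1
  have h2 := h1.tendsto.mono_left (nhdsWithin_le_nhds (s := Set.Ioi 0))
  rw [Complex.ofReal_zero] at h2
  simp only [zero_add] at h2
  refine h2.congr' ?_
  filter_upwards [self_mem_nhdsWithin] with η hη
  rw [← integral_regularized hQ hη (O.symm x), LinearIsometryEquiv.apply_symm_apply]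

lemma oscFourierInv_eq (hlam : ∀ j, lam j ≠ 0) (hQ : ∀ y, Q (O y) = ∑ j, lam j / 2 * y j ^ 2)
    (x : Euc d) :
    oscFourierInv (fun y => 𝐞⁻[(Q y : ℝ)]) x = diagKernel lam (O.symm x) :=
  (tendsto_regularized hlam hQ x).limUnder_eq

lemma continuous_diagKernel : Continuous (diagKernel lam : Euc d → ℂ) := by
  unfold diagKernel
  fun_prop

lemma norm_exp_sq_div_le_one (x : ℝ) {b : ℂ} (hb : 0 ≤ b.re) :
    ‖exp (-((x : ℂ) ^ 2 / (4 * b)))‖ ≤ 1 := by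
  rw [Complex.norm_exp, Real.exp_le_one_iff]
  have h1 : (x : ℂ) ^ 2 / (4 * b) = ((x ^ 2 / 4 : ℝ) : ℂ) * b⁻¹ := by
    push_cast; rw [div_mul_eq_div_div, div_eq_mul_inv]
  rw [h1, Complex.neg_re, Complex.re_ofReal_mul, Complex.inv_re]
  have : 0 ≤ x ^ 2 / 4 * (b.re / Complex.normSq b) :=
    mul_nonneg (by positivity) (div_nonneg hb (Complex.normSq_nonneg b))
  linarith

lemma norm_diagKernel_le : ∃ B, ∀ x : Euc d, ‖diagKernel lam x‖ ≤ B := by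
  refine ⟨‖c𝕋 d‖ * ∏ j, (‖(π / (I * (lam j / 2)) : ℂ) ^ (1 / 2 : ℂ)‖ * 1), fun x => ?_⟩
  rw [diagKernel, norm_mul, norm_prod]
  gcongr with j
  rw [norm_mul]
  gcongr
  have := norm_exp_sq_div_le_one (x j) (b := I * (lam j / 2)) (by simp)
  refine le_trans (le_of_eq ?_) this
  rw [neg_sq, mul_pow, Complex.I_sq]
  congr 2; ring

/-- The Gaussian-regularized Fourier transform of the kernel. -/
lemma integral_diagKernel (hη : 0 < η) (s : Euc d) (O : Euc d ≃ₗᵢ[ℝ] Euc d) : ∫ x : Euc d,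
    𝐆[η, x] * (𝐞[⟪O s, x⟫] * diagKernel lam (O.symm x)) = c𝕋 d * ∏ j,
    ((π / (I * (lam j / 2))) ^ (1 / 2 : ℂ) * ((π / (η + (4 * (I * (lam j / 2)))⁻¹)) ^ (1 / 2 : ℂ) *
    exp (-((s j : ℂ) ^ 2 / (4 * (η + (4 * (I * (lam j / 2)))⁻¹)))))) := by
  have hre : ∀ j, 0 < ((η : ℂ) + (4 * (I * (lam j / 2)))⁻¹).re := fun j => by
    have : ((4 * (I * (lam j / 2)) : ℂ)⁻¹).re = 0 := by rw [Complex.inv_re]; simp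
    rw [Complex.add_re, this]; simpa using hη
  have hg := integral_gauss hre (fun j => I * (s j : ℂ))
  rw [← integral_comp_isometry O]
  simp only [LinearIsometryEquiv.norm_map, LinearIsometryEquiv.inner_map_map,
    LinearIsometryEquiv.symm_apply_apply]
  have h1 : ∀ x : Euc d, 𝐆[η, x] * (𝐞[⟪s, x⟫] * diagKernel lam x) =
      (c𝕋 d * ∏ j, (π / (I * (lam j / 2))) ^ (1 / 2 : ℂ)) *
      exp (-∑ j, ((η : ℂ) + (4 * (I * (lam j / 2)))⁻¹) * (x j : ℂ) ^ 2 +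
        ∑ j, I * (s j : ℂ) * (x j : ℂ)) := fun x => by
    rw [diagKernel, prod_mul_distrib, ← Complex.exp_sum, inner_eq_sum, norm_sq_eq_sum,
      Complex.ofReal_exp]
    have e1 : exp (-∑ j, ((η : ℂ) + (4 * (I * (lam j / 2)))⁻¹) * (x j : ℂ) ^ 2 +
        ∑ j, I * (s j : ℂ) * (x j : ℂ)) =
        exp ((-η * ∑ j, x j ^ 2 : ℝ)) * (𝐞[(∑ j, s j * x j : ℝ)] *
          exp (∑ j, (-(I * (x j : ℂ))) ^ 2 / (4 * (I * (lam j / 2))))) := by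
      rw [← exp_add, ← exp_add]
      congr 1
      push_cast
      rw [mul_sum, mul_sum, ← sum_neg_distrib, ← sum_add_distrib,
        ← sum_add_distrib, ← sum_add_distrib]
      refine sum_congr rfl fun j _ => ?_
      rw [neg_sq, mul_pow, Complex.I_sq]
      ring
    rw [e1]
    ring
  rw [integral_congr_ae (Eventually.of_forall h1), integral_const_mul, hg, mul_assoc,
    ← prod_mul_distrib]
  congr 1
  refine Finset.prod_congr rfl fun j _ => ?_
  rw [mul_pow, Complex.I_sq, neg_one_mul, neg_div]

lemma cpow_half_mul (hl : l ≠ 0) : (π / (I * (l / 2)) : ℂ) ^ (1 / 2 : ℂ) *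
    (π * (4 * (I * (l / 2))) : ℂ) ^ (1 / 2 : ℂ) = ((2 * π : ℝ) : ℂ) := by
  have hl' : (l : ℂ) ≠ 0 := by exact_mod_cast hl
  set w : ℂ := π / (I * (l / 2)) with hw
  have hw0 : w ≠ 0 := by simp [hw, hl', Real.pi_ne_zero]
  have h1 : (π * (4 * (I * (l / 2))) : ℂ) = (((2 * π) ^ 2 : ℝ) : ℂ) * w⁻¹ := by
    rw [hw]; push_cast
    have : (π : ℂ) ≠ 0 := by exact_mod_cast Real.pi_ne_zero
    field_simp; ring
  have harg : w.arg ≠ π := Complex.slitPlane_arg_ne_pi (slit_aux hl).1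
  have hR : (0 : ℝ) < (2 * π) ^ 2 := by positivity
  have hR0 : (((2 * π) ^ 2 : ℝ) : ℂ) * w⁻¹ ≠ 0 :=
    mul_ne_zero (by exact_mod_cast hR.ne') (inv_ne_zero hw0)
  rw [h1, Complex.cpow_def_of_ne_zero hw0, Complex.cpow_def_of_ne_zero hR0,
    Complex.log_ofReal_mul hR (inv_ne_zero hw0), Complex.log_inv _ harg, ← exp_add,
    Real.log_pow]
  have e : Complex.log w * (1 / 2) + (((2 : ℕ) * Real.log (2 * π) : ℝ) + -Complex.log w) * (1 / 2) =
      ((Real.log (2 * π) : ℝ) : ℂ) := by push_cast; ring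
  rw [e, ← Complex.ofReal_exp, Real.exp_log (by positivity)]

lemma norm_integral_diagKernel_le (hlam : ∀ j, lam j ≠ 0) :
    ∃ M, ∀ η : ℝ, 0 < η → ∀ s : Euc d, ‖∫ x : Euc d, 𝐆[η, x] *
      (𝐞[⟪s, x⟫] * diagKernel lam (O.symm x))‖ ≤ M := by
  refine ⟨‖c𝕋 d‖ * ∏ j, (‖(π / (I * (lam j / 2)) : ℂ) ^
    (1 / 2 : ℂ)‖ * ((π * (2 * |lam j|)) ^ (1 / 2 : ℝ) * 1)), fun η hη s => ?_⟩
  have h := integral_diagKernel (lam := lam) hη (O.symm s) O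
  rw [LinearIsometryEquiv.apply_symm_apply] at h
  rw [h, norm_mul, norm_prod]
  gcongr with j
  rw [norm_mul, norm_mul]
  have hinv : (4 * (I * (lam j / 2)) : ℂ)⁻¹ = ((-(2 * lam j)⁻¹ : ℝ) : ℂ) * I := by
    have : (lam j : ℂ) ≠ 0 := by exact_mod_cast hlam j
    push_cast
    field_simp
    rw [Complex.I_sq]; ring
  have hre : ((η : ℂ) + (4 * (I * (lam j / 2)))⁻¹).re = η := by
    rw [hinv, Complex.add_re, Complex.re_ofReal_mul]; simp
  have him : ((η : ℂ) + (4 * (I * (lam j / 2)))⁻¹).im = -(2 * lam j)⁻¹ := by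
    rw [hinv, Complex.add_im, Complex.im_ofReal_mul]; simp
  gcongr
  · have e : ((1 : ℂ) / 2) = ((1 / 2 : ℝ) : ℂ) := by push_cast; ring
    rw [e, Complex.norm_cpow_real]
    refine rpow_le_rpow (norm_nonneg _) ?_ (by norm_num)
    rw [norm_div, norm_real, norm_of_nonneg pi_pos.le, div_eq_mul_inv]
    gcongr
    have hb := Complex.abs_im_le_norm ((η : ℂ) + (4 * (I * (lam j / 2)))⁻¹)
    rw [him, abs_neg, abs_inv, abs_mul, abs_two] at hb
    have hpos : 0 < 2 * |lam j| := by have := abs_pos.2 (hlam j); positivity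
    rw [inv_le_comm₀ (lt_of_lt_of_le (inv_pos.2 hpos) hb) hpos]
    exact hb
  · exact norm_exp_sq_div_le_one _ (by rw [hre]; exact hη.le)

lemma tendsto_integral_diagKernel (hlam : ∀ j, lam j ≠ 0)
    (hQ : ∀ y, Q (O y) = ∑ j, lam j / 2 * y j ^ 2) (s : Euc d) :
    Lim₀ (fun η : ℝ => ∫ x : Euc d, 𝐆[η, x] *
      (𝐞[⟪s, x⟫] * diagKernel lam (O.symm x))) (𝐞⁻[(Q s : ℝ)]) := by
  set y := O.symm s with hy
  have hc : ContinuousAt (fun η : ℝ => c𝕋 d * ∏ j, ((π / (I * (lam j / 2))) ^ (1 / 2 : ℂ) *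
        ((π / (η + (4 * (I * (lam j / 2)))⁻¹)) ^ (1 / 2 : ℂ) *
        exp (-((y j : ℂ) ^ 2 / (4 * (η + (4 * (I * (lam j / 2)))⁻¹))))))) 0 := by
    refine continuousAt_const.mul (tendsto_finsetProd _ fun j _ => ContinuousAt.mul
      continuousAt_const ?_)
    have hb : ((0 : ℝ) : ℂ) + (4 * (I * (lam j / 2)))⁻¹ ≠ 0 := by simp [hlam j]
    have hc : ContinuousAt (fun η : ℝ => (η : ℂ) + (4 * (I * (lam j / 2)))⁻¹) 0 := by fun_prop
    refine .mul (ContinuousAt.cpow (continuousAt_const.div hc hb) continuousAt_const ?_)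
      (ContinuousAt.cexp (continuousAt_const.div (continuousAt_const.mul hc) (by simpa using hb)).neg)
    rw [Complex.ofReal_zero, zero_add, div_inv_eq_mul]
    exact (slit_aux (hlam j)).2
  have h2 := hc.tendsto.mono_left (nhdsWithin_le_nhds (s := Set.Ioi 0))
  rw [Complex.ofReal_zero] at h2
  have hval : c𝕋 d * ∏ j, ((π / (I * (lam j / 2))) ^ (1 / 2 : ℂ) *
        ((π / (0 + (4 * (I * (lam j / 2)))⁻¹)) ^ (1 / 2 : ℂ) *
        exp (-((y j : ℂ) ^ 2 / (4 * (0 + (4 * (I * (lam j / 2)))⁻¹)))))) =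
      𝐞⁻[(Q s : ℝ)] := by
    have h3 : ∀ j, (π / (I * (lam j / 2)) : ℂ) ^ (1 / 2 : ℂ) *
        ((π / (0 + (4 * (I * (lam j / 2)))⁻¹)) ^ (1 / 2 : ℂ) *
        exp (-((y j : ℂ) ^ 2 / (4 * (0 + (4 * (I * (lam j / 2)))⁻¹))))) =
        ((2 * π : ℝ) : ℂ) * exp (-(I * (lam j / 2 * (y j : ℂ) ^ 2))) := fun j => by
      rw [zero_add, div_inv_eq_mul, ← mul_assoc, cpow_half_mul (hlam j)]
      congr 3
      rw [div_eq_mul_inv, mul_inv, inv_inv]; ring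
    simp_rw [h3]
    rw [prod_mul_distrib, Finset.prod_const, Finset.card_univ, Fintype.card_fin,
      ← Complex.ofReal_pow, inv_mul_cancel_left₀ (by
        have : (0 : ℝ) < (2 * π) ^ d := by positivity
        exact_mod_cast this.ne'), ← Complex.exp_sum]
    congr 1
    rw [← LinearIsometryEquiv.apply_symm_apply O s, hQ, ← hy]
    push_cast
    rw [mul_sum, sum_neg_distrib]
  rw [hval] at h2
  refine h2.congr' ?_
  filter_upwards [self_mem_nhdsWithin] with η hη
  have h := integral_diagKernel (lam := lam) hη y O
  rw [hy, LinearIsometryEquiv.apply_symm_apply] at h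
  rw [h]

/-- Gaussian summation against the Fourier transform of a finite measure. -/
lemma tendsto_integral_FTRep_mul_kernel {m : Measure (Euc d)} (H : FTRep F m g M) (hlam : ∀ j, lam
    j ≠ 0) (hQ : ∀ y, Q (O y) = ∑ j, lam j / 2 * y j ^ 2) (y : Euc d) : Lim₀ (fun η : ℝ => ∫ x :
    Euc d, 𝐆[η, x] * (F (y - x) * oscFourierInv (fun y => 𝐞⁻[(Q y : ℝ)])
    x)) (∫ s, 𝐞⁻[⟪s, y⟫] * 𝐞⁻[(Q s : ℝ)] * g s ∂m) := by
  have := H.sFinite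
  obtain ⟨B, hB⟩ := norm_integral_diagKernel_le (O := O) hlam
  obtain ⟨B', hB'⟩ := norm_diagKernel_le (lam := lam)
  have hint := H.integrable
  have hswap : ∀ η : ℝ, 0 < η → ∫ x : Euc d, 𝐆[η, x] * (F (y - x) *
      oscFourierInv (fun y => 𝐞⁻[(Q y : ℝ)]) x) =
      ∫ s, 𝐞⁻[⟪s, y⟫] * (∫ x : Euc d, 𝐆[η, x] * (𝐞[⟪s, x⟫] *
          diagKernel lam (O.symm x))) * g s ∂m := fun η hη => by
    have hgi : Integrable (fun x : Euc d => 𝐆[η, x] *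
        diagKernel lam (O.symm x)) := by
      have hG : Integrable (fun x : Euc d => Real.exp (-η * ‖x‖ ^ 2)) := by
        have := (GaussianFourier.integrable_cexp_neg_mul_sq_norm_add (V := Euc d) (b := (η : ℂ))
          (by simpa using hη) 0 0).norm
        refine this.congr (.of_forall fun x => ?_)
        simp only [Complex.norm_exp]
        congr 1
        simp [← Complex.ofReal_pow]
      refine Integrable.mono' (hG.mul_const B') ?_ (.of_forall fun x => ?_)
      · exact (Continuous.aestronglyMeasurable (by
          have := continuous_diagKernel (lam := lam)
          fun_prop))
      · rw [norm_mul, norm_real, norm_of_nonneg (Real.exp_pos _).le]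
        gcongr
        exact hB' _
    have hprod : Integrable (Function.uncurry fun (x s : Euc d) =>
        (𝐆[η, x] * diagKernel lam (O.symm x)) *
          (𝐞⁻[⟪s, y - x⟫] * g s)) (volume.prod m) := by
      have h1 := hgi.mul_prod hint
      have h2 : Continuous fun p : Euc d × Euc d => 𝐞⁻[⟪p.2, y - p.1⟫] := by fun_prop
      refine (h1.bdd_mul h2.aestronglyMeasurable (c := 1) (.of_forall fun p => ?_)).congr
        (.of_forall fun p => ?_)
      · rw [norm_cexp_neg_I_mul]
      · simp only [Function.uncurry]; ring
    calc _ = ∫ x : Euc d, ∫ s, (𝐆[η, x] * diagKernel lam (O.symm x)) *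
          (𝐞⁻[⟪s, y - x⟫] * g s) ∂m := by
          refine integral_congr_ae (.of_forall fun x => ?_)
          simp only
          rw [integral_const_mul, ← H.eq, oscFourierInv_eq hlam hQ]
          ring
      _ = ∫ s, (∫ x : Euc d, (𝐆[η, x] * diagKernel lam (O.symm x)) *
          (𝐞⁻[⟪s, y - x⟫] * g s)) ∂m := integral_integral_swap hprod
      _ = _ := by
          refine integral_congr_ae (.of_forall fun s => ?_)
          simp only
          rw [← integral_const_mul, ← integral_mul_const]
          refine integral_congr_ae (.of_forall fun x => ?_)
          simp only
          rw [inner_sub_right, Complex.ofReal_sub, mul_sub, neg_sub, sub_eq_add_neg, exp_add]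
          ring
  have hlim : Lim₀ (fun η : ℝ => ∫ s, 𝐞⁻[⟪s, y⟫] * (∫ x : Euc d,
        𝐆[η, x] * (𝐞[⟪s, x⟫] *
          diagKernel lam (O.symm x))) * g s ∂m) (∫ s,
        𝐞⁻[⟪s, y⟫] * 𝐞⁻[(Q s : ℝ)] * g s ∂m) := by
    refine tendsto_integral_filter_of_dominated_convergence (fun s => 1 * B * ‖g s‖) ?_ ?_
      (hint.norm.const_mul _) (.of_forall fun s => ?_)
    · filter_upwards [self_mem_nhdsWithin] with η hη
      refine .mul (AEStronglyMeasurable.mul ?_ ?_) hint.1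
      · exact Continuous.aestronglyMeasurable (by fun_prop)
      · have hj : StronglyMeasurable (Function.uncurry fun (s x : Euc d) =>
            𝐆[η, x] * (𝐞[⟪s, x⟫] * diagKernel lam (O.symm x))) := by
          have := continuous_diagKernel (lam := lam)
          exact Continuous.stronglyMeasurable (by unfold Function.uncurry; fun_prop)
        exact hj.integral_prod_right.aestronglyMeasurable
    · filter_upwards [self_mem_nhdsWithin] with η hη
      refine .of_forall fun s => ?_
      rw [norm_mul, norm_mul, norm_cexp_neg_I_mul]
      gcongr
      exact hB η hη s
    · exact (tendsto_const_nhds.mul (tendsto_integral_diagKernel hlam hQ s)).mul tendsto_const_nhds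
  refine hlim.congr' ?_
  filter_upwards [self_mem_nhdsWithin] with η hη using (hswap η hη).symm

end Gauss

end

section

variable {m : Measure (Euc d)}

/-- Diagonalization of a non-degenerate real quadratic form by an isometry. -/
lemma exists_diagonalization {H : Mat d ℝ} (hH : H.IsHermitian) (hdet : H.det ≠ 0) (hc : c ≠ 0) :
    ∃ (O : Euc d ≃ₗᵢ[ℝ] Euc d) (lam : Fin d → ℝ), (∀ j, lam j ≠ 0) ∧ ∀ y : Euc d, c / 2 *
    ((O y).ofLp ⬝ᵥ (H *ᵥ (O y).ofLp)) = ∑ j, lam j / 2 * y j ^ 2 := by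
  refine ⟨hH.eigenvectorBasis.repr.symm, fun j => c * hH.eigenvalues j, fun j => ?_, fun y => ?_⟩
  · refine mul_ne_zero hc fun h => hdet ?_
    rw [hH.det_eq_prod_eigenvalues]
    exact prod_eq_zero (mem_univ j) (by simp [h])
  · set v := hH.eigenvectorBasis.repr.symm y with hv
    have h1 : v = ∑ j, y j • hH.eigenvectorBasis j := (hH.eigenvectorBasis.sum_repr_symm y).symm
    have h2 : v.ofLp = ∑ j, y j • (hH.eigenvectorBasis j).ofLp := by
      conv_lhs => rw [h1]
      simp
    have h3 : H *ᵥ v.ofLp = ∑ j, (y j * hH.eigenvalues j) • (hH.eigenvectorBasis j).ofLp := by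
      rw [h2, mulVec_sum]
      refine sum_congr rfl fun j _ => ?_
      rw [mulVec_smul, hH.mulVec_eigenvectorBasis, smul_smul]
    have h4 : ∀ j, v.ofLp ⬝ᵥ (hH.eigenvectorBasis j).ofLp = y j := fun j => by
      have e1 : ⟪hH.eigenvectorBasis j, v⟫ = y j := by
        rw [← hH.eigenvectorBasis.repr_apply_apply, hv, LinearIsometryEquiv.apply_symm_apply]
      rw [← e1, inner_eq_sum, dotProduct]
      exact sum_congr rfl fun i _ => mul_comm _ _
    rw [h3, dotProduct_sum, mul_sum]
    refine sum_congr rfl fun j _ => ?_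
    rw [dotProduct_smul, h4, smul_eq_mul]
    ring

lemma hess_quadratic [Stable V] (hθ : θ ∈ analyticSet V) (hσ : σ < numBands V) (s : Euc d) :
    s.ofLp ⬝ᵥ (hessOm V σ θ *ᵥ s.ofLp) = D² (om V σ) θ s s := by
  have h1 : ∀ v w : Euc d, D² (om V σ) θ v w =
      ∑ i, v i * D² (om V σ) θ (single i 1) w := fun v w => by
    have := fderiv_apply_eq_sum ((ContinuousLinearMap.apply ℝ ℝ w).comp (D² (om V σ) θ)) v
    simpa using this
  rw [h1, dotProduct]
  refine sum_congr rfl fun i _ => ?_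
  congr 1
  rw [fderiv_apply_eq_sum, mulVec, dotProduct]
  exact sum_congr rfl fun j _ => by rw [hessOm_eq hθ hσ, mul_comm]

lemma isHermitian_hessOm [Stable V] (hθ : θ ∈ analyticSet V) (hσ : σ < numBands V) : (hessOm V σ
    θ).IsHermitian := by
  ext i j
  have h := isSymm_hess hθ hσ 1 (single i 1) (single j 1)
  rw [fderiv_fderiv_phase 1 hθ hσ, one_smul] at h
  rw [conjTranspose_apply, hessOm_eq hθ hσ, hessOm_eq hθ hσ, h]
  simp

lemma inner_gradOm (s θ : Euc d) (σ : ℕ) : ⟪s, gradOm V σ θ⟫ = fderiv ℝ (om V σ) θ s := by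
  rw [real_inner_comm, gradOm, gradient, InnerProductSpace.toDual_symm_apply]

/-- The oscillatory kernel exists as a limit, and `A` is the Fourier integral it stands for. -/
lemma kernel_data [Stable V] (hθ : θ ∈ analyticSet V) (hσ : σ < numBands V)
    (hdet : (hessOm V σ θ).det ≠ 0) (hs : sg = 1 ∨ sg = -1) (hτ : τ ≠ 0) : ∃ (O : Euc d ≃ₗᵢ[ℝ] Euc
    d) (lam : Fin d → ℝ), (∀ j, lam j ≠ 0) ∧ ∀ y : Euc d, sg * (τ / 2) * ((O y).ofLp ⬝ᵥ (hessOm V σ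
    θ *ᵥ (O y).ofLp)) = ∑ j, lam j / 2 * y j ^ 2 := by
  have hc : sg * τ ≠ 0 := mul_ne_zero (by rcases hs with rfl | rfl <;> norm_num) hτ
  obtain ⟨O, lam, h1, h2⟩ := exists_diagonalization (isHermitian_hessOm hθ hσ) hdet hc
  exact ⟨O, lam, h1, fun y => by rw [← h2]; ring⟩

lemma tendsto_kernelK [Stable V] (hθ : θ ∈ analyticSet V) (hσ : σ < numBands V)
    (hdet : (hessOm V σ θ).det ≠ 0) (hs : sg = 1 ∨ sg = -1) (hτ : τ ≠ 0) (x : Euc d) : Lim₀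
    (fun η : ℝ => c𝕋 d * ∫ y : Euc d, 𝐆[η, y] * (𝐞⁻[⟪x, y⟫] *
    𝐞⁻[(sg * (τ / 2) * (y.ofLp ⬝ᵥ (hessOm V σ θ *ᵥ y.ofLp)) : ℝ)])) (kernelK V sg σ τ x θ) := by
  obtain ⟨O, lam, h1, h2⟩ := kernel_data hθ hσ hdet hs hτ
  have h3 := oscFourierInv_eq (O := O) (Q := fun y => sg * (τ / 2) *
    (y.ofLp ⬝ᵥ (hessOm V σ θ *ᵥ y.ofLp))) h1 h2 x
  have h4 := tendsto_regularized (O := O) (Q := fun y => sg * (τ / 2) *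
    (y.ofLp ⬝ᵥ (hessOm V σ θ *ᵥ y.ofLp))) h1 h2 x
  rw [← h3] at h4
  exact h4

lemma tendsto_matA [Stable V] (hθ : θ ∈ analyticSet V) (hσ : σ < numBands V)
    (hdet : (hessOm V σ θ).det ≠ 0) (hs : sg = 1 ∨ sg = -1) (hτ : τ ≠ 0) (H : FTRep (fun y => R0hat
    R0 y θ p q) m g M) (e : ℝ) (r : Euc d) : Lim₀ (fun η : ℝ => ∫ x : Euc d,
    𝐆[η, x] * (R0hat R0 (r + (sg * (τ / e)) • gradOm V σ θ - x) θ p q *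
    kernelK V sg σ τ x θ)) (∫ s, 𝐞⁻[(⟪s, r⟫ + τ / e * fderiv ℝ (phase V sg σ) θ s + τ / 2 * D²
    (phase V sg σ) θ s s : ℝ)] * g s ∂m) := by
  obtain ⟨O, lam, h1, h2⟩ := kernel_data hθ hσ hdet hs hτ
  have h3 := tendsto_integral_FTRep_mul_kernel (O := O) (Q := fun y => sg * (τ / 2) *
    (y.ofLp ⬝ᵥ (hessOm V σ θ *ᵥ y.ofLp))) H h1 h2 (r + (sg * (τ / e)) • gradOm V σ θ)
  have h4 : (∫ s, 𝐞⁻[⟪s, r + (sg * (τ / e)) • gradOm V σ θ⟫] *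
      𝐞⁻[(sg * (τ / 2) * (s.ofLp ⬝ᵥ (hessOm V σ θ *ᵥ s.ofLp)) : ℝ)] *
      g s ∂m) = ∫ s, 𝐞⁻[(⟪s, r⟫ + τ / e * fderiv ℝ (phase V sg σ) θ s +
        τ / 2 * D² (phase V sg σ) θ s s : ℝ)] * g s ∂m := by
    refine integral_congr_ae (.of_forall fun s => ?_)
    simp only
    rw [← exp_add, hess_quadratic hθ hσ, inner_add_right, inner_smul_right,
      inner_gradOm, fderiv_fderiv_phase sg hθ hσ, fderiv_phase sg hθ hσ]
    congr 2
    simp only [_root_.smul_apply, smul_eq_mul]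
    push_cast
    ring
  rw [← h4]
  exact h3

lemma matA_eq [Stable V] (hθ : θ ∈ analyticSet V) (hσ : σ < numBands V) (hdet : (hessOm V σ θ).det
    ≠ 0) (hs : sg = 1 ∨ sg = -1) (hτ : τ ≠ 0) (H : FTRep (fun y => R0hat R0 y θ p q) m g M) (e : ℝ)
    (r : Euc d) : matA V R0 sg σ e τ r θ p q = ∫ s, 𝐞⁻[(⟪s, r⟫ + τ / e * fderiv ℝ (phase V sg σ) θ
    s + τ / 2 * D² (phase V sg σ) θ s s : ℝ)] * g s ∂m :=
  (tendsto_matA hθ hσ hdet hs hτ H e r).limUnder_eq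

lemma norm_matA_le [Stable V] (hθ : θ ∈ analyticSet V) (hσ : σ < numBands V)
    (hdet : (hessOm V σ θ).det ≠ 0) (hs : sg = 1 ∨ sg = -1) (hτ : τ ≠ 0) (H : FTRep (fun y => R0hat
    R0 y θ p q) m g M) (e : ℝ) (r : Euc d) : ‖matA V R0 sg σ e τ r θ p q‖ ≤ M := by
  rw [matA_eq hθ hσ hdet hs hτ H]
  exact H.norm_integral_le _

/-! ### Measurability in `θ` -/

lemma aestronglyMeasurable_hessOm [Stable V] (hσ : σ < numBands V) (i j : Fin d) :
    AEStronglyMeasurable (fun θ => hessOm V σ θ i j) (volume : Measure (Euc d)) := by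
  refine aestronglyMeasurable_of_analyticSet (V := V) fun θ hθ => ?_
  have h1 : ContinuousAt (fun θ => D² (om V σ) θ (single i 1) (single j 1)) θ :=
    ((analyticAt_om hθ hσ).fderiv.fderiv.continuousAt.clm_apply continuousAt_const).clm_apply
      continuousAt_const
  refine h1.congr ?_
  filter_upwards [isOpen_analyticSet.mem_nhds hθ] with x hx
  exact (hessOm_eq hx hσ i j).symm

lemma aestronglyMeasurable_gradOm [Stable V] (hσ : σ < numBands V) : AEStronglyMeasurable
    (gradOm V σ) (volume : Measure (Euc d)) :=
  aestronglyMeasurable_of_analyticSet (V := V) fun _ hθ =>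
    (InnerProductSpace.toDual ℝ (Euc d)).symm.continuous.continuousAt.comp
      (analyticAt_om hθ hσ).fderiv.continuousAt

lemma aestronglyMeasurable_kernelK [Stable V] (hσ : σ < numBands V) (hs : sg = 1 ∨ sg = -1)
    (hτ : τ ≠ 0) : AEStronglyMeasurable (fun q : Euc d × Euc d => kernelK V sg σ τ q.2 q.1)
    ((volume : Measure (Euc d)).prod volume) := by
  have hseq : Tendsto (fun k : ℕ => (1 / ((k : ℝ) + 1))) atTop (𝓝[>] 0) :=
    tendsto_nhdsWithin_iff.2 ⟨tendsto_one_div_add_atTop_nhds_zero_nat,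
      .of_forall fun k => by simp only [Set.mem_Ioi]; positivity⟩
  refine aestronglyMeasurable_of_tendsto_ae (u := atTop) (f := fun (k : ℕ) (q : Euc d × Euc d) =>
    c𝕋 d * ∫ y : Euc d, ((Real.exp (-(1 / ((k : ℝ) + 1)) * ‖y‖ ^ 2) : ℝ) : ℂ) *
        (𝐞⁻[⟪q.2, y⟫] * 𝐞⁻[(sg * (τ / 2) * (y.ofLp ⬝ᵥ (hessOm V σ q.1 *ᵥ y.ofLp)) : ℝ)])) (fun k => ?_) ?_
  · refine .const_mul ?_ _
    refine AEStronglyMeasurable.integral_prod_right' (f := fun w : (Euc d × Euc d) × Euc d =>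
      ((Real.exp (-(1 / ((k : ℝ) + 1)) * ‖w.2‖ ^ 2) : ℝ) : ℂ) *
        (𝐞⁻[⟪w.1.2, w.2⟫] * 𝐞⁻[(sg * (τ / 2) * (w.2.ofLp ⬝ᵥ (hessOm V σ w.1.1 *ᵥ w.2.ofLp)) : ℝ)])) ?_
    have h1 : AEStronglyMeasurable (fun w : (Euc d × Euc d) × Euc d =>
        w.2.ofLp ⬝ᵥ (hessOm V σ w.1.1 *ᵥ w.2.ofLp))
        (((volume : Measure (Euc d)).prod (volume : Measure (Euc d))).prod (volume : Measure (Euc d))) := by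
      simp only [dotProduct, mulVec]
      refine Finset.aestronglyMeasurable_fun_sum _ fun i _ => AEStronglyMeasurable.mul
        (Continuous.aestronglyMeasurable (by fun_prop)) (Finset.aestronglyMeasurable_fun_sum _
          fun j _ => AEStronglyMeasurable.mul ?_ (Continuous.aestronglyMeasurable (by fun_prop)))
      have := (aestronglyMeasurable_hessOm hσ i j)
      exact (this.comp_fst (ν := (volume : Measure (Euc d)))).comp_fst
    refine .mul (Continuous.aestronglyMeasurable (by fun_prop))
      (AEStronglyMeasurable.mul (Continuous.aestronglyMeasurable (by fun_prop)) ?_)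
    have hc : Continuous fun x : ℝ => 𝐞⁻[(sg * (τ / 2) * x : ℝ)] := by fun_prop
    exact hc.comp_aestronglyMeasurable h1
  · have h1 : ∀ᵐ q : Euc d × Euc d ∂((volume : Measure (Euc d)).prod volume),
        q.1 ∈ analyticSet V ∧ (hessOm V σ q.1).det ≠ 0 :=
      Measure.quasiMeasurePreserving_fst.ae ((ae_mem_analyticSet).and (ae_det_hessOm_ne hσ))
    filter_upwards [h1] with q hq
    exact (tendsto_kernelK hq.1 hσ hq.2 hs hτ q.2).comp hseq

lemma measurable_R0hat (hγ : (d : ℝ) < γ) (hI1 : CondI1 C γ R0) (hI4 : CondI4 R0) (p q : Ix n) :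
    Measurable (Function.uncurry fun (y θ : Euc d) => R0hat R0 y θ p q) := by
  refine measurable_uncurry_of_continuous_of_measurable (fun θ => (hI4.1 θ p q).continuous)
    fun y => ?_
  have : (fun θ => R0hat R0 y θ p q) = fsum (fun z => R0 y z p q) := by
    funext θ; exact R0hat_apply hγ hI1 ..
  rw [this]
  exact (continuous_fsum (hI1.summable hγ ..)).measurable

lemma aestronglyMeasurable_integral_gauss_mul {H : Euc d → Euc d → ℂ}
    (hH : Measurable (Function.uncurry H)) {G : Euc d → Euc d}
    (hG : AEStronglyMeasurable G (volume : Measure (Euc d))) {K : Euc d → Euc d → ℂ}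
    (hK : AEStronglyMeasurable (fun w : Euc d × Euc d => K w.2 w.1)
      ((volume : Measure (Euc d)).prod volume)) (r : Euc d) (c η : ℝ) :
    AEStronglyMeasurable (fun θ => ∫ x : Euc d, ((Real.exp (η * ‖x‖ ^ 2) : ℝ) : ℂ) *
      (H (r + c • G θ - x) θ * K x θ)) (volume : Measure (Euc d)) := by
  refine AEStronglyMeasurable.integral_prod_right' (f := fun w : Euc d × Euc d =>
    ((Real.exp (η * ‖w.2‖ ^ 2) : ℝ) : ℂ) * (H (r + c • G w.1 - w.2) w.1 * K w.2 w.1)) ?_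
  have hg := (hG.comp_fst (ν := (volume : Measure (Euc d)))).aemeasurable
  have hm : AEMeasurable (fun w : Euc d × Euc d =>
      ((r + c • G w.1 - w.2, w.1) : Euc d × Euc d)) ((volume : Measure (Euc d)).prod volume) :=
    (((hg.const_smul c).const_add r).sub measurable_snd.aemeasurable).prodMk
      measurable_fst.aemeasurable
  have h1 : AEStronglyMeasurable (fun w : Euc d × Euc d => H (r + c • G w.1 - w.2) w.1)
      ((volume : Measure (Euc d)).prod volume) :=
    (hH.comp_aemeasurable hm).aestronglyMeasurable
  have h2 : AEStronglyMeasurable (fun w : Euc d × Euc d => ((Real.exp (η * ‖w.2‖ ^ 2) : ℝ) : ℂ))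
      ((volume : Measure (Euc d)).prod volume) := by
    have : Continuous fun w : Euc d × Euc d => ((Real.exp (η * ‖w.2‖ ^ 2) : ℝ) : ℂ) := by fun_prop
    exact this.aestronglyMeasurable
  exact h2.mul (h1.mul hK)

lemma aestronglyMeasurable_matA [Stable V] (hσ : σ < numBands V) (hs : sg = 1 ∨ sg = -1)
    (hτ : τ ≠ 0) (hγ : (d : ℝ) < γ) (hI1 : CondI1 C γ R0) (hI4 : CondI4 R0) (p q : Ix n)
    {m : Euc d → Measure (Euc d)} {g : Euc d → Euc d → ℂ} (H : ∀ θ, FTRep (fun y => R0hat R0 y θ p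
    q) (m θ) (g θ) M) (e : ℝ) (r : Euc d) : AEStronglyMeasurable (fun θ => matA V R0 sg σ e τ r θ p
    q) (volume : Measure (Euc d)) := by
  have hseq : Tendsto (fun k : ℕ => (1 / ((k : ℝ) + 1))) atTop (𝓝[>] 0) :=
    tendsto_nhdsWithin_iff.2 ⟨tendsto_one_div_add_atTop_nhds_zero_nat,
      .of_forall fun k => by simp only [Set.mem_Ioi]; positivity⟩
  refine aestronglyMeasurable_of_tendsto_ae atTop
    (fun k : ℕ => aestronglyMeasurable_integral_gauss_mul (measurable_R0hat hγ hI1 hI4 p q)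
      (aestronglyMeasurable_gradOm hσ)
      (aestronglyMeasurable_kernelK hσ hs hτ) r (sg * (τ / e))
      (-(1 / ((k : ℝ) + 1)))) ?_
  filter_upwards [ae_mem_analyticSet (V := V), ae_det_hessOm_ne hσ] with θ h1 h2
  rw [matA_eq h1 hσ h2 hs hτ (H θ)]
  exact (tendsto_matA h1 hσ h2 hs hτ (H θ) e r).comp hseq

end

section

/-- The weight `(1 + |z|²)^α`. -/
def pointWeight (α : ℝ) (z : Lat d) : ℝ := (1 + ‖toEuc z‖ ^ 2) ^ α

lemma pointWeight_pos (α : ℝ) (z : Lat d) : 0 < pointWeight α z := by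
  unfold pointWeight; positivity

variable [NeZero d]

/-! ### The phase space -/

instance instBorelSpacePhaseSpace : BorelSpace (PhaseSpace d n α) := ⟨rfl⟩

lemma lintegral_weight (f : HalfLat d → ENNReal) :
    ∫⁻ x, f x ∂weight d α = ∑' x : HalfLat d, ofReal (pointWeight α x.1) * f x := by
  rw [weight, lintegral_sum_measure]
  refine tsum_congr fun x => ?_
  rw [lintegral_smul_measure, lintegral_dirac]
  rfl

lemma ae_weight_iff {P : HalfLat d → Prop} : (∀ᵐ x ∂weight d α, P x) ↔ ∀ x, P x := by
  rw [weight, Measure.ae_sum_iff]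
  refine forall_congr' fun x => ?_
  rw [Measure.ae_ennreal_smul_measure_iff (by
    simpa using Real.rpow_pos_of_pos (by positivity : (0 : ℝ) < 1 + ‖toEuc x.1‖ ^ 2) α)]
  simp

lemma eLpNorm_weight_sq {E : Type*} [NormedAddCommGroup E] (f : HalfLat d → E) :
    eLpNorm f 2 (weight d α) ^ 2 = ∑' x : HalfLat d, ofReal (pointWeight α x.1) * ‖f x‖ₑ ^ 2 := by
  have h := eLpNorm_nnreal_pow_eq_lintegral (f := f) (μ := weight d α) (p := 2) two_ne_zero
  have h2 : ((2 : NNReal) : ENNReal) = 2 := rfl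
  have h3 : ((2 : NNReal) : ℝ) = ((2 : ℕ) : ℝ) := by norm_num
  rw [h2, h3, ENNReal.rpow_natCast] at h
  rw [h, lintegral_weight]
  refine tsum_congr fun x => ?_
  rw [ENNReal.rpow_natCast]

lemma memLp_weight_iff {E : Type*} [NormedAddCommGroup E] (f : HalfLat d → E) :
    MemLp f 2 (weight d α) ↔ ∑' x : HalfLat d, ofReal (pointWeight α x.1) * ‖f x‖ₑ ^ 2 ≠ ⊤ := by
  rw [← eLpNorm_weight_sq]
  constructor
  · intro h
    exact ENNReal.pow_ne_top h.2.ne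
  · intro h
    exact ⟨StronglyMeasurable.of_discrete.aestronglyMeasurable,
      lt_top_iff_ne_top.2 fun h2 => h (by rw [h2]; rfl)⟩

lemma enorm_phaseSpace_sq (Y : PhaseSpace d n α) :
    ‖Y‖ₑ ^ 2 = ∑' x : HalfLat d, ofReal (pointWeight α x.1) * ‖Y x‖ₑ ^ 2 := by
  rw [Lp.enorm_def, eLpNorm_weight_sq]

lemma toLp_weight_apply {f : HalfLat d → EuclideanSpace ℝ (Ix n)} (hf : MemLp f 2 (weight d α))
    (x : HalfLat d) : hf.toLp f x = f x :=
  ae_weight_iff.1 hf.coeFn_toLp x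

lemma ev_of_pos (Y : PhaseSpace d n α) (hz : 0 < z 0) (p : Ix n) : ev Y z p = Y ⟨z, hz⟩ p := dif_pos hz

lemma ev_of_nonpos (Y : PhaseSpace d n α) (hz : ¬ 0 < z 0) (p : Ix n) : ev Y z p = 0 := dif_neg hz

lemma ext_ev {Y Z : PhaseSpace d n α} (h : ∀ z, 0 < z 0 → ∀ p, ev Y z p = ev Z z p) : Y = Z := by
  refine Lp.ext (ae_weight_iff.2 fun x => ?_)
  ext p
  have := h x.1 x.2 p
  rwa [ev_of_pos _ x.2, ev_of_pos _ x.2] at this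

lemma ev_add (Y Z : PhaseSpace d n α) (z : Lat d) (p : Ix n) :
    ev (Y + Z) z p = ev Y z p + ev Z z p := by
  by_cases hz : 0 < z 0
  · rw [ev_of_pos _ hz, ev_of_pos _ hz, ev_of_pos _ hz, ae_weight_iff.1 (Lp.coeFn_add Y Z) ⟨z, hz⟩]
    rfl
  · simp [ev_of_nonpos _ hz]

lemma ev_smul (c : ℝ) (Y : PhaseSpace d n α) (z : Lat d) (p : Ix n) :
    ev (c • Y) z p = c * ev Y z p := by
  by_cases hz : 0 < z 0
  · rw [ev_of_pos _ hz, ev_of_pos _ hz, ae_weight_iff.1 (Lp.coeFn_smul c Y) ⟨z, hz⟩]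
    rfl
  · simp [ev_of_nonpos _ hz]

lemma enorm_ev_sq_le (Y : PhaseSpace d n α) (x : HalfLat d) (p : Ix n) :
    ‖ev Y x.1 p‖ₑ ^ 2 ≤ ‖Y x‖ₑ ^ 2 := by
  rw [ev_of_pos Y x.2]
  have h : ‖Y x p‖ₑ ≤ ‖Y x‖ₑ := enorm_le_iff_norm_le.2 (PiLp.norm_apply_le (Y x) p)
  gcongr

lemma tsum_ev_sq_le (Y : PhaseSpace d n α) (p : Ix n) :
    ∑' y : Lat d, ofReal (pointWeight α y) * ‖ev Y y p‖ₑ ^ 2 ≤ ‖Y‖ₑ ^ 2 := by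
  rw [enorm_phaseSpace_sq]
  have h1 : ∑' y : Lat d, ofReal (pointWeight α y) * ‖ev Y y p‖ₑ ^ 2 =
      ∑' x : HalfLat d, ofReal (pointWeight α x.1) * ‖ev Y x.1 p‖ₑ ^ 2 := by
    refine (tsum_subtype_eq_of_support_subset (s := {z : Lat d | 0 < z 0}) (f := fun y : Lat d =>
      ofReal (pointWeight α y) * ‖ev Y y p‖ₑ ^ 2) ?_).symm
    intro y hy
    by_contra h
    exact hy (by simp [ev_of_nonpos Y h])
  rw [h1]
  exact ENNReal.tsum_le_tsum fun x => mul_le_mul_right (enorm_ev_sq_le Y x p) _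

/-- The coordinate functionals. -/
def evL (α : ℝ) (z : Lat d) (p : Ix n) : PhaseSpace d n α →L[ℝ] ℝ := LinearMap.mkContinuous
    { toFun := fun Y => ev Y z p, map_add' := fun Y Z => ev_add Y Z z p
      map_smul' := fun c Y => ev_smul c Y z p } (√(pointWeight α z))⁻¹ fun Y => by
    have h1 : ofReal (pointWeight α z) * ‖ev Y z p‖ₑ ^ 2 ≤ ‖Y‖ₑ ^ 2 :=
      (ENNReal.le_tsum z).trans (tsum_ev_sq_le Y p)
    have h2 : pointWeight α z * ‖ev Y z p‖ ^ 2 ≤ ‖Y‖ ^ 2 := by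
      rw [← ofReal_norm, ← ofReal_norm, ← ENNReal.ofReal_pow (norm_nonneg _),
        ← ENNReal.ofReal_pow (norm_nonneg _), ← ENNReal.ofReal_mul (pointWeight_pos α z).le,
        ENNReal.ofReal_le_ofReal_iff (by positivity)] at h1
      exact h1
    have hw := pointWeight_pos α z
    change ‖ev Y z p‖ ≤ _
    rw [inv_mul_eq_div, le_div_iff₀ (Real.sqrt_pos.2 hw)]
    refine abs_le_of_sq_le_sq' ?_ (norm_nonneg _) |>.2
    rw [mul_pow, Real.sq_sqrt hw.le]
    linarith

@[simp] lemma evL_apply (z : Lat d) (p : Ix n) (Y : PhaseSpace d n α) : evL α z p Y = ev Y z p :=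
  rfl

/-- The vector in direction `q` concentrated at a single site. -/
def siteVec (x : HalfLat d) (q : Ix n) : HalfLat d → EuclideanSpace ℝ (Ix n) :=
  Pi.single x (single q 1)

lemma memLp_siteVec (x : HalfLat d) (q : Ix n) : MemLp (siteVec x q) 2 (weight d α) := by
  rw [memLp_weight_iff, tsum_eq_single x]
  · exact ENNReal.mul_ne_top ENNReal.ofReal_ne_top (ENNReal.pow_ne_top enorm_ne_top)
  · intro y hy
    simp [siteVec, hy]

/-- The element of the phase space concentrated at a single site. -/
def site (α : ℝ) (x : HalfLat d) (q : Ix n) : PhaseSpace d n α := (memLp_siteVec x q).toLp _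

lemma ev_site (x : HalfLat d) (q : Ix n) (hz : 0 < z 0) (p : Ix n) : ev (site α x q) z p = if z =
    x.1 ∧ p = q then 1 else 0 := by
  rw [ev_of_pos _ hz, site, toLp_weight_apply, siteVec]
  by_cases h : z = x.1
  · have : (⟨z, hz⟩ : HalfLat d) = x := Subtype.ext h
    rw [this]
    simp [h]
  · have : (⟨z, hz⟩ : HalfLat d) ≠ x := fun h' => h (congrArg Subtype.val h')
    simp [Pi.single_eq_of_ne this, h]

/-- A continuous functional on the phase space is the sum over the sites of its coordinates. -/
lemma hasSum_functional (φ : PhaseSpace d n α →L[ℝ] ℝ) (Y : PhaseSpace d n α) :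
    HasSum (fun x : HalfLat d => ∑ q, φ (site α x q) * ev Y x.1 q) (φ Y) := by
  have key : ∀ Z : PhaseSpace d n α, HasSum (fun x : HalfLat d => pointWeight α x.1 *
      ⟪((InnerProductSpace.toDual ℝ (PhaseSpace d n α)).symm φ) x, Z x⟫) (φ Z) := fun Z => by
    set g := (InnerProductSpace.toDual ℝ (PhaseSpace d n α)).symm φ with hg
    have h1 : φ Z = ⟪g, Z⟫ := by rw [hg, InnerProductSpace.toDual_symm_apply]
    rw [h1, L2.inner_def]
    have h2 := hasSum_integral_measure (L2.integrable_inner (𝕜 := ℝ) g Z : Integrable (fun x =>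
      ⟪g x, Z x⟫) (weight d α))
    refine h2.congr_fun fun x => ?_
    rw [integral_smul_measure, integral_dirac, smul_eq_mul]
    exact congrArg (· * _) (ENNReal.toReal_ofReal (pointWeight_pos α x.1).le).symm
  have hsite : ∀ (x : HalfLat d) (q : Ix n), φ (site α x q) = pointWeight α x.1 *
      ((InnerProductSpace.toDual ℝ (PhaseSpace d n α)).symm φ) x q := fun x q => by
    refine (key (site α x q)).unique ?_
    refine (hasSum_ite_eq x (pointWeight α x.1 *
      ((InnerProductSpace.toDual ℝ (PhaseSpace d n α)).symm φ) x q)).congr_fun fun y => ?_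
    rw [site, toLp_weight_apply, siteVec]
    by_cases h : y = x
    · rw [h, if_pos rfl, Pi.single_eq_same, EuclideanSpace.inner_single_right]
      simp
    · simp [h]
  refine (key Y).congr_fun fun x => ?_
  rw [PiLp.inner_apply, mul_sum]
  refine sum_congr rfl fun q _ => ?_
  rw [hsite, ev_of_pos Y x.2, mul_assoc]
  congr 1
  exact mul_comm _ _

end

section

lemma norm_toEuc_eq_abs_pow_le (z x : Lat d) :
    1 + ‖toEuc x‖ ^ 2 ≤ (2 * (1 + ‖toEuc z‖)) ^ 2 * (1 + ‖toEuc (x - z)‖ ^ 2) := by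
  have h : ‖toEuc x‖ ≤ ‖toEuc (x - z)‖ + ‖toEuc z‖ := by
    have : toEuc x = toEuc (x - z) + toEuc z := by rw [← toEuc_add, sub_add_cancel]
    rw [this]; exact norm_add_le _ _
  have h1 := norm_nonneg (toEuc x)
  have h2 := norm_nonneg (toEuc (x - z))
  have h3 := norm_nonneg (toEuc z)
  have h4 : ‖toEuc x‖ ^ 2 ≤ (‖toEuc (x - z)‖ + ‖toEuc z‖) ^ 2 := by gcongr
  nlinarith [sq_nonneg (‖toEuc (x - z)‖ - ‖toEuc z‖), mul_nonneg h3 (sq_nonneg ‖toEuc (x - z)‖),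
    mul_nonneg (sq_nonneg ‖toEuc z‖) (sq_nonneg ‖toEuc (x - z)‖)]

lemma pointWeight_le {m : ℕ} (hm : |α| ≤ m) (z x : Lat d) :
    pointWeight α x ≤ ((2 * (1 + ‖toEuc z‖)) ^ m) ^ 2 * pointWeight α (x - z) := by
  have h3 := norm_nonneg (toEuc z)
  set P : ℝ := (2 * (1 + ‖toEuc z‖)) ^ 2 with hP
  have hP1 : 1 ≤ P := by rw [hP]; nlinarith
  have hPm : ((2 * (1 + ‖toEuc z‖)) ^ m) ^ 2 = P ^ (m : ℝ) := by
    rw [hP, Real.rpow_natCast]; exact pow_right_comm ..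
  have hle : P ^ |α| ≤ P ^ (m : ℝ) := Real.rpow_le_rpow_of_exponent_le hP1 hm
  rw [hPm]
  unfold pointWeight
  set X : ℝ := 1 + ‖toEuc x‖ ^ 2 with hX
  set Y : ℝ := 1 + ‖toEuc (x - z)‖ ^ 2 with hY
  have hX0 : 0 < X := by positivity
  have hY0 : 0 < Y := by positivity
  have h5 : X ≤ P * Y := norm_toEuc_eq_abs_pow_le z x
  have h6 : Y ≤ P * X := by
    have h7 := norm_toEuc_eq_abs_pow_le (-z) (x - z)
    rw [toEuc_neg, norm_neg, sub_neg_eq_add, sub_add_cancel] at h7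
    exact h7
  refine le_trans ?_ (mul_le_mul_of_nonneg_right hle (Real.rpow_nonneg hY0.le _))
  rcases le_total 0 α with h | h
  · rw [abs_of_nonneg h, ← Real.mul_rpow (by positivity) hY0.le]
    exact rpow_le_rpow hX0.le h5 h
  · rw [abs_of_nonpos h]
    have h8 : Y ^ (-α) ≤ P ^ (-α) * X ^ (-α) := by
      rw [← Real.mul_rpow (by positivity) hX0.le]
      exact rpow_le_rpow hY0.le h6 (by linarith)
    rw [rpow_neg hY0.le, rpow_neg hX0.le] at h8
    have hXa := Real.rpow_pos_of_pos hX0 α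
    have hYa := Real.rpow_pos_of_pos hY0 α
    rw [← div_eq_mul_inv, inv_eq_one_div, div_le_div_iff₀ hYa hXa] at h8
    linarith

/-- The coefficients `[[0, δ], [-V, 0]]` of the first-order system. -/
def genCoeff (V : Lat d → Mat n ℝ) (z : Lat d) : IxMat n ℝ :=
  (!![0, 1; 0, 0] : Mat 2 ℝ) ⊗ₖ (if z = 0 then 1 else 0) + (!![0, 0; -1, 0] : Mat 2 ℝ) ⊗ₖ V z

lemma genCoeff_apply (z : Lat d) (p q : Ix n) : genCoeff V z p q =
    (!![0, 1; 0, 0] : Mat 2 ℝ) p.1 q.1 * (if z = 0 then (1 : Mat n ℝ) p.2 q.2 else 0) +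
    (!![0, 0; -1, 0] : Mat 2 ℝ) p.1 q.1 * V z p.2 q.2 := by
  rw [genCoeff, Matrix.add_apply, kroneckerMap_apply, kroneckerMap_apply]
  split_ifs <;> rfl

lemma CondE1.genCoeff_bound (hE1 : CondE1 V) :
    ∃ C > 0, ∃ κ > 0, ∀ z p q, |genCoeff V z p q| ≤ C * Real.exp (-κ * ‖toEuc z‖) := by
  obtain ⟨C, hC, κ, hκ, h⟩ := hE1
  refine ⟨1 + C, by positivity, κ, hκ, fun z p q => ?_⟩
  have hentry : ∀ (M : Mat 2 ℝ), (M = !![0, 1; 0, 0] ∨ M = !![0, 0; -1, 0]) →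
      ∀ i j, |M i j| ≤ 1 := by
    rintro M (rfl | rfl) i j <;> fin_cases i <;> fin_cases j <;> simp
  rw [genCoeff_apply, add_mul]
  refine (abs_add_le _ _).trans (add_le_add ?_ ?_)
  · rw [abs_mul]
    refine mul_le_mul (hentry _ (Or.inl rfl) _ _) ?_ (abs_nonneg _) zero_le_one
    split_ifs with hz
    · subst hz
      have : toEuc (0 : Lat d) = 0 := toEuc_zero
      rw [this, norm_zero, mul_zero, Real.exp_zero, Matrix.one_apply]
      split_ifs <;> simp
    · rw [abs_zero]; positivity
  · rw [abs_mul]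
    refine (mul_le_mul (hentry _ (Or.inr rfl) _ _) (h z _ _) (abs_nonneg _) zero_le_one).trans ?_
    rw [one_mul]

variable [NeZero d]

lemma refl_refl (z : Lat d) : refl (refl z) = z := by
  funext i
  by_cases h : i = 0
  · subst h; simp [refl]
  · simp [refl, h]

lemma refl_injective : Function.Injective (refl : Lat d → Lat d) :=
  Function.LeftInverse.injective refl_refl

lemma refl_apply_zero (z : Lat d) : refl z 0 = -z 0 := by simp [refl]

lemma refl_sub (x y : Lat d) : refl (x - y) = refl x - refl y := by
  funext i
  by_cases h : i = 0
  · subst h; simp [refl]; ring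
  · simp [refl, h]

lemma norm_toEuc_refl (z : Lat d) : ‖toEuc (refl z)‖ = ‖toEuc z‖ := by
  rw [EuclideanSpace.norm_eq, EuclideanSpace.norm_eq]
  congr 1
  refine sum_congr rfl fun i _ => ?_
  by_cases h : i = 0
  · subst h; simp [refl, toEuc]
  · simp [refl, toEuc, h]

lemma pointWeight_refl (z : Lat d) : pointWeight α (refl z) = pointWeight α z := by
  rw [pointWeight, pointWeight, norm_toEuc_refl]

/-- Composition with an injective map of the lattice, from one coordinate to another. -/
lemma exists_transfer {φ : Lat d → Lat d} (hφ : Function.Injective φ) {K : ℝ} (hK0 : 0 ≤ K)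
    (hK : ∀ x, pointWeight α x ≤ K ^ 2 * pointWeight α (φ x)) (p q : Ix n) :
    ∃ T : PhaseSpace d n α →L[ℝ] PhaseSpace d n α, ‖T‖ ≤ K ∧ ∀ Y z p', 0 < z 0 →
      ev (T Y) z p' = if p' = p then ev Y (φ z) q else 0 := by
  have hbd : ∀ Y : PhaseSpace d n α, ∑' x : HalfLat d, ofReal (pointWeight α x.1) *
      ‖(single p (ev Y (φ x.1) q) : EuclideanSpace ℝ (Ix n))‖ₑ ^ 2 ≤
      ofReal K ^ 2 * ‖Y‖ₑ ^ 2 := fun Y => by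
    calc _ ≤ ∑' x : HalfLat d, ofReal K ^ 2 *
          (ofReal (pointWeight α (φ x.1)) * ‖ev Y (φ x.1) q‖ₑ ^ 2) := by
          refine ENNReal.tsum_le_tsum fun x => ?_
          have h1 : ‖(single p (ev Y (φ x.1) q) : EuclideanSpace ℝ (Ix n))‖ₑ =
              ‖ev Y (φ x.1) q‖ₑ := by
            rw [← ofReal_norm, ← ofReal_norm, PiLp.norm_single]
          rw [h1, ← mul_assoc, ← ENNReal.ofReal_pow hK0, ← ENNReal.ofReal_mul (by positivity)]
          exact mul_le_mul_left (ENNReal.ofReal_le_ofReal (hK x.1)) _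
      _ = ofReal K ^ 2 * ∑' x : HalfLat d,
          (ofReal (pointWeight α (φ x.1)) * ‖ev Y (φ x.1) q‖ₑ ^ 2) :=
          ENNReal.tsum_mul_left
      _ ≤ _ := by
          refine mul_le_mul_right ((ENNReal.tsum_comp_le_tsum_of_injective
            (hφ.comp Subtype.val_injective) fun y : Lat d =>
              ofReal (pointWeight α y) * ‖ev Y y q‖ₑ ^ 2).trans (tsum_ev_sq_le Y q)) _
  have hm : ∀ Y : PhaseSpace d n α, MemLp (fun x : HalfLat d =>
      (single p (ev Y (φ x.1) q) : EuclideanSpace ℝ (Ix n))) 2 (weight d α) := fun Y => by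
    rw [memLp_weight_iff]
    exact ne_top_of_le_ne_top (ENNReal.mul_ne_top (ENNReal.pow_ne_top ENNReal.ofReal_ne_top)
      (ENNReal.pow_ne_top enorm_ne_top)) (hbd Y)
  have hev : ∀ (Y : PhaseSpace d n α) (z : Lat d) (p' : Ix n), 0 < z 0 →
      ev ((hm Y).toLp _) z p' = if p' = p then ev Y (φ z) q else 0 := fun Y z p' hz => by
    rw [ev_of_pos _ hz, toLp_weight_apply]
    simp
  refine ⟨LinearMap.mkContinuous {
      toFun := fun Y => (hm Y).toLp _
      map_add' := fun Y Z => ext_ev fun z hz p' => ?_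
      map_smul' := fun c Y => ext_ev fun z hz p' => ?_ } K fun Y => ?_,
    LinearMap.mkContinuous_norm_le _ hK0 _, hev⟩
  · rw [ev_add, hev _ _ _ hz, hev _ _ _ hz, hev _ _ _ hz, ev_add]
    split_ifs <;> simp
  · rw [RingHom.id_apply, ev_smul, hev _ _ _ hz, hev _ _ _ hz, ev_smul]
    split_ifs <;> simp
  · change ‖(hm Y).toLp _‖ ≤ _
    have h1 : ‖(hm Y).toLp _‖ₑ ^ 2 ≤ ofReal K ^ 2 * ‖Y‖ₑ ^ 2 := by
      rw [enorm_phaseSpace_sq]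
      refine le_trans (le_of_eq (tsum_congr fun x => ?_)) (hbd Y)
      rw [toLp_weight_apply]
    rw [← mul_pow, ← ofReal_norm, ← ofReal_norm, ← ENNReal.ofReal_mul hK0,
      ← ENNReal.ofReal_pow (norm_nonneg _), ← ENNReal.ofReal_pow (by positivity),
      ENNReal.ofReal_le_ofReal_iff (by positivity)] at h1
    exact le_of_sq_le_sq h1 (by positivity)

lemma genCoeff_refl (hr : ∀ z, V (refl z) = V z) (z : Lat d) :
    genCoeff V (refl z) = genCoeff V z := by
  have h : refl z = 0 ↔ z = 0 := by
    constructor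
    · intro h; rw [← refl_refl z, h]; funext i; simp [refl]
    · intro h; rw [h]; funext i; simp [refl]
  rw [genCoeff, genCoeff, hr]
  simp only [h]

/-- The generator of the dynamics in the half-space. -/
lemma exists_generator [Stable V] (α : ℝ) :
    ∃ A : PhaseSpace d n α →L[ℝ] PhaseSpace d n α, ∀ Y z p, 0 < z 0 →
      HasSum (fun y => ∑ q, genCoeff V y p q * (ev Y (z - y) q - ev Y (refl (z - y)) q))
        (ev (A Y) z p) := by
  obtain ⟨m, hm⟩ := exists_nat_ge |α|
  obtain ⟨C, hC, κ, hκ, hb⟩ := (Stable.e1 (V := V)).genCoeff_bound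
  have hK0 : ∀ y : Lat d, 0 ≤ (2 * (1 + ‖toEuc y‖)) ^ m := fun y => by positivity
  choose T₁ hT₁ hT₁' using fun (y : Lat d) (p q : Ix n) => exists_transfer (α := α)
    (φ := fun x => x - y) (sub_left_injective) (hK0 y) (fun x => pointWeight_le hm y x) p q
  choose T₂ hT₂ hT₂' using fun (y : Lat d) (p q : Ix n) => exists_transfer (α := α)
    (φ := fun x => refl (x - y)) (refl_injective.comp sub_left_injective) (hK0 y)
    (fun x => by rw [pointWeight_refl]; exact pointWeight_le hm y x) p q
  set B : Lat d → PhaseSpace d n α →L[ℝ] PhaseSpace d n α := fun y =>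
    ∑ p, ∑ q, genCoeff V y p q • (T₁ y p q - T₂ y p q) with hB
  have hBs : Summable B := by
    have h0 : Summable fun y : Lat d => Real.exp (-κ * ‖toEuc y‖) * (1 + ‖toEuc y‖) ^ m := by
      simpa only [Real.rpow_natCast] using summable_exp_mul_one_add_norm (d := d) hκ m
    have h1 : Summable fun y : Lat d => ∑ _p : Ix n, ∑ _q : Ix n,
        (C * (2 * 2 ^ m)) * (Real.exp (-κ * ‖toEuc y‖) * (1 + ‖toEuc y‖) ^ m) :=
      summable_sum fun _ _ => summable_sum fun _ _ => h0.mul_left _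
    refine .of_norm_bounded h1 fun y => (norm_sum_le _ _).trans (sum_le_sum
      fun p _ => (norm_sum_le _ _).trans (sum_le_sum fun q _ => ?_))
    rw [norm_smul, norm_eq_abs]
    have h2 : ‖T₁ y p q - T₂ y p q‖ ≤ 2 * (2 * (1 + ‖toEuc y‖)) ^ m :=
      (norm_sub_le _ _).trans (by linarith [hT₁ y p q, hT₂ y p q])
    refine (mul_le_mul (hb y p q) h2 (norm_nonneg _) (by positivity)).trans (le_of_eq ?_)
    rw [mul_pow]
    ring
  refine ⟨∑' y, B y, fun Y z p hz => ?_⟩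
  have h3 := ((evL α z p).comp (ContinuousLinearMap.apply ℝ (PhaseSpace d n α) Y)).hasSum hBs.hasSum
  refine h3.congr_fun fun y => ?_
  have h4 : ((evL α z p).comp (ContinuousLinearMap.apply ℝ (PhaseSpace d n α) Y)) (B y) =
      evL α z p (B y Y) := rfl
  rw [h4, hB]
  simp only [_root_.sum_apply, _root_.smul_apply,
    _root_.sub_apply, map_sum, map_smul, map_sub, evL_apply, hT₁' _ _ _ _ _ _ hz,
    hT₂' _ _ _ _ _ _ hz, smul_eq_mul]
  symm
  rw [sum_eq_single p]
  · simp
  · intro p' _ hp'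
    simp [Ne.symm hp']
  · simp

end

section

variable [NeZero d]

/-- The reflection as a permutation of the lattice. -/
def reflEquiv (d : ℕ) [NeZero d] : Lat d ≃ Lat d := ⟨refl, refl, refl_refl, refl_refl⟩

lemma hasSum_halfLat {f : Lat d → ℝ} {S : ℝ} (hf : HasSum f S) (h0 : ∀ y, y 0 = 0 → f y = 0) :
    HasSum (fun x : HalfLat d => f x.1 + f (refl x.1)) S := by
  have hs := hf.summable
  have h1 : HasSum (fun x : HalfLat d => f x.1) (∑' x : HalfLat d, f x.1) :=
    (hs.comp_injective Subtype.val_injective).hasSum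
  have h2 : HasSum (fun x : HalfLat d => f (refl x.1)) (∑' x : HalfLat d, f (refl x.1)) :=
    (hs.comp_injective (refl_injective.comp Subtype.val_injective)).hasSum
  have h3 := h1.add h2
  have hsR : Summable fun y => f (refl y) := hs.comp_injective refl_injective
  have e1 : ∑' x : HalfLat d, f x.1 = ∑' y, Set.indicator {z : Lat d | 0 < z 0} f y :=
    tsum_subtype {z : Lat d | 0 < z 0} f
  have e2 : ∑' x : HalfLat d, f (refl x.1) =
      ∑' y, Set.indicator {z : Lat d | 0 < z 0} (fun y => f (refl y)) (refl y) :=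
    (tsum_subtype {z : Lat d | 0 < z 0} fun y => f (refl y)).trans
      ((reflEquiv d).tsum_eq (Set.indicator {z : Lat d | 0 < z 0} fun y => f (refl y))).symm
  have hs2 : Summable fun y => Set.indicator {z : Lat d | 0 < z 0} (fun y => f (refl y)) (refl y) :=
    (hsR.indicator {z : Lat d | 0 < z 0}).comp_injective refl_injective
  convert h3 using 1
  rw [e1, e2, ← Summable.tsum_add (hs.indicator _) hs2, ← hf.tsum_eq]
  refine tsum_congr fun y => ?_
  simp only [Set.indicator_apply, Set.mem_ofPred_eq, refl_refl, refl_apply_zero]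
  rcases lt_trichotomy (y 0) 0 with h | h | h
  · rw [if_neg (by omega), if_pos (by omega), zero_add]
  · rw [if_neg (by omega), if_neg (by omega), h0 y h, zero_add]
  · rw [if_pos h, if_neg (by omega), add_zero]

/-- `A` acts on odd extensions as the convolution with `genCoeff V`. -/
def IsGenerator (V : Lat d → Mat n ℝ) (A : PhaseSpace d n α →L[ℝ] PhaseSpace d n α) : Prop :=
  ∀ Y z p, 0 < z 0 →
    HasSum (fun y => ∑ q, genCoeff V y p q * (ev Y (z - y) q - ev Y (refl (z - y)) q))
      (ev (A Y) z p)

variable {A : PhaseSpace d n α →L[ℝ] PhaseSpace d n α}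

lemma IsGenerator.ev_fst (hA : IsGenerator V A)
    (Y : PhaseSpace d n α) (hz : 0 < z 0) (k : Fin n) : ev (A Y) z (0, k) = ev Y z (1, k) := by
  refine (hA Y z (0, k) hz).unique ?_
  refine (hasSum_ite_eq (0 : Lat d) (ev Y z (1, k))).congr_fun fun y => ?_
  rw [Fintype.sum_prod_type, Fin.sum_univ_two]
  by_cases hy : y = 0
  · have hz' : ¬ 0 < refl z 0 := by rw [refl_apply_zero]; omega
    simp [genCoeff_apply, hy, Matrix.one_apply, ev_of_nonpos _ hz']
  · simp [genCoeff_apply, hy]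

lemma IsGenerator.ev_snd (hA : IsGenerator V A)
    (Y : PhaseSpace d n α) (hz : 0 < z 0) (k : Fin n) : ev (A Y) z (1, k) = -∑' z' : HalfLat d, ∑ l
    : Fin n, (V (z - z'.1) k l - V (z - refl z'.1) k l) * ev Y z'.1 (0, l) := by
  have h1 := (Equiv.subLeft z).hasSum_iff.2 (hA Y z (1, k) hz)
  have h2 := hasSum_halfLat h1 fun y hy => by
    have hy1 : ¬ 0 < y 0 := by omega
    have hy2 : ¬ 0 < refl y 0 := by rw [refl_apply_zero]; omega
    simp [ev_of_nonpos _ hy1, ev_of_nonpos _ hy2]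
  rw [← h2.tsum_eq, ← tsum_neg]
  refine tsum_congr fun x => ?_
  have hx : ¬ 0 < refl x.1 0 := by rw [refl_apply_zero]; have := x.2; omega
  simp only [Function.comp_apply, Equiv.subLeft_apply, sub_sub_cancel, refl_refl, ev_of_nonpos _ hx]
  rw [Fintype.sum_prod_type, Fintype.sum_prod_type, Fin.sum_univ_two, Fin.sum_univ_two]
  simp only [genCoeff_apply]
  simp [sub_mul, sum_sub_distrib]
  ring

lemma IsGenerator.isSolution_iff (hA : IsGenerator V A) (Y : ℝ → PhaseSpace d n α) :
    IsSolution V Y ↔ Continuous Y ∧ ∀ t z p, 0 < z 0 →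
      HasDerivAt (fun t => ev (Y t) z p) (ev (A (Y t)) z p) t := by
  refine and_congr_right fun _ => ⟨fun h t z p hz => ?_, fun h t z hz k => ?_⟩
  · obtain ⟨i, k⟩ := p
    have := h t z hz k
    rw [← hA.ev_snd (Y t) hz, ← hA.ev_fst (Y t) hz] at this
    fin_cases i
    · exact this.1
    · exact this.2
  · rw [← hA.ev_snd (Y t) hz, ← hA.ev_fst (Y t) hz]
    exact ⟨h t z _ hz, h t z _ hz⟩

lemma hasDerivAt_exp_smul_apply {E : Type*} [NormedAddCommGroup E] [NormedSpace ℝ E]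
    [CompleteSpace E] (A : E →L[ℝ] E) (y : E) (t : ℝ) :
    HasDerivAt (fun t : ℝ => NormedSpace.exp (t • A) y) (A (NormedSpace.exp (t • A) y)) t := by
  have h := (hasDerivAt_exp_smul_const' A t).clm_apply (hasDerivAt_const t y)
  simpa using h

lemma IsGenerator.isSolution_exp (hA : IsGenerator V A) (Y0 : PhaseSpace d n α) :
    IsSolution V fun t => NormedSpace.exp (t • A) Y0 := by
  rw [hA.isSolution_iff]
  refine ⟨continuous_iff_continuousAt.2 fun t => (hasDerivAt_exp_smul_apply A Y0 t).continuousAt,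
    fun t z p _ => ?_⟩
  exact (evL α z p).hasFDerivAt.comp_hasDerivAt t (hasDerivAt_exp_smul_apply A Y0 t)

lemma IsGenerator.eq_exp (hA : IsGenerator V A) {Y : ℝ → PhaseSpace d n α} (hY : IsSolution V Y) :
    Y = fun t => NormedSpace.exp (t • A) (Y 0) := by
  rw [hA.isSolution_iff] at hY
  have hc : Continuous fun s => A (Y s) := A.continuous.comp hY.1
  have hint : ∀ t, Y t = Y 0 + ∫ s in (0 : ℝ)..t, A (Y s) := fun t => by
    refine ext_ev fun z hz p => ?_
    have h1 : ev (∫ s in (0 : ℝ)..t, A (Y s)) z p = ∫ s in (0 : ℝ)..t, ev (A (Y s)) z p :=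
      ((evL α z p).intervalIntegral_comp_comm (hc.intervalIntegrable 0 t)).symm
    rw [ev_add, h1, intervalIntegral.integral_eq_sub_of_hasDerivAt (fun s _ => hY.2 s z p hz)
      (((evL α z p).continuous.comp hc).intervalIntegrable 0 t)]
    ring
  have hd : ∀ t, HasDerivAt Y (A (Y t)) t := fun t => by
    have h2 := (intervalIntegral.integral_hasDerivAt_right (hc.intervalIntegrable 0 t)
      (hc.stronglyMeasurableAtFilter _ _) hc.continuousAt).const_add (Y 0)
    exact h2.congr_of_eventuallyEq (Eventually.of_forall hint)
  refine ODE_solution_unique_univ (v := fun _ y => A y) (s := fun _ => univ) (t₀ := 0)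
    (K := ‖A‖₊) (fun _ => A.lipschitz.lipschitzOnWith) (fun t => ⟨hd t, trivial⟩)
    (fun t => ⟨hasDerivAt_exp_smul_apply A (Y 0) t, trivial⟩) ?_
  simp

lemma IsGenerator.flow_eq (hA : IsGenerator V A)
    (t : ℝ) (Y0 : PhaseSpace d n α) : flow V t Y0 = NormedSpace.exp (t • A) Y0 := by
  have h := Classical.epsilon_spec (p := fun Y : ℝ → PhaseSpace d n α => IsSolution V Y ∧ Y 0 = Y0)
    ⟨fun t => NormedSpace.exp (t • A) Y0, hA.isSolution_exp Y0, by simp⟩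
  have h2 := hA.eq_exp h.1
  rw [h.2] at h2
  exact congrFun h2 t

end

section

lemma fcoef_fsum_mul (ha : Summable fun z => ‖a z‖) (hf : Integrable f (𝕋 d)) (z : Lat d) : HasSum
    (fun y => a y * fcoef f (z - y)) (fcoef (fun θ => fsum a θ * f θ) z) := by
  have h := hasSum_integral_of_summable_integral_norm (μ := 𝕋 d)
    (F := fun (y : Lat d) θ => a y * (𝐞⁻[(z - y) ⋄ θ] * f θ))
    (fun y => (integrable_cexp_mul hf (z - y)).const_mul _) (by
      have : (fun y : Lat d => ∫ θ in cell d, ‖a y * (𝐞⁻[(z - y) ⋄ θ] * f θ)‖) =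
          fun y => ‖a y‖ * ∫ θ in cell d, ‖f θ‖ := by
        funext y
        rw [← integral_const_mul]
        refine integral_congr_ae (.of_forall fun θ => ?_)
        simp only [norm_mul]
        rw [norm_cexp_neg_I_mul, one_mul]
      rw [this]
      exact ha.mul_right _)
  have h2 := h.mul_left c𝕋 d
  have h3 : (∫ θ in cell d, ∑' y : Lat d, a y * (𝐞⁻[(z - y) ⋄ θ] * f θ)) =
      ∫ θ in cell d, 𝐞⁻[z ⋄ θ] * (fsum a θ * f θ) := by
    refine integral_congr_ae (.of_forall fun θ => ?_)
    simp only [fsum]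
    rw [← tsum_mul_right, ← tsum_mul_left]
    refine tsum_congr fun y => ?_
    have : 𝐞⁻[(z - y) ⋄ θ] = 𝐞⁻[z ⋄ θ] * 𝐞[y ⋄ θ] := by
      rw [← exp_add, toEuc_sub, inner_sub_left]
      push_cast
      ring_nf
    rw [this]
    ring
  rw [h3] at h2
  refine h2.congr_fun fun y => ?_
  rw [fcoef, integral_const_mul]
  ring

lemma CondE1.summable_genCoeff (hE1 : CondE1 V) (p q : Ix n) :
    Summable fun z => ‖((genCoeff V z p q : ℝ) : ℂ)‖ := by
  obtain ⟨C, hC, κ, hκ, h⟩ := hE1.genCoeff_bound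
  have h0 := (summable_exp_mul_one_add_norm (d := d) hκ 0).mul_left C
  simp only [Real.rpow_zero, mul_one] at h0
  exact .of_nonneg_of_le (fun z => norm_nonneg _) (fun z => by rw [norm_real]; exact h z p q) h0

lemma fsum_ite_zero (c : ℂ) (θ : Euc d) : fsum (fun z => if z = 0 then c else 0) θ = c := by
  rw [fsum, tsum_eq_single 0 fun z hz => by simp [hz]]
  simp [toEuc_zero]

lemma Ahat_eq_fsum [Stable V] (θ : Euc d) (p q : Ix n) :
    Ahat V θ p q = fsum (fun z => ((genCoeff V z p q : ℝ) : ℂ)) θ := by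
  have h1 : ∀ z, 𝐞[z ⋄ θ] * ((genCoeff V z p q : ℝ) : ℂ) =
      (!![0, 1; 0, 0] : Mat 2 ℂ) p.1 q.1 * (𝐞[z ⋄ θ] * (if z = 0 then (1 : Mat n ℂ) p.2 q.2 else 0)) +
      (!![0, 0; -1, 0] : Mat 2 ℂ) p.1 q.1 * (𝐞[z ⋄ θ] * ((V z p.2 q.2 : ℝ) : ℂ)) := fun z => by
    rw [genCoeff_apply]
    have e1 : ((!![0, 1; 0, 0] : Mat 2 ℂ) p.1 q.1) =
        (((!![0, 1; 0, 0] : Mat 2 ℝ) p.1 q.1 : ℝ) : ℂ) := by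
      obtain ⟨i, -⟩ := p; obtain ⟨j, -⟩ := q; fin_cases i <;> fin_cases j <;> simp
    have e2 : ((!![0, 0; -1, 0] : Mat 2 ℂ) p.1 q.1) =
        (((!![0, 0; -1, 0] : Mat 2 ℝ) p.1 q.1 : ℝ) : ℂ) := by
      obtain ⟨i, -⟩ := p; obtain ⟨j, -⟩ := q; fin_cases i <;> fin_cases j <;> simp
    have e3 : (if z = 0 then (1 : Mat n ℂ) p.2 q.2 else 0) =
        (((if z = 0 then (1 : Mat n ℝ) p.2 q.2 else 0) : ℝ) : ℂ) := by
      simp only [Matrix.one_apply]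
      split_ifs <;> simp
    rw [e1, e2, e3]
    push_cast
    ring
  have hδ : Summable fun z : Lat d => 𝐞[z ⋄ θ] * (if z = 0 then (1 : Mat n ℂ) p.2 q.2 else 0) :=
    summable_of_ne_finset_zero (s := {0}) fun z hz => by simp at hz; simp [hz]
  rw [fsum, tsum_congr h1, Summable.tsum_add (hδ.mul_left _)
    ((summable_cexp_mul (Stable.e1.summable _ _) θ).mul_left _), tsum_mul_left, tsum_mul_left]
  have h2 := fsum_ite_zero ((1 : Mat n ℂ) p.2 q.2) θ
  rw [fsum] at h2
  have h3 := Vhat_apply (V := V) θ p.2 q.2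
  rw [fsum] at h3
  rw [h2, ← h3]
  rfl

lemma continuous_Ahat [Stable V] (p q : Ix n) : Continuous fun θ => Ahat V θ p q := by
  simp only [Ahat_eq_fsum]
  exact continuous_fsum (Stable.e1.summable_genCoeff p q)

lemma continuous_Ahat_pow [Stable V] (k : ℕ) (p q : Ix n) :
    Continuous fun θ => (Ahat V θ ^ k) p q := by
  induction k generalizing p q with
  | zero => simpa using continuous_const
  | succ k ih =>
    simp only [pow_succ', Matrix.mul_apply]
    exact continuous_finsetSum _ fun j _ => (continuous_Ahat p j).mul (ih j q)

/-- The kernel of the `k`-th power of the generator on the whole lattice. -/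
def powCoeff (V : Lat d → Mat n ℝ) (k : ℕ) (z : Lat d) (p q : Ix n) : ℂ :=
  fcoef (fun θ => (Ahat V θ ^ k) p q) z

lemma powCoeff_zero (z : Lat d) (p q : Ix n) :
    powCoeff V 0 z p q = if z = 0 then (1 : IxMat n ℂ) p q else 0 := by
  have h : (fun θ : Euc d => (Ahat V θ ^ 0) p q) =
      fsum (fun z => if z = 0 then (1 : IxMat n ℂ) p q else 0) := by
    funext θ
    rw [fsum_ite_zero, pow_zero]
  rw [powCoeff, h, fcoef_fsum]
  exact summable_of_ne_finset_zero (s := {0}) fun z hz => by simp at hz; simp [hz]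

lemma hasSum_powCoeff_succ [Stable V] (k : ℕ) (z : Lat d) (p q : Ix n) :
    HasSum (fun y => ∑ j, ((genCoeff V y p j : ℝ) : ℂ) * powCoeff V k (z - y) j q)
      (powCoeff V (k + 1) z p q) := by
  have h : ∀ j ∈ (Finset.univ : Finset (Ix n)), HasSum
      (fun y => ((genCoeff V y p j : ℝ) : ℂ) * powCoeff V k (z - y) j q)
      (fcoef (fun θ => Ahat V θ p j * (Ahat V θ ^ k) j q) z) := fun j _ => by
    have := fcoef_fsum_mul ((Stable.e1 (V := V)).summable_genCoeff p j)
      (integrable_cell_of_continuous (continuous_Ahat_pow (V := V) k j q)) z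
    simp only [← Ahat_eq_fsum] at this
    exact this
  have h2 := hasSum_sum h
  have h3 := fcoef_finset_sum Finset.univ (f := fun j θ => Ahat V θ p j * (Ahat V θ ^ k) j q)
    (fun j _ => integrable_cell_of_continuous
      ((continuous_Ahat p j).mul (continuous_Ahat_pow k j q))) z
  have h4 : powCoeff V (k + 1) z p q =
      fcoef (fun θ => ∑ j, Ahat V θ p j * (Ahat V θ ^ k) j q) z := by
    simp only [powCoeff, pow_succ', Matrix.mul_apply]
  rw [h4, h3]
  exact h2

lemma exists_Ahat_pow_bound [Stable V] :
    ∃ M, ∀ k, ∀ θ : Euc d, ∀ p q, ‖(Ahat V θ ^ k) p q‖ ≤ M ^ k := by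
  set B : ℝ := ∑ p : Ix n, ∑ q : Ix n, ∑' z, ‖((genCoeff V z p q : ℝ) : ℂ)‖ with hB
  have hb : ∀ θ : Euc d, ∀ p, ∑ j, ‖Ahat V θ p j‖ ≤ B := fun θ p => by
    have h0 : ∀ p, ∑ j, ‖Ahat V θ p j‖ ≤ ∑ j, ∑' z, ‖((genCoeff V z p j : ℝ) : ℂ)‖ := fun p =>
      sum_le_sum fun j _ => by
        rw [Ahat_eq_fsum]; exact norm_fsum_le (Stable.e1.summable_genCoeff p j) θ
    refine (h0 p).trans ?_
    exact Finset.single_le_sum (f := fun p => ∑ j, ∑' z, ‖((genCoeff V z p j : ℝ) : ℂ)‖)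
      (fun i _ => sum_nonneg fun j _ => tsum_nonneg fun z => norm_nonneg _)
      (mem_univ p)
  refine ⟨B, fun k θ => ?_⟩
  induction k with
  | zero =>
    intro p q
    rw [pow_zero, pow_zero, Matrix.one_apply]
    split_ifs <;> simp
  | succ k ih =>
    intro p q
    rw [pow_succ', Matrix.mul_apply, pow_succ']
    calc _ ≤ ∑ j, ‖Ahat V θ p j‖ * B ^ k := (norm_sum_le _ _).trans (sum_le_sum fun j _ => by
            rw [norm_mul]
            exact mul_le_mul_of_nonneg_left (ih j q) (norm_nonneg _))
      _ ≤ _ := by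
          rw [← sum_mul]
          refine mul_le_mul_of_nonneg_right (hb θ p) (pow_nonneg ?_ _)
          exact (sum_nonneg fun j _ => norm_nonneg _).trans (hb θ p)

/-- The kernel of the propagator on the whole lattice. -/
def propKernel (V : Lat d → Mat n ℝ) (t : ℝ) (z : Lat d) (p q : Ix n) : ℂ :=
  fcoef (fun θ => ∑ σ ∈ Finset.range (numBands V),
    (wave t (phase V 1 σ) (fun θ => amp V 1 σ θ p q) θ +
      wave t (phase V (-1) σ) (fun θ => amp V (-1) σ θ p q) θ)) z

lemma hasSum_propKernel [Stable V] (t : ℝ) (z : Lat d) (p q : Ix n) :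
    HasSum (fun k : ℕ => ((t : ℂ) ^ k / k.factorial) * powCoeff V k z p q)
      (propKernel V t z p q) := by
  obtain ⟨M, hM⟩ := exists_Ahat_pow_bound (V := V)
  have hint : ∀ k : ℕ, Integrable (fun θ => ((t : ℂ) ^ k / k.factorial) *
      (𝐞⁻[z ⋄ θ] * (Ahat V θ ^ k) p q))
      (𝕋 d) := fun k =>
    (integrable_cexp_mul (integrable_cell_of_continuous (continuous_Ahat_pow k p q)) z).const_mul _
  have h := hasSum_integral_of_summable_integral_norm hint (by
    refine .of_nonneg_of_le (fun k => integral_nonneg fun θ => norm_nonneg _) (fun k => ?_)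
      ((Real.summable_pow_div_factorial (|t| * M)).mul_right (volume.real (cell d)))
    calc _ ≤ ∫ _θ in cell d, (|t| * M) ^ k / k.factorial := by
          refine integral_mono_of_nonneg (.of_forall fun θ => norm_nonneg _)
            (integrable_const _) (.of_forall fun θ => ?_)
          simp only [norm_mul, norm_div, norm_pow, norm_real, Complex.norm_natCast]
          rw [norm_cexp_neg_I_mul, one_mul, norm_eq_abs, mul_pow, div_mul_eq_mul_div]
          gcongr
          exact hM k θ p q
      _ = _ := by simp [mul_comm])
  have h2 := h.mul_left c𝕋 d
  have h3 : propKernel V t z p q = c𝕋 d * ∫ θ in cell d, ∑' k : ℕ, ((t : ℂ) ^ k / k.factorial) *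
        (𝐞⁻[z ⋄ θ] * (Ahat V θ ^ k) p q) := by
    rw [propKernel, fcoef]
    congr 1
    refine integral_congr_ae (ae_restrict_of_ae ?_)
    filter_upwards [ae_mem_analyticSet (V := V)] with θ hθ
    rw [← (hasSum_Ahat_pow hθ t p q).tsum_eq, ← tsum_mul_left]
    refine tsum_congr fun k => ?_
    ring
  rw [h3]
  refine h2.congr_fun fun k => ?_
  rw [powCoeff, fcoef, integral_const_mul]
  ring

/-! ### The kernel in the half-space -/

variable [NeZero d]

lemma powCoeff_refl [Stable V] (hr : ∀ z, V (refl z) = V z) (k : ℕ) (z : Lat d)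
    (p q : Ix n) : powCoeff V k (refl z) p q = powCoeff V k z p q := by
  induction k generalizing z p q with
  | zero =>
    have h : refl z = 0 ↔ z = 0 := by
      constructor
      · intro h; rw [← refl_refl z, h]; funext i; simp [refl]
      · intro h; rw [h]; funext i; simp [refl]
    simp only [powCoeff_zero, h]
  | succ k ih =>
    refine (hasSum_powCoeff_succ k (refl z) p q).unique ?_
    refine ((reflEquiv d).hasSum_iff.1 ((hasSum_powCoeff_succ k z p q).congr_fun fun y => ?_))
    refine sum_congr rfl fun j _ => ?_
    change ((genCoeff V (refl y) p j : ℝ) : ℂ) * powCoeff V k (refl z - refl y) j q = _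
    rw [genCoeff_refl hr, ← refl_sub, ih]

lemma ev_sub_ev_refl (Y : PhaseSpace d n α) {P : Lat d → ℂ} (p : Ix n)
    (hP : ∀ y, P (refl y) = -P y) (h : ∀ y, 0 < y 0 → ((ev Y y p : ℝ) : ℂ) = P y) (y : Lat d) :
    ((ev Y y p : ℝ) : ℂ) - ((ev Y (refl y) p : ℝ) : ℂ) = P y := by
  rcases lt_trichotomy (y 0) 0 with hy | hy | hy
  · have h1 : 0 < refl y 0 := by rw [refl_apply_zero]; omega
    rw [ev_of_nonpos Y (by omega : ¬ 0 < y 0), h _ h1, hP]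
    simp
  · have h1 : refl y = y := by
      funext i
      by_cases hi : i = 0
      · subst hi; rw [refl_apply_zero]; omega
      · simp [refl, hi]
    have h2 := hP y
    rw [h1] at h2 ⊢
    rw [sub_self]
    have h3 : (2 : ℂ) * P y = 0 := by linear_combination h2
    exact ((mul_eq_zero.1 h3).resolve_left two_ne_zero).symm
  · have h1 : ¬ 0 < refl y 0 := by rw [refl_apply_zero]; omega
    rw [h y hy, ev_of_nonpos Y h1]
    simp

variable {A : PhaseSpace d n α →L[ℝ] PhaseSpace d n α}

lemma IsGenerator.ev_pow_site (hA : IsGenerator V A)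
    [Stable V] (hr : ∀ z, V (refl z) = V z) (k : ℕ) (x : HalfLat d) (q : Ix n) (y : Lat d)
    (hy : 0 < y 0) (p : Ix n) :
    ((ev ((A ^ k) (site α x q)) y p : ℝ) : ℂ) =
      powCoeff V k (y - x.1) p q - powCoeff V k (y - refl x.1) p q := by
  induction k generalizing y p with
  | zero =>
    have h1 : y - refl x.1 ≠ 0 := fun h => by
      have h2 := congrFun h 0
      rw [Pi.sub_apply, refl_apply_zero] at h2
      have := x.2
      simp only [Pi.zero_apply] at h2
      omega
    rw [pow_zero, powCoeff_zero, powCoeff_zero, if_neg h1, sub_zero, one_apply_eq_self,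
      ev_site x q hy]
    simp only [sub_eq_zero, Matrix.one_apply]
    split_ifs <;> simp_all
  | succ k ih =>
    rw [pow_succ', mul_apply_eq_comp]
    have h1 := Complex.hasSum_ofReal.2 (hA ((A ^ k) (site α x q)) y p hy)
    refine h1.unique (((hasSum_powCoeff_succ k (y - x.1) p q).sub
      (hasSum_powCoeff_succ k (y - refl x.1) p q)).congr_fun fun w => ?_)
    rw [← sum_sub_distrib]
    simp only [Complex.ofReal_sum, ofReal_mul, Complex.ofReal_sub]
    refine sum_congr rfl fun j _ => ?_
    rw [ev_sub_ev_refl ((A ^ k) (site α x q)) (P := fun y => powCoeff V k (y - x.1) j q -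
      powCoeff V k (y - refl x.1) j q) j (fun y => ?_) (fun y hy => ih y hy j) (y - w),
      ← mul_sub, sub_right_comm, sub_right_comm y _ (refl x.1)]
    have e1 : refl y - x.1 = refl (y - refl x.1) := by rw [refl_sub, refl_refl]
    rw [e1, ← refl_sub, powCoeff_refl hr, powCoeff_refl hr]
    ring

lemma IsGenerator.ev_exp_site (hA : IsGenerator V A)
    [Stable V] (hr : ∀ z, V (refl z) = V z) (t : ℝ)
    (x : HalfLat d) (q : Ix n) (y : Lat d) (hy : 0 < y 0) (p : Ix n) :
    ((ev (NormedSpace.exp (t • A) (site α x q)) y p : ℝ) : ℂ) =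
      propKernel V t (y - x.1) p q - propKernel V t (y - refl x.1) p q := by
  have h1 := NormedSpace.exp_series_hasSum_exp' (𝕂 := ℝ) (t • A)
  have h2 := ((evL α y p).comp (ContinuousLinearMap.apply ℝ (PhaseSpace d n α)
    (site α x q))).hasSum h1
  have h3 := Complex.hasSum_ofReal.2 h2
  refine h3.unique (((hasSum_propKernel t (y - x.1) p q).sub
    (hasSum_propKernel t (y - refl x.1) p q)).congr_fun fun k => ?_)
  have h4 : ((evL α y p).comp (ContinuousLinearMap.apply ℝ (PhaseSpace d n α) (site α x q)))
      ((k.factorial : ℝ)⁻¹ • (t • A) ^ k) = t ^ k / k.factorial * ev ((A ^ k) (site α x q)) y p := by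
    rw [smul_pow, smul_smul, map_smul, smul_eq_mul, inv_mul_eq_div]
    rfl
  rw [h4, ofReal_mul, hA.ev_pow_site hr k x q y hy p]
  push_cast
  ring

/-- The kernel of the solution operator in the half-space. -/
def halfKernel (V : Lat d → Mat n ℝ) (t : ℝ) (y x : Lat d) (p q : Ix n) : ℝ :=
  (propKernel V t (y - x) p q - propKernel V t (y - refl x) p q).re

lemma IsGenerator.ev_exp_site' (hA : IsGenerator V A) [Stable V]
    (hr : ∀ z, V (refl z) = V z) (t : ℝ) (x : HalfLat d) (q : Ix n) (y : Lat d) (hy : 0 < y 0)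
    (p : Ix n) : ev (NormedSpace.exp (t • A) (site α x q)) y p = halfKernel V t y x.1 p q := by
  rw [halfKernel, ← hA.ev_exp_site hr t x q y hy p, Complex.ofReal_re]

lemma ofReal_halfKernel [Stable V] (hr : ∀ z, V (refl z) = V z) (t : ℝ) {x : Lat d} (hy : 0 < y 0)
    (hx : 0 < x 0) (p q : Ix n) : ((halfKernel V t y x p q : ℝ) : ℂ) = propKernel V t (y - x) p q -
    propKernel V t (y - refl x) p q := by
  obtain ⟨A, hA⟩ := exists_generator (V := V) 0
  have hA : IsGenerator V A := hA
  rw [← hA.ev_exp_site hr t ⟨x, hx⟩ q y hy p, hA.ev_exp_site' hr t ⟨x, hx⟩ q y hy p]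

lemma hasSum_flow [Stable V] (hr : ∀ z, V (refl z) = V z) (t : ℝ) (Y : PhaseSpace d n α)
    (hy : 0 < y 0) (p : Ix n) : HasSum (fun x : HalfLat d => ∑ q, halfKernel V t y x.1 p q * ev Y
    x.1 q) (ev (flow V t Y) y p) := by
  obtain ⟨A, hA⟩ := exists_generator (V := V) α
  have hA : IsGenerator V A := hA
  have h := hasSum_functional ((evL α y p).comp (NormedSpace.exp (t • A))) Y
  rw [hA.flow_eq]
  refine h.congr_fun fun x => sum_congr rfl fun q _ => ?_
  rw [← hA.ev_exp_site' hr t x q y hy p]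
  rfl

lemma continuous_flow [Stable V] (t : ℝ) :
    Continuous (flow V t : PhaseSpace d n α → PhaseSpace d n α) := by
  obtain ⟨A, hA⟩ := exists_generator (V := V) α
  have : (flow V t : PhaseSpace d n α → PhaseSpace d n α) = NormedSpace.exp (t • A) :=
    funext fun Y => IsGenerator.flow_eq hA t Y
  rw [this]
  exact ContinuousLinearMap.continuous _

lemma summable_halfKernel [Stable V] (hr : ∀ z, V (refl z) = V z) (t : ℝ) (hy : 0 < y 0)
    (p q : Ix n) : Summable fun x : HalfLat d => |halfKernel V t y x.1 p q| := by
  set f : HalfLat d → EuclideanSpace ℝ (Ix n) := fun x =>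
    single q (SignType.sign (halfKernel V t y x.1 p q) : ℝ) with hf
  have hd : (0 : ℝ) < d := by exact_mod_cast Nat.pos_of_ne_zero (NeZero.ne d)
  have hw : Summable fun x : HalfLat d => pointWeight (-(d : ℝ)) x.1 := by
    have h1 := (summable_one_add_norm (d := d) (γ := 2 * d) (by linarith)).mul_left ((2 : ℝ) ^ (d : ℝ))
    refine (Summable.of_nonneg_of_le (fun z => (pointWeight_pos _ z).le) (fun z => ?_)
      h1).comp_injective Subtype.val_injective
    have hn := norm_nonneg (toEuc z)
    rw [pointWeight, rpow_neg (by positivity), rpow_neg (by positivity),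
      ← div_eq_mul_inv, inv_eq_one_div, div_le_div_iff₀ (by positivity) (by positivity), one_mul,
      Real.rpow_mul (by positivity), ← Real.mul_rpow (by norm_num) (by positivity)]
    refine rpow_le_rpow (by positivity) ?_ hd.le
    rw [Real.rpow_two]
    nlinarith [sq_nonneg (1 - ‖toEuc z‖)]
  have hm : MemLp f 2 (weight d (-(d : ℝ))) := by
    rw [memLp_weight_iff]
    refine ne_top_of_le_ne_top (hw.tsum_ofReal_ne_top) (ENNReal.tsum_le_tsum fun x => ?_)
    refine mul_le_of_le_one_right' (pow_le_one' ?_ 2)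
    rw [← ofReal_norm, ← ENNReal.ofReal_one, hf, PiLp.norm_single]
    refine ENNReal.ofReal_le_ofReal ?_
    rcases SignType.sign (halfKernel V t y x.1 p q) <;> simp
  have h := (hasSum_flow hr t (hm.toLp f) hy p).summable
  refine h.congr fun x => ?_
  rw [sum_eq_single q]
  · rw [ev_of_pos _ x.2, toLp_weight_apply, hf]
    simp
  · intro q' _ hq'
    rw [ev_of_pos _ x.2, toLp_weight_apply, hf]
    simp [hq']
  · simp

end

section

lemma memLp_wave_amp [Stable V] (hs : sg = 1 ∨ sg = -1) (hσ : σ < numBands V) (t : ℝ) (p q : Ix n)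
    : MemLp (wave t (phase V sg σ) fun θ => amp V sg σ θ p q) 2 (𝕋 d) := by
  have h := memLp_amp hs hσ p q
  have h1 : AEStronglyMeasurable (fun θ => 𝐞⁻[(t * phase V sg σ θ : ℝ)]) (𝕋 d) := by
    have h2 := (aestronglyMeasurable_of_analyticSet (V := V) fun θ hθ =>
      (analyticAt_phase sg hθ hσ).continuousAt).restrict (s := cell d)
    have hc : Continuous fun x : ℝ => 𝐞⁻[(t * x : ℝ)] := by fun_prop
    exact hc.comp_aestronglyMeasurable h2
  refine h.of_le (h1.mul h.1) (.of_forall fun θ => ?_)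
  rw [norm_wave]

lemma propKernel_memLp [Stable V] (t : ℝ) (p q : Ix n) :
    MemLp (fun θ => ∑ σ ∈ Finset.range (numBands V),
      (wave t (phase V 1 σ) (fun θ => amp V 1 σ θ p q) θ +
        wave t (phase V (-1) σ) (fun θ => amp V (-1) σ θ p q) θ)) 2 (𝕋 d) :=
  memLp_finsetSum _ fun _ hσ =>
    (memLp_wave_amp (Or.inl rfl) (mem_range.1 hσ) t p q).add
      (memLp_wave_amp (Or.inr rfl) (mem_range.1 hσ) t p q)

lemma exists_sqBound_propKernel [Stable V] (t : ℝ)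
    (p q : Ix n) : ∃ m, SqBound (fun z => propKernel V t z p q) univ m :=
  ⟨_, sqBound_fcoef (propKernel_memLp t p q)⟩

variable [NeZero d]

lemma propKernel_refl [Stable V] (hr : ∀ z, V (refl z) = V z) (t : ℝ) (z : Lat d) (p q : Ix n) :
    propKernel V t (refl z) p q = propKernel V t z p q := by
  have h := hasSum_propKernel (V := V) t (refl z) p q
  simp only [powCoeff_refl hr] at h
  exact h.unique (hasSum_propKernel t z p q)

lemma integral_abs_ev_mul_le {μ : Measure (PhaseSpace d n α)} (hμ : ∀ x p, 0 < x 0 → MemLp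
    (fun Y => ev Y x p) 2 μ) (hC : ∀ x p, 0 < x 0 → ‖corr μ x x p p‖ ≤ C) (x y : HalfLat d)
    (i j : Ix n) : ∫ Y, |ev Y x.1 i| * |ev Y y.1 j| ∂μ ≤ C := by
  have hsq : ∀ (x : HalfLat d) i, Integrable (fun Y => ev Y x.1 i * ev Y x.1 i) μ := fun x i =>
    (hμ x.1 i x.2).integrable_mul (hμ x.1 i x.2)
  have hle : ∀ (x : HalfLat d) i, ∫ Y, ev Y x.1 i * ev Y x.1 i ∂μ ≤ C := fun x i => by
    have := hC x.1 i x.2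
    rw [corr, Matrix.of_apply, norm_real] at this
    exact (le_abs_self _).trans this
  calc _ ≤ ∫ Y, (1 / 2 * (ev Y x.1 i * ev Y x.1 i) + 1 / 2 * (ev Y y.1 j * ev Y y.1 j)) ∂μ := by
        refine integral_mono_of_nonneg (.of_forall fun Y => by positivity)
          (((hsq x i).const_mul _).add ((hsq y j).const_mul _)) (.of_forall fun Y => ?_)
        simp only
        rw [← abs_mul_abs_self (ev Y x.1 i), ← abs_mul_abs_self (ev Y y.1 j)]
        nlinarith [sq_nonneg (|ev Y x.1 i| - |ev Y y.1 j|)]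
    _ ≤ C := by
        rw [integral_add ((hsq x i).const_mul _) ((hsq y j).const_mul _), integral_const_mul,
          integral_const_mul]
        linarith [hle x i, hle y j]

lemma hasSum_integral_bilinear {S Ω κ : Type*} [Countable S] [Fintype κ] [MeasurableSpace Ω]
    {μ : Measure Ω} {e : S → κ → Ω → ℝ} (he : ∀ x i, MemLp (e x i) 2 μ) (hC : ∀ x y i j, ∫ Z, |e x i
    Z| * |e y j Z| ∂μ ≤ C) {a b : S → κ → ℝ} (ha : ∀ i, Summable fun x => |a x i|)
    (hb : ∀ i, Summable fun x => |b x i|) : HasSum (fun w : S × S => ∑ i, ∑ j, a w.1 i * b w.2 j * ∫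
    Z, e w.1 i Z * e w.2 j Z ∂μ) (∫ Z, ∑' w : S × S, (∑ i, a w.1 i * e w.1 i Z) * (∑ j, b w.2 j * e
    w.2 j Z) ∂μ) := by
  set F : S × S → Ω → ℝ := fun w Z =>
    (∑ i, a w.1 i * e w.1 i Z) * (∑ j, b w.2 j * e w.2 j Z) with hF
  have hF' : ∀ w Z, F w Z = ∑ i, ∑ j, a w.1 i * b w.2 j * (e w.1 i Z * e w.2 j Z) := fun w Z => by
    rw [hF]
    simp only
    rw [Finset.sum_mul_sum]
    exact sum_congr rfl fun i _ => sum_congr rfl fun j _ => by ring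
  have hprod : ∀ (x y : S) i j, Integrable (fun Z => e x i Z * e y j Z) μ :=
    fun x y i j => (he x i).integrable_mul (he y j)
  have hint : ∀ w, Integrable (F w) μ := fun w => by
    simp only [funext (hF' w)]
    exact integrable_finsetSum _ fun i _ => integrable_finsetSum _ fun j _ =>
      (hprod w.1 w.2 i j).const_mul _
  have hA : Summable fun x => ∑ i, |a x i| := summable_sum fun i _ => ha i
  have hB : Summable fun x => ∑ i, |b x i| := summable_sum fun i _ => hb i
  have hAB : Summable fun w : S × S => (∑ i, |a w.1 i|) * ∑ j, |b w.2 j| :=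
    hA.mul_of_nonneg hB (fun x => sum_nonneg fun i _ => abs_nonneg _)
      (fun x => sum_nonneg fun i _ => abs_nonneg _)
  have hsum : Summable fun w => ∫ Z, ‖F w Z‖ ∂μ := by
    refine .of_nonneg_of_le (fun w => integral_nonneg fun Z => norm_nonneg _) (fun w => ?_)
      (hAB.mul_right C)
    calc ∫ Z, ‖F w Z‖ ∂μ ≤ ∫ Z, ∑ i, ∑ j, |a w.1 i| * |b w.2 j| * (|e w.1 i Z| * |e w.2 j Z|) ∂μ := by
          refine integral_mono_of_nonneg (.of_forall fun Z => norm_nonneg _) ?_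
            (.of_forall fun Z => ?_)
          · refine integrable_finsetSum _ fun i _ => integrable_finsetSum _ fun j _ =>
              Integrable.const_mul ?_ _
            refine (hprod w.1 w.2 i j).abs.congr (.of_forall fun Z => ?_)
            simp only [abs_mul]
          · simp only
            rw [hF', norm_eq_abs]
            refine (Finset.abs_sum_le_sum_abs _ _).trans (sum_le_sum fun i _ => ?_)
            refine (Finset.abs_sum_le_sum_abs _ _).trans (sum_le_sum fun j _ => ?_)
            simp only [abs_mul, le_refl]
      _ = ∑ i, ∑ j, |a w.1 i| * |b w.2 j| * ∫ Z, |e w.1 i Z| * |e w.2 j Z| ∂μ := by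
          have h1 : ∀ i j, Integrable (fun Z => |a w.1 i| * |b w.2 j| *
              (|e w.1 i Z| * |e w.2 j Z|)) μ := fun i j => by
            refine .const_mul ?_ _
            refine (hprod w.1 w.2 i j).abs.congr (.of_forall fun Z => ?_)
            simp only [abs_mul]
          rw [integral_finsetSum _ fun i _ => integrable_finsetSum _ fun j _ => h1 i j]
          refine sum_congr rfl fun i _ => ?_
          rw [integral_finsetSum _ fun j _ => h1 i j]
          exact sum_congr rfl fun j _ => integral_const_mul _ _
      _ ≤ ∑ i, ∑ j, |a w.1 i| * |b w.2 j| * C := by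
          refine sum_le_sum fun i _ => sum_le_sum fun j _ => ?_
          exact mul_le_mul_of_nonneg_left (hC _ _ _ _) (by positivity)
      _ = _ := by
          rw [Finset.sum_mul_sum, sum_mul]
          exact sum_congr rfl fun i _ => (sum_mul _ _ _).symm
  have h := hasSum_integral_of_summable_integral_norm hint hsum
  refine h.congr_fun fun w => ?_
  have h3 : ∫ Z, F w Z ∂μ = ∑ i, ∑ j, a w.1 i * b w.2 j * ∫ Z, e w.1 i Z * e w.2 j Z ∂μ := by
    simp only [hF']
    rw [integral_finsetSum _ fun i _ => integrable_finsetSum _ fun j _ =>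
      (hprod w.1 w.2 i j).const_mul _]
    refine sum_congr rfl fun i _ => ?_
    rw [integral_finsetSum _ fun j _ => (hprod w.1 w.2 i j).const_mul _]
    exact sum_congr rfl fun j _ => integral_const_mul _ _
  exact h3.symm

lemma hasSum_corr_evolve [Stable V] (hr : ∀ z, V (refl z) = V z) {μ : Measure (PhaseSpace d n α)}
    (hμ : ∀ x p, 0 < x 0 → MemLp (fun Y => ev Y x p) 2 μ) (hC : ∀ x p, 0 < x 0 → ‖corr μ x x p p‖ ≤
    C) (t : ℝ) (hX : 0 < X 0) (hY : 0 < Y 0) (p q : Ix n) : HasSum (fun w : HalfLat d × HalfLat d =>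
    ∑ i, ∑ j, (halfKernel V t X w.1.1 p i : ℂ) * (halfKernel V t Y w.2.1 q j : ℂ) * corr μ w.1.1
    w.2.1 i j) (corr (evolve V μ t) X Y p q) := by
  have h := hasSum_integral_bilinear (e := fun (x : HalfLat d) i (Z : PhaseSpace d n α) => ev Z x.1 i)
    (fun x i => hμ x.1 i x.2) (integral_abs_ev_mul_le hμ hC)
    (fun i => summable_halfKernel hr t hX p i)
    (fun i => summable_halfKernel hr t hY q i)
  have h1 : ∀ Z : PhaseSpace d n α, ∑' w : HalfLat d × HalfLat d,
      (∑ i, halfKernel V t X w.1.1 p i * ev Z w.1.1 i) *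
        (∑ j, halfKernel V t Y w.2.1 q j * ev Z w.2.1 j) =
      ev (flow V t Z) X p * ev (flow V t Z) Y q := fun Z => by
    have e1 := hasSum_flow hr t Z hX p
    have e2 := hasSum_flow hr t Z hY q
    rw [← e1.tsum_eq, ← e2.tsum_eq, tsum_mul_tsum_of_summable_norm e1.summable.norm e2.summable.norm]
  have h2 : corr (evolve V μ t) X Y p q =
      ((∫ Z, ev (flow V t Z) X p * ev (flow V t Z) Y q ∂μ : ℝ) : ℂ) := by
    rw [corr, Matrix.of_apply, evolve, integral_map (continuous_flow t).aemeasurable]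
    exact (((evL α X p).continuous.mul (evL α Y q).continuous)).aestronglyMeasurable
  rw [h2, ← integral_congr_ae (Eventually.of_forall h1)]
  refine (Complex.hasSum_ofReal.2 h).congr_fun fun w => ?_
  rw [Complex.ofReal_sum]
  refine sum_congr rfl fun i _ => ?_
  rw [Complex.ofReal_sum]
  refine sum_congr rfl fun j _ => ?_
  rw [ofReal_mul, ofReal_mul]
  rfl

/-! ### Correlations as bilinear forms -/

/-- The correlations `Q(x, x - k)`, extended by zero off the half-lattice. -/
def corrWeight (μ : Measure (PhaseSpace d n α)) (i j : Ix n) (x k : Lat d) : ℂ :=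
  if 0 < x 0 ∧ 0 < (x - k) 0 then corr μ x (x - k) i j else 0

lemma norm_corrWeight_le {μ : Measure (PhaseSpace d n α)} (hC : 0 ≤ C) (h : ∀ x x', 0 < x 0 → 0 <
    x' 0 → ∀ p q, ‖corr μ x x' p q‖ ≤ C * (1 + ‖toEuc (x - x')‖) ^ (-γ)) (i j : Ix n) (x k : Lat d)
    : ‖corrWeight μ i j x k‖ ≤ C * (1 + ‖toEuc k‖) ^ (-γ) := by
  rw [corrWeight]
  split_ifs with hx
  · have := h x (x - k) hx.1 hx.2 i j
    rwa [sub_sub_cancel] at this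
  · rw [norm_zero]; positivity

/-- The image sum of the four forms attached to a pair of points and their mirror images. -/
def imageForm (w : Lat d → Lat d → ℂ) (φ ψ : Lat d → ℂ) (X Y : Lat d) : ℂ :=
  bform w φ ψ X Y - bform w φ ψ X (refl Y) - bform w φ ψ (refl X) Y + bform w φ ψ (refl X) (refl Y)

lemma hasSum_imageForm {w : Lat d → Lat d → ℂ} (hν : Summable ν) (hw : ∀ x k, ‖w x k‖ ≤ ν k)
    (hφ : SqBound φ univ m1) (hψ : SqBound ψ univ m2) (X Y : Lat d) : HasSum (fun k => ∑' x,
    w x k * ((φ (X - x) - φ (refl X - x)) * conj (ψ (Y - (x - k)) - ψ (refl Y - (x - k)))))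
    (imageForm w φ ψ X Y) := by
  have hs := fun P Q => (summable_pairSum hν hw hφ hψ P Q).hasSum
  have h := (((hs X Y).sub (hs X (refl Y))).sub (hs (refl X) Y)).add (hs (refl X) (refl Y))
  refine h.congr_fun fun k => ?_
  have hp := fun P Q => summable_pair (fun x => hw x k) hφ hψ P Q
  simp only [pairSum]
  rw [← (hp X (Y + k)).tsum_sub (hp X (refl Y + k)),
    ← ((hp X (Y + k)).sub (hp X (refl Y + k))).tsum_sub (hp (refl X) (Y + k)),
    ← (((hp X (Y + k)).sub (hp X (refl Y + k))).sub (hp (refl X) (Y + k))).tsum_add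
      (hp (refl X) (refl Y + k))]
  refine tsum_congr fun x => ?_
  have e : ∀ Q : Lat d, Q - (x - k) = Q + k - x := fun Q => by abel
  rw [e, e, map_sub]
  ring

lemma corr_evolve_eq [Stable V] (hr : ∀ z, V (refl z) = V z) {μ : Measure (PhaseSpace d n α)}
    (hμ : ∀ x p, 0 < x 0 → MemLp (fun Y => ev Y x p) 2 μ) (hC : 0 ≤ C) (hγ : (d : ℝ) < γ)
    (h : ∀ x x', 0 < x 0 → 0 < x' 0 → ∀ p q, ‖corr μ x x' p q‖ ≤ C * (1 + ‖toEuc (x - x')‖) ^ (-γ))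
    (t : ℝ) (hX : 0 < X 0) (hY : 0 < Y 0) (p q : Ix n) : corr (evolve V μ t) X Y p q = ∑ i, ∑ j,
    imageForm (corrWeight μ i j) (fun z => propKernel V t z p i) (fun z => propKernel V t z q j) X Y
    := by
  have hν := (summable_one_add_norm (d := d) hγ).mul_left C
  set K : Lat d → Lat d → Ix n → Ix n → ℂ := fun X x p i =>
    propKernel V t (X - x) p i - propKernel V t (refl X - x) p i with hK
  have hker : ∀ {X x : Lat d}, 0 < X 0 → 0 < x 0 → ∀ p i, (halfKernel V t X x p i : ℂ) = K X x p i := fun {X x} hX hx p i => by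
    rw [ofReal_halfKernel hr t hX hx, hK]
    simp only
    have : X - refl x = refl (refl X - x) := by rw [refl_sub, refl_refl]
    rw [this, propKernel_refl hr]
  set f : Lat d × Lat d → ℂ := fun u => ∑ i, ∑ j, corrWeight μ i j u.2 u.1 *
    (K X u.2 p i * conj (K Y (u.2 - u.1) q j)) with hf
  have h0 := hasSum_corr_evolve hr hμ (C := C) (fun x p hx => by
    have := h x x hx hx p p
    have e : toEuc (x - x) = 0 := by rw [sub_self]; exact toEuc_zero
    rwa [e, norm_zero, add_zero, Real.one_rpow, mul_one] at this) t hX hY p q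
  set g : HalfLat d × HalfLat d → Lat d × Lat d := fun w => (w.1.1 - w.2.1, w.1.1) with hg
  have hginj : Function.Injective g := by
    rintro ⟨x, y⟩ ⟨x', y'⟩ h
    simp only [hg, Prod.mk.injEq] at h
    have h2 : x = x' := Subtype.ext h.2
    have h3 : y = y' := Subtype.ext (by have := h.1; rw [h.2] at this; exact sub_right_injective this)
    rw [h2, h3]
  have hfg : HasSum (f ∘ g) (corr (evolve V μ t) X Y p q) := by
    refine h0.congr_fun fun w => sum_congr rfl fun i _ => sum_congr rfl fun j _ => ?_
    have e1 : g w = (w.1.1 - w.2.1, w.1.1) := rfl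
    have e2 : w.1.1 - (w.1.1 - w.2.1) = w.2.1 := sub_sub_cancel _ _
    simp only [e1, corrWeight, e2]
    rw [if_pos ⟨w.1.2, w.2.2⟩, ← hker hX w.1.2, ← hker hY w.2.2, Complex.conj_ofReal]
    ring
  have hfs : HasSum f (corr (evolve V μ t) X Y p q) := by
    refine (hginj.hasSum_iff fun u hu => ?_).1 hfg
    refine Finset.sum_eq_zero fun i _ => Finset.sum_eq_zero fun j _ => ?_
    rw [corrWeight, if_neg, zero_mul]
    rintro ⟨h1, h2⟩
    exact hu ⟨(⟨u.2, h1⟩, ⟨u.2 - u.1, h2⟩), by simp [hg]⟩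
  rw [← hfs.tsum_eq, hfs.summable.tsum_prod]
  choose m hm using exists_sqBound_propKernel (V := V) t
  have hw := fun i j => norm_corrWeight_le hC h i j
  have hI := hasSum_sum (s := Finset.univ) fun i (_ : i ∈ (Finset.univ : Finset (Ix n))) =>
    hasSum_sum (s := Finset.univ) fun j (_ : j ∈ (Finset.univ : Finset (Ix n))) =>
      hasSum_imageForm hν (hw i j) (hm p i) (hm q j) X Y
  rw [← hI.tsum_eq]
  refine tsum_congr fun k => ?_
  have hK2 : ∀ i j, Summable fun x => corrWeight μ i j x k * (K X x p i * conj (K Y (x - k) q j)) := fun i j => by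
    have hp := fun P Q => summable_pair (fun x => hw i j x k) (hm p i) (hm q j) P Q
    refine ((((hp X (Y + k)).sub (hp X (refl Y + k))).sub (hp (refl X) (Y + k))).add
      (hp (refl X) (refl Y + k))).congr fun x => ?_
    have e : ∀ Q : Lat d, Q - (x - k) = Q + k - x := fun Q => by abel
    simp only [hK, map_sub, e]
    ring
  simp only [hf]
  rw [Summable.tsum_finsetSum fun i _ => summable_sum fun j _ => hK2 i j]
  refine sum_congr rfl fun i _ => ?_
  rw [Summable.tsum_finsetSum fun j _ => hK2 i j]

end

section

/-! ### Cutoffs -/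

/-- Smooth cutoffs that exhaust an open set. -/
lemma exists_cutoff (hG : IsOpen G) (hGc : Gᶜ.Nonempty) : ∃ η : ℕ → Euc d → ℝ, (∀ k, ContDiff ℝ
    (⊤ : ℕ∞) (η k)) ∧ (∀ k, HasCompactSupport (η k)) ∧ (∀ k, tsupport (η k) ⊆ G) ∧ (∀ k θ, η k θ ∈
    Set.Icc (0 : ℝ) 1) ∧ ∀ θ ∈ G, ∀ᶠ k in atTop, η k θ = 1 := by
  set K : ℕ → Set (Euc d) := fun k =>
    Metric.closedBall 0 k ∩ {θ | 1 / ((k : ℝ) + 1) ≤ Metric.infDist θ Gᶜ} with hK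
  have hKc : ∀ k, IsCompact (K k) := fun k =>
    (isCompact_closedBall 0 _).inter_right
      (isClosed_le continuous_const (Metric.continuous_infDist_pt _))
  have hKG : ∀ k, K k ⊆ G := fun k θ hθ => by
    by_contra h
    have h1 : Metric.infDist θ Gᶜ = 0 := Metric.infDist_zero_of_mem h
    have h2 := hθ.2
    simp only [Set.mem_ofPred_eq, h1] at h2
    have : (0 : ℝ) < 1 / ((k : ℝ) + 1) := by positivity
    linarith
  have h1 : ∀ k, ∃ η : Euc d → ℝ, ContDiff ℝ (⊤ : ℕ∞) η ∧ HasCompactSupport η ∧ tsupport η ⊆ G ∧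
      (∀ θ, η θ ∈ Set.Icc (0 : ℝ) 1) ∧ ∀ θ ∈ K k, η θ = 1 := fun k => by
    obtain ⟨L, hL, hKL, hLG⟩ := exists_compact_between (hKc k) hG (hKG k)
    obtain ⟨f, hf1, hf2, hf3, hf4⟩ := exists_contMDiff_support_eq_eq_one_iff
      (modelWithCornersSelf ℝ (Euc d)) (n := (⊤ : ℕ∞)) isOpen_interior (hKc k).isClosed hKL
    have h2 : tsupport f ⊆ L := by
      rw [tsupport, hf3]
      exact closure_minimal interior_subset hL.isClosed
    exact ⟨f, hf1.contDiff, HasCompactSupport.of_support_subset_isCompact hL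
      (subset_closure.trans h2), h2.trans hLG, fun θ => hf2 ⟨θ, rfl⟩, fun θ hθ => (hf4 θ).1 hθ⟩
  choose η h2 h3 h4 h5 h6 using h1
  refine ⟨η, h2, h3, h4, h5, fun θ hθ => ?_⟩
  have hpos : 0 < Metric.infDist θ Gᶜ :=
    (hG.isClosed_compl.notMem_iff_infDist_pos hGc).1 fun h => h hθ
  obtain ⟨k₁, hk₁⟩ := exists_nat_ge ‖θ‖
  obtain ⟨k₂, hk₂⟩ := exists_nat_one_div_lt hpos
  filter_upwards [eventually_ge_atTop (max k₁ k₂)] with k hk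
  refine h6 k θ ⟨?_, ?_⟩
  · rw [mem_closedBall_zero_iff]
    exact hk₁.trans (by exact_mod_cast (le_max_left _ _).trans hk)
  · refine le_trans ?_ hk₂.le
    have : (k₂ : ℝ) ≤ k := by exact_mod_cast (le_max_right _ _).trans hk
    exact one_div_le_one_div_of_le (by positivity) (by linarith)

lemma isPiece_cutoff {η : Euc d → ℝ} (h1 : ContDiff ℝ (⊤ : ℕ∞) η) (h2 : HasCompactSupport η)
    (h3 : tsupport η ⊆ interior (cell d)) {a : Euc d → ℂ} (ha : ∀ θ ∈ tsupport η, ContDiffAt ℝ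
    (⊤ : ℕ∞) a θ) (hω : ∀ θ ∈ tsupport η, ContDiffAt ℝ (⊤ : ℕ∞) ω θ) : IsPiece ω fun θ => (η θ : ℂ)
    * a θ := by
  have hs : tsupport (fun θ => (η θ : ℂ) * a θ) ⊆ tsupport η := by
    refine closure_mono fun θ hθ => ?_
    simp only [Function.mem_support] at hθ ⊢
    intro h; exact hθ (by simp [h])
  refine ⟨contDiff_of_contDiffAt_tsupport fun θ hθ => ?_, h2.of_isClosed_subset
    (isClosed_tsupport _) hs, hs.trans h3, fun θ hθ => hω θ (hs hθ)⟩
  exact ((ofRealCLM.contDiff.comp h1).contDiffAt).mul (ha θ (hs hθ))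

variable [NeZero d]

/-! ### Incoming and outgoing parts of a piece -/

/-- The part of an amplitude where `τ ∂₁ω > 0`. -/
def incoming (τ : ℝ) (ω : Euc d → ℝ) (a : Euc d → ℂ) (θ : Euc d) : ℂ :=
  if 0 < τ * der0 ω θ then a θ else 0

lemma tsupport_incoming_subset (τ : ℝ) (ω : Euc d → ℝ) (a : Euc d → ℂ) :
    tsupport (incoming τ ω a) ⊆ tsupport a := by
  refine closure_mono fun θ hθ => ?_
  simp only [Function.mem_support, incoming] at hθ ⊢
  intro h; exact hθ (by simp [h])

variable {a : Euc d → ℂ}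

lemma IsPiece.incoming (h : IsPiece ω a) (hne : ∀ θ ∈ tsupport a, τ * der0 ω θ ≠ 0) : IsPiece ω
    (incoming τ ω a) := by
  have hs := tsupport_incoming_subset τ ω a
  refine ⟨contDiff_of_contDiffAt_tsupport fun θ hθ => ?_, h.compact.of_isClosed_subset
    (isClosed_tsupport _) hs, hs.trans h.subset, fun θ hθ => h.phase θ (hs hθ)⟩
  have hc : ContinuousAt (fun θ => τ * der0 ω θ) θ :=
    (contDiffAt_der0 (h.phase θ (hs hθ))).continuousAt.const_mul τ
  rcases lt_or_gt_of_ne (hne θ (hs hθ)) with h0 | h0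
  · have : Crystal.incoming τ ω a =ᶠ[𝓝 θ] fun _ => 0 := by
      filter_upwards [hc.eventually (gt_mem_nhds h0)] with x hx
      rw [Crystal.incoming, if_neg (not_lt.2 hx.le)]
    exact contDiffAt_const.congr_of_eventuallyEq this
  · have : Crystal.incoming τ ω a =ᶠ[𝓝 θ] a := by
      filter_upwards [hc.eventually (lt_mem_nhds h0)] with x hx
      rw [Crystal.incoming, if_pos hx]
    exact h.smooth.contDiffAt.congr_of_eventuallyEq this

lemma IsPiece.exists_incoming_lower (h : IsPiece ω a) (hne : ∀ θ ∈ tsupport a, τ * der0 ω θ ≠ 0) :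
    ∃ c > 0, ∀ θ ∈ tsupport (Crystal.incoming τ ω a), c ≤ τ * der0 ω θ := by
  have hs := tsupport_incoming_subset τ ω a
  have hcont : ContinuousOn (fun θ => τ * der0 ω θ) (tsupport a) := fun θ hθ =>
    ((contDiffAt_der0 (h.phase θ hθ)).continuousAt.const_mul τ).continuousWithinAt
  have hpos : ∀ θ ∈ tsupport (Crystal.incoming τ ω a), 0 < τ * der0 ω θ := fun θ hθ => by
    by_contra h0
    have h1 := lt_of_le_of_ne (not_lt.1 h0) (hne θ (hs hθ))
    have hc : ContinuousAt (fun θ => τ * der0 ω θ) θ :=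
      (contDiffAt_der0 (h.phase θ (hs hθ))).continuousAt.const_mul τ
    have : θ ∉ tsupport (Crystal.incoming τ ω a) := by
      rw [notMem_tsupport_iff_eventuallyEq]
      filter_upwards [hc.eventually (gt_mem_nhds h1)] with x hx
      rw [Crystal.incoming, if_neg (not_lt.2 hx.le)]
      rfl
    exact this hθ
  rcases (tsupport (Crystal.incoming τ ω a)).eq_empty_or_nonempty with he | he
  · exact ⟨1, one_pos, fun θ hθ => by rw [he] at hθ; exact hθ.elim⟩
  · obtain ⟨x, hx, hmin⟩ := (h.compact.of_isClosed_subset (isClosed_tsupport _) hs).exists_isMinOn he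
      (hcont.mono hs)
    exact ⟨_, hpos x hx, fun θ hθ => hmin hθ⟩

lemma incoming_add_incoming_neg (hne : ∀ θ ∈ tsupport a, τ * der0 ω θ ≠ 0) (θ : Euc d) : a θ =
    incoming τ ω a θ + incoming (-τ) ω a θ := by
  by_cases h : a θ = 0
  · simp [incoming, h]
  · have h1 := hne θ (subset_tsupport a h)
    rcases lt_or_gt_of_ne h1 with h2 | h2
    · rw [incoming, incoming, if_neg (by linarith), if_pos (by linarith), zero_add]
    · rw [incoming, incoming, if_pos h2, if_neg (by linarith), add_zero]

lemma IsPiece.packet_eq_incoming (h : IsPiece ω a) (hne : ∀ θ ∈ tsupport a, τ * der0 ω θ ≠ 0)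
    (t : ℝ) (z : Lat d) : packet t ω a z = packet t ω (Crystal.incoming τ ω a) z + packet t ω
    (Crystal.incoming (-τ) ω a) z := by
  have h1 := h.incoming hne
  have h2 := h.incoming (τ := -τ) fun θ hθ => by have := hne θ hθ; rwa [neg_mul, neg_ne_zero]
  rw [packet, packet, packet, ← fcoef_add (integrable_cell_of_continuous (h1.continuous_wave t))
    (integrable_cell_of_continuous (h2.continuous_wave t))]
  congr 1
  funext θ
  rw [wave, wave, wave, ← mul_add, ← incoming_add_incoming_neg hne]

/-- The assumptions on a family of correlations on the half-lattice that is locally close to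
`R(ε x, ·)` far from the boundary. -/
structure HalfFamily (N : ℝ → Lat d → Lat d → ℂ) (R : Euc d → Lat d → ℂ) (ν : Lat d → ℝ) : Prop where
  summable : Summable ν
  bound : ∀ e, 0 < e → ∀ x k, ‖N e x k‖ ≤ ν k
  zero : ∀ e x k, x 0 ≤ 0 → N e x k = 0
  boundR : ∀ y k, ‖R y k‖ ≤ ν k
  lim : ∀ k, ∀ δ > 0, ∃ M : ℝ, ∀ᶠ e in 𝓝[>] (0 : ℝ), ∀ x : Lat d, M < x 0 →
    ‖N e x k - R (e • toEuc x) k‖ ≤ δ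

variable {N : ℝ → Lat d → Lat d → ℂ} {R : Euc d → Lat d → ℂ} {p q : ℝ → Lat d}

lemma tendsto_abs_time (hτ : τ ≠ 0) : Tendsto (fun e : ℝ => |τ / e ^ 2|) (𝓝[>] 0) atTop := by
  have h : Tendsto (fun e : ℝ => e ^ 2) (𝓝[>] 0) (𝓝[>] 0) := by
    refine tendsto_nhdsWithin_iff.2 ⟨?_, ?_⟩
    · have : Tendsto (fun e : ℝ => e ^ 2) (𝓝 0) (𝓝 (0 ^ 2)) := (continuous_pow 2).tendsto 0
      rw [zero_pow two_ne_zero] at this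
      exact this.mono_left nhdsWithin_le_nhds
    · filter_upwards [self_mem_nhdsWithin] with e he
      exact pow_pos (Set.mem_Ioi.1 he) 2
  have h2 := (tendsto_inv_nhdsGT_zero.comp h).const_mul_atTop (abs_pos.2 hτ)
  refine h2.congr fun e => ?_
  rw [Function.comp_apply, abs_div, abs_of_nonneg (sq_nonneg e), div_eq_mul_inv]

/-- Only the incoming part of a packet is seen, and it sees the homogeneous correlations. -/
lemma HalfFamily.tendsto_incoming (H : HalfFamily N R ν) (hτ : τ ≠ 0) (h : IsPiece ω a)
    (hne : ∀ θ ∈ tsupport a, τ * der0 ω θ ≠ 0) (hp : ∀ δ > 0, ∀ᶠ e in 𝓝[>] (0 : ℝ), |(p e 0 : ℝ)| ≤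
    δ * |τ / e ^ 2|) {ψ : ℝ → Lat d → ℂ} (hψ : ∀ e, SqBound (ψ e) univ m) : Lim₀
    (fun e => bform (N e) (packet (τ / e ^ 2) ω a) (ψ e) (p e) (q e) - bform (fun x k => R
    (e • toEuc x) k) (packet (τ / e ^ 2) ω (Crystal.incoming τ ω a)) (ψ e) (p e) (q e)) 0 := by
  have hne' : ∀ θ ∈ tsupport a, -τ * der0 ω θ ≠ 0 := fun θ hθ => by
    have := hne θ hθ; rwa [neg_mul, neg_ne_zero]
  have h1 := h.incoming hne
  have h2 := h.incoming hne'
  obtain ⟨c₁, hc₁, hl₁⟩ := h.exists_incoming_lower hne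
  obtain ⟨c₂, hc₂, hl₂⟩ := h.exists_incoming_lower hne'
  have hτ' := abs_pos.2 hτ
  have ht := tendsto_abs_time hτ
  have htc : ∀ c e : ℝ, c / |τ| * |τ / e ^ 2| = c / e ^ 2 := fun c e => by
    rw [abs_div, abs_of_nonneg (sq_nonneg e)]
    field_simp
  have t1 : Lim₀ (fun e => bform (N e) (packet (τ / e ^ 2) ω (Crystal.incoming (-τ) ω a)) (ψ e)
      (p e) (q e)) 0 := by
    refine h2.tendsto_bform_of_neg (c := c₂ / |τ|) (by positivity) ht ?_ hp
      (Eventually.of_forall hψ) H.summable ?_ (.of_forall fun e => H.zero e)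
    · filter_upwards [self_mem_nhdsWithin] with e he θ hθ
      have := hl₂ θ hθ
      have he2 : 0 < e ^ 2 := pow_pos he 2
      rw [htc, ← neg_div, div_mul_eq_mul_div]
      exact div_le_div_of_nonneg_right (by linarith) he2.le
    · filter_upwards [self_mem_nhdsWithin] with e he using H.bound e he
  have t2 : Lim₀ (fun e => bform (fun x k => N e x k - R (e • toEuc x) k)
      (packet (τ / e ^ 2) ω (Crystal.incoming τ ω a)) (ψ e) (p e) (q e)) 0 := by
    refine h1.tendsto_bform_of_pos (c := c₁ / |τ|) (by positivity) ht ?_ hp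
      (Eventually.of_forall hψ) (H.summable.add H.summable)
      (n := fun e x k => N e x k - R (e • toEuc x) k) ?_ H.lim
    · filter_upwards [self_mem_nhdsWithin] with e he θ hθ
      have := hl₁ θ hθ
      have he2 : 0 < e ^ 2 := pow_pos he 2
      rw [htc, div_mul_eq_mul_div]
      exact div_le_div_of_nonneg_right (by linarith) he2.le
    · filter_upwards [self_mem_nhdsWithin] with e he x k
      exact (norm_sub_le _ _).trans (add_le_add (H.bound e he x k) (H.boundR _ k))
  have t3 := t1.add t2
  rw [add_zero] at t3
  refine t3.congr' ?_
  filter_upwards [self_mem_nhdsWithin] with e he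
  rw [bform_sub_weight H.summable (H.bound e he) H.summable (fun x k => H.boundR _ k)
    (h1.sqBound _) (hψ e)]
  have e1 : packet (τ / e ^ 2) ω a = fun z => ∑ b : Bool, (if b then
      packet (τ / e ^ 2) ω (Crystal.incoming τ ω a) else
      packet (τ / e ^ 2) ω (Crystal.incoming (-τ) ω a)) z := by
    funext z
    rw [h.packet_eq_incoming hne]
    simp
  rw [e1, bform_sum_left Finset.univ H.summable (H.bound e he) (fun b _ => ?_) (hψ e)]
  · simp only [Fintype.sum_bool, if_true, Bool.false_eq_true, if_false]
    ring
  · cases b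
    · exact ⟨_, h2.sqBound _⟩
    · exact ⟨_, h1.sqBound _⟩

end

section

variable {u : Euc d → ℝ} {s : ℕ → ℝ}

lemma bform_add_left {n : Lat d → Lat d → ℂ} (hν : Summable ν) (hn : ∀ x k, ‖n x k‖ ≤ ν k)
    (hφ : SqBound φ univ m1) (hφ' : SqBound φ' univ m1') (hψ : SqBound ψ univ m)
    (p q : Lat d) : bform n (fun y => φ y + φ' y) ψ p q = bform n φ ψ p q + bform n φ' ψ p q := by
  have h := bform_sum_left (Finset.univ : Finset Bool) hν hn (φ := fun b => if b then φ else φ')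
    (fun b _ => by cases b; exacts [⟨_, hφ'⟩, ⟨_, hφ⟩]) hψ p q
  simpa using h

lemma bform_add_right {n : Lat d → Lat d → ℂ} (hν : Summable ν) (hn : ∀ x k, ‖n x k‖ ≤ ν k)
    {ψ' : Lat d → ℂ} (hψ : SqBound ψ univ m1) (hψ' : SqBound ψ' univ m1') (hφ : SqBound φ
    univ m) (p q : Lat d) : bform n φ (fun y => ψ y + ψ' y) p q = bform n φ ψ p q + bform n φ ψ'
    p q := by
  have h := bform_sum_right (Finset.univ : Finset Bool) hν hn (ψ := fun b => if b then ψ else ψ')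
    (fun b _ => by cases b; exacts [⟨_, hψ'⟩, ⟨_, hψ⟩]) hφ p q
  simpa using h

lemma norm_fcoef_le_integral (f : Euc d → ℂ) (z : Lat d) :
    ‖fcoef f z‖ ≤ ((2 * π) ^ d)⁻¹ * ∫ θ in cell d, ‖f θ‖ := by
  rw [fcoef, norm_mul, norm_inv, norm_real, norm_of_nonneg (two_pi_pow_pos d).le]
  refine mul_le_mul_of_nonneg_left ((norm_integral_le_integral_norm _).trans (le_of_eq ?_))
    (by positivity)
  refine integral_congr_ae (.of_forall fun θ => ?_)
  simp only
  rw [norm_mul, norm_cexp_neg_I_mul, one_mul]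

lemma tendsto_zero_of_approx {ι : Type*} {l : Filter ι} {F : ι → ℂ} {Fk : ℕ → ι → ℂ}
    (h1 : ∀ k, Tendsto (Fk k) l (𝓝 0)) (h2 : ∀ k, ∀ᶠ e in l, ‖F e - Fk k e‖ ≤ s k) (hs : Tendsto s
    atTop (𝓝 0)) : Tendsto F l (𝓝 0) := by
  rw [Metric.tendsto_nhds]
  intro δ hδ
  obtain ⟨k, hk⟩ := (hs.eventually (gt_mem_nhds (half_pos hδ))).exists
  filter_upwards [h2 k, Metric.tendsto_nhds.1 (h1 k) (δ / 2) (half_pos hδ)] with e he1 he2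
  rw [dist_zero_right] at he2 ⊢
  have : ‖F e‖ ≤ ‖F e - Fk k e‖ + ‖Fk k e‖ := by simpa using norm_add_le (F e - Fk k e) (Fk k e)
  linarith

/-- The normalized square norm of an amplitude over the torus. -/
def mass (a : Euc d → ℂ) : ℝ := ((2 * π) ^ d)⁻¹ * ∫ θ in cell d, ‖a θ‖ ^ 2

variable {ω' : Euc d → ℝ} {a b : Euc d → ℂ}

lemma wave_real_mul (u : Euc d → ℝ) (t : ℝ) :
    wave t ω (fun θ => (u θ : ℂ) * a θ) = fun θ => (u θ : ℂ) * wave t ω a θ := by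
  funext θ
  simp only [wave]
  ring

lemma memLp_real_mul (hu : Continuous u) (hu1 : ∀ θ, |u θ| ≤ 1) (ha : MemLp a 2 (𝕋 d)) : MemLp
    (fun θ => (u θ : ℂ) * a θ) 2 (𝕋 d) := by
  refine ha.of_le (((continuous_ofReal.comp hu).aestronglyMeasurable).mul ha.1)
    (.of_forall fun θ => ?_)
  rw [norm_mul, norm_real, norm_eq_abs]
  exact mul_le_of_le_one_left (norm_nonneg _) (hu1 θ)

lemma mass_real_mul_le (hu1 : ∀ θ, |u θ| ≤ 1) (ha : MemLp a 2 (𝕋 d)) : mass (fun θ => (u θ : ℂ) *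
    a θ) ≤ mass a := by
  refine mul_le_mul_of_nonneg_left (integral_mono_of_nonneg (.of_forall fun θ =>
    by positivity) ((memLp_two_iff_integrable_sq_norm ha.1).1 ha)
    (.of_forall fun θ => ?_)) (by positivity)
  simp only
  rw [norm_mul, norm_real, norm_eq_abs]
  gcongr
  exact mul_le_of_le_one_left (norm_nonneg _) (hu1 θ)

lemma sqBound_packet (t : ℝ) (ha : MemLp (wave t ω a) 2 (𝕋 d)) :
    SqBound (packet t ω a) univ (mass a) := by
  have h := sqBound_fcoef ha
  simp only [norm_wave] at h
  exact h

lemma tendsto_mass_cutoff (hGa : ∀ᵐ θ ∂𝕋 d, θ ∈ G) {η : ℕ → Euc d → ℝ} (hη : ∀ k, Continuous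
    (η k)) (hη1 : ∀ k θ, η k θ ∈ Set.Icc (0 : ℝ) 1) (hηG : ∀ θ ∈ G, ∀ᶠ k in atTop, η k θ = 1)
    (ha : MemLp a 2 (𝕋 d)) : Tendsto (fun k => mass fun θ => ((1 - η k θ : ℝ) : ℂ) * a θ) atTop
    (𝓝 0) := by
  have h := tendsto_integral_of_dominated_convergence (μ := 𝕋 d)
    (F := fun k θ => ‖((1 - η k θ : ℝ) : ℂ) * a θ‖ ^ 2) (f := fun _ => 0) (fun θ => ‖a θ‖ ^ 2)
    (fun k => (((continuous_ofReal.comp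
      (continuous_const.sub (hη k))).aestronglyMeasurable.mul ha.1).norm.pow 2))
    ((memLp_two_iff_integrable_sq_norm ha.1).1 ha) (fun k => .of_forall fun θ => by
      rw [norm_of_nonneg (by positivity), norm_mul, norm_real, norm_eq_abs]
      have := hη1 k θ
      gcongr
      exact mul_le_of_le_one_left (norm_nonneg _) (abs_le.2 ⟨by linarith [this.2], by linarith [this.1]⟩))
    (by
      filter_upwards [hGa] with θ hθ
      refine tendsto_const_nhds.congr' ?_
      filter_upwards [hηG θ hθ] with k hk
      simp [hk])
  have h2 := h.const_mul ((2 * π) ^ d)⁻¹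
  rw [integral_zero, mul_zero] at h2
  exact h2

lemma packet_add (t : ℝ) (u : Euc d → ℝ) (h1 : MemLp (wave t ω fun θ => (u θ : ℂ) * a θ) 2 (𝕋 d))
    (h2 : MemLp (wave t ω fun θ => ((1 - u θ : ℝ) : ℂ) * a θ) 2 (𝕋 d)) :
    packet t ω a = fun z => packet t ω (fun θ => (u θ : ℂ) * a θ) z +
      packet t ω (fun θ => ((1 - u θ : ℝ) : ℂ) * a θ) z := by
  funext z
  rw [packet, packet, packet, ← fcoef_add (h1.integrable one_le_two) (h2.integrable one_le_two)]
  congr 1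
  funext θ
  simp only [wave]
  push_cast
  ring

lemma norm_bform_sub_cutoff_le {n : Lat d → Lat d → ℂ} (hν : Summable ν) (hn : ∀ x k, ‖n x k‖ ≤ ν
    k) {t : ℝ} (ha : MemLp a 2 (𝕋 d)) (hwa : MemLp (wave t ω a) 2 (𝕋 d)) (hwb : MemLp (wave t ω' b)
    2 (𝕋 d)) (hu : Continuous u) (hu1 : ∀ θ, u θ ∈ Set.Icc (0 : ℝ) 1) (p q : Lat d) : ‖bform n
    (packet t ω a) (packet t ω' b) p q - bform n (packet t ω fun θ => (u θ : ℂ) * a θ) (packet t ω'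
    fun θ => (u θ : ℂ) * b θ) p q‖ ≤ (∑' k, ν k) * (√(mass a) * √(mass fun θ => ((1 - u θ : ℝ) : ℂ)
    * b θ) + √(mass fun θ => ((1 - u θ : ℝ) : ℂ) * a θ) * √(mass b)) := by
  have hu2 : ∀ θ, |u θ| ≤ 1 := fun θ => abs_le.2 ⟨by linarith [(hu1 θ).1], (hu1 θ).2⟩
  have hu3 : ∀ θ, |1 - u θ| ≤ 1 := fun θ =>
    abs_le.2 ⟨by linarith [(hu1 θ).2], by linarith [(hu1 θ).1]⟩
  have hu' : Continuous fun θ => 1 - u θ := continuous_const.sub hu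
  have ha1 : MemLp (wave t ω fun θ => (u θ : ℂ) * a θ) 2 (𝕋 d) := by
    rw [wave_real_mul]; exact memLp_real_mul hu hu2 hwa
  have ha2 : MemLp (wave t ω fun θ => ((1 - u θ : ℝ) : ℂ) * a θ) 2 (𝕋 d) := by
    rw [wave_real_mul]; exact memLp_real_mul hu' hu3 hwa
  have hb1 : MemLp (wave t ω' fun θ => (u θ : ℂ) * b θ) 2 (𝕋 d) := by
    rw [wave_real_mul]; exact memLp_real_mul hu hu2 hwb
  have hb2 : MemLp (wave t ω' fun θ => ((1 - u θ : ℝ) : ℂ) * b θ) 2 (𝕋 d) := by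
    rw [wave_real_mul]; exact memLp_real_mul hu' hu3 hwb
  have sa := sqBound_packet t hwa
  have sb := sqBound_packet t hwb
  have sa1 := sqBound_packet t ha1
  have sa2 := sqBound_packet t ha2
  have sb1 := sqBound_packet t hb1
  have sb2 := sqBound_packet t hb2
  have e1 : bform n (packet t ω a) (packet t ω' b) p q =
      bform n (packet t ω fun θ => (u θ : ℂ) * a θ) (packet t ω' b) p q +
        bform n (packet t ω fun θ => ((1 - u θ : ℝ) : ℂ) * a θ) (packet t ω' b) p q := by
    rw [packet_add t u ha1 ha2]
    exact bform_add_left hν hn sa1 sa2 sb p q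
  have e2 : bform n (packet t ω fun θ => (u θ : ℂ) * a θ) (packet t ω' b) p q =
      bform n (packet t ω fun θ => (u θ : ℂ) * a θ) (packet t ω' fun θ => (u θ : ℂ) * b θ) p q +
      bform n (packet t ω fun θ => (u θ : ℂ) * a θ)
        (packet t ω' fun θ => ((1 - u θ : ℝ) : ℂ) * b θ) p q := by
    rw [packet_add t u hb1 hb2]
    exact bform_add_right hν hn sb1 sb2 sa1 p q
  have hν0 : 0 ≤ ∑' k, ν k := tsum_nonneg fun k => (norm_nonneg _).trans (hn 0 k)
  rw [e1, e2, add_assoc, add_sub_cancel_left, mul_add]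
  refine (norm_add_le _ _).trans (add_le_add ?_ ?_)
  · refine (norm_bform_le hν hn sa1 sb2 p q).trans ?_
    gcongr
    exact mass_real_mul_le hu2 ha
  · exact norm_bform_le hν hn sa2 sb p q

lemma tsupport_cutoff_subset (u : Euc d → ℝ) (a : Euc d → ℂ) :
    tsupport (fun θ => (u θ : ℂ) * a θ) ⊆ tsupport u := by
  refine closure_mono fun θ hθ => ?_
  simp only [Function.mem_support] at hθ ⊢
  intro h; exact hθ (by simp [h])

variable [NeZero d]

/-- A square integrable amplitude and a phase, smooth with `∂₁ω ≠ 0` on a set `G`. -/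
structure IsAmplitude (G : Set (Euc d)) (ω : Euc d → ℝ) (a : Euc d → ℂ) : Prop where
  smooth : ∀ θ ∈ G, ContDiffAt ℝ (⊤ : ℕ∞) a θ
  phase : ∀ θ ∈ G, ContDiffAt ℝ (⊤ : ℕ∞) ω θ
  der_ne : ∀ θ ∈ G, der0 ω θ ≠ 0
  memLp : MemLp a 2 (𝕋 d)
  memLp_wave : ∀ t, MemLp (wave t ω a) 2 (𝕋 d)

/-- Cutoffs exhausting a set of full measure in the torus. -/
structure IsCutoff (G : Set (Euc d)) (η : ℕ → Euc d → ℝ) : Prop where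
  ae_mem : ∀ᵐ θ ∂𝕋 d, θ ∈ G
  subset : G ⊆ interior (cell d)
  smooth : ∀ k, ContDiff ℝ (⊤ : ℕ∞) (η k)
  compact : ∀ k, HasCompactSupport (η k)
  support : ∀ k, tsupport (η k) ⊆ G
  mem_Icc : ∀ k θ, η k θ ∈ Set.Icc (0 : ℝ) 1
  eventually : ∀ θ ∈ G, ∀ᶠ k in atTop, η k θ = 1

variable {η : ℕ → Euc d → ℝ}

lemma IsCutoff.isPiece (hη : IsCutoff G η) (ha : IsAmplitude G ω a) (k : ℕ) :
    IsPiece ω fun θ => (η k θ : ℂ) * a θ :=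
  isPiece_cutoff (hη.smooth k) (hη.compact k) ((hη.support k).trans hη.subset)
    (fun θ hθ => ha.smooth θ (hη.support k hθ)) (fun θ hθ => ha.phase θ (hη.support k hθ))

variable {N : ℝ → Lat d → Lat d → ℂ} {R : Euc d → Lat d → ℂ} {p q : ℝ → Lat d}

/-- It is enough to treat cut off amplitudes and homogeneous correlations. -/
lemma HalfFamily.tendsto_of_cutoff (H : HalfFamily N R ν) (hτ : τ ≠ 0) (hη : IsCutoff G η)
    (ha : IsAmplitude G ω a) (hb : IsAmplitude G ω' b) (hp : ∀ δ > 0, ∀ᶠ e in 𝓝[>] (0 : ℝ),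
    |(p e 0 : ℝ)| ≤ δ * |τ / e ^ 2|) {g : ℝ → ℂ} {gk : ℕ → ℝ → ℂ} (hk : ∀ k, Lim₀
    (fun e => bform (fun x k => R (e • toEuc x) k) (packet (τ / e ^ 2) ω (incoming τ ω fun θ =>
    (η k θ : ℂ) * a θ)) (packet (τ / e ^ 2) ω' fun θ => (η k θ : ℂ) * b θ) (p e) (q e) - gk k e) 0)
    (hg : ∀ k, ∀ᶠ e in 𝓝[>] (0 : ℝ), ‖g e - gk k e‖ ≤ s k) (hs : Tendsto s atTop (𝓝 0)) : Lim₀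
    (fun e => bform (N e) (packet (τ / e ^ 2) ω a) (packet (τ / e ^ 2) ω' b) (p e) (q e) - g e) 0 :=
    by
  set rk : ℕ → ℝ := fun k => (∑' k, ν k) *
      (√(mass a) * √(mass fun θ => ((1 - η k θ : ℝ) : ℂ) * b θ) +
        √(mass fun θ => ((1 - η k θ : ℝ) : ℂ) * a θ) * √(mass b)) with hrk
  have hr : Tendsto rk atTop (𝓝 0) := by
    have h1 := (tendsto_mass_cutoff hη.ae_mem (fun k => (hη.smooth k).continuous) hη.mem_Icc
      hη.eventually hb.memLp).sqrt.const_mul (√(mass a))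
    have h2 := (tendsto_mass_cutoff hη.ae_mem (fun k => (hη.smooth k).continuous) hη.mem_Icc
      hη.eventually ha.memLp).sqrt.mul_const (√(mass b))
    have h3 := (h1.add h2).const_mul (∑' k, ν k)
    simpa only [Real.sqrt_zero, mul_zero, zero_mul, add_zero] using h3
  refine tendsto_zero_of_approx (s := fun k => rk k + s k) (Fk := fun k e => bform (N e)
    (packet (τ / e ^ 2) ω fun θ => (η k θ : ℂ) * a θ)
    (packet (τ / e ^ 2) ω' fun θ => (η k θ : ℂ) * b θ) (p e) (q e) - gk k e) (fun k => ?_)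
    (fun k => ?_) (by simpa using hr.add hs)
  · have h1 := H.tendsto_incoming hτ (hη.isPiece ha k) (fun θ hθ => mul_ne_zero hτ
      (ha.der_ne θ (hη.support k (tsupport_cutoff_subset _ _ hθ)))) hp (q := q)
      (ψ := fun e => packet (τ / e ^ 2) ω' fun θ => (η k θ : ℂ) * b θ)
      fun e => (hη.isPiece hb k).sqBound _
    have h2 := h1.add (hk k)
    rw [add_zero] at h2
    refine h2.congr fun e => ?_
    ring
  · filter_upwards [hg k, self_mem_nhdsWithin] with e he1 he2
    have h1 := norm_bform_sub_cutoff_le H.summable (H.bound e he2) ha.memLp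
      (ha.memLp_wave (τ / e ^ 2)) (hb.memLp_wave (τ / e ^ 2)) (hη.smooth k).continuous
      (hη.mem_Icc k) (p e) (q e)
    rw [sub_sub_sub_comm]
    exact (norm_sub_le _ _).trans (add_le_add h1 he1)

section Terms

variable {m : Euc d → Measure (Euc d)} {g : Euc d → Euc d → ℂ}

lemma HalfFamily.tendsto_cross (H : HalfFamily N R ν)
    (hF : ∀ ϑ, FTRep (fun y => fsum (R y) ϑ) (m ϑ) (g ϑ) M) (hτ : τ ≠ 0) (hη : IsCutoff G η)
    (ha : IsAmplitude G ω a) (hb : IsAmplitude G ω' b)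
    (hp : ∀ δ > 0, ∀ᶠ e in 𝓝[>] (0 : ℝ), |(p e 0 : ℝ)| ≤ δ * |τ / e ^ 2|)
    (hns : ∀ a' b', IsPiece ω a' → IsPiece ω' b' → tsupport a' ⊆ G → ∀ s,
      NonStationary ω ω' p q (fun e => τ / e ^ 2) s (tsupport a' ∩ tsupport b')) :
    Lim₀ (fun e => bform (N e) (packet (τ / e ^ 2) ω a) (packet (τ / e ^ 2) ω' b) (p e) (q e))
      0 := by
  have h := H.tendsto_of_cutoff (p := p) (q := q) hτ hη ha hb hp (g := fun _ => 0)
    (gk := fun _ _ => 0) (s := fun _ => 0) (fun k => ?_) (fun k => by simp) tendsto_const_nhds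
  · simpa using h
  · have h1 := (hη.isPiece ha k).incoming (τ := τ) (fun θ hθ => mul_ne_zero hτ
      (ha.der_ne θ (hη.support k (tsupport_cutoff_subset _ _ hθ))))
    have h2 := tendsto_bform_cross h1 (hη.isPiece hb k) H.summable H.boundR hF
      (hns _ _ h1 (hη.isPiece hb k) (((tsupport_incoming_subset _ _ _).trans
        (tsupport_cutoff_subset _ _)).trans (hη.support k)))
    simpa using h2

lemma HalfFamily.tendsto_diag (H : HalfFamily N R ν) (hF : ∀ ϑ, FTRep (fun y => fsum (R y) ϑ)
    (m ϑ) (g ϑ) M) (hτ : τ ≠ 0) (hη : IsCutoff G η) (ha : IsAmplitude G ω a) (hb : IsAmplitude G ω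
    b) (hp0 : ∀ δ > 0, ∀ᶠ e in 𝓝[>] (0 : ℝ), |(p e 0 : ℝ)| ≤ δ * |τ / e ^ 2|) (hp : Lim₀
    (fun e => e • toEuc (p e)) ρ) (hpq : ∀ e, p e - q e = z) (hA : ∀ᵐ θ ∂𝕋 d, ∀ e, 0 < e → A e θ = ∫
    s, 𝐞⁻[(⟪s, ρ⟫ + τ / e * fderiv ℝ ω θ s + τ / 2 * D² ω θ s s : ℝ)] * g θ s ∂m θ) (hAm : ∀ e, 0 <
    e → AEStronglyMeasurable (A e) (𝕋 d)) {χ : ℝ → Euc d → ℝ} (hχm : ∀ e, 0 < e →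
    AEStronglyMeasurable (χ e) (𝕋 d)) (hχ1 : ∀ e θ, |χ e θ| ≤ 1) (hχ : ∀ᵐ θ ∂𝕋 d, Lim₀
    (fun e => χ e θ) (if 0 < τ * der0 ω θ then 1 else 0)) : Lim₀ (fun e => bform (N e)
    (packet (τ / e ^ 2) ω a) (packet (τ / e ^ 2) ω b) (p e) (q e) - fcoef (fun θ => a θ *
    ((χ e θ : ℂ) * A e θ) * conj (b θ)) z) 0 := by
  set ind : Euc d → ℝ := fun θ => if 0 < τ * der0 ω θ then 1 else 0 with hind
  set μ := 𝕋 d with hμ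
  have hM : ∀ᵐ θ ∂μ, ∀ e, 0 < e → ‖A e θ‖ ≤ M := by
    filter_upwards [hA] with θ hθ e he
    rw [hθ e he]
    exact (hF θ).norm_integral_le _
  have hM0 : 0 ≤ M := (norm_nonneg _).trans ((hF 0).norm_le 0)
  have hpos : Tendsto (fun k : ℕ => 1 / ((k : ℝ) + 1)) atTop (𝓝[>] 0) :=
    tendsto_nhdsWithin_iff.2 ⟨tendsto_one_div_add_atTop_nhds_zero_nat,
      .of_forall fun k => by simp only [Set.mem_Ioi]; positivity⟩
  have hindm : AEStronglyMeasurable ind μ :=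
    aestronglyMeasurable_of_tendsto_ae atTop (fun k : ℕ => hχm (1 / ((k : ℝ) + 1)) (by positivity))
      (by filter_upwards [hχ] with θ hθ using hθ.comp hpos)
  have hind1 : ∀ θ, |ind θ| ≤ 1 := fun θ => by simp only [hind]; split_ifs <;> simp
  have hab : Integrable (fun θ => ‖a θ‖ * ‖b θ‖) μ := ha.memLp.norm.integrable_mul hb.memLp.norm
  have hbc : AEStronglyMeasurable (fun θ => conj (b θ)) μ :=
    continuous_conj.comp_aestronglyMeasurable hb.memLp.1
  have hinc : ∀ k, IsPiece ω (incoming τ ω fun θ => (η k θ : ℂ) * a θ) := fun k =>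
    (hη.isPiece ha k).incoming (fun θ hθ => mul_ne_zero hτ
      (ha.der_ne θ (hη.support k (tsupport_cutoff_subset _ _ hθ))))
  set w : ℕ → Euc d → ℝ := fun k θ => η k θ ^ 2 * ind θ with hw
  have hw1 : ∀ k θ, |w k θ| ≤ 1 := fun k θ => by
    have := hη.mem_Icc k θ
    rw [hw, abs_mul]
    exact mul_le_one₀ (abs_le.2 ⟨by nlinarith [this.1], by nlinarith [this.1, this.2]⟩)
      (abs_nonneg _) (hind1 θ)
  have hwm : ∀ k, AEStronglyMeasurable (w k) μ := fun k =>
    ((hη.smooth k).continuous.pow 2).aestronglyMeasurable.mul hindm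
  have hle : ∀ x y θ, |x| ≤ 1 → |y| ≤ 1 → ‖‖a θ‖ * ‖b θ‖ * |x - y|‖ ≤ ‖a θ‖ * ‖b θ‖ * 2 := fun x y θ hx hy => by
    rw [norm_of_nonneg (by positivity)]
    have := abs_sub x y
    gcongr
    linarith
  set D : ℕ → ℝ → ℝ := fun k e => ∫ θ, ‖a θ‖ * ‖b θ‖ * |χ e θ - w k θ| ∂μ with hD
  set D₀ : ℕ → ℝ := fun k => ∫ θ, ‖a θ‖ * ‖b θ‖ * |ind θ - w k θ| ∂μ with hD₀
  have hDm : ∀ k e, 0 < e → AEStronglyMeasurable (fun θ => ‖a θ‖ * ‖b θ‖ * |χ e θ - w k θ|) μ :=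
    fun k e he => hab.1.mul ((hχm e he).sub (hwm k)).norm
  have hDlim : ∀ k, Lim₀ (D k) (D₀ k) := fun k =>
    tendsto_integral_filter_of_dominated_convergence (fun θ => ‖a θ‖ * ‖b θ‖ * 2)
      (by filter_upwards [self_mem_nhdsWithin] with e he using hDm k e he)
      (.of_forall fun e => .of_forall fun θ => hle _ _ _ (hχ1 e θ) (hw1 k θ)) (hab.mul_const 2) (by
        filter_upwards [hχ] with θ hθ using ((hθ.sub_const _).abs).const_mul _)
  have hD₀lim : Tendsto D₀ atTop (𝓝 0) := by
    have h := tendsto_integral_of_dominated_convergence (μ := μ)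
      (F := fun k θ => ‖a θ‖ * ‖b θ‖ * |ind θ - w k θ|) (f := fun _ => 0)
      (fun θ => ‖a θ‖ * ‖b θ‖ * 2) (fun k => hab.1.mul (hindm.sub (hwm k)).norm) (hab.mul_const 2)
      (fun k => .of_forall fun θ => hle _ _ _ (hind1 θ) (hw1 k θ)) (by
        filter_upwards [hη.ae_mem] with θ hθ
        refine tendsto_const_nhds.congr' ?_
        filter_upwards [hη.eventually θ hθ] with k hk
        simp [hw, hk])
    rwa [integral_zero] at h
  have hgi : ∀ e, 0 < e → ∀ v : Euc d → ℝ, AEStronglyMeasurable v μ → (∀ θ, |v θ| ≤ 1) →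
      Integrable (fun θ => a θ * ((v θ : ℂ) * A e θ) * conj (b θ)) μ := fun e he v hv hv1 => by
    refine (hab.mul_const M).mono' ((ha.memLp.1.mul
      ((continuous_ofReal.comp_aestronglyMeasurable hv).mul (hAm e he))).mul hbc) ?_
    filter_upwards [hM] with θ hθ
    rw [norm_mul, norm_mul, norm_mul, RCLike.norm_conj, norm_real, norm_eq_abs,
      mul_right_comm, ← one_mul M]
    gcongr
    exacts [hv1 θ, hθ e he]
  have hgk : ∀ k e, (fun θ => conj ((η k θ : ℂ) * b θ) *
      incoming τ ω (fun θ => (η k θ : ℂ) * a θ) θ * A e θ) =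
        fun θ => a θ * ((w k θ : ℂ) * A e θ) * conj (b θ) := fun k e => by
    funext θ
    simp only [incoming, hw, hind, map_mul, Complex.conj_ofReal]
    split_ifs <;> push_cast <;> ring
  refine H.tendsto_of_cutoff (p := p) (q := q) hτ hη ha hb hp0
    (gk := fun k e => fcoef (fun θ => a θ * ((w k θ : ℂ) * A e θ) * conj (b θ)) z)
    (s := fun k => ((2 * π) ^ d)⁻¹ * (M * (D₀ k + 1 / ((k : ℝ) + 1)))) (fun k => ?_) (fun k => ?_) ?_
  · simp only [← hgk]
    exact tendsto_bform_diag (hinc k) (hη.isPiece hb k) H.summable H.boundR hF (fun e _ => rfl) hp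
      hpq hA fun e he => (((continuous_conj.comp (hη.isPiece hb k).smooth.continuous).mul
        (hinc k).smooth.continuous).aestronglyMeasurable).mul (hAm e he)
  · filter_upwards [self_mem_nhdsWithin, (hDlim k).eventually (gt_mem_nhds
      (lt_add_of_pos_right (D₀ k) (by positivity : (0 : ℝ) < 1 / ((k : ℝ) + 1))))] with e he hDe
    rw [← fcoef_sub (hgi e he _ (hχm e he) (hχ1 e)) (hgi e he _ (hwm k) (hw1 k))]
    refine (norm_fcoef_le_integral _ _).trans (mul_le_mul_of_nonneg_left ?_ (by positivity))
    calc _ ≤ ∫ θ, M * (‖a θ‖ * ‖b θ‖ * |χ e θ - w k θ|) ∂μ := by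
          refine integral_mono_of_nonneg (.of_forall fun θ => norm_nonneg _)
            (((hab.mul_const 2).mono' (hDm k e he)
              (.of_forall fun θ => hle _ _ _ (hχ1 e θ) (hw1 k θ))).const_mul M) ?_
          filter_upwards [hM] with θ hθ
          have e1 : a θ * ((χ e θ : ℂ) * A e θ) * conj (b θ) -
              a θ * ((w k θ : ℂ) * A e θ) * conj (b θ) =
              A e θ * (a θ * conj (b θ) * ((χ e θ - w k θ : ℝ) : ℂ)) := by
            push_cast; ring
          rw [e1, norm_mul, norm_mul, norm_mul, RCLike.norm_conj, norm_real, norm_eq_abs]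
          exact mul_le_mul_of_nonneg_right (hθ e he) (by positivity)
      _ ≤ _ := by
          rw [integral_const_mul]
          exact mul_le_mul_of_nonneg_left hDe.le hM0
  · have h1 := ((hD₀lim.add tendsto_one_div_add_atTop_nhds_zero_nat).const_mul M).const_mul
      ((2 * π) ^ d)⁻¹
    simpa only [add_zero, mul_zero] using h1

end Terms

end

section

variable {m : Euc d → Measure (Euc d)} {g : Euc d → Euc d → ℂ} {p : ℝ → Lat d}

/-- The labels `(σ, ±)` of the phases `± ω_σ`. -/
def bands (V : Lat d → Mat n ℝ) : Finset (ℕ × ℝ) := Finset.range (numBands V) ×ˢ {1, -1}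

lemma mem_bands : β ∈ bands V ↔ β.1 < numBands V ∧ (β.2 = 1 ∨ β.2 = -1) := by simp [bands]

lemma sum_bands {M : Type*} [AddCommMonoid M] (f : ℕ × ℝ → M) :
    ∑ β ∈ bands V, f β = ∑ σ ∈ Finset.range (numBands V), (f (σ, 1) + f (σ, -1)) := by
  rw [bands, Finset.sum_product]
  refine sum_congr rfl fun σ _ => Finset.sum_pair (by norm_num)

lemma propKernel_eq_sum [Stable V] (t : ℝ) (p q : Ix n) :
    (fun z => propKernel V t z p q) = fun z => ∑ β ∈ bands V,
      packet t (phase V β.2 β.1) (fun θ => amp V β.2 β.1 θ p q) z := by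
  funext z
  have h := fcoef_finset_sum (bands V) (f := fun β => wave t (phase V β.2 β.1)
    (fun θ => amp V β.2 β.1 θ p q)) (fun β hβ => (memLp_wave_amp (mem_bands.1 hβ).2
      (mem_bands.1 hβ).1 t p q).integrable one_le_two) z
  simp only [packet]
  rw [← h, propKernel]
  congr 1
  funext θ
  rw [sum_bands]

lemma volume_cell_diff_interior : volume (cell d \ interior (cell d)) = 0 := by
  have hconv : Convex ℝ (cell d) := fun x hx y hy a b ha hb hab i => by
    have := (convex_Icc (-π) π) (hx i) (hy i) ha hb hab
    simpa using this
  have h := hconv.addHaar_frontier (volume : Measure (Euc d))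
  rwa [isCompact_cell.isClosed.frontier_eq] at h

lemma chi_eq [NeZero d] (sg : ℝ) (σ : ℕ) (τ r1 : ℝ) (θ : Euc d) :
    chi V sg σ τ r1 θ = (1 + Real.sign (r1 + sg * (gradOm V σ θ 0 * τ))) / 2 := rfl

lemma measurable_real_sign : Measurable Real.sign := by
  unfold Real.sign
  exact Measurable.ite measurableSet_Iio measurable_const
    (Measurable.ite measurableSet_Ioi measurable_const measurable_const)

lemma tendsto_sub_div_time {q : ℝ → Lat d} {ρ' : Euc d} (hp : Lim₀ (fun e => e • toEuc (p e))
    ρ) (hq : Lim₀ (fun e => e • toEuc (q e)) ρ') (τ : ℝ) : Lim₀ (fun e => (τ / e ^ 2)⁻¹ •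
    toEuc (q e - p e)) 0 := by
  have h0 : Lim₀ (fun e : ℝ => e * τ⁻¹) 0 := by
    have h : Tendsto (fun e : ℝ => e * τ⁻¹) (𝓝 0) (𝓝 (0 * τ⁻¹)) := tendsto_id.mul_const _
    rw [zero_mul] at h
    exact h.mono_left nhdsWithin_le_nhds
  have h := h0.smul (hq.sub hp)
  rw [zero_smul] at h
  refine h.congr' ?_
  filter_upwards [self_mem_nhdsWithin] with e he
  have he : e ≠ 0 := (Set.mem_Ioi.1 he).ne'
  rw [← smul_sub, ← toEuc_sub, smul_smul]
  congr 1
  rw [inv_div]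
  ring

variable [Stable V] [NeZero d]

/-- The points of the torus interior where all phases and amplitudes are analytic and
`∂₁ω_σ ≠ 0`. -/
def stationarySet (V : Lat d → Mat n ℝ) : Set (Euc d) :=
  interior (cell d) ∩ (analyticSet V ∩ {θ | ∀ σ < numBands V, der0 (om V σ) θ ≠ 0})

lemma isOpen_stationarySet : IsOpen (stationarySet V) := by
  refine isOpen_interior.inter ?_
  rw [isOpen_iff_mem_nhds]
  rintro θ ⟨hθ, h0⟩
  have h1 : ∀ᶠ x in 𝓝 θ, ∀ σ ∈ Finset.range (numBands V), der0 (om V σ) x ≠ 0 := by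
    rw [Filter.eventually_all_finset]
    intro σ hσ
    exact (analyticAt_der0_om hθ (mem_range.1 hσ)).continuousAt.eventually_ne
      (h0 σ (mem_range.1 hσ))
  filter_upwards [isOpen_analyticSet.mem_nhds hθ, h1] with x hx1 hx2
  exact ⟨hx1, fun σ hσ => hx2 σ (mem_range.2 hσ)⟩

lemma ae_mem_stationarySet : ∀ᵐ θ ∂𝕋 d, θ ∈ stationarySet V := by
  have h1 : ∀ᵐ θ : Euc d, ∀ σ ∈ Finset.range (numBands V), der0 (om V σ) θ ≠ 0 :=
    (Finset.eventually_all _).2 fun σ hσ => ae_der0_om_ne (mem_range.1 hσ)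
  have h2 : ∀ᵐ θ : Euc d, θ ∉ cell d \ interior (cell d) :=
    measure_eq_zero_iff_ae_notMem.1 volume_cell_diff_interior
  rw [ae_restrict_iff' measurableSet_cell]
  filter_upwards [h1, h2, ae_mem_analyticSet (V := V)] with θ h1 h2 h3 hc
  refine ⟨?_, h3, fun σ hσ => h1 σ (mem_range.2 hσ)⟩
  by_contra h
  exact h2 ⟨hc, h⟩

lemma exists_isCutoff : ∃ η, IsCutoff (stationarySet V) η := by
  have hne : (stationarySet V)ᶜ.Nonempty := by
    refine ⟨single 0 (2 * π), fun h => ?_⟩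
    have h1 := (interior_subset h.1) 0
    simp only [PiLp.single_apply, if_true] at h1
    linarith [h1.2, pi_pos]
  obtain ⟨η, h1, h2, h3, h4, h5⟩ := exists_cutoff isOpen_stationarySet hne
  exact ⟨η, ae_mem_stationarySet, Set.inter_subset_left, h1, h2, h3, h4, h5⟩

lemma der0_phase (sg : ℝ) (hθ : θ ∈ analyticSet V) (hσ : σ < numBands V) : der0 (phase V sg σ) θ =
    sg * gradOm V σ θ 0 := by
  have h1 : gradOm V σ θ 0 = fderiv ℝ (om V σ) θ (single 0 1) := by
    rw [← inner_gradOm, EuclideanSpace.inner_single_left]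
    simp
  rw [der0, fderiv_phase sg hθ hσ, h1]
  rfl

lemma isAmplitude_amp (hβ : β ∈ bands V) (p q : Ix n) : IsAmplitude (stationarySet V) (phase V β.2
    β.1) (fun θ => amp V β.2 β.1 θ p q) := by
  obtain ⟨hσ, hs⟩ := mem_bands.1 hβ
  refine ⟨fun θ hθ => (analyticAt_amp _ hθ.2.1 hσ p q).contDiffAt,
    fun θ hθ => (analyticAt_phase _ hθ.2.1 hσ).contDiffAt, fun θ hθ => ?_,
    memLp_amp hs hσ p q, fun t => memLp_wave_amp hs hσ t p q⟩
  have h1 : der0 (phase V β.2 β.1) θ = β.2 * der0 (om V β.1) θ := by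
    rw [der0, fderiv_phase _ hθ.2.1 hσ]
    rfl
  rw [h1]
  refine mul_ne_zero ?_ (hθ.2.2 _ hσ)
  rcases hs with h | h <;> rw [h] <;> norm_num

/-! ### The factors `χ` -/

lemma abs_chi_le (sg : ℝ) (σ : ℕ) (τ r1 : ℝ) (θ : Euc d) : |chi V sg σ τ r1 θ| ≤ 1 := by
  rw [chi_eq]
  rcases Real.sign_apply_eq (r1 + sg * (gradOm V σ θ 0 * τ)) with h | h | h <;> rw [h] <;> norm_num

lemma aestronglyMeasurable_chi (hσ : σ < numBands V) (sg τ r1 : ℝ) : AEStronglyMeasurable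
    (chi V sg σ τ r1) (𝕋 d) := by
  have h := (aestronglyMeasurable_gradOm hσ).aemeasurable
  have hm : Measurable fun y : Euc d => (1 + Real.sign (r1 + sg * (y 0 * τ))) / 2 := by
    have : Measurable fun y : Euc d => r1 + sg * (y 0 * τ) := by fun_prop
    exact ((measurable_real_sign.comp this).const_add 1).div_const 2
  exact (hm.comp_aemeasurable h).aestronglyMeasurable.restrict

lemma tendsto_chi (hβ : β ∈ bands V) (hθ : θ ∈ stationarySet V) (hτ : τ ≠ 0) (r1 : ℝ) : Lim₀
    (fun e : ℝ => chi V β.2 β.1 (τ / e) r1 θ) (if 0 < τ * der0 (phase V β.2 β.1) θ then 1 else 0) :=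
    by
  obtain ⟨hσ, hs⟩ := mem_bands.1 hβ
  have h1 : der0 (phase V β.2 β.1) θ = β.2 * der0 (om V β.1) θ := by
    rw [der0, fderiv_phase _ hθ.2.1 hσ]
    rfl
  have h2 := der0_phase β.2 hθ.2.1 hσ
  have hne : τ * der0 (phase V β.2 β.1) θ ≠ 0 := by
    rw [h1]
    refine mul_ne_zero hτ (mul_ne_zero ?_ (hθ.2.2 _ hσ))
    rcases hs with h | h <;> rw [h] <;> norm_num
  set x := τ * der0 (phase V β.2 β.1) θ with hx
  have h3 : ∀ e : ℝ, chi V β.2 β.1 (τ / e) r1 θ = (1 + Real.sign (r1 + x * e⁻¹)) / 2 := fun e => by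
    rw [chi_eq, hx, h2]
    congr 3
    ring
  simp only [h3]
  rcases lt_or_gt_of_ne hne with h0 | h0
  · rw [if_neg (not_lt.2 h0.le)]
    have h4 : Tendsto (fun e : ℝ => r1 + x * e⁻¹) (𝓝[>] 0) atBot :=
      tendsto_atBot_add_const_left _ _ (tendsto_inv_nhdsGT_zero.const_mul_atTop_of_neg h0)
    refine tendsto_const_nhds.congr' ?_
    filter_upwards [h4.eventually_lt_atBot 0] with e he
    rw [Real.sign_of_neg he]
    norm_num
  · rw [if_pos h0]
    have h4 : Tendsto (fun e : ℝ => r1 + x * e⁻¹) (𝓝[>] 0) atTop :=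
      tendsto_atTop_add_const_left _ _ (tendsto_inv_nhdsGT_zero.const_mul_atTop h0)
    refine tendsto_const_nhds.congr' ?_
    filter_upwards [h4.eventually_gt_atTop 0] with e he
    rw [Real.sign_of_pos he]
    norm_num

/-! ### Points -/

lemma eventually_abs_zero_le (hp : Lim₀ (fun e => e • toEuc (p e)) ρ) (hτ : τ ≠ 0) : ∀ δ > 0,
    ∀ᶠ e in 𝓝[>] (0 : ℝ), |(p e 0 : ℝ)| ≤ δ * |τ / e ^ 2| := fun δ hδ => by
  have hτ' := abs_pos.2 hτ
  have h1 : ∀ᶠ e in 𝓝[>] (0 : ℝ), ‖e • toEuc (p e)‖ ≤ ‖ρ‖ + 1 :=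
    (hp.norm.eventually (gt_mem_nhds (by linarith : ‖ρ‖ < ‖ρ‖ + 1))).mono fun _ h => h.le
  have h2 : ∀ᶠ e in 𝓝[>] (0 : ℝ), e * (‖ρ‖ + 1) ≤ δ * |τ| := by
    have : Lim₀ (fun e : ℝ => e * (‖ρ‖ + 1)) 0 := by
      have h : Tendsto (fun e : ℝ => e * (‖ρ‖ + 1)) (𝓝 0) (𝓝 (0 * (‖ρ‖ + 1))) :=
        tendsto_id.mul_const _
      rw [zero_mul] at h
      exact h.mono_left nhdsWithin_le_nhds
    exact (this.eventually (gt_mem_nhds (by positivity : 0 < δ * |τ|))).mono fun _ h => h.le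
  filter_upwards [h1, h2, self_mem_nhdsWithin] with e h1 h2 he
  have he : 0 < e := he
  have h3 : e * |(p e 0 : ℝ)| ≤ ‖ρ‖ + 1 := by
    refine le_trans ?_ h1
    have := PiLp.norm_apply_le (e • toEuc (p e)) 0
    simpa [toEuc, abs_of_pos he] using this
  rw [abs_div, abs_of_pos (pow_pos he 2), ← mul_div_assoc, le_div_iff₀ (pow_pos he 2)]
  have : 0 ≤ |(p e 0 : ℝ)| := abs_nonneg _
  nlinarith

/-! ### The bilinear forms of the propagator -/

section Propagator

variable {N : ℝ → Lat d → Lat d → ℂ} {P Q : ℝ → Lat d} {ρ' : Euc d}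

lemma bform_propKernel (H : HalfFamily N (fun y k => R0 y k i j) ν) (p q : Ix n) (he : 0 < e)
    (t : ℝ) (x y : Lat d) : bform (N e) (fun z => propKernel V t z p i) (fun z => propKernel V t z q
    j) x y = ∑ β ∈ bands V, ∑ β' ∈ bands V, bform (N e) (packet t (phase V β.2 β.1) fun θ => amp V
    β.2 β.1 θ p i) (packet t (phase V β'.2 β'.1) fun θ => amp V β'.2 β'.1 θ q j) x y := by
  have hs : ∀ p i, ∀ β ∈ bands V, ∃ m, SqBound (packet t (phase V β.2 β.1)
      fun θ => amp V β.2 β.1 θ p i) univ m := fun p i β hβ =>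
    ⟨_, sqBound_packet t ((isAmplitude_amp hβ p i).memLp_wave t)⟩
  obtain ⟨m, hm⟩ := exists_sqBound_sum (bands V) (hs q j)
  rw [propKernel_eq_sum, propKernel_eq_sum,
    bform_sum_left (bands V) H.summable (H.bound e he) (hs p i) hm]
  refine sum_congr rfl fun β hβ => ?_
  obtain ⟨m', hm'⟩ := hs p i β hβ
  exact bform_sum_right (bands V) H.summable (H.bound e he) (hs q j) hm' x y

lemma HalfFamily.tendsto_band_cross (H : HalfFamily N (fun y k => R0 y k i j) ν) (hγ : (d : ℝ) <
    γ) (hI1 : CondI1 C γ R0) (hF : ∀ θ, FTRep (fun y => R0hat R0 y θ i j) (m θ) (g θ) M)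
    (hτ : τ ≠ 0) (hP : Lim₀ (fun e => e • toEuc (P e)) ρ) (hQ : Lim₀ (fun e => e • toEuc
    (Q e)) ρ') (p q : Ix n) {β' : ℕ × ℝ} (hβ : β ∈ bands V) (hβ' : β' ∈ bands V) (hne : β ≠ β' ∨ ρ ≠
    ρ') : Lim₀ (fun e => bform (N e) (packet (τ / e ^ 2) (phase V β.2 β.1) fun θ => amp V β.2
    β.1 θ p i) (packet (τ / e ^ 2) (phase V β'.2 β'.1) fun θ => amp V β'.2 β'.1 θ q j) (P e) (Q e))
    0 := by
  obtain ⟨η, hη⟩ := exists_isCutoff (V := V)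
  obtain ⟨hσ, hs⟩ := mem_bands.1 hβ
  obtain ⟨hσ', hs'⟩ := mem_bands.1 hβ'
  refine H.tendsto_cross (m := m) (g := g) (M := M) (fun θ => ?_) hτ hη
    (isAmplitude_amp hβ p i) (isAmplitude_amp hβ' q j)
    (eventually_abs_zero_le hP hτ) fun a' b' ha' hb' _ s => ?_
  · have := hF θ
    simp only [R0hat_apply hγ hI1] at this
    exact this
  · by_cases hbb : β = β'
    · subst hbb
      have hρ : ρ' - ρ ≠ 0 := sub_ne_zero.2 (hne.resolve_left (fun h => h rfl)).symm
      refine nonStationary_of_shift ha' s (ρ' - ρ) τ (fun _ _ => rfl) ?_ ?_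
      · refine (hQ.sub hP).congr fun e => ?_
        rw [toEuc_sub, smul_sub]
      · filter_upwards [ae_hess_shift_ne hσ hs hρ hτ s] with θ hθ _ using hθ
    · refine nonStationary_of_ne ha' hb' s ?_ (tendsto_abs_time hτ) (tendsto_sub_div_time hP hQ τ)
      filter_upwards [ae_fderiv_phase_sub_ne hσ hσ' hs hs'
        (fun h => hbb (Prod.ext h.1 h.2))] with θ hθ _ using hθ

/-- The contribution of one band to the asymptotic covariance. -/
def bandTerm (V : Lat d → Mat n ℝ) (R0 : Euc d → Lat d → IxMat n ℂ)
    (β : ℕ × ℝ) (e τ : ℝ) (ρ : Euc d) (p i j q : Ix n) (θ : Euc d) : ℂ :=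
  amp V β.2 β.1 θ p i * ((chi V β.2 β.1 (τ / e) (ρ 0) θ : ℂ) * matA V R0 β.2 β.1 e τ ρ θ i j) *
    conj (amp V β.2 β.1 θ q j)

lemma HalfFamily.tendsto_band_diag (H : HalfFamily N (fun y k => R0 y k i j) ν) (hγ : (d : ℝ) < γ)
    (hI1 : CondI1 C γ R0) (hI4 : CondI4 R0) (hF : ∀ θ, FTRep (fun y => R0hat R0 y θ i j) (m θ) (g θ)
    M) (hτ : τ ≠ 0) (hP : Lim₀ (fun e => e • toEuc (P e)) ρ) (hPQ : ∀ e, P e - Q e = z)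
    (p q : Ix n) (hβ : β ∈ bands V) : Lim₀ (fun e => bform (N e) (packet (τ / e ^ 2)
    (phase V β.2 β.1) fun θ => amp V β.2 β.1 θ p i) (packet (τ / e ^ 2) (phase V β.2 β.1) fun θ =>
    amp V β.2 β.1 θ q j) (P e) (Q e) - fcoef (bandTerm V R0 β e τ ρ p i j q) z) 0 := by
  obtain ⟨η, hη⟩ := exists_isCutoff (V := V)
  obtain ⟨hσ, hs⟩ := mem_bands.1 hβ
  refine H.tendsto_diag (m := m) (g := g) (M := M) (fun θ => ?_) hτ hη
    (isAmplitude_amp hβ p i) (isAmplitude_amp hβ q j)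
    (eventually_abs_zero_le hP hτ) hP hPQ
    (A := fun e θ => matA V R0 β.2 β.1 e τ ρ θ i j) ?_ (fun e _ =>
      (aestronglyMeasurable_matA hσ hs hτ hγ hI1 hI4 i j hF e ρ).restrict)
    (χ := fun e => chi V β.2 β.1 (τ / e) (ρ 0))
    (fun e _ => aestronglyMeasurable_chi hσ _ _ _) (fun e θ => abs_chi_le _ _ _ _ _) ?_
  · have := hF θ
    simp only [R0hat_apply hγ hI1] at this
    exact this
  · refine ae_restrict_of_ae ?_
    filter_upwards [ae_mem_analyticSet (V := V), ae_det_hessOm_ne hσ] with θ h1 h2 e _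
    exact matA_eq h1 hσ h2 hs hτ (hF θ) e ρ
  · filter_upwards [hη.ae_mem] with θ hθ
    exact tendsto_chi hβ hθ hτ (ρ 0)

lemma HalfFamily.tendsto_propKernel_cross (H : HalfFamily N (fun y k => R0 y k i j) ν)
    (hγ : (d : ℝ) < γ) (hI1 : CondI1 C γ R0) (hF : ∀ θ, FTRep (fun y => R0hat R0 y θ i j) (m θ)
    (g θ) M) (hτ : τ ≠ 0) (hP : Lim₀ (fun e => e • toEuc (P e)) ρ) (hQ : Lim₀
    (fun e => e • toEuc (Q e)) ρ') (p q : Ix n) (hne : ρ ≠ ρ') : Lim₀ (fun e => bform (N e)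
    (fun z => propKernel V (τ / e ^ 2) z p i) (fun z => propKernel V (τ / e ^ 2) z q j) (P e) (Q e))
    0 := by
  have h := tendsto_finsetSum (bands V) fun β hβ => tendsto_finsetSum (bands V) fun β' hβ' =>
    H.tendsto_band_cross hγ hI1 hF hτ hP hQ p q hβ hβ' (Or.inr hne)
  simp only [Finset.sum_const_zero] at h
  refine h.congr' ?_
  filter_upwards [self_mem_nhdsWithin] with e he
  exact (bform_propKernel H p q he _ _ _).symm

lemma HalfFamily.tendsto_propKernel_diag (H : HalfFamily N (fun y k => R0 y k i j) ν)
    (hγ : (d : ℝ) < γ) (hI1 : CondI1 C γ R0) (hI4 : CondI4 R0) (hF : ∀ θ, FTRep (fun y => R0hat R0 y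
    θ i j) (m θ) (g θ) M) (hτ : τ ≠ 0) (hP : Lim₀ (fun e => e • toEuc (P e)) ρ) (hQ : Lim₀
    (fun e => e • toEuc (Q e)) ρ) (hPQ : ∀ e, P e - Q e = z) (p q : Ix n) : Lim₀ (fun e => bform
    (N e) (fun z => propKernel V (τ / e ^ 2) z p i) (fun z => propKernel V (τ / e ^ 2) z q j) (P e)
    (Q e) - ∑ β ∈ bands V, fcoef (bandTerm V R0 β e τ ρ p i j q) z) 0 := by
  classical
  have h := tendsto_finsetSum (bands V) fun β hβ => tendsto_finsetSum (bands V) fun β' hβ' =>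
    (show Lim₀ (fun e => bform (N e)
      (packet (τ / e ^ 2) (phase V β.2 β.1) fun θ => amp V β.2 β.1 θ p i)
      (packet (τ / e ^ 2) (phase V β'.2 β'.1) fun θ => amp V β'.2 β'.1 θ q j) (P e) (Q e) -
      if β = β' then fcoef (bandTerm V R0 β e τ ρ p i j q) z else 0) 0 by
      by_cases hbb : β = β'
      · subst hbb
        simp only [if_true]
        exact H.tendsto_band_diag hγ hI1 hI4 hF hτ hP hPQ p q hβ
      · simp only [hbb, if_false, sub_zero]
        exact H.tendsto_band_cross hγ hI1 hF hτ hP hQ p q hβ hβ' (Or.inl hbb))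
  simp only [Finset.sum_const_zero] at h
  refine h.congr' ?_
  filter_upwards [self_mem_nhdsWithin] with e he
  rw [bform_propKernel H p q he, ← sum_sub_distrib]
  refine sum_congr rfl fun β hβ => ?_
  rw [sum_sub_distrib, Finset.sum_ite_eq, if_pos hβ]

end Propagator

end

section

variable {m : Euc d → Measure (Euc d)} {g : Euc d → Euc d → ℂ}

variable [Stable V]

/-! ### The points `[r / ε] + z` -/

lemma tendsto_smul_intPart (r : Euc d) (z : Lat d) :
    Lim₀ (fun e : ℝ => e • toEuc (intPart (e⁻¹ • r) + z)) r := by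
  have h : ∀ i, Lim₀ (fun e : ℝ => e * ((⌊e⁻¹ * r i⌋ : ℝ) + z i)) (r i) := fun i => by
    have h0 : Lim₀ (fun e : ℝ => e) 0 := tendsto_id.mono_left nhdsWithin_le_nhds
    have h1 : Lim₀ (fun e : ℝ => r i - e + e * z i) (r i) := by
      simpa using (tendsto_const_nhds.sub h0).add (h0.mul_const (z i : ℝ))
    have h2 : Lim₀ (fun e : ℝ => r i + e * z i) (r i) := by
      simpa using tendsto_const_nhds.add (h0.mul_const (z i : ℝ))
    refine tendsto_of_tendsto_of_tendsto_of_le_of_le' h1 h2 ?_ ?_ <;>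
      filter_upwards [self_mem_nhdsWithin] with e he
    · have h3 := mul_le_mul_of_nonneg_left (Int.sub_one_lt_floor (e⁻¹ * r i)).le (Set.mem_Ioi.1 he).le
      rw [mul_sub, mul_inv_cancel_left₀ (Set.mem_Ioi.1 he).ne', mul_one] at h3
      linarith
    · have h3 := mul_le_mul_of_nonneg_left (Int.floor_le (e⁻¹ * r i)) (Set.mem_Ioi.1 he).le
      rw [mul_inv_cancel_left₀ (Set.mem_Ioi.1 he).ne'] at h3
      linarith
  have h2 := ((PiLp.continuous_toLp 2 _).tendsto _).comp (tendsto_pi_nhds.2 h)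
  refine h2.congr fun e => ?_
  ext i
  simp [toEuc, intPart]

variable [NeZero d]

/-! ### The initial correlations form a half-space family -/

lemma halfFamily_corrWeight (hC : 0 < C) (hγ : (d : ℝ) < γ) (hI1 : CondI1 C γ R0) {R : Euc d → Lat
    d → Lat d → IxMat n ℂ} (ha : CondA R R0) {μ₀ : ℝ → Measure (PhaseSpace d n α)} (hV1 : CondV1' C
    γ R μ₀) (hV2 : CondV2' C γ μ₀) (i j : Ix n) : HalfFamily (fun e => corrWeight (μ₀ e) i j)
    (fun y k => R0 y k i j) (fun k => C * (1 + ‖toEuc k‖) ^ (-γ)) where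
  summable := (summable_one_add_norm hγ).mul_left C
  bound e he x k := norm_corrWeight_le hC.le (hV2 e he) i j x k
  zero e x k hx := if_neg fun h => absurd h.1 (not_lt.2 hx)
  boundR y k := hI1 y k i j
  lim k δ hδ := by
    obtain ⟨m₀, hm₀⟩ := eventually_atTop.1
      (Metric.tendstoUniformly_iff.1 (ha.2.2 k i j) (δ / 2) (half_pos hδ))
    have h0 : Lim₀ (fun e : ℝ => C * (e * ‖toEuc k‖)) 0 := by
      have : Continuous fun e : ℝ => C * (e * ‖toEuc k‖) := by fun_prop
      simpa using (this.tendsto 0).mono_left nhdsWithin_le_nhds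
    refine ⟨m₀ + |(k 0 : ℝ)|, ?_⟩
    filter_upwards [h0.eventually (gt_mem_nhds (half_pos hδ)), self_mem_nhdsWithin] with e h1 he x hx
    have hx' : (m₀ : ℤ) + |k 0| < x 0 := by exact_mod_cast hx
    have hxk : (m₀ : ℤ) < (x - k) 0 := by
      rw [Pi.sub_apply]
      linarith [le_abs_self (k 0)]
    have hx0 : 0 < x 0 := by linarith [abs_nonneg (k 0), Int.natCast_nonneg m₀]
    have hxk0 : 0 < (x - k) 0 := by linarith [Int.natCast_nonneg m₀]
    obtain ⟨m, hm⟩ := Int.eq_ofNat_of_zero_le hxk0.le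
    have hR : R (e • toEuc x) x (x - k) =
        R (e • toEuc x) (Pi.single 0 (m : ℤ) + k) (Pi.single 0 (m : ℤ)) := by
      have h2 := ha.2.1 (e • toEuc x) (Pi.single 0 (m : ℤ) + k) (Pi.single 0 (m : ℤ))
        (x - k - Pi.single 0 (m : ℤ)) ?_ (by simp) (by simp [hm])
      · rw [← h2]
        congr 1 <;> abel
      · rw [Pi.add_apply, Pi.single_eq_same, ← hm, Pi.sub_apply, sub_add_cancel]
        exact hx0.le
    have h3 := hm₀ m (by rw [hm] at hxk; exact_mod_cast hxk.le) (e • toEuc x)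
    have h4 := hV1 e he x (x - k) hx0 hxk0 i j
    rw [hR, sub_sub_cancel] at h4
    have h5 := h4.trans (mul_le_mul_of_nonneg_left (min_le_right _ _) hC.le)
    rw [dist_comm, dist_eq_norm] at h3
    rw [corrWeight, if_pos ⟨hx0, hxk0⟩]
    calc _ = ‖(corr (μ₀ e) x (x - k) i j - R (e • toEuc x) (Pi.single 0 (m : ℤ) + k)
          (Pi.single 0 (m : ℤ)) i j) + (R (e • toEuc x) (Pi.single 0 (m : ℤ) + k)
          (Pi.single 0 (m : ℤ)) i j - R0 (e • toEuc x) k i j)‖ := by rw [sub_add_sub_cancel]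
      _ ≤ _ := (norm_add_le _ _).trans (by linarith)

/-! ### The asymptotic covariance as a sum over bands -/

section GLat

lemma integrable_bandTerm (hγ : (d : ℝ) < γ) (hI1 : CondI1 C γ R0) (hI4 : CondI4 R0)
    (hF : ∀ θ, FTRep (fun y => R0hat R0 y θ i j) (m θ) (g θ) M) (hτ : τ ≠ 0) (e : ℝ) (ρ : Euc d)
    (p q : Ix n) (hβ : β ∈ bands V) : Integrable (bandTerm V R0 β e τ ρ p i j q) (𝕋 d) := by
  obtain ⟨hσ, hs⟩ := mem_bands.1 hβ
  have h1 := memLp_amp hs hσ p i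
  have h2 := (memLp_amp hs hσ q j).star
  have h3 : Integrable (fun θ => amp V β.2 β.1 θ p i * conj (amp V β.2 β.1 θ q j))
      (𝕋 d) := h1.integrable_mul h2
  have h4 := (aestronglyMeasurable_matA hσ hs hτ hγ hI1 hI4 i j hF e ρ).restrict (s := cell d)
  have h5 := continuous_ofReal.comp_aestronglyMeasurable
    (aestronglyMeasurable_chi hσ β.2 (τ / e) (ρ 0))
  have h6 := h3.mul_bdd (c := M) (h5.mul h4) (by
    refine ae_restrict_of_ae ?_
    filter_upwards [ae_mem_analyticSet (V := V), ae_det_hessOm_ne hσ] with θ h1 h2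
    have h7 := norm_matA_le h1 hσ h2 hs hτ (hF θ) e ρ
    have h8 := abs_chi_le (V := V) β.2 β.1 (τ / e) (ρ 0) θ
    simp only [Pi.mul_apply, norm_mul, norm_real, norm_eq_abs]
    calc _ ≤ 1 * M := mul_le_mul h8 h7 (norm_nonneg _) zero_le_one
      _ = M := one_mul M)
  refine h6.congr (.of_forall fun θ => ?_)
  simp only [Pi.mul_apply, bandTerm]
  ring

lemma gHat_apply (e τ : ℝ) (ρ θ : Euc d) (p q : Ix n) :
    gHat V R0 e τ ρ θ p q = ∑ i, ∑ j, ∑ β ∈ bands V, bandTerm V R0 β e τ ρ p i j q θ := by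
  have h1 : ∀ β : ℕ × ℝ, (1 / 4 : ℂ) • (matPi V β.1 θ * signTerm V R0 β.2 β.1 e τ ρ θ *
      matPi V β.1 θ) = amp V β.2 β.1 θ * ((chi V β.2 β.1 (τ / e) (ρ 0) θ : ℂ) •
        matA V R0 β.2 β.1 e τ ρ θ) * (amp V β.2 β.1 θ)ᴴ := fun β =>
    (amp_mul_mul_conjTranspose β.1 θ _).symm
  have h2 : gHat V R0 e τ ρ θ = ∑ β ∈ bands V, amp V β.2 β.1 θ *
      ((chi V β.2 β.1 (τ / e) (ρ 0) θ : ℂ) • matA V R0 β.2 β.1 e τ ρ θ) * (amp V β.2 β.1 θ)ᴴ := by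
    rw [sum_bands, gHat, Finset.smul_sum]
    refine sum_congr rfl fun σ _ => ?_
    rw [← h1 (σ, 1), ← h1 (σ, -1), ← smul_add, mul_add, add_mul]
  have h3 : ∀ β : ℕ × ℝ, (amp V β.2 β.1 θ * ((chi V β.2 β.1 (τ / e) (ρ 0) θ : ℂ) •
      matA V R0 β.2 β.1 e τ ρ θ) * (amp V β.2 β.1 θ)ᴴ) p q =
      ∑ i, ∑ j, bandTerm V R0 β e τ ρ p i j q θ := fun β => by
    rw [Finset.sum_comm, mul_apply]
    refine sum_congr rfl fun j _ => ?_
    rw [mul_apply, sum_mul]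
    rfl
  rw [h2, Matrix.sum_apply, sum_congr rfl fun β _ => h3 β, Finset.sum_comm]
  exact sum_congr rfl fun i _ => Finset.sum_comm

lemma gLat_apply (hγ : (d : ℝ) < γ) (hI1 : CondI1 C γ R0) (hI4 : CondI4 R0)
    {m : Ix n → Ix n → Euc d → Measure (Euc d)} {g : Ix n → Ix n → Euc d → Euc d → ℂ}
    (hF : ∀ i j θ, FTRep (fun y => R0hat R0 y θ i j) (m i j θ) (g i j θ) M) (hτ : τ ≠ 0) (e : ℝ)
    (ρ : Euc d) (z : Lat d) (p q : Ix n) :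
    gLat V R0 e τ ρ z p q = ∑ i, ∑ j, ∑ β ∈ bands V, fcoef (bandTerm V R0 β e τ ρ p i j q) z := by
  have hi : ∀ i j, ∀ β ∈ bands V, Integrable (bandTerm V R0 β e τ ρ p i j q)
      (𝕋 d) := fun i j β hβ =>
    integrable_bandTerm hγ hI1 hI4 (hF i j) hτ e ρ p q hβ
  have h1 : gLat V R0 e τ ρ z p q = fcoef (fun θ => gHat V R0 e τ ρ θ p q) z := rfl
  simp only [h1, gHat_apply]
  rw [fcoef_finset_sum _ fun i _ => integrable_finsetSum _ fun j _ =>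
    integrable_finsetSum _ (hi i j)]
  refine sum_congr rfl fun i _ => ?_
  rw [fcoef_finset_sum _ fun j _ => integrable_finsetSum _ (hi i j)]
  exact sum_congr rfl fun j _ => fcoef_finset_sum _ (hi i j) z

end GLat

lemma toEuc_refl (z : Lat d) : toEuc (refl z) = reflE (toEuc z) := by
  ext i
  by_cases hi : i = 0
  · subst hi
    simp [toEuc, reflE, refl]
  · simp [toEuc, reflE, refl, hi]

lemma reflE_smul (c : ℝ) (x : Euc d) : reflE (c • x) = c • reflE x := by
  ext i
  by_cases hi : i = 0
  · subst hi
    simp [reflE]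
  · simp [reflE, hi]

lemma continuous_reflE : Continuous (reflE : Euc d → Euc d) := by
  refine (PiLp.continuous_toLp 2 _).comp ?_
  exact (PiLp.continuous_ofLp 2 _).update 0 (by fun_prop)

lemma tendsto_smul_refl (h : Lim₀ (fun e => e • toEuc (P e)) r) : Lim₀ (fun e => e • toEuc
    (refl (P e))) (reflE r) := by
  refine ((continuous_reflE.tendsto r).comp h).congr fun e => ?_
  rw [Function.comp_apply, reflE_smul, toEuc_refl]

lemma eventually_pos_of_tendsto_smul (h : Lim₀ (fun e => e • toEuc (P e)) r) (hr : 0 < r 0) :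
    ∀ᶠ e in 𝓝[>] (0 : ℝ), 0 < P e 0 := by
  have h1 : Lim₀ (fun e : ℝ => e * (P e 0 : ℝ)) (r 0) :=
    ((show Continuous fun x : Euc d => x 0 by fun_prop).tendsto r).comp h
  filter_upwards [h1.eventually (lt_mem_nhds hr), self_mem_nhdsWithin] with e h2 he
  exact_mod_cast (pos_iff_pos_of_mul_pos h2).1 he

lemma refl_add (x y : Lat d) : refl (x + y) = refl x + refl y := by
  rw [← sub_eq_iff_eq_add, ← refl_sub, add_sub_cancel_right]

lemma reflE_eq_self (h : r 0 = 0) : reflE r = r := by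
  rw [reflE, h, neg_zero, ← h, Function.update_eq_self]

lemma refl_eq_self (h : z 0 = 0) : refl z = z := by
  rw [refl, h, neg_zero, ← h, Function.update_eq_self]

lemma reflE_ne_self (h : r 0 ≠ 0) : r ≠ reflE r := fun h1 => h <| by
  have := congrFun (congrArg WithLp.ofLp h1) 0
  simp only [reflE, Function.update_self] at this
  linarith

/-! ### Convergence of the covariance -/

lemma HalfFamily.tendsto_imageForm {N : ℝ → Lat d → Lat d → ℂ} (H : HalfFamily N (fun y k => R0 y
    k i j) ν) (hγ : (d : ℝ) < γ) (hI1 : CondI1 C γ R0) (hI4 : CondI4 R0) (hF : ∀ θ, FTRep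
    (fun y => R0hat R0 y θ i j) (m θ) (g θ) M) (hτ : τ ≠ 0) (hr : 0 ≤ r 0) (z z' : Lat d)
    (p q : Ix n) : Lim₀ (fun e : ℝ => imageForm (N e) (fun z => propKernel V (τ / e ^ 2) z p i)
    (fun z => propKernel V (τ / e ^ 2) z q j) (intPart (e⁻¹ • r) + z) (intPart (e⁻¹ • r) + z') - if
    0 < r 0 then ∑ β ∈ bands V, fcoef (bandTerm V R0 β e τ r p i j q) (z - z') + ∑ β ∈ bands V,
    fcoef (bandTerm V R0 β e τ (reflE r) p i j q) (refl z - refl z') else ∑ β ∈ bands V, fcoef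
    (bandTerm V R0 β e τ r p i j q) (z - z') - ∑ β ∈ bands V, fcoef (bandTerm V R0 β e τ r p i j q)
    (z - refl z') - ∑ β ∈ bands V, fcoef (bandTerm V R0 β e τ r p i j q) (refl z - z') + ∑ β ∈ bands
    V, fcoef (bandTerm V R0 β e τ r p i j q) (refl z - refl z')) 0 := by
  have hX := tendsto_smul_intPart r z
  have hY := tendsto_smul_intPart r z'
  have hX' := tendsto_smul_refl hX
  have hY' := tendsto_smul_refl hY
  have h1 := H.tendsto_propKernel_diag (V := V) hγ hI1 hI4 hF hτ hX hY
    (z := z - z') (fun e => by abel) p q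
  have h4 := H.tendsto_propKernel_diag (V := V) hγ hI1 hI4 hF hτ hX' hY'
    (z := refl z - refl z') (fun e => by rw [refl_add, refl_add]; abel) p q
  rcases hr.lt_or_eq with h0 | h0
  · have hne := reflE_ne_self h0.ne'
    have h2 := H.tendsto_propKernel_cross (V := V) hγ hI1 hF hτ hX hY' p q hne
    have h3 := H.tendsto_propKernel_cross (V := V) hγ hI1 hF hτ hX' hY p q hne.symm
    have h := ((h1.sub h2).sub h3).add h4
    simp only [sub_zero, add_zero] at h
    refine h.congr fun e => ?_
    rw [if_pos h0, imageForm]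
    ring
  · have hfix : ∀ e : ℝ, refl (intPart (e⁻¹ • r)) = intPart (e⁻¹ • r) := fun e =>
      refl_eq_self (by simp [intPart, ← h0])
    rw [reflE_eq_self h0.symm] at hX' hY' h4
    have h2 := H.tendsto_propKernel_diag (V := V) hγ hI1 hI4 hF hτ hX hY'
      (z := z - refl z') (fun e => by rw [refl_add, hfix]; abel) p q
    have h3 := H.tendsto_propKernel_diag (V := V) hγ hI1 hI4 hF hτ hX' hY
      (z := refl z - z') (fun e => by rw [refl_add, hfix]; abel) p q
    have h := ((h1.sub h2).sub h3).add h4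
    simp only [sub_zero, add_zero] at h
    refine h.congr fun e => ?_
    rw [if_neg h0.not_lt, imageForm]
    ring

end

end Crystal

end

theorem theorem5p4 {d n : ℕ} [NeZero d] (α : ℝ)
    (V : Crystal.Lat d → Matrix (Fin n) (Fin n) ℝ)
    (hE1 : Crystal.CondE1 V) (hE2 : Crystal.CondE2 V) (hE3 : Crystal.CondE3 V)
    (hE4 : Crystal.CondE4 V) (hE5 : Crystal.CondE5 V) (hE6 : Crystal.CondE6 V)
    (hVrefl : ∀ z, V (Crystal.refl z) = V z)
    (C γ : ℝ) (hC : 0 < C) (hγ : (d : ℝ) < γ)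
    (R₀ : Crystal.Euc d → Crystal.Lat d → Matrix (Crystal.Ix n) (Crystal.Ix n) ℂ)
    (hI1 : Crystal.CondI1 C γ R₀) (hI2 : Crystal.CondI2 R₀) (hI3 : Crystal.CondI3 R₀)
    (hI4 : Crystal.CondI4 R₀) (hI4' : Crystal.CondI4' R₀)
    (R : Crystal.Euc d → Crystal.Lat d → Crystal.Lat d →
      Matrix (Crystal.Ix n) (Crystal.Ix n) ℂ)
    (ha : Crystal.CondA R R₀) (hb : Crystal.CondB C γ R) (hc : Crystal.CondC R)
    (hd : Crystal.CondD R) (hd' : Crystal.CondD' R)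
    (μ₀ : ℝ → MeasureTheory.Measure (Crystal.PhaseSpace d n α))
    (hμ₀ : Crystal.IsInitialFamily μ₀)
    (hV1 : Crystal.CondV1' C γ R μ₀) (hV2 : Crystal.CondV2' C γ μ₀)
    (τ : ℝ) (hτ : τ ≠ 0) (r : Crystal.Euc d) (hr : 0 ≤ r 0)
    (z z' : Crystal.Lat d) (hz : r 0 = 0 → 0 < z 0 ∧ 0 < z' 0) :
    Filter.Tendsto
      (fun ε : ℝ =>
        Crystal.corr (Crystal.evolve V (μ₀ ε) (τ / ε ^ 2))
            (Crystal.intPart (ε⁻¹ • r) + z) (Crystal.intPart (ε⁻¹ • r) + z')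
          - Crystal.Qeps V R₀ ε τ r z z')
      (nhdsWithin 0 (Set.Ioi 0)) (nhds 0) := by
  open Crystal in
  have : Stable V := ⟨hE1, hE3, hE4, hE5, hE6⟩
  obtain ⟨M, m, g, hF⟩ := exists_ftRep hI4 hI4'
  have hpos : ∀ {w : Lat d}, (r 0 = 0 → 0 < w 0) →
      ∀ᶠ e in 𝓝[>] (0 : ℝ), 0 < (intPart (e⁻¹ • r) + w) 0 := fun {w} hw => by
    rcases hr.lt_or_eq with h0 | h0
    · exact eventually_pos_of_tendsto_smul (tendsto_smul_intPart r w) h0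
    · exact Eventually.of_forall fun e => by simpa [intPart, ← h0] using hw h0.symm
  refine tendsto_pi_nhds.2 fun p => tendsto_pi_nhds.2 fun q => ?_
  have h := tendsto_finsetSum Finset.univ fun i _ => tendsto_finsetSum Finset.univ fun j _ =>
    (halfFamily_corrWeight hC hγ hI1 ha hV1 hV2 i j).tendsto_imageForm (V := V) hγ hI1 hI4
      (hF i j) hτ hr z z' p q
  simp only [Finset.sum_const_zero] at h
  refine h.congr' ?_
  filter_upwards [hpos fun h0 => (hz h0).1, hpos fun h0 => (hz h0).2, self_mem_nhdsWithin]
    with e hXe hYe he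
  have hg := fun ρ w => gLat_apply (V := V) hγ hI1 hI4 hF hτ e ρ w p q
  rw [Matrix.sub_apply, corr_evolve_eq hVrefl (fun x p hx => ((hμ₀ e he).2 x p hx).1)
    hC.le hγ (hV2 e he) (τ / e ^ 2) hXe hYe p q, Qeps]
  split_ifs with h0 <;> simp only [Matrix.sub_apply, Matrix.add_apply, hg, Finset.sum_sub_distrib,
    Finset.sum_add_distrib]
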